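/- For $A\subset\mathbb{R}^2\simeq\mathbb{C}$ write $A^-=\{-z: z\in A\}$. There are absolute constants $0<c\le C$ such that for every $\delta\in(0,1)$ the following holds. There are * a bounded simply connected domain $\Omega(0)\subset\mathbb{C}$ whose boundary is a smooth ($C^\infty$, regular) simple closed curve, with $c\le \mathrm{dist}(\Omega(0),\Omega^-(0))\le C$; * a time-dependent vector field (strain) $S(z,t)$, $t\ge 0$, that is odd in $z$, incompressible (divergence free in the sense of distributions) for every $t$, and supported in a fixed ball for all $t\ge0$, with $$\sup_{t\ge 0,\,z\ne 0}\frac{|S(z,t)|}{|z|}<\infty,\qquad |S(z_2,t)-S(z_1,t)|\le K\,|z_1-z_2|\bigl(1+\bigl|\log|z_1-z_2|\bigr|\bigr)$$ for all $z_1,z_2\in\mathbb{C}$, $t\ge0$, with a constant $K$ independent of $z_1,z_2,t$ (the right-hand side is read as $0$ if $z_1=z_2$); * sets $\Omega(t)$, $t\ge0$, such that $\theta(z,t)=\chi_{\Omega(t)}(z)+\chi_{\Omega^-(t)}(z)$ solves the two-dimensional Euler equation with added strain $$\dot\theta=\nabla\theta\cdot(u+S),\qquad u=\pi\nabla^\perp\Delta^{-1}\theta,\qquad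 \theta(z,0)=\chi_{\Omega(0)}(z)+\chi_{\Omega^-(0)}(z),$$ where $\nabla^\perp=(-\partial_y,\partial_x)$ and $\Delta^{-1}$ is convolution with $\frac1{2\pi}\log|z|$. This is understood along particle trajectories: there are homeomorphisms $Z_t$ of the plane with $Z_0=\mathrm{id}$, $\frac{d}{dt}Z_t(z)=-(u+S)(Z_t(z),t)$ for all $z\in\mathbb{C}$, $t\ge 0$, $\Omega(t)=Z_t(\Omega(0))$ and $\theta(Z_t(z),t)=\theta(z,0)$. Moreover, for some positive constants $a$, $A$, $B$ (which may depend on $\delta$ but not on $t$) and all $t\ge0$, $$a\,\mathrm{dist}(\Omega(t),\Omega^-(t))\le \mathrm{dist}(\Omega(t),0)\le A\,\mathrm{dist}(\Omega(t),\Omega^-(t)),\qquad \mathrm{dist}(\Omega(t),\Omega^-(t))\le B\exp\bigl(-e^{\delta t}\bigr).$$ -/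

import Mathlib

open Set MeasureTheory
open scoped ContDiff

noncomputable section

/-- The image `{-z | z ∈ A}` of a plane set under the central symmetry. -/
def centralReflection (A : Set ℂ) : Set ℂ := (fun z => -z) '' A

/-- The distance between two nonempty plane sets, the infimum of `|a - b|` over `a ∈ A`, `b ∈ B`. -/
def setDist (A B : Set ℂ) : ℝ := sInf {r : ℝ | ∃ a ∈ A, ∃ b ∈ B, r = dist a b}

/-- A smooth simply connected patch: a bounded simply connected domain of the plane whose boundary
is a smooth regular simple closed curve. -/
structure IsSmoothPatch (A : Set ℂ) : Prop where
  isOpen : IsOpen A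
  isBounded : Bornology.IsBounded A
  isSimplyConnected : IsSimplyConnected A
  smooth_boundary : ∃ γ : ℝ → ℂ, ContDiff ℝ ∞ γ ∧ Function.Periodic γ (2 * Real.pi) ∧
    (∀ s, deriv γ s ≠ 0) ∧ InjOn γ (Ico 0 (2 * Real.pi)) ∧ frontier A = range γ

/-- The vorticity `χ_A + χ_{A⁻}` of the centrally symmetric pair of patches `A`, `A⁻`. -/
def pairVorticity (A : Set ℂ) (z : ℂ) : ℝ :=
  A.indicator (fun _ => 1) z + (centralReflection A).indicator (fun _ => 1) z

/-- The velocity `π ∇^⊥ Δ⁻¹ θ`, where `∇^⊥ = (-∂_y, ∂_x)` and `Δ⁻¹` is the convolution with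
`(2π)⁻¹ log |z|`, so that `π ∇^⊥ Δ⁻¹ θ (z) = (1/2) ∫ (z - ξ)^⊥ / |z - ξ|² θ(ξ) dξ`. The vector
`(a, b)^⊥ = (-b, a)` is the product of `a + i b` with `i`. -/
def eulerVelocity (θ : ℂ → ℝ) (z : ℂ) : ℂ :=
  (1 / 2 : ℝ) • ∫ ξ : ℂ, (θ ξ / ‖z - ξ‖ ^ 2) • (Complex.I * (z - ξ))

/-- A plane vector field is incompressible if its divergence vanishes in the sense of
distributions. -/
def IsIncompressible (v : ℂ → ℂ) : Prop :=
  ∀ φ : ℂ → ℝ, ContDiff ℝ ∞ φ → HasCompactSupport φ → ∫ z : ℂ, fderiv ℝ φ z (v z) = 0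

/-- A time-dependent compactly supported incompressible odd strain `S(z, t) = S t z`, `t ≥ 0`,
with `sup |S(z, t)| / |z| < ∞` and a log-Lipschitz bound that is uniform in time. -/
structure IsAdmissibleStrain (S : ℝ → ℂ → ℂ) : Prop where
  measurable : Measurable (fun p : ℝ × ℂ => S p.1 p.2)
  compact_support : ∃ R : ℝ, ∀ t, 0 ≤ t → ∀ z : ℂ, R < ‖z‖ → S t z = 0
  incompressible : ∀ t, 0 ≤ t → IsIncompressible (S t)
  odd : ∀ t, 0 ≤ t → ∀ z, S t (-z) = -S t z
  linear_bound : ∃ K : ℝ, ∀ t, 0 ≤ t → ∀ z : ℂ, z ≠ 0 → ‖S t z‖ / ‖z‖ ≤ K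
  log_lipschitz : ∃ K : ℝ, ∀ t, 0 ≤ t → ∀ z₁ z₂ : ℂ,
    ‖S t z₂ - S t z₁‖ ≤ K * (‖z₁ - z₂‖ * (1 + |Real.log ‖z₁ - z₂‖|))

/-- The patch dynamics `θ(z, t) = χ_{Ω(t)}(z) + χ_{Ω⁻(t)}(z)`, `t ≥ 0`, solving
`∂_t θ = ∇θ · (u + S)`, `u = π ∇^⊥ Δ⁻¹ θ`: the particle trajectories `t ↦ Z t z` of the whole
plane solve `dz/dt = -(u + S)` and form homeomorphisms of the plane, and the patch and the
vorticity are transported along them. -/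
structure IsPatchDynamics (S : ℝ → ℂ → ℂ) (Ω : ℝ → Set ℂ) (Z : ℝ → ℂ ≃ₜ ℂ) : Prop where
  initial : ∀ z, Z 0 z = z
  trajectory : ∀ z, ∀ t, 0 ≤ t → HasDerivWithinAt (fun s => Z s z)
    (-(eulerVelocity (pairVorticity (Ω t)) (Z t z) + S t (Z t z))) (Ici 0) t
  patch_transport : ∀ t, 0 ≤ t → Ω t = Z t '' Ω 0
  vorticity_transport : ∀ t, 0 ≤ t → ∀ z,
    pairVorticity (Ω t) (Z t z) = pairVorticity (Ω 0) z

end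

/-! The strain is found backwards. One prescribes a velocity field `v`, lets it carry a well-chosen
initial patch, and puts `S = -v - u` near the origin. The Euler equation with strain then holds by
construction, and oddness, incompressibility and log-Lipschitz bounds hold for `v` and `u`
separately. The real content is `|S| ≤ K|z|`: both `v` and `u` are of size `|z| log(1/|z|)`, so the
moving patch must itself produce the singular part of `-v`.

The field `v` (`cellField`) has near the origin the stream function `x y (-log r + a(t))`. Along the
incoming `x`-axis `-log x` grows like `e^t`, which is the source of double exponential approach. On
the other side, let a patch in the first quadrant stay outside radius `ε` and fill the quadrant
between the radii `ε` and `1/e` up to a set on which `∫|ξ|⁻²` is bounded. Its velocity is then the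
logarithmic strain truncated at `ε`, up to `O(|z|)` (`exists_velocity_expansion`). It remains to
show that, with `ε` comparable to the distance of the patch from the origin, the patch misses only
thin sectors along the axes.

Let `ℓ = -log r + e^{-t/2} - 1` be the depth; the cell is `ℓ > 0` in the quadrant. With the decaying
term replaced by zero, `x y ℓ` would be conserved and the streamlines in the cell closed, so what
the patch misses near the rim would circulate forever. The decaying term makes `ℓ = 0` a curve that
is crossed outwards only, and a trajectory starting in the thin set missed by the initial patch
leaves the cell after one passage (`IsCellPath.one_le_div_of_thin`). As long as it is in the cell it
is thus first incoming (`y ≤ x`), then outgoing (`y ≥ x`), and its position is controlled by two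
facts: the level `x y ℓ` does not increase, and a corrected depth grows at least like `e^t` on the
way in (`incoming_growth`) and decreases at least like `e^{-t}` on the way out while `ℓ ≥ 1`
(`outgoing_decay`).

The initial patch lies in the square `(0,2)²` and touches its sides at the midpoints to infinite
order: at depth `u` it misses a strip whose width is comparable to a profile `f(u)`, with `f(u) ≤
exp(-(8u²)⁻ⁿ)`. An incoming point of depth `ℓ` at time `T` started at depth about `e^{-T}ℓ` with at
least the same level, while a diagonal point of depth `ℓ` has level about `e^{-2ℓ}ℓ`. So the
diagonal point lies in the patch as soon as `e^{-2ℓ}ℓ` dominates `u f(u)`, `u = e^{-T}ℓ`. For `ℓ =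
e^{δT}` and large `T` this holds if `δ < 2n(1-δ)`, whence the rate (`exists_time_mem_of_diagonal`).
Conversely the point of the patch nearest to the origin bounds `u f(u)` from above, and the same
comparison gives `sin 2θ ≤ C((ε/r)^{1/4} + r)` for the missed points (`exists_angle_bound`,
`exists_gap_bound`), which is integrable against `|ξ|⁻²` uniformly in `ε`
(`exists_thin_integral_bound`).

Two devices make this a genuine flow. The logarithm is continued linearly in `r²` below a small
radius, so that the fields are Lipschitz; no trajectory of the patch sees this. The Biot–Savart
kernel is split into a near and a far part; the far part vanishes around the patch, and leaving it
out of `S` keeps `S` compactly supported. -/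

noncomputable section

open Filter Topology NNReal

/-! ### Flows of bounded Lipschitz time-dependent fields -/

/-- A time-dependent plane vector field, `t ≥ 0`, that is continuous in time and, locally uniformly
in time, bounded and Lipschitz in space. -/
structure IsFlowField (v : ℝ → ℂ → ℂ) : Prop where
  cont : ∀ z, ContinuousOn (fun t => v t z) (Ici 0)
  lip : ∀ T, ∃ K : ℝ≥0, ∀ t ∈ Icc 0 T, LipschitzWith K (v t)
  bdd : ∀ T, ∃ M : ℝ, ∀ t ∈ Icc 0 T, ∀ z, ‖v t z‖ ≤ M

/-- Trajectories of a time-dependent vector field on the time interval `[0, T]`. -/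
def IsTrajectory (v : ℝ → ℂ → ℂ) (T : ℝ) (γ : ℝ → ℂ) : Prop :=
  ∀ s ∈ Icc 0 T, HasDerivWithinAt γ (v s (γ s)) (Icc 0 T) s

theorem IsTrajectory.continuousOn {v : ℝ → ℂ → ℂ} {T : ℝ} {γ : ℝ → ℂ} (h : IsTrajectory v T γ) :
    ContinuousOn γ (Icc 0 T) := fun s hs => (h s hs).continuousWithinAt

theorem IsTrajectory.mono {v : ℝ → ℂ → ℂ} {T T' : ℝ} {γ : ℝ → ℂ} (h : IsTrajectory v T γ)
    (hT : T' ≤ T) : IsTrajectory v T' γ := fun s hs =>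
  (h s ⟨hs.1, hs.2.trans hT⟩).mono (Icc_subset_Icc_right hT)

theorem IsTrajectory.congr_field {v w : ℝ → ℂ → ℂ} {T : ℝ} {γ : ℝ → ℂ} (h : IsTrajectory v T γ)
    (hvw : ∀ s ∈ Icc 0 T, v s (γ s) = w s (γ s)) : IsTrajectory w T γ := fun s hs =>
  hvw s hs ▸ h s hs

theorem IsFlowField.exists_trajectory {v : ℝ → ℂ → ℂ} (hv : IsFlowField v) {T t : ℝ}
    (ht : t ∈ Icc 0 T) (z : ℂ) : ∃ γ, γ t = z ∧ IsTrajectory v T γ := by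
  obtain ⟨K, hK⟩ := hv.lip T
  obtain ⟨M, hM⟩ := hv.bdd T
  have hT : 0 ≤ T := ht.1.trans ht.2
  have hM0 : 0 ≤ M := (norm_nonneg _).trans (hM t ht z)
  have hp : IsPicardLindelof v (⟨t, ht⟩ : Icc 0 T) z ⟨M * T, mul_nonneg hM0 hT⟩ 0 ⟨M, hM0⟩ K := by
    refine ⟨fun s hs => (hK s hs).lipschitzOnWith, fun x _ => (hv.cont x).mono fun s hs => hs.1,
      fun s hs x _ => hM s hs x, ?_⟩
    have : max (T - t) (t - 0) ≤ T := max_le (by linarith [ht.1]) (by linarith [ht.2])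
    show M * max (T - t) (t - 0) ≤ M * T - ((0 : ℝ≥0) : ℝ)
    simpa using mul_le_mul_of_nonneg_left this hM0
  exact hp.exists_eq_forall_mem_Icc_hasDerivWithinAt₀

theorem IsTrajectory.dist_le {v : ℝ → ℂ → ℂ} {K : ℝ≥0} {T : ℝ}
    (hK : ∀ t ∈ Icc 0 T, LipschitzWith K (v t)) {γ γ' : ℝ → ℂ} (h : IsTrajectory v T γ)
    (h' : IsTrajectory v T γ') {t : ℝ} (ht : t ∈ Icc 0 T) :
    dist (γ t) (γ' t) ≤ dist (γ 0) (γ' 0) * Real.exp (K * t) := by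
  have key := dist_le_of_trajectories_ODE_of_mem (v := v) (s := fun _ => univ) (a := 0) (b := T)
    (K := K) (δ := dist (γ 0) (γ' 0))
    (fun t ht => (hK t ⟨ht.1, ht.2.le⟩).lipschitzOnWith) h.continuousOn
    (fun t ht => (h t ⟨ht.1, ht.2.le⟩).mono_of_mem_nhdsWithin
      (mem_of_superset (Icc_mem_nhdsGE ht.2) (Icc_subset_Icc_left ht.1))) (fun _ _ => trivial)
    h'.continuousOn (fun t ht => (h' t ⟨ht.1, ht.2.le⟩).mono_of_mem_nhdsWithin
      (mem_of_superset (Icc_mem_nhdsGE ht.2) (Icc_subset_Icc_left ht.1))) (fun _ _ => trivial)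
    le_rfl t ht
  simpa using key

theorem IsTrajectory.comp_reverse {v : ℝ → ℂ → ℂ} {T : ℝ} {γ : ℝ → ℂ} (h : IsTrajectory v T γ) :
    IsTrajectory (fun s z => -v (T - s) z) T (fun s => γ (T - s)) := by
  intro s hs
  have h1 : HasDerivWithinAt (fun s : ℝ => T - s) (-1) (Icc 0 T) s := by
    simpa using ((hasDerivWithinAt_id s (Icc 0 T)).const_sub T)
  have := (h (T - s) ⟨by linarith [hs.2], by linarith [hs.1]⟩).scomp s h1
    (fun u hu => ⟨by linarith [hu.2], by linarith [hu.1]⟩)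
  simpa [Function.comp_def] using this

theorem IsTrajectory.dist_le_reverse {v : ℝ → ℂ → ℂ} {K : ℝ≥0} {T : ℝ}
    (hK : ∀ t ∈ Icc 0 T, LipschitzWith K (v t)) {γ γ' : ℝ → ℂ} (h : IsTrajectory v T γ)
    (h' : IsTrajectory v T γ') {t : ℝ} (ht : t ∈ Icc 0 T) :
    dist (γ t) (γ' t) ≤ dist (γ T) (γ' T) * Real.exp (K * (T - t)) := by
  have hK' : ∀ s ∈ Icc 0 T, LipschitzWith K (fun z => -v (T - s) z) := fun s hs =>
    LipschitzWith.of_dist_le_mul fun x y => by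
      rw [dist_neg_neg]
      exact (hK _ ⟨by linarith [hs.2], by linarith [hs.1]⟩).dist_le_mul x y
  have := IsTrajectory.dist_le (v := fun s z => -v (T - s) z) hK' h.comp_reverse h'.comp_reverse
    (t := T - t) ⟨by linarith [ht.2], by linarith [ht.1]⟩
  simpa using this

/-- Agreement at any intermediate time suffices: Grönwall backwards from `t` identifies the initial
points, then Grönwall forwards identifies the whole trajectories. This is the tool behind all
invariance statements below. -/
theorem IsFlowField.trajectory_unique {v : ℝ → ℂ → ℂ} (hv : IsFlowField v) {T t : ℝ}
    (ht : t ∈ Icc 0 T) {γ γ' : ℝ → ℂ} (h : IsTrajectory v T γ) (h' : IsTrajectory v T γ')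
    (heq : γ t = γ' t) : EqOn γ γ' (Icc 0 T) := by
  obtain ⟨K, hK⟩ := hv.lip T
  have h0 : γ 0 = γ' 0 := by
    have := (h.mono ht.2).dist_le_reverse (fun s hs => hK s ⟨hs.1, hs.2.trans ht.2⟩) (h'.mono ht.2)
      (t := 0) ⟨le_rfl, ht.1⟩
    rw [heq, dist_self, zero_mul] at this
    exact dist_le_zero.1 this
  intro s hs
  have := h.dist_le hK h' hs
  rw [h0, dist_self, zero_mul] at this
  exact dist_le_zero.1 this

/-- The flow of a bounded Lipschitz time-dependent vector field, by homeomorphisms. -/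
theorem IsFlowField.exists_flow {v : ℝ → ℂ → ℂ} (hv : IsFlowField v) :
    ∃ Z : ℝ → ℂ ≃ₜ ℂ, (∀ z, Z 0 z = z) ∧
      (∀ T z, IsTrajectory v T (fun s => Z s z)) ∧
      ∀ z t, 0 ≤ t → HasDerivWithinAt (fun s => Z s z) (v t (Z t z)) (Ici 0) t := by
  have hex : ∀ t : ℝ, 0 ≤ t → ∀ z, ∃ γ, γ 0 = z ∧ IsTrajectory v t γ := fun t ht z =>
    hv.exists_trajectory (t := 0) ⟨le_rfl, ht⟩ z
  have hex' : ∀ t : ℝ, 0 ≤ t → ∀ z, ∃ γ, γ t = z ∧ IsTrajectory v t γ := fun t ht z =>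
    hv.exists_trajectory (t := t) ⟨ht, le_rfl⟩ z
  choose F hF0 hF using hex
  choose G hG0 hG using hex'
  have hFG : ∀ t (ht : 0 ≤ t) z, F t ht (G t ht z 0) t = z := fun t ht z => by
    have := hv.trajectory_unique (t := 0) ⟨le_rfl, ht⟩ (hF t ht (G t ht z 0)) (hG t ht z)
      (hF0 t ht _) ⟨ht, le_rfl⟩
    rw [this, hG0]
  have hGF : ∀ t (ht : 0 ≤ t) z, G t ht (F t ht z t) 0 = z := fun t ht z => by
    have := hv.trajectory_unique (t := t) ⟨ht, le_rfl⟩ (hG t ht (F t ht z t)) (hF t ht z)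
      (hG0 t ht _) ⟨le_rfl, ht⟩
    rw [this, hF0]
  have hcF : ∀ t (ht : 0 ≤ t), Continuous fun z => F t ht z t := fun t ht => by
    obtain ⟨K, hK⟩ := hv.lip t
    refine (LipschitzWith.of_dist_le_mul (K := ⟨Real.exp (K * t), (Real.exp_pos _).le⟩)
      fun x y => ?_).continuous
    have := (hF t ht x).dist_le hK (hF t ht y) (t := t) ⟨ht, le_rfl⟩
    rw [hF0, hF0, mul_comm] at this
    exact this
  have hcG : ∀ t (ht : 0 ≤ t), Continuous fun z => G t ht z 0 := fun t ht => by
    obtain ⟨K, hK⟩ := hv.lip t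
    refine (LipschitzWith.of_dist_le_mul (K := ⟨Real.exp (K * (t - 0)), (Real.exp_pos _).le⟩)
      fun x y => ?_).continuous
    have := (hG t ht x).dist_le_reverse hK (hG t ht y) (t := 0) ⟨le_rfl, ht⟩
    rw [hG0, hG0, mul_comm] at this
    exact this
  let Z : ℝ → ℂ ≃ₜ ℂ := fun t => if ht : 0 ≤ t then
    { toFun := fun z => F t ht z t
      invFun := fun z => G t ht z 0
      left_inv := hGF t ht
      right_inv := hFG t ht
      continuous_toFun := hcF t ht
      continuous_invFun := hcG t ht } else Homeomorph.refl ℂ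
  have hZ : ∀ t (ht : 0 ≤ t) z, Z t z = F t ht z t := fun t ht z => by
    simp only [Z, dif_pos ht]; rfl
  have hZF : ∀ T (hT : 0 ≤ T) z, EqOn (fun s => Z s z) (F T hT z) (Icc 0 T) := by
    intro T hT z s hs
    show Z s z = _
    rw [hZ s hs.1]
    exact hv.trajectory_unique (t := 0) ⟨le_rfl, hs.1⟩ (hF s hs.1 z) ((hF T hT z).mono hs.2)
      (by rw [hF0, hF0]) ⟨hs.1, le_rfl⟩
  have htraj : ∀ T z, IsTrajectory v T (fun s => Z s z) := by
    intro T z s hs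
    have hT : 0 ≤ T := hs.1.trans hs.2
    have e := hZF T hT z
    show HasDerivWithinAt _ (v s (Z s z)) _ _
    rw [show Z s z = F T hT z s from e hs]
    exact (hF T hT z s hs).congr e (e hs)
  refine ⟨Z, fun z => by rw [hZ 0 le_rfl, hF0], htraj, fun z t ht => ?_⟩
  refine (htraj (t + 1) z t ⟨ht, by linarith⟩).mono_of_mem_nhdsWithin ?_
  rw [mem_nhdsWithin]
  exact ⟨Iio (t + 1), isOpen_Iio, by simp, fun s hs => ⟨hs.2, le_of_lt hs.1⟩⟩

/-! ### Monotonicity, first hitting times and barriers -/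

theorem le_of_hasDerivWithinAt_nonpos {f f' : ℝ → ℝ} {T s t : ℝ}
    (hf : ∀ u ∈ Icc s t, HasDerivWithinAt f (f' u) (Icc 0 T) u) (h0 : 0 ≤ s) (hst : s ≤ t)
    (hT : t ≤ T) (hn : ∀ u ∈ Icc s t, f' u ≤ 0) : f t ≤ f s := by
  have hsub : Icc s t ⊆ Icc 0 T := Icc_subset_Icc h0 hT
  refine antitoneOn_of_hasDerivWithinAt_nonpos (f' := f') (convex_Icc s t)
    (fun u hu => ((hf u hu).mono hsub).continuousWithinAt) (fun u hu => ?_) (fun u hu => ?_)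
    (left_mem_Icc.2 hst) (right_mem_Icc.2 hst) hst
  · exact (hf u (interior_subset hu)).mono (interior_subset.trans hsub)
  · exact hn u (interior_subset hu)

theorem le_of_hasDerivWithinAt_nonneg {f f' : ℝ → ℝ} {T s t : ℝ}
    (hf : ∀ u ∈ Icc s t, HasDerivWithinAt f (f' u) (Icc 0 T) u) (h0 : 0 ≤ s) (hst : s ≤ t)
    (hT : t ≤ T) (hn : ∀ u ∈ Icc s t, 0 ≤ f' u) : f s ≤ f t := by
  have := le_of_hasDerivWithinAt_nonpos (f := fun u => -f u) (f' := fun u => -f' u)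
    (fun u hu => (hf u hu).neg) h0 hst hT (fun u hu => by linarith [hn u hu])
  linarith

theorem exists_first_eq {f : ℝ → ℝ} {a b c : ℝ} (hab : a ≤ b) (hf : ContinuousOn f (Icc a b))
    (ha : f a < c) (hb : c ≤ f b) : ∃ s ∈ Ioc a b, f s = c ∧ ∀ u ∈ Ico a s, f u < c := by
  have hcl : IsClosed (Icc a b ∩ f ⁻¹' Ici c) := hf.preimage_isClosed_of_isClosed isClosed_Icc
    isClosed_Ici
  have hcp : IsCompact (Icc a b ∩ f ⁻¹' Ici c) := isCompact_Icc.of_isClosed_subset hcl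
    inter_subset_left
  have hmem := hcp.sInf_mem ⟨b, right_mem_Icc.2 hab, hb⟩
  set s := sInf (Icc a b ∩ f ⁻¹' Ici c) with hs
  have hlt : ∀ u ∈ Ico a s, f u < c := fun u hu => by
    by_contra hcon
    exact absurd (csInf_le hcp.bddBelow ⟨⟨hu.1, hu.2.le.trans hmem.1.2⟩, not_lt.1 hcon⟩)
      (not_le.2 hu.2)
  have has : a < s := lt_of_le_of_ne hmem.1.1 fun h => by
    have := hmem.2
    rw [← h] at this
    exact absurd this (not_le.2 ha)
  refine ⟨s, ⟨has, hmem.1.2⟩, le_antisymm ?_ hmem.2, hlt⟩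
  have hc : ContinuousWithinAt f (Ico a s) s := (hf s hmem.1).mono fun u hu =>
    ⟨hu.1, hu.2.le.trans hmem.1.2⟩
  have hne : (𝓝[Ico a s] s).NeBot := by
    rw [← mem_closure_iff_nhdsWithin_neBot, closure_Ico has.ne]
    exact right_mem_Icc.2 has.le
  exact le_of_tendsto hc (eventually_nhdsWithin_of_forall fun u hu => (hlt u hu).le)

/-- At the infimum of the times with `d < 1` one has `d = 1`, and a positive derivative there makes
`d > 1` immediately afterwards, contradicting the choice of the infimum. The derivative condition is
required only at times up to which `d ≥ 1` has held, so it may use the past of the path. -/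
theorem one_le_of_barrier {d d' : ℝ → ℝ} {s₀ T : ℝ} (hc : ContinuousOn d (Icc s₀ T))
    (hd : ∀ s ∈ Icc s₀ T, HasDerivWithinAt d (d' s) (Icc s₀ T) s) (h0 : 1 ≤ d s₀)
    (H : ∀ t ∈ Icc s₀ T, (∀ s ∈ Icc s₀ t, 1 ≤ d s) → d t = 1 → 0 < d' t) :
    ∀ t ∈ Icc s₀ T, 1 ≤ d t := by
  by_contra! hcon
  obtain ⟨t₂, ht₂, hdt₂⟩ := hcon
  set B := {t | t ∈ Icc s₀ T ∧ d t < 1} with hB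
  have hne : B.Nonempty := ⟨t₂, ht₂, hdt₂⟩
  have hbb : BddBelow B := ⟨s₀, fun t ht => ht.1.1⟩
  set t₁ := sInf B with ht₁
  have h1 : s₀ ≤ t₁ := le_csInf hne fun t ht => ht.1.1
  have h2 : t₁ ≤ t₂ := csInf_le hbb ⟨ht₂, hdt₂⟩
  have hm : t₁ ∈ Icc s₀ T := ⟨h1, h2.trans ht₂.2⟩
  have hbefore : ∀ s ∈ Ico s₀ t₁, 1 ≤ d s := fun s hs => by
    by_contra hlt
    exact absurd (csInf_le hbb ⟨⟨hs.1, hs.2.le.trans hm.2⟩, not_le.1 hlt⟩) (not_le.2 hs.2)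
  have hle : d t₁ ≤ 1 := by
    have hcl : t₁ ∈ closure B := csInf_mem_closure hne hbb
    have : (𝓝[B] t₁).NeBot := mem_closure_iff_nhdsWithin_neBot.1 hcl
    exact le_of_tendsto ((hc t₁ hm).mono (s := B) fun t ht => ht.1)
      (eventually_nhdsWithin_of_forall fun u (hu : u ∈ B) => hu.2.le)
  have hge : 1 ≤ d t₁ := by
    rcases h1.eq_or_lt with h | h
    · rw [← h]; exact h0
    · have hne : (𝓝[Ico s₀ t₁] t₁).NeBot := by
        rw [← mem_closure_iff_nhdsWithin_neBot, closure_Ico h.ne]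
        exact right_mem_Icc.2 h.le
      exact ge_of_tendsto ((hc t₁ hm).mono fun t ht => ⟨ht.1, ht.2.le.trans hm.2⟩)
        (eventually_nhdsWithin_of_forall fun u hu => hbefore u hu)
  have heq : d t₁ = 1 := le_antisymm hle hge
  have hpos := H t₁ hm (fun s hs => (hs.2.eq_or_lt).elim (fun h => h ▸ hge)
    fun h => hbefore s ⟨hs.1, h⟩) heq
  have hslope := (hasDerivWithinAt_iff_tendsto_slope.1 (hd t₁ hm)).eventually (lt_mem_nhds hpos)
  have hev : ∀ᶠ u in 𝓝[B] t₁, 0 < slope d t₁ u := by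
    refine (nhdsWithin_mono t₁ ?_) hslope
    intro u hu
    exact ⟨hu.1, fun h => by
      have h' : u = t₁ := h
      have := hu.2
      rw [h', heq] at this
      exact lt_irrefl _ this⟩
  have : (𝓝[B] t₁).NeBot := mem_closure_iff_nhdsWithin_neBot.1 (csInf_mem_closure hne hbb)
  obtain ⟨u, hu, huB⟩ := (hev.and self_mem_nhdsWithin).exists
  have hut : t₁ < u := lt_of_le_of_ne (csInf_le hbb huB) fun h => by
    have := huB.2
    rw [← h, heq] at this
    exact lt_irrefl _ this
  rw [slope_def_field, heq] at hu
  have := (div_pos_iff_of_pos_right (sub_pos.2 hut)).1 hu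
  linarith [huB.2]

theorem le_exp_mul_of_exp_mul_le {k s t a b : ℝ}
    (h : Real.exp (k * t) * a ≤ Real.exp (k * s) * b) : a ≤ Real.exp (k * (s - t)) * b := by
  have h2 := mul_le_mul_of_nonneg_left h (Real.exp_pos (-(k * t))).le
  rw [← mul_assoc, ← mul_assoc, ← Real.exp_add, ← Real.exp_add, neg_add_cancel, Real.exp_zero,
    one_mul] at h2
  rwa [show -(k * t) + k * s = k * (s - t) by ring] at h2

/-! ### The cell flow: depth, slope and level along a trajectory -/

/-- The amplitude of the decaying correction of the strain. -/
def decay (t : ℝ) : ℝ := Real.exp (-t / 2)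

theorem decay_pos (t : ℝ) : 0 < decay t := Real.exp_pos _

theorem decay_le_one {t : ℝ} (ht : 0 ≤ t) : decay t ≤ 1 := Real.exp_le_one_iff.2 (by linarith)

theorem hasDerivAt_decay (t : ℝ) : HasDerivAt decay (-decay t / 2) t := by
  have : HasDerivAt (fun t : ℝ => -t / 2) (-1 / 2) t := ((hasDerivAt_id t).neg).div_const 2
  refine this.exp.congr_deriv ?_
  show Real.exp (-t / 2) * (-1 / 2) = -Real.exp (-t / 2) / 2
  ring

/-- The logarithmic depth of the point `(x, y)` at time `t`; the circular cell of the flow is the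
region of positive depth. -/
def depth (t x y : ℝ) : ℝ := -(1 / 2) * Real.log (x ^ 2 + y ^ 2) + decay t - 1

/-- Trajectories of the cell flow in the first quadrant. -/
structure IsCellPath (x y : ℝ → ℝ) (T : ℝ) : Prop where
  x_pos : ∀ s ∈ Icc 0 T, 0 < x s
  y_pos : ∀ s ∈ Icc 0 T, 0 < y s
  depth_pos : ∀ s ∈ Icc 0 T, 0 < depth s (x s) (y s)
  dx : ∀ s ∈ Icc 0 T, HasDerivWithinAt x
    (-x s * (depth s (x s) (y s) + decay s / 2) + x s * y s ^ 2 / (x s ^ 2 + y s ^ 2)) (Icc 0 T) s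
  dy : ∀ s ∈ Icc 0 T, HasDerivWithinAt y
    (y s * (depth s (x s) (y s) + decay s / 2) - x s ^ 2 * y s / (x s ^ 2 + y s ^ 2)) (Icc 0 T) s

theorem exp_two_depth {t x y : ℝ} (hx : 0 < x) :
    x ^ 2 + y ^ 2 = Real.exp (2 * (decay t - 1 - depth t x y)) := by
  have h : 0 < x ^ 2 + y ^ 2 := by positivity
  rw [show 2 * (decay t - 1 - depth t x y) = Real.log (x ^ 2 + y ^ 2) by
    simp only [depth]; ring, Real.exp_log h]

theorem depth_le_log {t x y : ℝ} (hx : 0 < x) : depth t x y ≤ -Real.log x + decay t - 1 := by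
  have : Real.log (x ^ 2) ≤ Real.log (x ^ 2 + y ^ 2) :=
    Real.log_le_log (by positivity) (by nlinarith [sq_nonneg y])
  rw [Real.log_pow] at this
  simp only [depth]
  push_cast at this
  linarith

theorem log_le_depth {t x y : ℝ} (hx : 0 < x) :
    -Real.log x + decay t - 1 - (y / x) ^ 2 / 2 ≤ depth t x y := by
  have h1 : x ^ 2 + y ^ 2 = x ^ 2 * (1 + (y / x) ^ 2) := by field_simp
  have h2 : Real.log (1 + (y / x) ^ 2) ≤ (y / x) ^ 2 := by
    have := Real.log_le_sub_one_of_pos (show 0 < 1 + (y / x) ^ 2 by positivity)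
    linarith
  simp only [depth]
  rw [h1, Real.log_mul (by positivity) (by positivity), Real.log_pow]
  push_cast
  linarith

theorem depth_comm (t x y : ℝ) : depth t x y = depth t y x := by
  simp only [depth, add_comm]

namespace IsCellPath

variable {x y : ℝ → ℝ} {T : ℝ}

theorem hasDerivWithinAt_depth (h : IsCellPath x y T) {s : ℝ} (hs : s ∈ Icc 0 T) :
    HasDerivWithinAt (fun s => depth s (x s) (y s))
      ((1 - 2 * (y s ^ 2 / (x s ^ 2 + y s ^ 2))) * depth s (x s) (y s)
        - decay s * (y s ^ 2 / (x s ^ 2 + y s ^ 2))) (Icc 0 T) s := by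
  have hx := h.x_pos s hs
  have hr : 0 < x s ^ 2 + y s ^ 2 := by positivity
  have h1 := (((h.dx s hs).fun_pow 2).add ((h.dy s hs).fun_pow 2)).log hr.ne'
  have h2 := ((h1.const_mul (-(1 / 2))).add (hasDerivAt_decay s).hasDerivWithinAt).sub_const 1
  refine h2.congr_deriv ?_
  simp only [Pi.add_apply]
  field_simp
  ring

theorem hasDerivWithinAt_mul (h : IsCellPath x y T) {s : ℝ} (hs : s ∈ Icc 0 T) :
    HasDerivWithinAt (fun s => x s * y s)
      (-(1 - 2 * (y s ^ 2 / (x s ^ 2 + y s ^ 2))) * (x s * y s)) (Icc 0 T) s := by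
  have hx := h.x_pos s hs
  have hr : 0 < x s ^ 2 + y s ^ 2 := by positivity
  refine ((h.dx s hs).mul (h.dy s hs)).congr_deriv ?_
  field_simp
  ring

/-- The slope increases wherever `2ℓ + decay > 1`. Hence a path can turn back from the outgoing to
the incoming half only at depth below `1/2`, near the rim of the cell. -/
theorem hasDerivWithinAt_div (h : IsCellPath x y T) {s : ℝ} (hs : s ∈ Icc 0 T) :
    HasDerivWithinAt (fun s => y s / x s)
      (y s / x s * (2 * depth s (x s) (y s) + decay s - 1)) (Icc 0 T) s := by
  have hx := h.x_pos s hs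
  have hr : 0 < x s ^ 2 + y s ^ 2 := by positivity
  refine ((h.dy s hs).div (h.dx s hs) hx.ne').congr_deriv ?_
  field_simp
  ring

theorem hasDerivWithinAt_div' (h : IsCellPath x y T) {s : ℝ} (hs : s ∈ Icc 0 T) :
    HasDerivWithinAt (fun s => x s / y s)
      (-(x s / y s) * (2 * depth s (x s) (y s) + decay s - 1)) (Icc 0 T) s := by
  have hx := h.x_pos s hs
  have hy := h.y_pos s hs
  have hr : 0 < x s ^ 2 + y s ^ 2 := by positivity
  refine ((h.dx s hs).div (h.dy s hs) hy.ne').congr_deriv ?_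
  field_simp
  ring

/-- The factors `1 - 2σ`, `σ = y²/(x²+y²)`, in the logarithmic derivatives of `x y` and of the depth
cancel. Only the contribution of the decaying amplitude survives, and it has a sign: levels never
increase. -/
theorem hasDerivWithinAt_level (h : IsCellPath x y T) {s : ℝ} (hs : s ∈ Icc 0 T) :
    HasDerivWithinAt (fun s => x s * y s * depth s (x s) (y s))
      (-decay s * (y s ^ 2 / (x s ^ 2 + y s ^ 2)) * (x s * y s)) (Icc 0 T) s := by
  refine ((h.hasDerivWithinAt_mul hs).mul (h.hasDerivWithinAt_depth hs)).congr_deriv ?_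
  ring

theorem hasDerivWithinAt_logx (h : IsCellPath x y T) {s : ℝ} (hs : s ∈ Icc 0 T) :
    HasDerivWithinAt (fun s => -Real.log (x s) + decay s - 1)
      (depth s (x s) (y s) - y s ^ 2 / (x s ^ 2 + y s ^ 2)) (Icc 0 T) s := by
  have hx := h.x_pos s hs
  have hr : 0 < x s ^ 2 + y s ^ 2 := by positivity
  refine ((((h.dx s hs).log hx.ne').neg.add (hasDerivAt_decay s).hasDerivWithinAt).sub_const
    1).congr_deriv ?_
  field_simp
  ring

theorem hasDerivWithinAt_logy (h : IsCellPath x y T) {s : ℝ} (hs : s ∈ Icc 0 T) :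
    HasDerivWithinAt (fun s => -Real.log (y s) + decay s - 1)
      (-depth s (x s) (y s) - decay s + x s ^ 2 / (x s ^ 2 + y s ^ 2)) (Icc 0 T) s := by
  have hx := h.x_pos s hs
  have hy := h.y_pos s hs
  have hr : 0 < x s ^ 2 + y s ^ 2 := by positivity
  refine ((((h.dy s hs).log hy.ne').neg.add (hasDerivAt_decay s).hasDerivWithinAt).sub_const
    1).congr_deriv ?_
  field_simp
  ring

theorem frac_mem (h : IsCellPath x y T) {s : ℝ} (hs : s ∈ Icc 0 T) :
    0 ≤ y s ^ 2 / (x s ^ 2 + y s ^ 2) ∧ y s ^ 2 / (x s ^ 2 + y s ^ 2) ≤ 1 := by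
  have hx := h.x_pos s hs
  have hr : 0 < x s ^ 2 + y s ^ 2 := by positivity
  exact ⟨by positivity, by rw [div_le_one hr]; nlinarith⟩

theorem frac_le_half (h : IsCellPath x y T) {s : ℝ} (hs : s ∈ Icc 0 T) (hd : y s / x s ≤ 1) :
    y s ^ 2 / (x s ^ 2 + y s ^ 2) ≤ 1 / 2 := by
  have hx := h.x_pos s hs
  have hy := h.y_pos s hs
  have hr : 0 < x s ^ 2 + y s ^ 2 := by positivity
  rw [div_le_one hx] at hd
  rw [div_le_iff₀ hr]
  nlinarith

theorem half_le_frac (h : IsCellPath x y T) {s : ℝ} (hs : s ∈ Icc 0 T) (hd : 1 ≤ y s / x s) :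
    1 / 2 ≤ y s ^ 2 / (x s ^ 2 + y s ^ 2) := by
  have hx := h.x_pos s hs
  have hy := h.y_pos s hs
  have hr : 0 < x s ^ 2 + y s ^ 2 := by positivity
  rw [one_le_div hx] at hd
  rw [le_div_iff₀ hr]
  nlinarith

theorem hasDerivWithinAt_exp_neg_mul {f : ℝ → ℝ} {f' s : ℝ} {S : Set ℝ}
    (hf : HasDerivWithinAt f f' S s) (k : ℝ) :
    HasDerivWithinAt (fun s => Real.exp (k * s) * f s) (Real.exp (k * s) * (f' + k * f s)) S s := by
  have h1 : HasDerivAt (fun s : ℝ => Real.exp (k * s)) (Real.exp (k * s) * (k * 1)) s :=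
    ((hasDerivAt_id s).const_mul k).exp
  refine (h1.hasDerivWithinAt.mul hf).congr_deriv ?_
  ring

theorem depth_le_exp_mul (h : IsCellPath x y T) {s t : ℝ} (h0 : 0 ≤ s) (hst : s ≤ t) (hT : t ≤ T) :
    depth t (x t) (y t) ≤ Real.exp (t - s) * depth s (x s) (y s) := by
  have := le_of_hasDerivWithinAt_nonpos (T := T) (s := s) (t := t)
    (fun u hu => hasDerivWithinAt_exp_neg_mul
      (h.hasDerivWithinAt_depth ⟨h0.trans hu.1, hu.2.trans hT⟩) (-1)) h0 hst hT (fun u hu => by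
      have hm : u ∈ Icc 0 T := ⟨h0.trans hu.1, hu.2.trans hT⟩
      refine mul_nonpos_of_nonneg_of_nonpos (Real.exp_pos _).le ?_
      have := (h.frac_mem hm).1
      nlinarith [h.depth_pos u hm, decay_pos u, mul_nonneg this (h.depth_pos u hm).le,
        mul_nonneg this (decay_pos u).le])
  have h2 := le_exp_mul_of_exp_mul_le this
  rwa [show (-1) * (s - t) = t - s by ring] at h2

theorem mul_le_exp_mul (h : IsCellPath x y T) {s t : ℝ} (h0 : 0 ≤ s) (hst : s ≤ t) (hT : t ≤ T) :
    x s * y s ≤ Real.exp (t - s) * (x t * y t) := by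
  have key := le_of_hasDerivWithinAt_nonneg (T := T) (s := s) (t := t)
    (fun u hu => hasDerivWithinAt_exp_neg_mul
      (h.hasDerivWithinAt_mul ⟨h0.trans hu.1, hu.2.trans hT⟩) 1) h0 hst hT (fun u hu => by
      have hm : u ∈ Icc 0 T := ⟨h0.trans hu.1, hu.2.trans hT⟩
      refine mul_nonneg (Real.exp_pos _).le ?_
      have h1 := (h.frac_mem hm).1
      have h2 : 0 < x u * y u := mul_pos (h.x_pos u hm) (h.y_pos u hm)
      nlinarith [mul_nonneg h1 h2.le])
  have h2 := mul_le_mul_of_nonneg_left key (Real.exp_pos (-s)).le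
  rw [← mul_assoc (Real.exp (-s)) (Real.exp (1 * s)), ← mul_assoc (Real.exp (-s)) (Real.exp (1 * t)),
    ← Real.exp_add, ← Real.exp_add] at h2
  rwa [show -s + 1 * s = 0 by ring, Real.exp_zero, one_mul, show -s + 1 * t = t - s by ring] at h2

theorem level_le (h : IsCellPath x y T) {s t : ℝ} (h0 : 0 ≤ s) (hst : s ≤ t) (hT : t ≤ T) :
    x t * y t * depth t (x t) (y t) ≤ x s * y s * depth s (x s) (y s) :=
  le_of_hasDerivWithinAt_nonpos (T := T)
    (fun u hu => h.hasDerivWithinAt_level ⟨h0.trans hu.1, hu.2.trans hT⟩) h0 hst hT (fun u hu => by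
      have hm : u ∈ Icc 0 T := ⟨h0.trans hu.1, hu.2.trans hT⟩
      have h1 := (h.frac_mem hm).1
      have h2 : 0 < x u * y u := mul_pos (h.x_pos u hm) (h.y_pos u hm)
      nlinarith [mul_nonneg (mul_nonneg (decay_pos u).le h1) h2.le])

theorem mul_antitone (h : IsCellPath x y T) {s t : ℝ} (h0 : 0 ≤ s) (hst : s ≤ t) (hT : t ≤ T)
    (hd : ∀ u ∈ Icc s t, y u / x u ≤ 1) : x t * y t ≤ x s * y s :=
  le_of_hasDerivWithinAt_nonpos (T := T)
    (fun u hu => h.hasDerivWithinAt_mul ⟨h0.trans hu.1, hu.2.trans hT⟩) h0 hst hT (fun u hu => by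
      have hm : u ∈ Icc 0 T := ⟨h0.trans hu.1, hu.2.trans hT⟩
      have h1 := h.frac_le_half hm (hd u hu)
      have h2 : 0 < x u * y u := mul_pos (h.x_pos u hm) (h.y_pos u hm)
      nlinarith)

theorem depth_antitone (h : IsCellPath x y T) {s t : ℝ} (h0 : 0 ≤ s) (hst : s ≤ t) (hT : t ≤ T)
    (hd : ∀ u ∈ Icc s t, 1 ≤ y u / x u) : depth t (x t) (y t) ≤ depth s (x s) (y s) :=
  le_of_hasDerivWithinAt_nonpos (T := T)
    (fun u hu => h.hasDerivWithinAt_depth ⟨h0.trans hu.1, hu.2.trans hT⟩) h0 hst hT (fun u hu => by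
      have hm : u ∈ Icc 0 T := ⟨h0.trans hu.1, hu.2.trans hT⟩
      have h1 := h.half_le_frac hm (hd u hu)
      nlinarith [h.depth_pos u hm, decay_pos u,
        mul_nonneg (sub_nonneg.2 h1) (h.depth_pos u hm).le])

/-- The exponential growth of the corrected depth along the incoming arm. -/
theorem incoming_growth (h : IsCellPath x y T) {t : ℝ} (h0 : 0 ≤ t) (hT : t ≤ T)
    (hd : ∀ u ∈ Icc 0 t, y u / x u ≤ 1) :
    Real.exp t * (-Real.log (x 0) + decay 0 - 1 - 100000 * (x 0 * y 0) ^ 2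
        + 3 / 2 * (y 0 / x 0) ^ 2) ≤
      -Real.log (x t) + decay t - 1 - 100000 * (x t * y t) ^ 2 + 3 / 2 * (y t / x t) ^ 2 := by
  have := le_of_hasDerivWithinAt_nonneg (T := T) (s := 0) (t := t)
    (fun u hu => hasDerivWithinAt_exp_neg_mul
      (((h.hasDerivWithinAt_logx ⟨hu.1, hu.2.trans hT⟩).sub
        (((h.hasDerivWithinAt_mul ⟨hu.1, hu.2.trans hT⟩).fun_pow 2).const_mul 100000)).add
        (((h.hasDerivWithinAt_div ⟨hu.1, hu.2.trans hT⟩).fun_pow 2).const_mul (3 / 2))) (-1))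
      le_rfl h0 hT (fun u hu => by
      have hm : u ∈ Icc 0 T := ⟨hu.1, hu.2.trans hT⟩
      refine mul_nonneg (Real.exp_pos _).le ?_
      have hx := h.x_pos u hm
      have hy := h.y_pos u hm
      have hl := h.depth_pos u hm
      have hk := decay_pos u
      have hσ := h.frac_le_half hm (hd u hu)
      have hσ0 := (h.frac_mem hm).1
      have hlog := log_le_depth (t := u) (y := y u) hx
      have hσd : y u ^ 2 / (x u ^ 2 + y u ^ 2) ≤ (y u / x u) ^ 2 := by
        rw [div_pow]
        exact div_le_div_of_nonneg_left (sq_nonneg _) (by positivity) (by nlinarith [sq_nonneg (y u)])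
      simp only [Pi.add_apply, Pi.sub_apply, Nat.cast_ofNat, Nat.add_one_sub_one, pow_one]
      set σ := y u ^ 2 / (x u ^ 2 + y u ^ 2) with hσdef
      set D := y u / x u with hD
      set l := depth u (x u) (y u) with hldef
      set k := decay u with hkdef
      have hP : x u * y u = D * x u ^ 2 := by rw [hD]; field_simp
      rw [hP]
      have hD0 : 0 ≤ D ^ 2 := sq_nonneg _
      have hP2 : 0 ≤ (D * x u ^ 2) ^ 2 := sq_nonneg _
      -- The errors `σ ≤ D²`, `D²/2` from replacing `ℓ` by `-log x`, and `9/2 · D²` from the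
      -- correction itself add up to `6D²`. For `ℓ ≥ 1` they are absorbed by the growth of the
      -- slope. For `ℓ < 1` the radius is bounded below, so `(x y)²` is comparable to `D²`; this is
      -- the role of the term with the factor `100000`.
      have main : 6 * D ^ 2 ≤ 100000 * (D * x u ^ 2) ^ 2 + 6 * l * D ^ 2 := by
        rcases le_or_gt 1 l with hl1 | hl1
        · nlinarith
        · have hr := exp_two_depth (t := u) (y := y u) hx
          have hyx : y u ≤ x u := by have := hd u hu; rwa [div_le_one hx] at this
          have hx2 : Real.exp (-4) / 2 ≤ x u ^ 2 := by
            have : Real.exp (-4) ≤ x u ^ 2 + y u ^ 2 := by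
              rw [hr]; exact Real.exp_le_exp.2 (by linarith)
            nlinarith
          have he : (1 : ℝ) / 64 ≤ Real.exp (-4) := by
            have h1 := Real.exp_one_lt_d9
            have h2 : Real.exp (-4) = (Real.exp 1 ^ 4)⁻¹ := by
              rw [← Real.exp_nat_mul, ← Real.exp_neg]; norm_num
            rw [h2, one_div]
            apply inv_anti₀ (by positivity)
            have : Real.exp 1 ^ 4 ≤ 2.7182818286 ^ 4 :=
              pow_le_pow_left₀ (Real.exp_pos 1).le h1.le 4
            norm_num at this ⊢
            linarith
          have hx4 : (1 / 128 : ℝ) ^ 2 ≤ (x u ^ 2) ^ 2 :=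
            pow_le_pow_left₀ (by norm_num) (by linarith) 2
          have h6 : 6 * D ^ 2 ≤ 100000 * (D ^ 2 * (x u ^ 2) ^ 2) := by nlinarith
          have : 0 ≤ 6 * l * D ^ 2 := by positivity
          calc 6 * D ^ 2 ≤ 100000 * (D ^ 2 * (x u ^ 2) ^ 2) := h6
            _ ≤ _ := by nlinarith
      nlinarith [mul_nonneg hk.le hD0, mul_nonneg (sub_nonneg.2 hσ) hP2])
  have h2 := mul_le_mul_of_nonneg_left this (Real.exp_pos t).le
  rw [← mul_assoc, ← mul_assoc, ← Real.exp_add, ← Real.exp_add] at h2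
  simpa using h2

/-- The exponential decrease of the corrected depth along the outgoing arm. -/
theorem outgoing_decay (h : IsCellPath x y T) {s t : ℝ} (h0 : 0 ≤ s) (hst : s ≤ t) (hT : t ≤ T)
    (hl : ∀ u ∈ Icc s t, 1 ≤ depth u (x u) (y u)) :
    -Real.log (y t) + decay t - 1 + 3 / 2 * (x t / y t) ^ 2 ≤
      Real.exp (-(t - s)) *
        (-Real.log (y s) + decay s - 1 + 3 / 2 * (x s / y s) ^ 2) := by
  have := le_of_hasDerivWithinAt_nonpos (T := T) (s := s) (t := t)
    (fun u hu => hasDerivWithinAt_exp_neg_mul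
      ((h.hasDerivWithinAt_logy ⟨h0.trans hu.1, hu.2.trans hT⟩).add
        (((h.hasDerivWithinAt_div' ⟨h0.trans hu.1, hu.2.trans hT⟩).fun_pow 2).const_mul (3 / 2))) 1)
      h0 hst hT (fun u hu => by
      have hm : u ∈ Icc 0 T := ⟨h0.trans hu.1, hu.2.trans hT⟩
      refine mul_nonpos_of_nonneg_of_nonpos (Real.exp_pos _).le ?_
      have hx := h.x_pos u hm
      have hy := h.y_pos u hm
      have hl := hl u hu
      have hk := decay_pos u
      have hlog := log_le_depth (t := u) (y := x u) hy
      rw [depth_comm] at hlog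
      have hσd : x u ^ 2 / (x u ^ 2 + y u ^ 2) ≤ (x u / y u) ^ 2 := by
        rw [div_pow]
        exact div_le_div_of_nonneg_left (sq_nonneg _) (by positivity) (by nlinarith [sq_nonneg (x u)])
      simp only [Pi.add_apply, Nat.cast_ofNat, Nat.add_one_sub_one, pow_one]
      -- Again all errors sum to `6(x/y)²`, against a gain `6ℓ(x/y)²`; this is where depth at least
      -- `1` is needed.
      nlinarith [mul_nonneg (sq_nonneg (x u / y u)) (sub_nonneg.2 hl),
        mul_nonneg (sq_nonneg (x u / y u)) hk.le])
  have h2 := le_exp_mul_of_exp_mul_le this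
  rwa [show 1 * (s - t) = -(t - s) by ring] at h2

end IsCellPath

/-! ### Thin trajectories leave the cell after one passage -/

theorem exp_four_lt : Real.exp 4 < 55 := by
  have h1 := Real.exp_one_lt_d9
  have h2 : Real.exp 4 = Real.exp 1 ^ 4 := by rw [← Real.exp_nat_mul]; norm_num
  rw [h2]
  have : Real.exp 1 ^ 4 ≤ 2.7182818286 ^ 4 := pow_le_pow_left₀ (Real.exp_pos 1).le h1.le 4
  norm_num at this ⊢
  linarith

/-- Used to absorb all polynomial losses in the depth into `x y ≤ e^{-2ℓ}/2`. Nine is the largest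
power that occurs, as `lp (lp + 2)⁸` in `one_le_div_of_thin`. -/
theorem pow_nine_mul_exp_le {l : ℝ} (hl : 0 ≤ l) :
    (l + 2) ^ 9 * Real.exp (-2 * l) ≤ 800000 := by
  have h1 : (1 + 2 * l / 9) ^ 9 ≤ Real.exp (2 * l) := by
    have : Real.exp (2 * l) = Real.exp (2 * l / 9) ^ 9 := by rw [← Real.exp_nat_mul]; congr 1; ring
    rw [this]
    exact pow_le_pow_left₀ (by positivity) (by linarith [Real.add_one_le_exp (2 * l / 9)]) 9
  have h2 : (l + 2) ^ 9 ≤ (9 / 2) ^ 9 * (1 + 2 * l / 9) ^ 9 := by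
    rw [← mul_pow]
    exact pow_le_pow_left₀ (by positivity) (by linarith) 9
  rw [show -2 * l = -(2 * l) by ring, Real.exp_neg, ← div_eq_mul_inv, div_le_iff₀ (Real.exp_pos _)]
  calc (l + 2) ^ 9 ≤ (9 / 2) ^ 9 * (1 + 2 * l / 9) ^ 9 := h2
    _ ≤ 800000 * Real.exp (2 * l) := by
      have : (0 : ℝ) ≤ (1 + 2 * l / 9) ^ 9 := by positivity
      nlinarith [Real.exp_pos (2 * l)]

namespace IsCellPath

variable {x y : ℝ → ℝ} {T : ℝ}

theorem mul_le_exp (h : IsCellPath x y T) {s : ℝ} (hs : s ∈ Icc 0 T) :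
    x s * y s ≤ Real.exp (-2 * depth s (x s) (y s)) / 2 := by
  have hr := exp_two_depth (t := s) (y := y s) (h.x_pos s hs)
  have : Real.exp (2 * (decay s - 1 - depth s (x s) (y s))) ≤
      Real.exp (-2 * depth s (x s) (y s)) :=
    Real.exp_le_exp.2 (by linarith [decay_le_one hs.1])
  nlinarith [sq_nonneg (x s - y s)]

theorem mul_pos' (h : IsCellPath x y T) {s : ℝ} (hs : s ∈ Icc 0 T) : 0 < x s * y s :=
  mul_pos (h.x_pos s hs) (h.y_pos s hs)

/-- At depth at most `1` the radius satisfies `r² ≥ e^{-4}`, and `55` is a bound for `e⁴`. -/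
theorem sq_add_sq_ge (h : IsCellPath x y T) {s : ℝ} (hs : s ∈ Icc 0 T)
    (hl : depth s (x s) (y s) ≤ 1) : 1 ≤ 55 * (x s ^ 2 + y s ^ 2) := by
  have hr := exp_two_depth (t := s) (y := y s) (h.x_pos s hs)
  have h1 : Real.exp (-4) ≤ x s ^ 2 + y s ^ 2 := by
    rw [hr]
    exact Real.exp_le_exp.2 (by linarith [decay_pos s])
  have h2 : Real.exp 4 * Real.exp (-4) = 1 := by rw [← Real.exp_add]; simp
  nlinarith [exp_four_lt, Real.exp_pos (-4)]

theorem continuousOn_div (h : IsCellPath x y T) : ContinuousOn (fun s => y s / x s) (Icc 0 T) :=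
  fun _ hs => (h.hasDerivWithinAt_div hs).continuousWithinAt

/-- A path that is in the outgoing half of the cell stays there as long as it crosses the diagonal
only at depth more than `1 / 2`. -/
theorem one_le_div_of_diagonal (h : IsCellPath x y T) {s₀ : ℝ} (hs₀ : s₀ ∈ Icc 0 T)
    (hd : 1 ≤ y s₀ / x s₀)
    (H : ∀ t ∈ Icc s₀ T, (∀ s ∈ Icc s₀ t, 1 ≤ y s / x s) → y t / x t = 1 →
      1 / 2 ≤ depth t (x t) (y t)) : ∀ t ∈ Icc s₀ T, 1 ≤ y t / x t := by
  have hsub : Icc s₀ T ⊆ Icc 0 T := Icc_subset_Icc_left hs₀.1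
  refine one_le_of_barrier (h.continuousOn_div.mono hsub)
    (fun s hs => (h.hasDerivWithinAt_div (hsub hs)).mono hsub) hd fun t ht hh hd1 => ?_
  have := H t ht hh hd1
  rw [hd1]
  nlinarith [decay_pos t]

/-- A race between two clocks. Once at depth at most `1`, a path with tiny `x/y` needs a long time
to bring `x/y` up to `1/3`, since `x/y` grows at most like `e^t`. During that time the amplitude
`e^{-t/2}` pushes the depth below zero, that is, out of the cell. The factor `e^{2s}` in the
hypothesis on `x/y` makes up for the amplitude being weak at late times. -/
theorem one_le_div_of_entry (h : IsCellPath x y T) {p : ℝ} (hp : p ∈ Icc 0 T)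
    (hd : 1 ≤ y p / x p)
    (H : ∀ s ∈ Icc p T, depth s (x s) (y s) ≤ 1 →
      (s = p ∨ (depth s (x s) (y s) = 1 ∧ ∀ u ∈ Icc p s, 1 ≤ depth u (x u) (y u))) →
      1 ≤ y s / x s → 48 * (x s / y s) * Real.exp (2 * s) ≤ 1) :
    ∀ t ∈ Icc p T, 1 ≤ y t / x t := by
  refine h.one_le_div_of_diagonal hp hd fun t ht hh hd1 => ?_
  by_contra! hlt
  have htm : t ∈ Icc 0 T := ⟨hp.1.trans ht.1, ht.2⟩
  have hsub : ∀ u ∈ Icc p t, u ∈ Icc 0 T := fun u hu => ⟨hp.1.trans hu.1, hu.2.trans ht.2⟩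
  obtain ⟨s₁, hs₁, hl₁, hc₁⟩ : ∃ s₁ ∈ Icc p t, depth s₁ (x s₁) (y s₁) ≤ 1 ∧
      48 * (x s₁ / y s₁) * Real.exp (2 * s₁) ≤ 1 := by
    rcases le_or_gt (depth p (x p) (y p)) 1 with hl | hl
    · exact ⟨p, left_mem_Icc.2 ht.1, hl, H p (left_mem_Icc.2 hp.2) hl (Or.inl rfl) hd⟩
    · obtain ⟨s, hs, hs1, hbef⟩ := exists_first_eq (f := fun s => -depth s (x s) (y s)) (c := -1)
        ht.1 (fun u hu => ((h.hasDerivWithinAt_depth (hsub u hu)).neg.continuousWithinAt).mono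
          fun v hv => hsub v hv) (by linarith) (by linarith)
      have hs1' : depth s (x s) (y s) = 1 := by linarith
      refine ⟨s, ⟨hs.1.le, hs.2⟩, hs1'.le, H s ⟨hs.1.le, hs.2.trans ht.2⟩ hs1'.le
        (Or.inr ⟨hs1', fun u hu => ?_⟩) (hh s ⟨hs.1.le, hs.2⟩)⟩
      rcases hu.2.eq_or_lt with e | e
      · rw [e, hs1']
      · linarith [hbef u ⟨hu.1, e⟩]
  have hs₁m := hsub s₁ hs₁
  have hE1 : 1 ≤ Real.exp (2 * s₁) := Real.one_le_exp (by linarith [hs₁m.1])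
  have hcpos : ∀ u ∈ Icc 0 T, 0 < x u / y u := fun u hu => div_pos (h.x_pos u hu) (h.y_pos u hu)
  have hct : x t / y t = 1 := by
    rw [← one_div_div, hd1]; norm_num
  have hcs : x s₁ / y s₁ < 1 / 3 := by nlinarith [hcpos s₁ hs₁m]
  obtain ⟨t₂, ht₂, hct₂, hbef⟩ := exists_first_eq (f := fun s => x s / y s) (c := 1 / 3)
    hs₁.2 (fun u hu => ((h.hasDerivWithinAt_div'
      (hsub u ⟨hs₁.1.trans hu.1, hu.2⟩)).continuousWithinAt).mono
        fun v hv => hsub v ⟨hs₁.1.trans hv.1, hv.2⟩) hcs (by rw [hct]; norm_num)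
  have hle : ∀ u ∈ Icc s₁ t₂, x u / y u ≤ 1 / 3 := fun u hu =>
    hu.2.eq_or_lt.elim (fun e => e ▸ hct₂.le) fun e => (hbef u ⟨hu.1, e⟩).le
  have hsub2 : ∀ u ∈ Icc s₁ t₂, u ∈ Icc 0 T := fun u hu =>
    hsub u ⟨hs₁.1.trans hu.1, hu.2.trans ht₂.2⟩
  have hT₂ : t₂ ≤ T := ht₂.2.trans ht.2
  have hgrow : x t₂ / y t₂ ≤ Real.exp (t₂ - s₁) * (x s₁ / y s₁) := by
    have := le_of_hasDerivWithinAt_nonpos (T := T) (s := s₁) (t := t₂)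
      (fun u hu => hasDerivWithinAt_exp_neg_mul (h.hasDerivWithinAt_div' (hsub2 u hu)) (-1))
      hs₁m.1 ht₂.1.le hT₂ (fun u hu => by
        refine mul_nonpos_of_nonneg_of_nonpos (Real.exp_pos _).le ?_
        have h1 := hcpos u (hsub2 u hu)
        have h2 := h.depth_pos u (hsub2 u hu)
        nlinarith [decay_pos u, mul_pos h1 h2, mul_pos h1 (decay_pos u)])
    have h2 := le_exp_mul_of_exp_mul_le this
    rwa [show (-1) * (s₁ - t₂) = t₂ - s₁ by ring] at h2
  -- For `x/y ≤ 1/3` one has `σ ≥ 9/10`, so `ℓ' ≤ -(3/4)ℓ - (9/10)e^{-t/2}`. Equivalently `e^{3t/4}ℓ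
  -- + (18/5)e^{t/4}` does not increase.
  have hdec := le_of_hasDerivWithinAt_nonpos (T := T) (s := s₁) (t := t₂)
      (fun u hu => (hasDerivWithinAt_exp_neg_mul (h.hasDerivWithinAt_depth (hsub2 u hu))
        (3 / 4)).add (hasDerivWithinAt_exp_neg_mul (hasDerivWithinAt_const u (Icc 0 T) (18 / 5 : ℝ))
          (1 / 4)))
      hs₁m.1 ht₂.1.le hT₂ (fun u hu => by
        have hm := hsub2 u hu
        have hx := h.x_pos u hm
        have hy := h.y_pos u hm
        have hl := h.depth_pos u hm
        have hc := hle u hu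
        have hσ : 9 / 10 ≤ y u ^ 2 / (x u ^ 2 + y u ^ 2) := by
          rw [div_le_iff₀ hy] at hc
          rw [le_div_iff₀ (by positivity)]
          nlinarith
        have hE : Real.exp (3 / 4 * u) * decay u = Real.exp (1 / 4 * u) := by
          rw [decay, ← Real.exp_add]; congr 1; ring
        have h1 : (1 - 2 * (y u ^ 2 / (x u ^ 2 + y u ^ 2))) * depth u (x u) (y u)
            - decay u * (y u ^ 2 / (x u ^ 2 + y u ^ 2)) + 3 / 4 * depth u (x u) (y u) ≤
            -(9 / 10) * decay u := by
          nlinarith [decay_pos u, mul_nonneg (sub_nonneg.2 hσ) hl.le,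
            mul_nonneg (sub_nonneg.2 hσ) (decay_pos u).le]
        have h2 := mul_le_mul_of_nonneg_left h1 (Real.exp_pos (3 / 4 * u)).le
        nlinarith [Real.exp_pos (1 / 4 * u)])
  simp only [Pi.add_apply] at hdec
  set A := Real.exp (1 / 4 * s₁) with hA
  set D := Real.exp (1 / 4 * (t₂ - s₁)) with hD
  have hA1 : 1 ≤ A := Real.one_le_exp (by linarith [hs₁m.1])
  have hDpos : 0 < D := Real.exp_pos _
  have e1 : Real.exp (3 / 4 * s₁) = A ^ 3 := by
    rw [hA, ← Real.exp_nat_mul]; congr 1; push_cast; ring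
  have e2 : Real.exp (1 / 4 * t₂) = A * D := by
    rw [hA, hD, ← Real.exp_add]; congr 1; ring
  have e3 : Real.exp (2 * s₁) = A ^ 8 := by
    rw [hA, ← Real.exp_nat_mul]; congr 1; push_cast; ring
  have e4 : Real.exp (t₂ - s₁) = D ^ 4 := by
    rw [hD, ← Real.exp_nat_mul]; congr 1; push_cast; ring
  rw [e1, e2] at hdec
  rw [e3] at hc₁
  rw [hct₂, e4] at hgrow
  have hc0 := hcpos s₁ hs₁m
  -- Going from `x/y ≤ 1/(48 e^{2s₁})` to `1/3` takes `e^{t₂-s₁} ≥ 16 e^{2s₁}`, i.e. `D ≥ 2A²`. Then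
  -- `A³ + (18/5)A - (18/5)AD < 0` contradicts positive depth at `t₂`.
  have hD4 : (2 * A ^ 2) ^ 4 ≤ D ^ 4 := by
    have h3 : 1 ≤ D ^ 4 * (3 * (x s₁ / y s₁)) := by linarith
    have h4 : D ^ 4 * (48 * (x s₁ / y s₁) * A ^ 8) ≤ D ^ 4 * 1 :=
      mul_le_mul_of_nonneg_left hc₁ (by positivity)
    have h5 : 16 * A ^ 8 * 1 ≤ 16 * A ^ 8 * (D ^ 4 * (3 * (x s₁ / y s₁))) :=
      mul_le_mul_of_nonneg_left h3 (by positivity)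
    nlinarith
  have hDA : 2 * A ^ 2 ≤ D := le_of_pow_le_pow_left₀ (by norm_num) hDpos.le hD4
  have hlt₂ := h.depth_pos t₂ (hsub2 t₂ (right_mem_Icc.2 ht₂.1.le))
  have hp1 : 0 < Real.exp (3 / 4 * t₂) * depth t₂ (x t₂) (y t₂) := by positivity
  have hp2 : A ^ 3 * depth s₁ (x s₁) (y s₁) ≤ A ^ 3 := by
    have : 0 ≤ A ^ 3 := by positivity
    nlinarith
  nlinarith [mul_le_mul_of_nonneg_left hDA (show 0 ≤ A by linarith), mul_self_nonneg (A - 1)]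

set_option maxHeartbeats 1000000 in
/-- Paths that start close to the boundary of the cell leave it on their first outgoing passage,
without returning to the incoming half of the cell. -/
theorem one_le_div_of_thin (h : IsCellPath x y T)
    (h0 : x 0 * y 0 ≤ 1 / 10 ^ 16 * depth 0 (x 0) (y 0) ^ 3) {s₀ : ℝ} (hs₀ : s₀ ∈ Icc 0 T)
    (hd : 1 ≤ y s₀ / x s₀) : ∀ t ∈ Icc s₀ T, 1 ≤ y t / x t := by
  have hT : 0 ≤ T := hs₀.1.trans hs₀.2
  have m0 : (0 : ℝ) ∈ Icc 0 T := left_mem_Icc.2 hT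
  obtain ⟨p, hp, hps, hdp, hbef⟩ : ∃ p ∈ Icc 0 T, p ≤ s₀ ∧ 1 ≤ y p / x p ∧
      (p = 0 ∨ (y p / x p = 1 ∧ ∀ u ∈ Icc 0 p, y u / x u ≤ 1)) := by
    rcases le_or_gt 1 (y 0 / x 0) with h1 | h1
    · exact ⟨0, m0, hs₀.1, h1, Or.inl rfl⟩
    · obtain ⟨s, hs, hs1, hb⟩ := exists_first_eq (f := fun s => y s / x s) hs₀.1
        (h.continuousOn_div.mono (Icc_subset_Icc_right hs₀.2)) h1 hd
      refine ⟨s, ⟨hs.1.le, hs.2.trans hs₀.2⟩, hs.2, hs1.ge, Or.inr ⟨hs1, fun u hu => ?_⟩⟩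
      exact hu.2.eq_or_lt.elim (fun e => e ▸ hs1.le) fun e => (hb u ⟨hu.1, e⟩).le
  suffices H : ∀ t ∈ Icc p T, 1 ≤ y t / x t from fun t ht => H t ⟨hps.trans ht.1, ht.2⟩
  have hP0 := h.mul_le_exp m0
  have hP0' := h.mul_pos' m0
  have hl0 := h.depth_pos 0 m0
  set P₀ := x 0 * y 0 with hP₀
  set l₀ := depth 0 (x 0) (y 0) with hl₀
  -- Two independent bounds of `x y` are multiplied: thinness for small depth and `e^{-2ℓ}` for
  -- large depth. The product is small at every depth.
  have hsq : P₀ ^ 2 ≤ 1 / 10 ^ 16 * l₀ ^ 3 * (Real.exp (-2 * l₀) / 2) := by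
    rw [sq]; exact mul_le_mul h0 hP0 hP0'.le (by positivity)
  have hl9 := pow_nine_mul_exp_le hl0.le
  have hE0 := Real.exp_pos (-2 * l₀)
  have hsq1 : P₀ ^ 2 ≤ 1 / 10 ^ 10 := by
    have : l₀ ^ 3 ≤ (l₀ + 2) ^ 9 := by
      calc l₀ ^ 3 ≤ (l₀ + 2) ^ 3 := pow_le_pow_left₀ hl0.le (by linarith) 3
        _ ≤ (l₀ + 2) ^ 9 := pow_le_pow_right₀ (by linarith) (by norm_num)
    have := (mul_le_mul_of_nonneg_right this hE0.le).trans hl9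
    linarith
  have hsq2 : 100000 * P₀ ^ 2 ≤ l₀ / 2 := by
    have : l₀ ^ 2 ≤ (l₀ + 2) ^ 9 := by
      calc l₀ ^ 2 ≤ (l₀ + 2) ^ 2 := pow_le_pow_left₀ hl0.le (by linarith) 2
        _ ≤ (l₀ + 2) ^ 9 := pow_le_pow_right₀ (by linarith) (by norm_num)
    have := mul_le_mul_of_nonneg_right this hE0.le
    have h3 : l₀ * (l₀ ^ 2 * Real.exp (-2 * l₀)) ≤ l₀ * 800000 :=
      mul_le_mul_of_nonneg_left (this.trans hl9) hl0.le
    nlinarith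
  have hc_le : ∀ s ∈ Icc 0 T, depth s (x s) (y s) ≤ 1 → 1 ≤ y s / x s →
      x s / y s ≤ 110 * (x s * y s) := fun s hs hl hd => by
    have hx := h.x_pos s hs
    have hy := h.y_pos s hs
    have := h.sq_add_sq_ge hs hl
    rw [one_le_div hx] at hd
    rw [div_le_iff₀ hy]
    have : 1 ≤ 110 * y s ^ 2 := by nlinarith
    nlinarith
  refine h.one_le_div_of_entry hp hdp fun s hs hl hcase hds => ?_
  have hsm : s ∈ Icc 0 T := ⟨hp.1.trans hs.1, hs.2⟩
  have hc := hc_le s hsm hl hds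
  have hxyp : 0 < x s / y s := div_pos (h.x_pos s hsm) (h.y_pos s hsm)
  rcases hcase with rfl | ⟨hl1, hlge⟩
  · rcases hbef with rfl | ⟨hd1, hb⟩
    · rw [mul_zero, Real.exp_zero]
      have : x 0 * y 0 ≤ 1 / 10 ^ 5 := by
        refine le_of_sq_le_sq ?_ (by norm_num)
        calc (x 0 * y 0) ^ 2 ≤ 1 / 10 ^ 10 := hsq1
          _ = _ := by norm_num
      linarith
    -- A diagonal crossing at depth at most `1` would have `x y ≥ 1/110`, but `x y` has not
    -- increased from its tiny initial value on the incoming half.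
    · exfalso
      have hP := h.mul_antitone le_rfl hp.1 hp.2 hb
      have h55 := h.sq_add_sq_ge hp hl
      have hxy : y s = x s := by rwa [div_eq_one_iff_eq (h.x_pos s hp).ne'] at hd1
      rw [hxy] at h55 hP
      have h1 : 1 / 110 ≤ P₀ := by nlinarith
      nlinarith
  · have hlp := h.depth_pos p hp
    set lp := depth p (x p) (y p) with hlpd
    have hPp := h.mul_le_exp hp
    have hPp0 := h.mul_pos' hp
    have hlev_s := h.level_le hp.1 hs.1 hs.2
    have hlev_p := h.level_le le_rfl hp.1 hp.2
    rw [hl1, mul_one] at hlev_s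
    rw [← hlpd] at hlev_s hlev_p hPp
    set hh := x p * y p * lp with hhd
    have hh0 : 0 < hh := mul_pos hPp0 hlp
    have hh1 : hh ≤ 1 / 10 ^ 16 * l₀ ^ 4 := by
      calc hh ≤ P₀ * l₀ := hlev_p
        _ ≤ (1 / 10 ^ 16 * l₀ ^ 3) * l₀ := mul_le_mul_of_nonneg_right h0 hl0.le
        _ = _ := by ring
    have hh2 : hh ≤ Real.exp (-2 * lp) / 2 * lp := mul_le_mul_of_nonneg_right hPp hlp.le
    -- The level at `p` is bounded both by the initial thinness, `l₀⁴`, and by the size `e^{-2lp}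
    -- lp` at the turning point. The travel time will cost `e^{2s} ≤ W` with `W²` of order `l₀⁻⁴`,
    -- which is exactly what the cube in the thinness hypothesis pays for.
    have hhsq : hh ^ 2 ≤ (1 / 10 ^ 16 * l₀ ^ 4) * (Real.exp (-2 * lp) / 2 * lp) := by
      rw [sq]; exact mul_le_mul hh1 hh2 hh0.le (by positivity)
    have hxp := h.x_pos p hp
    have hyp := h.y_pos p hp
    have hout := h.outgoing_decay hp.1 hs.1 hs.2 hlge
    have hYs : 1 ≤ -Real.log (y s) + decay s - 1 + 3 / 2 * (x s / y s) ^ 2 := by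
      have := depth_le_log (t := s) (y := x s) (h.y_pos s hsm)
      rw [depth_comm, hl1] at this
      linarith [sq_nonneg (x s / y s)]
    have hcp1 : x p / y p ≤ 1 := by
      rw [div_le_one hyp]; rwa [one_le_div hxp] at hdp
    have hcp0 : 0 < x p / y p := div_pos hxp hyp
    have hYp : -Real.log (y p) + decay p - 1 + 3 / 2 * (x p / y p) ^ 2 ≤ lp + 2 := by
      have := log_le_depth (t := p) (y := x p) hyp
      rw [depth_comm, ← hlpd] at this
      have hsq : (x p / y p) ^ 2 ≤ 1 := pow_le_one₀ hcp0.le hcp1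
      linarith
    have hEs : Real.exp s ≤ Real.exp p * (lp + 2) := by
      have h1 : Real.exp (s - p) * 1 ≤ Real.exp (s - p) * (Real.exp (-(s - p)) * (lp + 2)) :=
        mul_le_mul_of_nonneg_left
          ((hYs.trans hout).trans (mul_le_mul_of_nonneg_left hYp (Real.exp_pos _).le))
          (Real.exp_pos _).le
      rw [← mul_assoc, ← Real.exp_add, add_neg_cancel, Real.exp_zero, one_mul, mul_one] at h1
      calc Real.exp s = Real.exp p * Real.exp (s - p) := by rw [← Real.exp_add]; congr 1; ring
        _ ≤ _ := mul_le_mul_of_nonneg_left h1 (Real.exp_pos _).le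
    have hE2 : Real.exp (2 * s) = Real.exp s ^ 2 := by rw [← Real.exp_nat_mul]; norm_num
    have hlp9 := pow_nine_mul_exp_le hlp.le
    have hEp := Real.exp_pos p
    -- The outgoing time is bounded by `e^{s-p} ≤ lp + 2`. The incoming time satisfies `e^p ≤
    -- 2(lp+2)/l₀`, or `p = 0` if the path starts in the outgoing half.
    obtain ⟨W, hW0, hW, hWE⟩ : ∃ W : ℝ, 0 ≤ W ∧ hh * W ≤ 1 / 10 ^ 4 ∧ Real.exp s ^ 2 ≤ W := by
      rcases hbef with rfl | ⟨hd1, hb⟩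
      · refine ⟨(lp + 2) ^ 2, by positivity, ?_, ?_⟩
        · refine le_of_sq_le_sq ?_ (by norm_num)
          have hll : l₀ = lp := rfl
          rw [hll] at hhsq
          have h1 : lp ^ 5 ≤ (lp + 2) ^ 5 := pow_le_pow_left₀ hlp.le (by linarith) 5
          have h2 : lp ^ 5 * ((lp + 2) ^ 4 * Real.exp (-2 * lp)) ≤
              (lp + 2) ^ 5 * ((lp + 2) ^ 4 * Real.exp (-2 * lp)) :=
            mul_le_mul_of_nonneg_right h1 (by positivity)
          calc (hh * (lp + 2) ^ 2) ^ 2 = hh ^ 2 * (lp + 2) ^ 4 := by ring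
            _ ≤ (1 / 10 ^ 16 * lp ^ 4) * (Real.exp (-2 * lp) / 2 * lp) * (lp + 2) ^ 4 :=
              mul_le_mul_of_nonneg_right hhsq (by positivity)
            _ = 1 / 10 ^ 16 / 2 * (lp ^ 5 * ((lp + 2) ^ 4 * Real.exp (-2 * lp))) := by ring
            _ ≤ 1 / 10 ^ 16 / 2 * 800000 := by
              refine mul_le_mul_of_nonneg_left (h2.trans (le_of_eq_of_le ?_ hlp9)) (by norm_num)
              ring
            _ ≤ (1 / 10 ^ 4) ^ 2 := by norm_num
        · rw [Real.exp_zero, one_mul] at hEs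
          exact pow_le_pow_left₀ (Real.exp_pos _).le hEs 2
      · have hgr := h.incoming_growth hp.1 hp.2 hb
        have hX0 : l₀ / 2 ≤ -Real.log (x 0) + decay 0 - 1 - 100000 * P₀ ^ 2
            + 3 / 2 * (y 0 / x 0) ^ 2 := by
          have := depth_le_log (t := 0) (y := y 0) (h.x_pos 0 m0)
          linarith [sq_nonneg (y 0 / x 0)]
        have hXp : -Real.log (x p) + decay p - 1 - 100000 * (x p * y p) ^ 2
            + 3 / 2 * (y p / x p) ^ 2 ≤ lp + 2 := by
          have := log_le_depth (t := p) (y := y p) hxp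
          rw [hd1] at this ⊢
          rw [← hlpd] at this
          linarith [sq_nonneg (x p * y p)]
        have hEp2 : Real.exp p * (l₀ / 2) ≤ lp + 2 :=
          (mul_le_mul_of_nonneg_left hX0 hEp.le).trans (hgr.trans hXp)
        have hEp3 : Real.exp p ≤ 2 * (lp + 2) / l₀ := by
          rw [le_div_iff₀ hl0]; linarith
        refine ⟨(2 * (lp + 2) / l₀ * (lp + 2)) ^ 2, by positivity, ?_, ?_⟩
        · refine le_of_sq_le_sq ?_ (by norm_num)
          have h1 : lp ≤ lp + 2 := by linarith
          have h2 : lp * ((lp + 2) ^ 8 * Real.exp (-2 * lp)) ≤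
              (lp + 2) * ((lp + 2) ^ 8 * Real.exp (-2 * lp)) :=
            mul_le_mul_of_nonneg_right h1 (by positivity)
          calc (hh * (2 * (lp + 2) / l₀ * (lp + 2)) ^ 2) ^ 2
              = hh ^ 2 * (16 * (lp + 2) ^ 8 / l₀ ^ 4) := by field_simp; ring
            _ ≤ (1 / 10 ^ 16 * l₀ ^ 4) * (Real.exp (-2 * lp) / 2 * lp) *
                (16 * (lp + 2) ^ 8 / l₀ ^ 4) :=
              mul_le_mul_of_nonneg_right hhsq (by positivity)
            _ = 8 / 10 ^ 16 * (lp * ((lp + 2) ^ 8 * Real.exp (-2 * lp))) := by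
              field_simp
              norm_num
            _ ≤ 8 / 10 ^ 16 * 800000 := by
              refine mul_le_mul_of_nonneg_left (h2.trans (le_of_eq_of_le ?_ hlp9)) (by norm_num)
              ring
            _ ≤ (1 / 10 ^ 4) ^ 2 := by norm_num
        · refine pow_le_pow_left₀ (Real.exp_pos _).le (hEs.trans ?_) 2
          exact mul_le_mul_of_nonneg_right hEp3 (by linarith)
    rw [hE2]
    have hcs : x s / y s ≤ 110 * hh := hc.trans (by linarith)
    calc 48 * (x s / y s) * Real.exp s ^ 2 ≤ 48 * (110 * hh) * W :=
          mul_le_mul (by linarith) hWE (by positivity) (by positivity)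
      _ = 5280 * (hh * W) := by ring
      _ ≤ 1 := by linarith

/-- Along a path with a tiny final value of `x y` the level `x y ℓ` is conserved up to a constant
factor, and the path starts in the incoming half of the cell. -/
theorem level_ge (h : IsCellPath x y T) (hT : 0 ≤ T)
    (hP : x T * y T * Real.exp (2 * T) * (1 + T) ≤ 1 / 1000)
    (hl : depth 0 (x 0) (y 0) < depth T (x T) (y T)) (hl1 : 1 ≤ depth T (x T) (y T)) :
    y 0 < x 0 ∧ x 0 * y 0 * depth 0 (x 0) (y 0) ≤
      Real.exp 3 * (x T * y T * depth T (x T) (y T)) := by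
  have m0 : (0 : ℝ) ∈ Icc 0 T := left_mem_Icc.2 hT
  have mT : T ∈ Icc 0 T := right_mem_Icc.2 hT
  have hPT := h.mul_pos' mT
  have hE2 : 1 ≤ Real.exp (2 * T) := Real.one_le_exp (by linarith)
  have hPe : x T * y T * Real.exp (2 * T) ≤ 1 / 1000 := by
    have : 0 < x T * y T * Real.exp (2 * T) := by positivity
    nlinarith
  have hPs : ∀ s ∈ Icc 0 T, x s * y s ≤ 1 / 1000 := fun s hs => by
    have h1 := h.mul_le_exp_mul hs.1 hs.2 le_rfl
    have h2 : Real.exp (T - s) ≤ Real.exp (2 * T) := Real.exp_le_exp.2 (by linarith [hs.1])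
    nlinarith
  -- Turning back would need a diagonal point at depth below `1/2`, where `x y ≥ 1/110`. But `x y`
  -- changes at most exponentially and is tiny at time `T`, so it is tiny throughout.
  have hstay : ∀ s₀ ∈ Icc 0 T, 1 ≤ y s₀ / x s₀ → ∀ t ∈ Icc s₀ T, 1 ≤ y t / x t := by
    intro s₀ hs₀ hd
    refine h.one_le_div_of_diagonal hs₀ hd fun t ht _ hd1 => ?_
    have htm : t ∈ Icc 0 T := ⟨hs₀.1.trans ht.1, ht.2⟩
    by_contra! hlt
    have hx := h.x_pos t htm
    have hxy : y t = x t := by rwa [div_eq_one_iff_eq hx.ne'] at hd1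
    have h55 := h.sq_add_sq_ge htm (by linarith)
    have := hPs t htm
    rw [hxy] at h55 this
    nlinarith
  have hgt : ∀ s ∈ Icc 0 T, 1 ≤ y s / x s → depth T (x T) (y T) ≤ depth s (x s) (y s) :=
    fun s hs hd => h.depth_antitone hs.1 hs.2 le_rfl (hstay s hs hd)
  refine ⟨?_, ?_⟩
  · by_contra! hcon
    have := hgt 0 m0 ((one_le_div (h.x_pos 0 m0)).2 hcon)
    linarith
  · set M := 55 * (x T * y T) * Real.exp (2 * T) with hM
    have hM0 : 0 ≤ M := by positivity
    have hlev : ∀ s ∈ Icc 0 T, 0 < x s * y s * depth s (x s) (y s) := fun s hs =>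
      mul_pos (h.mul_pos' hs) (h.depth_pos s hs)
    have key := le_of_hasDerivWithinAt_nonneg (T := T) (s := 0) (t := T)
      (fun u hu => (((h.hasDerivWithinAt_level hu).log (hlev u hu).ne').add
        (((hasDerivAt_decay u).const_mul (-2)).hasDerivWithinAt)).add
        (((hasDerivAt_id u).const_mul M).hasDerivWithinAt)) le_rfl hT le_rfl (fun u hu => by
        have hx := h.x_pos u hu
        have hy := h.y_pos u hu
        have hP := h.mul_pos' hu
        have hld := h.depth_pos u hu
        have hσ := h.frac_mem hu
        have hk := decay_pos u
        have hk1 := decay_le_one hu.1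
        have e : -decay u * (y u ^ 2 / (x u ^ 2 + y u ^ 2)) * (x u * y u) /
            (x u * y u * depth u (x u) (y u)) =
            -(decay u * (y u ^ 2 / (x u ^ 2 + y u ^ 2)) / depth u (x u) (y u)) := by
          field_simp
        rw [e]
        -- The logarithm of the level decreases at rate `decay · σ/ℓ`. For `ℓ ≥ 1` this is at most
        -- `decay`, whose integral is at most `2`. For `ℓ < 1` the path must still be incoming,
        -- since an outgoing point is at least as deep as the end point; there `σ ≤ 55xy` is so
        -- small that the rate is at most `M` with `M T ≤ 1`. Together this gives the factor `e³`.
        have goal : decay u * (y u ^ 2 / (x u ^ 2 + y u ^ 2)) / depth u (x u) (y u) ≤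
            decay u + M := by
          rw [div_le_iff₀ hld]
          rcases le_or_gt 1 (depth u (x u) (y u)) with h1 | h1
          · nlinarith [mul_nonneg hk.le hσ.1, mul_nonneg hM0 hld.le]
          · have hd1 : y u / x u < 1 := by
              by_contra! hcon
              linarith [hgt u hu hcon]
            rw [div_lt_one hx] at hd1
            have h55 := h.sq_add_sq_ge hu h1.le
            have hσP : y u ^ 2 / (x u ^ 2 + y u ^ 2) ≤ 55 * (x u * y u) := by
              rw [div_le_iff₀ (by positivity)]
              have : y u ^ 2 ≤ x u * y u := by nlinarith
              nlinarith
            have hPu := h.mul_le_exp_mul hu.1 hu.2 le_rfl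
            have hlu := h.depth_le_exp_mul hu.1 hu.2 le_rfl
            have hEE : Real.exp (T - u) * Real.exp (T - u) ≤ Real.exp (2 * T) := by
              rw [← Real.exp_add]; exact Real.exp_le_exp.2 (by linarith [hu.1])
            have hEp := Real.exp_pos (T - u)
            have h1l : 1 ≤ Real.exp (T - u) * depth u (x u) (y u) := hl1.trans hlu
            have : 55 * (x u * y u) ≤ M * depth u (x u) (y u) := by
              calc 55 * (x u * y u) ≤ 55 * (Real.exp (T - u) * (x T * y T)) * 1 := by linarith
                _ ≤ 55 * (Real.exp (T - u) * (x T * y T)) *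
                    (Real.exp (T - u) * depth u (x u) (y u)) :=
                  mul_le_mul_of_nonneg_left h1l (by positivity)
                _ = 55 * (x T * y T) * (Real.exp (T - u) * Real.exp (T - u)) *
                    depth u (x u) (y u) := by ring
                _ ≤ 55 * (x T * y T) * Real.exp (2 * T) * depth u (x u) (y u) := by gcongr
            nlinarith [mul_nonneg hk.le hσ.1, mul_nonneg hk.le hld.le]
        linarith)
    simp only [Pi.add_apply, id_eq, mul_zero, add_zero] at key
    have hMT : M * T ≤ 1 := by
      have h0 : x T * y T * Real.exp (2 * T) * T ≤ 1 / 1000 := by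
        have : 0 < x T * y T * Real.exp (2 * T) := by positivity
        nlinarith
      rw [hM]; nlinarith
    have hk0 := decay_le_one le_rfl
    have hkT := decay_pos T
    have hlog : Real.log (x 0 * y 0 * depth 0 (x 0) (y 0)) ≤
        3 + Real.log (x T * y T * depth T (x T) (y T)) := by linarith
    rw [← Real.log_exp 3, ← Real.log_mul (Real.exp_pos _).ne' (hlev T mT).ne'] at hlog
    exact (Real.log_le_log_iff (hlev 0 m0) (mul_pos (Real.exp_pos _) (hlev T mT))).1 hlog

end IsCellPath

/-! ### The initial patch -/

/-- The interior of a smooth star-shaped curve, given by a quadratically homogeneous gauge, is a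
smooth patch. -/
theorem isSmoothPatch_of_gauge {N : ℂ → ℝ} (c : ℂ) {k : ℝ} (hk : 0 < k) (hN : Continuous N)
    (hsmul : ∀ (r : ℝ) (w : ℂ), N (r * w) = r ^ 2 * N w) (hpos : ∀ w, k * ‖w‖ ^ 2 ≤ N w)
    (hsm : ContDiff ℝ ∞ fun s : ℝ => N (Complex.exp (s * Complex.I))) :
    IsSmoothPatch {z | N (z - c) < 1} := by
  have hN0 : N 0 = 0 := by simpa using hsmul 0 0
  have hcont : Continuous fun z => N (z - c) := hN.comp (continuous_id.sub continuous_const)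
  have hopen : IsOpen {z | N (z - c) < 1} := isOpen_lt hcont continuous_const
  have hstar : StarConvex ℝ c {z | N (z - c) < 1} := by
    intro z hz a b ha hb hab
    have e : a • c + b • z - c = (b : ℂ) * (z - c) := by
      have : (a : ℂ) = 1 - b := by rw [← Complex.ofReal_one, ← hab]; push_cast; ring
      simp only [Complex.real_smul, this]; ring
    show N (a • c + b • z - c) < 1
    rw [e, hsmul]
    have hz' : N (z - c) < 1 := hz
    have h0 : 0 ≤ N (z - c) := le_trans (by positivity) (hpos _)
    have hb1 : b ^ 2 ≤ 1 := pow_le_one₀ hb (by linarith)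
    nlinarith
  have hc : c ∈ {z | N (z - c) < 1} := by simp [hN0]
  have hn1 : ∀ s : ℝ, 0 < N (Complex.exp (s * Complex.I)) := fun s => by
    have := hpos (Complex.exp (s * Complex.I))
    rw [Complex.norm_exp_ofReal_mul_I] at this
    nlinarith
  -- By quadratic homogeneity the ray of angle `s` meets `N = 1` exactly at radius
  -- `N(e^{is})^{-1/2}`.
  set ρ : ℝ → ℝ := fun s => (Real.sqrt (N (Complex.exp (s * Complex.I))))⁻¹ with hρ
  have hρpos : ∀ s, 0 < ρ s := fun s => inv_pos.2 (Real.sqrt_pos.2 (hn1 s))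
  have hρsm : ContDiff ℝ ∞ ρ :=
    (hsm.sqrt fun s => (hn1 s).ne').inv fun s => (Real.sqrt_pos.2 (hn1 s)).ne'
  have hexp : ContDiff ℝ ∞ fun s : ℝ => Complex.exp (s * Complex.I) :=
    (Complex.ofRealCLM.contDiff.mul contDiff_const).cexp
  refine ⟨hopen, ?_, ?_, ?_⟩
  · refine (Metric.isBounded_closedBall (x := c) (r := Real.sqrt (1 / k))).subset fun z hz => ?_
    have h1 := hpos (z - c)
    have hz' : N (z - c) < 1 := hz
    rw [Metric.mem_closedBall, dist_eq_norm]
    apply Real.le_sqrt_of_sq_le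
    rw [le_div_iff₀ hk]
    linarith
  · have : ContractibleSpace {z | N (z - c) < 1} := hstar.contractibleSpace ⟨c, hc⟩
    show SimplyConnectedSpace _
    infer_instance
  · refine ⟨fun s => c + ρ s * Complex.exp (s * Complex.I), ?_, ?_, ?_, ?_, ?_⟩
    · exact contDiff_const.add ((Complex.ofRealCLM.contDiff.comp hρsm).mul hexp)
    · intro s
      have e : Complex.exp (((s + 2 * Real.pi : ℝ) : ℂ) * Complex.I) =
          Complex.exp (s * Complex.I) := by
        rw [← Complex.exp_periodic (s * Complex.I)]
        congr 1; push_cast; ring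
      simp only [hρ]
      rw [e]
    · intro s
      have h1 : HasDerivAt ρ (deriv ρ s) s :=
        (hρsm.differentiable (by simp)).differentiableAt.hasDerivAt
      have h2 : HasDerivAt (fun s : ℝ => Complex.exp (s * Complex.I))
          (Complex.exp (s * Complex.I) * Complex.I) s := by
        have := ((Complex.ofRealCLM.hasDerivAt (x := s)).mul_const Complex.I).cexp
        simpa using this
      have h3 := (h1.ofReal_comp.mul h2).const_add c
      have h4 : HasDerivAt (fun s : ℝ => c + ρ s * Complex.exp (s * Complex.I)) _ s := h3
      rw [h4.deriv]
      -- The velocity of the boundary curve is `(ρ' + iρ)e^{is}`, which cannot vanish because its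
      -- factor has imaginary part `ρ > 0`.
      have e : ((deriv ρ s : ℝ) : ℂ) * Complex.exp (s * Complex.I) +
          (ρ s : ℂ) * (Complex.exp (s * Complex.I) * Complex.I) =
          (((deriv ρ s : ℝ) : ℂ) + ρ s * Complex.I) * Complex.exp (s * Complex.I) := by ring
      rw [e]
      refine mul_ne_zero (fun h => ?_) (Complex.exp_ne_zero _)
      have := congrArg Complex.im h
      simp at this
      exact (hρpos s).ne' this
    · intro s hs s' hs' h
      have h1 : (ρ s : ℂ) * Complex.exp (s * Complex.I) = ρ s' * Complex.exp (s' * Complex.I) :=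
        add_left_cancel h
      have h2 := congrArg norm h1
      simp only [norm_mul, Complex.norm_exp_ofReal_mul_I, mul_one, Complex.norm_real,
        Real.norm_eq_abs, abs_of_pos (hρpos _)] at h2
      rw [h2] at h1
      have h3 := mul_left_cancel₀ (Complex.ofReal_ne_zero.2 (hρpos s').ne') h1
      obtain ⟨n, hn⟩ := Complex.exp_eq_exp_iff_exists_int.1 h3
      have h4 : s = s' + n * (2 * Real.pi) := by
        have h5 : (s : ℂ) * Complex.I = ((s' + n * (2 * Real.pi) : ℝ) : ℂ) * Complex.I := by
          rw [hn]; push_cast; ring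
        exact_mod_cast mul_right_cancel₀ Complex.I_ne_zero h5
      have hp := Real.pi_pos
      have hn0 : n = 0 := by
        have h6 : (n : ℝ) < 1 := by
          by_contra! hcon
          nlinarith [hs.2, hs'.1]
        have h7 : (-1 : ℝ) < n := by
          by_contra! hcon
          nlinarith [hs.1, hs'.2]
        have h8 : n < 1 := by exact_mod_cast h6
        have h9 : -1 < n := by exact_mod_cast h7
        omega
      simpa [hn0] using h4
    · have hrange : ∀ z, N (z - c) = 1 ↔ z ∈ range fun s : ℝ =>
          c + ρ s * Complex.exp (s * Complex.I) := by
        intro z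
        constructor
        · intro hz
          have hpol : z - c = (‖z - c‖ : ℂ) * Complex.exp (Complex.arg (z - c) * Complex.I) :=
            (Complex.norm_mul_exp_arg_mul_I _).symm
          refine ⟨Complex.arg (z - c), ?_⟩
          have h1 := hz
          rw [hpol, hsmul] at h1
          have h2 : ‖z - c‖ = ρ (Complex.arg (z - c)) := by
            simp only [hρ]
            rw [← Real.sqrt_inv, eq_comm, ← Real.sqrt_sq (norm_nonneg (z - c))]
            congr 1
            exact inv_eq_of_mul_eq_one_left h1
          simp only [← h2, ← hpol]
          ring
        · rintro ⟨s, rfl⟩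
          rw [add_sub_cancel_left, hsmul]
          simp only [hρ]
          rw [inv_pow, Real.sq_sqrt (hn1 s).le, inv_mul_cancel₀ (hn1 s).ne']
      ext z
      rw [← hrange, hopen.frontier_eq]
      constructor
      · rintro ⟨h1, h2⟩
        have : z ∈ {z | N (z - c) ≤ 1} :=
          closure_minimal (fun z (hz : N (z - c) < 1) => hz.le) (isClosed_le hcont continuous_const) h1
        exact le_antisymm this (not_lt.1 h2)
      · intro hz
        refine ⟨?_, fun h => absurd hz (ne_of_lt h)⟩
        have hlim : Tendsto (fun r : ℝ => c + r * (z - c)) (𝓝[<] 1) (𝓝 (c + (1 : ℝ) * (z - c))) := by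
          refine Tendsto.mono_left ?_ nhdsWithin_le_nhds
          exact Continuous.tendsto (by fun_prop) 1
        rw [Complex.ofReal_one, one_mul, add_sub_cancel] at hlim
        refine mem_closure_of_tendsto hlim ?_
        filter_upwards [Ioo_mem_nhdsLT (show (0 : ℝ) < 1 by norm_num)] with r hr
        show N (c + r * (z - c) - c) < 1
        rw [add_sub_cancel_left, hsmul, hz]
        nlinarith [hr.1, hr.2]

/-- The flat profile of the initial patch at its contact points with the axes. -/
def profile (n : ℕ) (v : ℝ) : ℝ := expNegInvGlue ((2 * v) ^ n)

theorem profile_nonneg (n : ℕ) (v : ℝ) : 0 ≤ profile n v := expNegInvGlue.nonneg _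

theorem profile_eq {n : ℕ} {v : ℝ} (hv : 0 < v) : profile n v = Real.exp (-((2 * v) ^ n)⁻¹) := by
  have : 0 < (2 * v) ^ n := by positivity
  simp [profile, expNegInvGlue, not_le.2 this]

theorem profile_pos {n : ℕ} {v : ℝ} (hv : 0 < v) : 0 < profile n v := by
  rw [profile_eq hv]; exact Real.exp_pos _

theorem profile_zero {n : ℕ} (hn : n ≠ 0) : profile n 0 = 0 := by
  simp [profile, hn]

theorem profile_le_one (n : ℕ) {v : ℝ} (hv : 0 ≤ v) : profile n v ≤ 1 := by
  rcases hv.eq_or_lt with rfl | h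
  · by_cases hn : n = 0
    · subst hn
      norm_num [profile, expNegInvGlue]
    · rw [profile_zero hn]; norm_num
  · rw [profile_eq h]
    exact Real.exp_le_one_iff.2 (neg_nonpos.2 (by positivity))

theorem profile_mono {n : ℕ} (hn : n ≠ 0) {v w : ℝ} (hv : 0 ≤ v) (hvw : v ≤ w) :
    profile n v ≤ profile n w := by
  rcases hv.eq_or_lt with rfl | h
  · rw [profile_zero hn]; exact profile_nonneg _ _
  · rw [profile_eq h, profile_eq (h.trans_le hvw)]
    gcongr

/-- The factor `2` in `2v` makes this bound independent of `n`; it is why the initial distance has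
an absolute lower bound. -/
theorem exp_neg_one_le_profile {n : ℕ} {v : ℝ} (hv : 1 ≤ 2 * v) :
    Real.exp (-1) ≤ profile n v := by
  rw [profile_eq (by linarith)]
  exact Real.exp_le_exp.2 (neg_le_neg (inv_le_one_of_one_le₀ (one_le_pow₀ hv)))

theorem exp_neg_le {a : ℝ} (ha : 0 < a) : Real.exp (-a) ≤ 6 * (a⁻¹) ^ 3 := by
  have h := Real.pow_div_factorial_le_exp a ha.le 3
  rw [Real.exp_neg, inv_pow, ← div_eq_mul_inv, inv_eq_one_div, div_le_div_iff₀ (Real.exp_pos _)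
    (by positivity)]
  norm_num [Nat.factorial] at h
  linarith

theorem profile_le_cube {n : ℕ} (hn : n ≠ 0) {v : ℝ} (hv : 0 ≤ v) : profile n v ≤ 48 * v ^ 3 := by
  rcases hv.eq_or_lt with rfl | h
  · rw [profile_zero hn]; norm_num
  rcases le_or_gt 1 (2 * v) with h1 | h1
  · refine (profile_le_one n hv).trans ?_
    have : (1 : ℝ) ^ 3 ≤ (2 * v) ^ 3 := pow_le_pow_left₀ (by norm_num) h1 3
    nlinarith
  · rw [profile_eq h]
    have h2 : (2 * v) ^ n ≤ 2 * v := pow_le_of_le_one (by positivity) h1.le hn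
    have h3 : (2 * v)⁻¹ ≤ ((2 * v) ^ n)⁻¹ := inv_anti₀ (by positivity) h2
    calc Real.exp (-((2 * v) ^ n)⁻¹) ≤ Real.exp (-(2 * v)⁻¹) := Real.exp_le_exp.2 (by linarith)
      _ ≤ 6 * ((2 * v)⁻¹⁻¹) ^ 3 := exp_neg_le (by positivity)
      _ = 48 * v ^ 3 := by rw [inv_inv]; ring

theorem contDiff_profile (n : ℕ) : ContDiff ℝ ∞ (profile n) :=
  expNegInvGlue.contDiff.comp ((contDiff_const.mul contDiff_id).pow n)

/-- The width of the initial patch in the diagonal direction. -/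
def patchWidth : ℝ := 1 / 10 ^ 25

/-- The gauge of the initial patch with respect to its centre. -/
def patchGauge (n : ℕ) (w : ℂ) : ℝ :=
  (w.re ^ 2 + w.im ^ 2) / 2 + Real.sqrt ((w.re ^ 2 - w.im ^ 2) ^ 2 / 4 +
    patchWidth * profile n (4 * w.re ^ 2 * w.im ^ 2 / (w.re ^ 2 + w.im ^ 2) ^ 2) *
      (w.re ^ 2 + w.im ^ 2) ^ 2)

/-- The initial patch, a thin smooth patch inscribed in the square `(0, 2)²` that touches its sides
at their midpoints. -/
def initialPatch (n : ℕ) : Set ℂ := {z | patchGauge n (z - (1 + Complex.I)) < 1}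

theorem continuous_patchGauge (n : ℕ) : Continuous (patchGauge n) := by
  have key : Continuous fun w : ℂ =>
      profile n (4 * w.re ^ 2 * w.im ^ 2 / (w.re ^ 2 + w.im ^ 2) ^ 2) *
        (w.re ^ 2 + w.im ^ 2) ^ 2 := by
    rw [continuous_iff_continuousAt]
    intro w
    by_cases hw : w = 0
    · subst hw
      have h1 : Tendsto (fun w : ℂ => (w.re ^ 2 + w.im ^ 2) ^ 2) (𝓝 0) (𝓝 0) := by
        have : Continuous fun w : ℂ => (w.re ^ 2 + w.im ^ 2) ^ 2 := by fun_prop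
        simpa using this.tendsto 0
      unfold ContinuousAt
      simp only [Complex.zero_re, Complex.zero_im]
      norm_num
      refine squeeze_zero (fun w => mul_nonneg (profile_nonneg _ _) (by positivity)) (fun w => ?_) h1
      exact mul_le_of_le_one_left (by positivity) (profile_le_one n (by positivity))
    · have h0 : (w.re ^ 2 + w.im ^ 2) ^ 2 ≠ 0 := by
        have : 0 < w.re ^ 2 + w.im ^ 2 := by
          have := Complex.normSq_pos.2 hw
          rw [Complex.normSq_apply] at this
          nlinarith
        positivity
      have hp : Continuous (profile n) := (contDiff_profile n).continuous
      refine ContinuousAt.mul (hp.continuousAt.comp ?_) (by fun_prop)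
      exact ContinuousAt.div (by fun_prop) (by fun_prop) h0
  unfold patchGauge
  simp only [mul_assoc patchWidth]
  fun_prop

theorem isSmoothPatch_initialPatch (n : ℕ) : IsSmoothPatch (initialPatch n) := by
  refine isSmoothPatch_of_gauge (N := patchGauge n) _ (k := 1 / 2) (by norm_num)
    (continuous_patchGauge n) ?_ ?_ ?_
  · intro r w
    simp only [patchGauge, Complex.re_ofReal_mul, Complex.im_ofReal_mul]
    by_cases hr : r = 0
    · simp [hr]
    have e1 : 4 * (r * w.re) ^ 2 * (r * w.im) ^ 2 / ((r * w.re) ^ 2 + (r * w.im) ^ 2) ^ 2 =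
        4 * w.re ^ 2 * w.im ^ 2 / (w.re ^ 2 + w.im ^ 2) ^ 2 := by
      rw [show 4 * (r * w.re) ^ 2 * (r * w.im) ^ 2 = r ^ 4 * (4 * w.re ^ 2 * w.im ^ 2) by ring,
        show ((r * w.re) ^ 2 + (r * w.im) ^ 2) ^ 2 = r ^ 4 * (w.re ^ 2 + w.im ^ 2) ^ 2 by ring,
        mul_div_mul_left _ _ (by positivity)]
    rw [e1]
    set p := profile n (4 * w.re ^ 2 * w.im ^ 2 / (w.re ^ 2 + w.im ^ 2) ^ 2)
    rw [show ((r * w.re) ^ 2 - (r * w.im) ^ 2) ^ 2 / 4 +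
        patchWidth * p * ((r * w.re) ^ 2 + (r * w.im) ^ 2) ^ 2 = (r ^ 2) ^ 2 *
        ((w.re ^ 2 - w.im ^ 2) ^ 2 / 4 + patchWidth * p * (w.re ^ 2 + w.im ^ 2) ^ 2) by ring,
      Real.sqrt_mul (by positivity), Real.sqrt_sq (by positivity)]
    ring
  · intro w
    have h : ‖w‖ ^ 2 = w.re ^ 2 + w.im ^ 2 := by
      rw [← Complex.normSq_eq_norm_sq, Complex.normSq_apply]; ring
    rw [h, patchGauge]
    have := Real.sqrt_nonneg ((w.re ^ 2 - w.im ^ 2) ^ 2 / 4 +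
      patchWidth * profile n (4 * w.re ^ 2 * w.im ^ 2 / (w.re ^ 2 + w.im ^ 2) ^ 2) *
        (w.re ^ 2 + w.im ^ 2) ^ 2)
    linarith
  · have e : (fun s : ℝ => patchGauge n (Complex.exp (s * Complex.I))) = fun s : ℝ =>
        1 / 2 + Real.sqrt (Real.cos (2 * s) ^ 2 / 4 +
          patchWidth * profile n (Real.sin (2 * s) ^ 2)) := by
      funext s
      simp only [patchGauge, Complex.exp_ofReal_mul_I_re, Complex.exp_ofReal_mul_I_im,
        Real.cos_sq_add_sin_sq]
      rw [Real.sin_two_mul, Real.cos_two_mul']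
      norm_num
      congr 3
      ring_nf
    rw [e]
    have hin : ContDiff ℝ ∞ fun s : ℝ => Real.cos (2 * s) ^ 2 / 4 +
        patchWidth * profile n (Real.sin (2 * s) ^ 2) := by
      have h1 : ContDiff ℝ ∞ fun s : ℝ => 2 * s := contDiff_const.mul contDiff_id
      exact ((h1.cos.pow 2).div_const 4).add
        (contDiff_const.mul ((contDiff_profile n).comp (h1.sin.pow 2)))
    refine contDiff_const.add (hin.sqrt fun s => ?_)
    have hg : 0 < patchWidth := by norm_num [patchWidth]
    have h2 := mul_nonneg hg.le (profile_nonneg n (Real.sin (2 * s) ^ 2))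
    -- The radicand could vanish only if `cos 2s = 0` and the profile is zero simultaneously, but
    -- the profile is zero only where `sin 2s = 0`.
    rcases eq_or_ne (Real.sin (2 * s)) 0 with h0 | h0
    · have h3 := Real.sin_sq_add_cos_sq (2 * s)
      rw [h0] at h3 h2 ⊢
      have : Real.cos (2 * s) ^ 2 = 1 := by linarith
      rw [this]
      positivity
    · have h3 : 0 < profile n (Real.sin (2 * s) ^ 2) := profile_pos (by positivity)
      positivity

/-- With `a`, `b` the squares of the centred coordinates, the gauge is the larger root `N` of `(N -
a)(N - b) = patchWidth · profile · (a + b)²`. Being less than `1` therefore means `a, b < 1` and `(1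
- a)(1 - b)` larger than the right-hand side; finally `1 - a = x(2 - x)`. -/
theorem mem_initialPatch_iff {n : ℕ} {z : ℂ} : z ∈ initialPatch n ↔
    |z.re - 1| < 1 ∧ |z.im - 1| < 1 ∧
      patchWidth * profile n (4 * (z.re - 1) ^ 2 * (z.im - 1) ^ 2 /
        ((z.re - 1) ^ 2 + (z.im - 1) ^ 2) ^ 2) * ((z.re - 1) ^ 2 + (z.im - 1) ^ 2) ^ 2 <
      (z.re * (2 - z.re)) * (z.im * (2 - z.im)) := by
  have hre : (z - (1 + Complex.I)).re = z.re - 1 := by simp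
  have him : (z - (1 + Complex.I)).im = z.im - 1 := by simp
  show patchGauge n (z - (1 + Complex.I)) < 1 ↔ _
  simp only [patchGauge, hre, him]
  have hg : 0 < patchWidth := by norm_num [patchWidth]
  have hp := profile_nonneg n
    (4 * (z.re - 1) ^ 2 * (z.im - 1) ^ 2 / ((z.re - 1) ^ 2 + (z.im - 1) ^ 2) ^ 2)
  set p := profile n
    (4 * (z.re - 1) ^ 2 * (z.im - 1) ^ 2 / ((z.re - 1) ^ 2 + (z.im - 1) ^ 2) ^ 2)
  have e1 : z.re * (2 - z.re) = 1 - (z.re - 1) ^ 2 := by ring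
  have e2 : z.im * (2 - z.im) = 1 - (z.im - 1) ^ 2 := by ring
  rw [e1, e2, ← sq_lt_one_iff_abs_lt_one, ← sq_lt_one_iff_abs_lt_one]
  set A := (z.re - 1) ^ 2 with hA
  set B := (z.im - 1) ^ 2 with hB
  have hA0 : 0 ≤ A := sq_nonneg _
  have hB0 : 0 ≤ B := sq_nonneg _
  have hq : 0 ≤ patchWidth * p * (A + B) ^ 2 := by positivity
  have hs : 0 ≤ (A - B) ^ 2 / 4 + patchWidth * p * (A + B) ^ 2 := by positivity
  constructor
  · intro h
    have h1 : Real.sqrt ((A - B) ^ 2 / 4 + patchWidth * p * (A + B) ^ 2) < 1 - (A + B) / 2 := by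
      linarith
    have h2 : 0 < 1 - (A + B) / 2 := (Real.sqrt_nonneg _).trans_lt h1
    rw [Real.sqrt_lt' h2] at h1
    have h3 : patchWidth * p * (A + B) ^ 2 < (1 - A) * (1 - B) := by nlinarith
    refine ⟨?_, ?_, h3⟩ <;> nlinarith
  · rintro ⟨h1, h2, h3⟩
    have h4 : 0 < 1 - (A + B) / 2 := by linarith
    have : Real.sqrt ((A - B) ^ 2 / 4 + patchWidth * p * (A + B) ^ 2) < 1 - (A + B) / 2 := by
      rw [Real.sqrt_lt' h4]
      nlinarith
    linarith

theorem initialPatch_swap {n : ℕ} {x y : ℝ} (h : (⟨x, y⟩ : ℂ) ∈ initialPatch n) :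
    (⟨y, x⟩ : ℂ) ∈ initialPatch n := by
  rw [mem_initialPatch_iff] at h ⊢
  simp only at h ⊢
  refine ⟨h.2.1, h.1, ?_⟩
  rw [add_comm ((y - 1) ^ 2), show 4 * (y - 1) ^ 2 * (x - 1) ^ 2 = 4 * (x - 1) ^ 2 * (y - 1) ^ 2 by
    ring, mul_comm (y * (2 - y))]
  exact h.2.2

theorem initialPatch_subset {n : ℕ} {z : ℂ} (hz : z ∈ initialPatch n) :
    0 < z.re ∧ z.re < 2 ∧ 0 < z.im ∧ z.im < 2 := by
  obtain ⟨h1, h2, -⟩ := mem_initialPatch_iff.1 hz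
  rw [abs_lt] at h1 h2
  exact ⟨by linarith, by linarith, by linarith, by linarith⟩

theorem one_add_I_mem_initialPatch (n : ℕ) : 1 + Complex.I ∈ initialPatch n := by
  rw [mem_initialPatch_iff]
  simp

/-- Near the corner the direction from the centre is nearly diagonal, so the profile is at least
`e^{-1}` and membership forces `4xy` to exceed a constant multiple of `patchWidth`, uniformly in
`n`. -/
theorem norm_ge_of_mem_initialPatch {n : ℕ} {z : ℂ} (hz : z ∈ initialPatch n) :
    1 / 10 ^ 14 ≤ ‖z‖ := by
  by_contra! hcon
  obtain ⟨h1, h2, h3, h4⟩ := initialPatch_subset hz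
  obtain ⟨-, -, h5⟩ := mem_initialPatch_iff.1 hz
  have hx : z.re < 1 / 10 ^ 14 := (Complex.re_le_norm z).trans_lt hcon
  have hy : z.im < 1 / 10 ^ 14 := (Complex.im_le_norm z).trans_lt hcon
  have hX : 9 / 10 ≤ (z.re - 1) ^ 2 := by nlinarith
  have hY : 9 / 10 ≤ (z.im - 1) ^ 2 := by nlinarith
  have hX1 : (z.re - 1) ^ 2 ≤ 1 := by nlinarith
  have hY1 : (z.im - 1) ^ 2 ≤ 1 := by nlinarith
  have hv : 1 ≤ 2 * (4 * (z.re - 1) ^ 2 * (z.im - 1) ^ 2 /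
      ((z.re - 1) ^ 2 + (z.im - 1) ^ 2) ^ 2) := by
    rw [← mul_div_assoc, one_le_div (by positivity)]
    nlinarith
  have hE := exp_neg_one_le_profile (n := n) hv
  have hE1 : 1 / 3 ≤ Real.exp (-1) := by
    rw [Real.exp_neg, ← one_div]
    exact one_div_le_one_div_of_le (Real.exp_pos _) (by linarith [Real.exp_one_lt_d9])
  have hw : 1 ≤ ((z.re - 1) ^ 2 + (z.im - 1) ^ 2) ^ 2 := one_le_pow₀ (by linarith)
  have hL : 1 / 10 ^ 25 * (1 / 3) * 1 ≤ patchWidth * profile n (4 * (z.re - 1) ^ 2 *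
      (z.im - 1) ^ 2 / ((z.re - 1) ^ 2 + (z.im - 1) ^ 2) ^ 2) *
      ((z.re - 1) ^ 2 + (z.im - 1) ^ 2) ^ 2 := by
    unfold patchWidth
    exact mul_le_mul (mul_le_mul_of_nonneg_left (hE1.trans hE) (by norm_num)) hw (by norm_num)
      (mul_nonneg (by norm_num) (profile_nonneg _ _))
  have hR : (z.re * (2 - z.re)) * (z.im * (2 - z.im)) ≤
      (1 / 10 ^ 14 * 2) * (1 / 10 ^ 14 * 2) := by
    have : 0 < 2 - z.re := by linarith
    have : 0 < 2 - z.im := by linarith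
    gcongr <;> linarith
  norm_num at hL hR h5
  linarith

/-! ### Flatness of the initial patch in terms of the depth -/

/-- The squared sine of twice the angle with slope `τ`. -/
def sqSinTwo (τ : ℝ) : ℝ := (2 * τ / (1 + τ ^ 2)) ^ 2

theorem sqSinTwo_mono {τ σ : ℝ} (h0 : 0 ≤ τ) (h : τ ≤ σ) (h1 : σ ≤ 1) :
    sqSinTwo τ ≤ sqSinTwo σ := by
  refine pow_le_pow_left₀ (by positivity) ?_ 2
  rw [div_le_div_iff₀ (by positivity) (by positivity)]
  nlinarith [mul_nonneg (sub_nonneg.2 h) (sub_nonneg.2 (mul_le_one₀ (h.trans h1) (h0.trans h) h1))]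

theorem sq_mul_sqSinTwo_le {τ σ k : ℝ} (hk : 0 ≤ k) (hk1 : k ≤ 1) (h0 : 0 ≤ τ) (h1 : k * τ ≤ σ)
    (hσ : σ ≤ 1) : k ^ 2 * sqSinTwo τ ≤ sqSinTwo σ := by
  refine le_trans ?_ (sqSinTwo_mono (by positivity) h1 hσ)
  rw [sqSinTwo, sqSinTwo, ← mul_pow]
  refine pow_le_pow_left₀ (by positivity) ?_ 2
  rw [mul_div_assoc', div_le_div_iff₀ (by positivity) (by positivity)]
  have h2 : k * τ ≤ τ := mul_le_of_le_one_left h0 hk1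
  have h3 : (k * τ) ^ 2 ≤ τ ^ 2 := pow_le_pow_left₀ (by positivity) h2 2
  calc k * (2 * τ) * (1 + (k * τ) ^ 2) ≤ k * (2 * τ) * (1 + τ ^ 2) := by gcongr
    _ = 2 * (k * τ) * (1 + τ ^ 2) := by ring

theorem sqSinTwo_le_one (τ : ℝ) : sqSinTwo τ ≤ 1 := by
  rw [sqSinTwo, div_pow, div_le_one (by positivity)]
  nlinarith [sq_nonneg (1 - τ ^ 2)]

theorem sqSinTwo_nonneg (τ : ℝ) : 0 ≤ sqSinTwo τ := sq_nonneg _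

theorem sqSinTwo_pos {τ : ℝ} (h : 0 < τ) : 0 < sqSinTwo τ := by
  unfold sqSinTwo; positivity

theorem sqSinTwo_le (τ : ℝ) : sqSinTwo τ ≤ 4 * τ ^ 2 := by
  rw [sqSinTwo, div_pow, div_le_iff₀ (by positivity)]
  have : 1 ≤ (1 + τ ^ 2) ^ 2 := one_le_pow₀ (by nlinarith [sq_nonneg τ])
  nlinarith [sq_nonneg τ]

theorem sqSinTwo_div {x y : ℝ} (hy : y < 1) : sqSinTwo ((1 - x) / (1 - y)) =
    4 * (x - 1) ^ 2 * (y - 1) ^ 2 / ((x - 1) ^ 2 + (y - 1) ^ 2) ^ 2 := by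
  have h1 : 0 < 1 - y := by linarith
  have h2 : 0 < (x - 1) ^ 2 + (y - 1) ^ 2 := by
    have : 0 < (y - 1) ^ 2 := by nlinarith
    positivity
  have h3 : 0 < (1 - y) ^ 2 + (1 - x) ^ 2 := by nlinarith
  have e1 : x - 1 = -(1 - x) := by ring
  have e2 : y - 1 = -(1 - y) := by ring
  rw [sqSinTwo, e1, e2]
  generalize 1 - x = a at *
  generalize 1 - y = b at *
  have hb : b ≠ 0 := h1.ne'
  have h4 : b ^ 2 + a ^ 2 ≠ 0 := h3.ne'
  have h5 : 1 + (a / b) ^ 2 = (b ^ 2 + a ^ 2) / b ^ 2 := by field_simp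
  rw [h5, neg_sq, neg_sq, add_comm (a ^ 2)]
  field_simp
  ring

/-- Shrinking the argument by the relative amount `q` raises the exponent `F = (2v)⁻ⁿ` by about
`4nFq`. Here `q` is at most `e^{-F}/v` and `1/v ≤ 2ⁿF`, so `Fq ≤ 2ⁿF²e^{-F}` is bounded: the profile
survives errors of its own size up to a constant. -/
theorem profile_tolerance {n : ℕ} (hn : n ≠ 0) : ∃ M, 0 < M ∧ ∀ v w : ℝ, 0 < v → v ≤ 1 →
    (1 - 80 * patchWidth * profile n v / v) ^ 2 * v ≤ w → profile n v ≤ M * profile n w := by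
  refine ⟨Real.exp (4 * n * Real.exp (2 * n) * (2 * 2 ^ n)), Real.exp_pos _,
    fun v w hv hv1 hw => ?_⟩
  set q := 80 * patchWidth * profile n v / v with hq
  have hE0 := profile_nonneg n v
  have hg : 0 < patchWidth := by norm_num [patchWidth]
  have hq0 : 0 ≤ q := by positivity
  have hqE : q ≤ profile n v / v := by
    rw [hq]
    gcongr
    have : 80 * patchWidth ≤ 1 := by norm_num [patchWidth]
    nlinarith
  have hq1 : q ≤ 1 / 2 := by
    rw [hq, div_le_iff₀ hv]
    have h1 := profile_le_cube hn hv.le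
    have h2 : v ^ 3 ≤ v := pow_le_of_le_one hv.le hv1 (by norm_num)
    calc 80 * patchWidth * profile n v ≤ 80 * patchWidth * (48 * v) := by gcongr; linarith
      _ ≤ 1 / 2 * v := by norm_num [patchWidth]; linarith
  have hv' : 0 < (1 - q) ^ 2 * v := by
    have : 0 < 1 - q := by linarith
    positivity
  suffices H : profile n v ≤ Real.exp (4 * n * Real.exp (2 * n) * (2 * 2 ^ n)) *
      profile n ((1 - q) ^ 2 * v) from
    H.trans (mul_le_mul_of_nonneg_left (profile_mono hn hv'.le hw) (Real.exp_pos _).le)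
  have hE : profile n v = Real.exp (-((2 * v) ^ n)⁻¹) := profile_eq hv
  set F := ((2 * v) ^ n)⁻¹ with hF
  have hF0 : 0 < F := by positivity
  rw [profile_eq hv', hE, ← Real.exp_add]
  apply Real.exp_le_exp.2
  have hpow : ((2 * ((1 - q) ^ 2 * v)) ^ n)⁻¹ = F * ((1 - q)⁻¹) ^ (2 * n) := by
    rw [hF, inv_pow, ← mul_inv]
    congr 1
    rw [show 2 * ((1 - q) ^ 2 * v) = (1 - q) ^ 2 * (2 * v) by ring, mul_pow, ← pow_mul]
    ring
  have hinv : (1 - q)⁻¹ ≤ Real.exp (2 * q) := by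
    have h1 : 0 < 1 - q := by linarith
    refine le_trans ?_ (Real.add_one_le_exp (2 * q))
    rw [inv_le_iff_one_le_mul₀ h1]
    nlinarith
  have hinvn : ((1 - q)⁻¹) ^ (2 * n) ≤ 1 + 4 * n * q * Real.exp (2 * n) := by
    have h1 : 0 ≤ (1 - q)⁻¹ := inv_nonneg.2 (by linarith)
    have h2 : Real.exp (4 * n * q) ≤ Real.exp (2 * n) :=
      Real.exp_le_exp.2 (by have : (0 : ℝ) ≤ n := n.cast_nonneg; nlinarith)
    have h3 : Real.exp (4 * n * q) * (1 - 4 * n * q) ≤ 1 := by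
      have h4 := Real.one_sub_le_exp_neg (4 * n * q)
      calc _ ≤ Real.exp (4 * n * q) * Real.exp (-(4 * n * q)) :=
            mul_le_mul_of_nonneg_left h4 (Real.exp_pos _).le
        _ = 1 := by rw [← Real.exp_add]; simp
    have h5 : 4 * n * q * Real.exp (4 * n * q) ≤ 4 * n * q * Real.exp (2 * n) :=
      mul_le_mul_of_nonneg_left h2 (by positivity)
    calc ((1 - q)⁻¹) ^ (2 * n) ≤ Real.exp (2 * q) ^ (2 * n) := pow_le_pow_left₀ h1 hinv _
      _ = Real.exp (4 * n * q) := by rw [← Real.exp_nat_mul]; congr 1; push_cast; ring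
      _ ≤ _ := by linarith
  have hFq : F * q ≤ 2 * 2 ^ n := by
    have h1 : F ^ 2 * Real.exp (-F) ≤ 2 := by
      have := Real.pow_div_factorial_le_exp F hF0.le 2
      norm_num [Nat.factorial] at this
      rw [Real.exp_neg, ← div_eq_mul_inv, div_le_iff₀ (Real.exp_pos _)]
      linarith
    have h2 : 1 ≤ 2 ^ n * (F * v) := by
      have h3 : v ^ n ≤ v := pow_le_of_le_one hv.le hv1 hn
      rw [hF, mul_pow]
      rw [show (2 : ℝ) ^ n * (((2 : ℝ) ^ n * v ^ n)⁻¹ * v) = v / v ^ n by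
        field_simp]
      rwa [one_le_div (by positivity)]
    have h4 : F * q ≤ F * (Real.exp (-F) / v) := by
      rw [← hE]; exact mul_le_mul_of_nonneg_left hqE hF0.le
    refine h4.trans ?_
    rw [← mul_div_assoc, div_le_iff₀ hv]
    calc F * Real.exp (-F) ≤ F * Real.exp (-F) * (2 ^ n * (F * v)) :=
          le_mul_of_one_le_right (by positivity) h2
      _ = (F ^ 2 * Real.exp (-F)) * (2 ^ n * v) := by ring
      _ ≤ 2 * (2 ^ n * v) := mul_le_mul_of_nonneg_right h1 (by positivity)
      _ = 2 * 2 ^ n * v := by ring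
  rw [hpow]
  have h6 := mul_le_mul_of_nonneg_left hinvn hF0.le
  have h7 : 4 * n * Real.exp (2 * n) * (F * q) ≤ 4 * n * Real.exp (2 * n) * (2 * 2 ^ n) :=
    mul_le_mul_of_nonneg_left hFq (by positivity)
  nlinarith

theorem exp_neg_lt_one {u : ℝ} (hu : 0 < u) : Real.exp (-u) < 1 := by
  rw [← Real.exp_zero]; exact Real.exp_lt_exp.2 (by linarith)

theorem exp_le_one_add_two_mul {a : ℝ} (h0 : 0 ≤ a) (h : a ≤ 1 / 2) : Real.exp a ≤ 1 + 2 * a := by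
  have h1 := Real.one_sub_le_exp_neg a
  have h2 : Real.exp a * Real.exp (-a) = 1 := by rw [← Real.exp_add]; simp
  have h3 : Real.exp a * (1 - a) ≤ 1 :=
    (mul_le_mul_of_nonneg_left h1 (Real.exp_pos a).le).trans_eq h2
  have h4 : 1 ≤ (1 + 2 * a) * (1 - a) := by nlinarith
  exact le_of_mul_le_mul_right (h3.trans h4) (by linarith)

/-- The profile of the initial patch at depth `u`. -/
def flatness (n : ℕ) (u : ℝ) : ℝ := profile n (sqSinTwo (1 - Real.exp (-u)))

theorem flatness_nonneg (n : ℕ) (u : ℝ) : 0 ≤ flatness n u := profile_nonneg _ _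

theorem flatness_mono {n : ℕ} (hn : n ≠ 0) {u u' : ℝ} (h0 : 0 ≤ u) (h : u ≤ u') :
    flatness n u ≤ flatness n u' := by
  have h1 : Real.exp (-u) ≤ 1 := Real.exp_le_one_iff.2 (by linarith)
  have h2 : Real.exp (-u') ≤ Real.exp (-u) := Real.exp_le_exp.2 (by linarith)
  exact profile_mono hn (sqSinTwo_nonneg _)
    (sqSinTwo_mono (by linarith) (by linarith) (by linarith [Real.exp_pos (-u')]))

theorem flatness_le_exp {n : ℕ} (hn : n ≠ 0) {u : ℝ} (hu : 0 < u) :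
    flatness n u ≤ Real.exp (-((8 * u ^ 2) ^ n)⁻¹) := by
  have h1 : Real.exp (-u) < 1 := exp_neg_lt_one hu
  have h2 : 1 - Real.exp (-u) ≤ u := by linarith [Real.one_sub_le_exp_neg u]
  have h3 : sqSinTwo (1 - Real.exp (-u)) ≤ 4 * u ^ 2 :=
    (sqSinTwo_le _).trans (by
      have : (1 - Real.exp (-u)) ^ 2 ≤ u ^ 2 := pow_le_pow_left₀ (by linarith) h2 2
      linarith)
  refine (profile_mono hn (sqSinTwo_nonneg _) h3).trans ?_
  rw [profile_eq (by positivity), show 2 * (4 * u ^ 2) = 8 * u ^ 2 by ring]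

theorem decay_zero : decay 0 = 1 := by simp [decay]

theorem half_one_sub_le_depth {x y : ℝ} (h : 0 < x ^ 2 + y ^ 2) :
    (1 - (x ^ 2 + y ^ 2)) / 2 ≤ depth 0 x y := by
  have := Real.log_le_sub_one_of_pos h
  rw [depth, decay_zero]
  linarith

/-- At time `0` the depth is `-log r`, and `x ≤ r` gives `1 - r ≤ 1 - x ≤ (1-x)/(1-y)`. Thus the
profile at the depth is below the profile at the actual direction, which membership bounds by a
multiple of `x y`. -/
theorem flatness_le_of_mem {n : ℕ} (hn : n ≠ 0) {x y : ℝ} (h : (⟨x, y⟩ : ℂ) ∈ initialPatch n)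
    (hyx : y ≤ x) (hr : x ^ 2 + y ^ 2 < 1) : flatness n (depth 0 x y) ≤ 10 ^ 29 * (x * y) := by
  obtain ⟨hx, -, hy, -⟩ := initialPatch_subset h
  obtain ⟨-, -, h5⟩ := mem_initialPatch_iff.1 h
  simp only at hx hy h5
  have hx1 : x < 1 := by nlinarith
  have hy1 : y < 3 / 4 := by nlinarith
  have hr0 : 0 < x ^ 2 + y ^ 2 := by positivity
  have hexp : Real.exp (-depth 0 x y) = Real.sqrt (x ^ 2 + y ^ 2) := by
    rw [depth, decay_zero, Real.sqrt_eq_rpow, Real.rpow_def_of_pos hr0]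
    congr 1; ring
  have hxr : x ≤ Real.sqrt (x ^ 2 + y ^ 2) := Real.le_sqrt_of_sq_le (by nlinarith [sq_nonneg y])
  have hr1 : Real.sqrt (x ^ 2 + y ^ 2) < 1 := by
    rw [Real.sqrt_lt' one_pos]; linarith
  have hEv : flatness n (depth 0 x y) ≤ profile n (4 * (x - 1) ^ 2 * (y - 1) ^ 2 /
      ((x - 1) ^ 2 + (y - 1) ^ 2) ^ 2) := by
    rw [flatness, hexp, ← sqSinTwo_div (by linarith)]
    refine profile_mono hn (sqSinTwo_nonneg _) (sqSinTwo_mono (by linarith) ?_ ?_)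
    · rw [le_div_iff₀ (by linarith)]
      nlinarith
    · rw [div_le_one (by linarith)]; linarith
  have hw : 1 / 256 ≤ ((x - 1) ^ 2 + (y - 1) ^ 2) ^ 2 := by
    have : 1 / 16 ≤ (x - 1) ^ 2 + (y - 1) ^ 2 := by nlinarith [sq_nonneg (x - 1)]
    nlinarith
  set E := profile n (4 * (x - 1) ^ 2 * (y - 1) ^ 2 / ((x - 1) ^ 2 + (y - 1) ^ 2) ^ 2)
  have hE0 : 0 ≤ E := profile_nonneg _ _
  have h6 : patchWidth * E * (1 / 256) ≤ patchWidth * E * ((x - 1) ^ 2 + (y - 1) ^ 2) ^ 2 :=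
    mul_le_mul_of_nonneg_left hw (mul_nonneg (by norm_num [patchWidth]) hE0)
  have h7 : x * (2 - x) * (y * (2 - y)) ≤ 4 * (x * y) := by
    have h8 : 0 < x * y := mul_pos hx hy
    have h9 : (2 - x) * (2 - y) ≤ 4 := by nlinarith
    nlinarith [mul_le_mul_of_nonneg_left h9 h8.le]
  refine hEv.trans ?_
  norm_num [patchWidth] at h6 h5
  nlinarith [mul_pos hx hy]

theorem mul_le_of_not_mem {n : ℕ} {x y : ℝ} (hx : 0 < x) (hy : 0 < y) (hr : x ^ 2 + y ^ 2 < 1)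
    (h : (⟨x, y⟩ : ℂ) ∉ initialPatch n) :
    x * y ≤ 4 * patchWidth * profile n (sqSinTwo ((1 - x) / (1 - y))) := by
  have hx1 : x < 1 := by nlinarith
  have hy1 : y < 1 := by nlinarith
  rw [mem_initialPatch_iff] at h
  simp only [not_and, not_lt] at h
  have h5 := h (abs_lt.2 ⟨by linarith, by linarith⟩) (abs_lt.2 ⟨by linarith, by linarith⟩)
  rw [← sqSinTwo_div hy1] at h5
  have hE0 := profile_nonneg n (sqSinTwo ((1 - x) / (1 - y)))
  set E := profile n (sqSinTwo ((1 - x) / (1 - y)))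
  have hw : ((x - 1) ^ 2 + (y - 1) ^ 2) ^ 2 ≤ 4 := by
    have h1 : (x - 1) ^ 2 ≤ 1 := by nlinarith
    have h2 : (y - 1) ^ 2 ≤ 1 := by nlinarith
    nlinarith [sq_nonneg (x - 1), sq_nonneg (y - 1)]
  have h6 : patchWidth * E * ((x - 1) ^ 2 + (y - 1) ^ 2) ^ 2 ≤ patchWidth * E * 4 :=
    mul_le_mul_of_nonneg_left hw (mul_nonneg (by norm_num [patchWidth]) hE0)
  have h7 : x * y ≤ x * (2 - x) * (y * (2 - y)) := by
    have h8 : 0 < x * y := mul_pos hx hy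
    have h9 : 1 ≤ (2 - x) * (2 - y) := by nlinarith
    nlinarith [mul_le_mul_of_nonneg_left h9 h8.le]
  linarith

/-- For `x ≥ 1/2` the profile is at most `48v³` with `v = O(1 - x)`, while the height `y` is much
smaller than `1 - x`, so that `1 - x = O(ℓ)`; this gives the cube of the depth. For `x < 1/2` the
depth is bounded below and the smallness of `patchWidth` suffices. -/
theorem thin_of_not_mem_of_le {n : ℕ} (hn : n ≠ 0) {x y : ℝ} (hx : 0 < x) (hy : 0 < y)
    (hyx : y ≤ x) (hr : x ^ 2 + y ^ 2 < 1) (h : (⟨x, y⟩ : ℂ) ∉ initialPatch n) :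
    x * y ≤ 1 / 10 ^ 16 * depth 0 x y ^ 3 := by
  have hP := mul_le_of_not_mem hx hy hr h
  have hl := half_one_sub_le_depth (x := x) (y := y) (by positivity)
  have hx1 : x < 1 := by nlinarith
  have hv0 := sqSinTwo_nonneg ((1 - x) / (1 - y))
  have hv1 := sqSinTwo_le_one ((1 - x) / (1 - y))
  have hv2 := sqSinTwo_le ((1 - x) / (1 - y))
  have hE := profile_le_cube hn hv0
  have hE1 := profile_le_one n hv0
  set v := sqSinTwo ((1 - x) / (1 - y)) with hv
  rcases le_or_gt (1 / 2) x with h2 | h2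
  · have hvv : v ^ 3 ≤ v := pow_le_of_le_one hv0 hv1 (by norm_num)
    have hy2 : y ≤ 384 * patchWidth * v := by
      have : patchWidth * profile n v ≤ patchWidth * (48 * v) :=
        mul_le_mul_of_nonneg_left (by linarith) (by norm_num [patchWidth])
      nlinarith
    have hys : y ≤ 1 / 2 := hy2.trans (by norm_num [patchWidth]; linarith)
    have hτ : (1 - x) / (1 - y) ≤ 2 * (1 - x) := by
      rw [div_le_iff₀ (by linarith)]
      nlinarith
    have hτ0 : 0 ≤ (1 - x) / (1 - y) := div_nonneg (by linarith) (by linarith)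
    have hvq : v ≤ 8 * (1 - x) := by
      have : ((1 - x) / (1 - y)) ^ 2 ≤ (2 * (1 - x)) ^ 2 := pow_le_pow_left₀ hτ0 hτ 2
      nlinarith
    have hyq : y ≤ (1 - x) / 10 := by
      norm_num [patchWidth] at hy2
      linarith
    have hlq : (1 - x) / 2 ≤ depth 0 x y := by nlinarith
    have hv3 : v ^ 3 ≤ (16 * depth 0 x y) ^ 3 := pow_le_pow_left₀ hv0 (by linarith) 3
    have hl3 : 0 ≤ depth 0 x y ^ 3 := by
      have : 0 ≤ depth 0 x y := by linarith
      positivity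
    calc x * y ≤ 4 * patchWidth * (48 * (16 * depth 0 x y) ^ 3) := hP.trans
          (mul_le_mul_of_nonneg_left (hE.trans (by linarith)) (by norm_num [patchWidth]))
      _ = 786432 * patchWidth * depth 0 x y ^ 3 := by ring
      _ ≤ _ := by
        refine mul_le_mul_of_nonneg_right ?_ hl3
        norm_num [patchWidth]
  · have h3 : 1 / 4 ≤ depth 0 x y := by nlinarith
    have h4 : (1 / 4) ^ 3 ≤ depth 0 x y ^ 3 := pow_le_pow_left₀ (by norm_num) h3 3
    calc x * y ≤ 4 * patchWidth * 1 := hP.trans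
          (mul_le_mul_of_nonneg_left hE1 (by norm_num [patchWidth]))
      _ ≤ 1 / 10 ^ 16 * (1 / 4) ^ 3 := by norm_num [patchWidth]
      _ ≤ _ := by gcongr

theorem thin_of_not_mem {n : ℕ} (hn : n ≠ 0) {x y : ℝ} (hx : 0 < x) (hy : 0 < y)
    (hr : x ^ 2 + y ^ 2 < 1) (h : (⟨x, y⟩ : ℂ) ∉ initialPatch n) :
    x * y ≤ 1 / 10 ^ 16 * depth 0 x y ^ 3 := by
  rcases le_total y x with hyx | hyx
  · exact thin_of_not_mem_of_le hn hx hy hyx hr h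
  · rw [mul_comm, depth_comm]
    exact thin_of_not_mem_of_le hn hy hx hyx (by linarith) fun h' => h (initialPatch_swap h')

/-- The incoming estimate is in terms of the corrected depth `X`, not of the direction seen from the
centre. The two differ by at most `5xy`, hence by at most `20 · patchWidth · profile`, which
`profile_tolerance` absorbs. -/
theorem exists_mul_le_flatness {n : ℕ} (hn : n ≠ 0) : ∃ M, 0 < M ∧ ∀ x y : ℝ, 0 < x → 0 < y →
    y ≤ x → x ^ 2 + y ^ 2 < 1 → (⟨x, y⟩ : ℂ) ∉ initialPatch n →
    x * y ≤ M * flatness n (-Real.log x + decay 0 - 1 - 100000 * (x * y) ^ 2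
      + 3 / 2 * (y / x) ^ 2) := by
  obtain ⟨M, hM, HM⟩ := profile_tolerance hn
  refine ⟨M + 3, by linarith, fun x y hx hy hyx hr h => ?_⟩
  have hP := mul_le_of_not_mem hx hy hr h
  have hx1 : x < 1 := by nlinarith
  have hv0 := sqSinTwo_nonneg ((1 - x) / (1 - y))
  have hv1 := sqSinTwo_le_one ((1 - x) / (1 - y))
  have hE0 := profile_nonneg n (sqSinTwo ((1 - x) / (1 - y)))
  have hE1 := profile_le_one n hv0
  have hP0 : 0 < x * y := mul_pos hx hy
  set X := -Real.log x + decay 0 - 1 - 100000 * (x * y) ^ 2 + 3 / 2 * (y / x) ^ 2 with hX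
  have hf0 := flatness_nonneg n X
  have hPs : x * y ≤ 4 * patchWidth := hP.trans
    (mul_le_of_le_one_right (by norm_num [patchWidth]) hE1)
  have hPs2 : 200000 * (x * y) ^ 2 ≤ x * y := by
    norm_num [patchWidth] at hPs
    nlinarith
  have hexp : Real.exp (-X) ≤ x + x * y := by
    have h1 : Real.exp (-X) ≤ Real.exp (Real.log x + 100000 * (x * y) ^ 2) := by
      apply Real.exp_le_exp.2
      rw [hX, decay_zero]
      nlinarith [sq_nonneg (y / x)]
    have h2 : Real.exp (100000 * (x * y) ^ 2) ≤ 1 + x * y := by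
      norm_num [patchWidth] at hPs
      have h3 := exp_le_one_add_two_mul (a := 100000 * (x * y) ^ 2) (by positivity) (by linarith)
      linarith
    rw [Real.exp_add, Real.exp_log hx] at h1
    nlinarith
  have hX1 : 1 - Real.exp (-X) ≤ 1 := by linarith [Real.exp_pos (-X)]
  rcases le_or_gt (1 / 2) x with h2 | h2
  · have hy2 : y ≤ 1 / 2 := by
      norm_num [patchWidth] at hPs
      nlinarith
    have hτ1 : (1 - x) / (1 - y) ≤ 1 := by rw [div_le_one (by linarith)]; linarith
    have hτ0 : 0 < (1 - x) / (1 - y) := div_pos (by linarith) (by linarith)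
    have hτq : (1 - x) / (1 - y) ≤ 1 - x + 2 * y := by
      rw [div_le_iff₀ (by linarith)]
      nlinarith
    have hvpos := sqSinTwo_pos hτ0
    have hv4 : sqSinTwo ((1 - x) / (1 - y)) ≤ 4 * ((1 - x) / (1 - y)) :=
      (sqSinTwo_le _).trans (by nlinarith)
    have hE3 := profile_le_cube hn hv0
    set τ := (1 - x) / (1 - y) with hτ
    set v := sqSinTwo τ with hv
    set q := 80 * patchWidth * profile n v / v with hq
    have hq0 : 0 ≤ q := div_nonneg (mul_nonneg (by norm_num [patchWidth]) hE0) hv0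
    have hq1 : q ≤ 1 := by
      rw [hq, div_le_one hvpos]
      have hvv : v ^ 3 ≤ v := pow_le_of_le_one hv0 hv1 (by norm_num)
      calc 80 * patchWidth * profile n v ≤ 80 * patchWidth * (48 * v) :=
            mul_le_mul_of_nonneg_left (by linarith) (by norm_num [patchWidth])
        _ ≤ v := by norm_num [patchWidth]; linarith
    have hqτ : 20 * patchWidth * profile n v ≤ q * τ := by
      have h3 : q * v = 80 * patchWidth * profile n v := div_mul_cancel₀ _ hvpos.ne'
      have h4 := mul_le_mul_of_nonneg_left hv4 hq0
      linarith
    have hlow : (1 - q) * τ ≤ 1 - Real.exp (-X) := by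
      have h3 : y ≤ 2 * (x * y) := by nlinarith
      have h4 : x * y ≤ 4 * (patchWidth * profile n v) := by linarith
      linarith
    have hw := HM v _ hvpos hv1
      (sq_mul_sqSinTwo_le (k := 1 - q) (by linarith) (by linarith) hτ0.le hlow hX1)
    calc x * y ≤ 4 * patchWidth * profile n v := hP
      _ ≤ 1 * profile n v := mul_le_mul_of_nonneg_right (by norm_num [patchWidth]) hE0
      _ ≤ M * flatness n X := by rw [one_mul]; exact hw
      _ ≤ (M + 3) * flatness n X := by nlinarith
  · norm_num [patchWidth] at hPs
    have h3 : 9 / 20 ≤ 1 - Real.exp (-X) := by linarith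
    have h4 : 1 ≤ 2 * sqSinTwo (1 - Real.exp (-X)) := by
      have := sqSinTwo_mono (by norm_num) h3 hX1
      norm_num [sqSinTwo] at this ⊢
      linarith
    have h5 := exp_neg_one_le_profile (n := n) h4
    have hE1 : 1 / 3 ≤ Real.exp (-1) := by
      rw [Real.exp_neg, ← one_div]
      exact one_div_le_one_div_of_le (Real.exp_pos _) (by linarith [Real.exp_one_lt_d9])
    have h6 : 1 / 3 ≤ flatness n X := hE1.trans h5
    nlinarith

/-! ### Where the patch and its complement are at time `T` -/

namespace IsCellPath

variable {x y : ℝ → ℝ} {T : ℝ}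

theorem initial_lt_one (h : IsCellPath x y T) (hT : 0 ≤ T) : x 0 ^ 2 + y 0 ^ 2 < 1 := by
  have m0 : (0 : ℝ) ∈ Icc 0 T := left_mem_Icc.2 hT
  have hx := h.x_pos 0 m0
  have hl := h.depth_pos 0 m0
  rw [depth, decay_zero] at hl
  have h1 : Real.log (x 0 ^ 2 + y 0 ^ 2) < 0 := by linarith
  exact (Real.log_neg_iff (by positivity)).1 h1

/-- A path that starts outside the initial patch is incoming up to some time and outgoing
afterwards. -/
theorem incoming_or_switch (h : IsCellPath x y T) (hT : 0 ≤ T) {n : ℕ} (hn : n ≠ 0)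
    (h0 : (⟨x 0, y 0⟩ : ℂ) ∉ initialPatch n) :
    (∀ u ∈ Icc 0 T, y u / x u ≤ 1) ∨ ∃ p ∈ Icc 0 T, (∀ u ∈ Icc p T, 1 ≤ y u / x u) ∧
      (p = 0 ∨ (y p / x p = 1 ∧ ∀ u ∈ Icc 0 p, y u / x u ≤ 1)) := by
  by_cases hall : ∀ u ∈ Icc 0 T, y u / x u ≤ 1
  · exact Or.inl hall
  · push Not at hall
    obtain ⟨s₀, hs₀, hd⟩ := hall
    have m0 : (0 : ℝ) ∈ Icc 0 T := left_mem_Icc.2 hT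
    have hthin := thin_of_not_mem hn (h.x_pos 0 m0) (h.y_pos 0 m0) (h.initial_lt_one hT) h0
    right
    rcases le_or_gt 1 (y 0 / x 0) with h1 | h1
    · exact ⟨0, m0, h.one_le_div_of_thin hthin m0 h1, Or.inl rfl⟩
    · obtain ⟨s, hs, hs1, hb⟩ := exists_first_eq (f := fun s => y s / x s) hs₀.1
        (h.continuousOn_div.mono (Icc_subset_Icc_right hs₀.2)) h1 hd.le
      have hsm : s ∈ Icc 0 T := ⟨hs.1.le, hs.2.trans hs₀.2⟩
      refine ⟨s, hsm, h.one_le_div_of_thin hthin hsm hs1.ge, Or.inr ⟨hs1, fun u hu => ?_⟩⟩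
      exact hu.2.eq_or_lt.elim (fun e => e ▸ hs1.le) fun e => (hb u ⟨hu.1, e⟩).le

theorem half_depth_le (h : IsCellPath x y T) (hT : 0 ≤ T)
    (h0 : x 0 * y 0 ≤ 1 / 10 ^ 16 * depth 0 (x 0) (y 0) ^ 3) :
    depth 0 (x 0) (y 0) / 2 ≤ -Real.log (x 0) + decay 0 - 1 - 100000 * (x 0 * y 0) ^ 2
      + 3 / 2 * (y 0 / x 0) ^ 2 := by
  have m0 : (0 : ℝ) ∈ Icc 0 T := left_mem_Icc.2 hT
  have hP0 := h.mul_le_exp m0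
  have hP0' := h.mul_pos' m0
  have hl0 := h.depth_pos 0 m0
  have hl1 := depth_le_log (t := 0) (y := y 0) (h.x_pos 0 m0)
  set P₀ := x 0 * y 0
  set l₀ := depth 0 (x 0) (y 0)
  have hl9 := pow_nine_mul_exp_le hl0.le
  have hE0 := Real.exp_pos (-2 * l₀)
  have h2 : l₀ ^ 2 ≤ (l₀ + 2) ^ 9 := by
    calc l₀ ^ 2 ≤ (l₀ + 2) ^ 2 := pow_le_pow_left₀ hl0.le (by linarith) 2
      _ ≤ (l₀ + 2) ^ 9 := pow_le_pow_right₀ (by linarith) (by norm_num)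
  have h3 : l₀ * (l₀ ^ 2 * Real.exp (-2 * l₀)) ≤ l₀ * 800000 :=
    mul_le_mul_of_nonneg_left ((mul_le_mul_of_nonneg_right h2 hE0.le).trans hl9) hl0.le
  have hsq : P₀ ^ 2 ≤ 1 / 10 ^ 16 * l₀ ^ 3 * (Real.exp (-2 * l₀) / 2) := by
    rw [sq]; exact mul_le_mul h0 hP0 hP0'.le (by positivity)
  linarith [sq_nonneg (y 0 / x 0)]

theorem exp_le_sq_add_sq (h : IsCellPath x y T) {s : ℝ} (hs : s ∈ Icc 0 T) :
    Real.exp (-2 - 2 * depth s (x s) (y s)) ≤ x s ^ 2 + y s ^ 2 := by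
  rw [exp_two_depth (t := s) (y := y s) (h.x_pos s hs)]
  exact Real.exp_le_exp.2 (by linarith [decay_pos s])

end IsCellPath

/-- Levels do not increase, so the level at time `s` is at most the initial one, which is `O(X
f(X))` for the initial corrected depth `X`. Exponential growth on the incoming half gives `X ≤
e^{-s}(ℓ + 2)`. The free bound `w` lets the right-hand side be evaluated at the depth of the tip. -/
theorem exists_level_le_of_incoming {n : ℕ} (hn : n ≠ 0) : ∃ M, 0 < M ∧
    ∀ (x y : ℝ → ℝ) (T : ℝ), IsCellPath x y T → (⟨x 0, y 0⟩ : ℂ) ∉ initialPatch n →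
      ∀ s ∈ Icc 0 T, (∀ u ∈ Icc 0 s, y u / x u ≤ 1) →
      ∀ w, Real.exp (-s) * (depth s (x s) (y s) + 2) ≤ w →
      x s * y s * depth s (x s) (y s) ≤ M * (w * flatness n w) := by
  obtain ⟨M, hM, HM⟩ := exists_mul_le_flatness hn
  refine ⟨2 * M, by positivity, fun x y T h h0 s hs hd w hw => ?_⟩
  have hT : 0 ≤ T := hs.1.trans hs.2
  have m0 : (0 : ℝ) ∈ Icc 0 T := left_mem_Icc.2 hT
  have hx0 := h.x_pos 0 m0
  have hy0 := h.y_pos 0 m0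
  have hthin := thin_of_not_mem hn hx0 hy0 (h.initial_lt_one hT) h0
  have hX0 := h.half_depth_le hT hthin
  have hl0 := h.depth_pos 0 m0
  have hd0 := hd 0 ⟨le_rfl, hs.1⟩
  have hyx : y 0 ≤ x 0 := by rwa [div_le_one hx0] at hd0
  have hP := HM (x 0) (y 0) hx0 hy0 hyx (h.initial_lt_one hT) h0
  have hgr := h.incoming_growth hs.1 hs.2 hd
  set X := -Real.log (x 0) + decay 0 - 1 - 100000 * (x 0 * y 0) ^ 2 + 3 / 2 * (y 0 / x 0) ^ 2
  have hXs : -Real.log (x s) + decay s - 1 - 100000 * (x s * y s) ^ 2 + 3 / 2 * (y s / x s) ^ 2 ≤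
      depth s (x s) (y s) + 2 := by
    have h1 := log_le_depth (t := s) (y := y s) (h.x_pos s hs)
    have h2 : (y s / x s) ^ 2 ≤ 1 :=
      pow_le_one₀ (div_pos (h.y_pos s hs) (h.x_pos s hs)).le (hd s ⟨hs.1, le_rfl⟩)
    linarith [sq_nonneg (x s * y s)]
  have hXw : X ≤ w := by
    refine le_trans ?_ hw
    have h3 := mul_le_mul_of_nonneg_left (hgr.trans hXs) (Real.exp_pos (-s)).le
    rwa [← mul_assoc, ← Real.exp_add, neg_add_cancel, Real.exp_zero, one_mul] at h3
  have hX : 0 < X := by linarith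
  have hf := flatness_mono hn hX.le hXw
  have hf0 := flatness_nonneg n X
  calc x s * y s * depth s (x s) (y s) ≤ x 0 * y 0 * depth 0 (x 0) (y 0) :=
        h.level_le le_rfl hs.1 hs.2
    _ ≤ (M * flatness n X) * (2 * X) := mul_le_mul hP (by linarith) hl0.le (by positivity)
    _ = 2 * M * (X * flatness n X) := by ring
    _ ≤ 2 * M * (w * flatness n w) :=
      mul_le_mul_of_nonneg_left (mul_le_mul hXw hf hf0 (hX.le.trans hXw)) (by positivity)

/-- The depth of the tip of the patch is controlled by the profile of the initial patch. -/
theorem IsCellPath.flatness_le_of_tip {x y : ℝ → ℝ} {T : ℝ} (h : IsCellPath x y T) (hT : 0 ≤ T)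
    {n : ℕ} (hn : n ≠ 0) (h0 : (⟨x 0, y 0⟩ : ℂ) ∈ initialPatch n)
    (hP : x T * y T * Real.exp (2 * T) * (1 + T) ≤ 1 / 1000)
    (hl : depth 0 (x 0) (y 0) < depth T (x T) (y T)) (hl1 : 1 ≤ depth T (x T) (y T)) :
    Real.exp (-T) * depth T (x T) (y T) * flatness n (Real.exp (-T) * depth T (x T) (y T)) ≤
      10 ^ 31 * (Real.exp (-2 * depth T (x T) (y T)) * depth T (x T) (y T)) := by
  have m0 : (0 : ℝ) ∈ Icc 0 T := left_mem_Icc.2 hT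
  have mT : T ∈ Icc 0 T := right_mem_Icc.2 hT
  obtain ⟨hyx, hlev⟩ := h.level_ge hT hP hl hl1
  have hfl := flatness_le_of_mem hn h0 hyx.le (h.initial_lt_one hT)
  have hg := h.depth_le_exp_mul le_rfl hT le_rfl
  have hu : Real.exp (-T) * depth T (x T) (y T) ≤ depth 0 (x 0) (y 0) := by
    have h3 := mul_le_mul_of_nonneg_left hg (Real.exp_pos (-T)).le
    rwa [← mul_assoc, ← Real.exp_add, sub_zero, neg_add_cancel, Real.exp_zero, one_mul] at h3
  have hu0 : 0 < Real.exp (-T) * depth T (x T) (y T) := by positivity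
  have hPT := h.mul_le_exp mT
  have hf := flatness_mono hn hu0.le hu
  have e3 : Real.exp 3 ≤ 55 := (Real.exp_le_exp.2 (by norm_num)).trans exp_four_lt.le
  calc _ ≤ depth 0 (x 0) (y 0) * flatness n (depth 0 (x 0) (y 0)) :=
        mul_le_mul hu hf (flatness_nonneg _ _) (h.depth_pos 0 m0).le
    _ ≤ depth 0 (x 0) (y 0) * (10 ^ 29 * (x 0 * y 0)) :=
        mul_le_mul_of_nonneg_left hfl (h.depth_pos 0 m0).le
    _ = 10 ^ 29 * (x 0 * y 0 * depth 0 (x 0) (y 0)) := by ring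
    _ ≤ 10 ^ 29 * (Real.exp 3 * (x T * y T * depth T (x T) (y T))) := by gcongr
    _ ≤ 10 ^ 29 * (55 * (Real.exp (-2 * depth T (x T) (y T)) / 2 * depth T (x T) (y T))) := by
        have := h.mul_pos' mT
        gcongr
    _ ≤ _ := by
        have : 0 < Real.exp (-2 * depth T (x T) (y T)) * depth T (x T) (y T) := by positivity
        nlinarith

theorem mul_exp_le_of_le {Λ l K : ℝ} (hl : 1 ≤ l) (hlΛ : l ≤ Λ) (hK : 0 ≤ K) :
    K * (Real.exp (-2 * Λ) * Λ) ≤ K * (Real.exp (-(Λ - l)) * (l * Real.exp (-2 * l))) := by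
  refine mul_le_mul_of_nonneg_left ?_ hK
  have h1 : Λ ≤ l * Real.exp (Λ - l) := by
    have := Real.add_one_le_exp (Λ - l)
    nlinarith
  calc Real.exp (-2 * Λ) * Λ ≤ Real.exp (-2 * Λ) * (l * Real.exp (Λ - l)) :=
        mul_le_mul_of_nonneg_left h1 (Real.exp_pos _).le
    _ = l * (Real.exp (-2 * Λ) * Real.exp (Λ - l)) := by ring
    _ = l * (Real.exp (-(Λ - l)) * Real.exp (-2 * l)) := by
      rw [← Real.exp_add, ← Real.exp_add]; congr 2; ring
    _ = _ := by ring

theorem le_of_sq_le_mul {Λ l q : ℝ} (hl : 0 < l) (hlq : l ≤ q) (h : (q + 2) ^ 2 ≤ Λ * l) :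
    q ≤ Λ := by
  have hq : 0 < q := hl.trans_le hlq
  have hΛ : 0 < Λ := by
    by_contra! hcon
    nlinarith [sq_nonneg (q + 2)]
  have h1 : q * q ≤ Λ * q := by nlinarith
  exact le_of_mul_le_mul_right h1 hq

theorem sub_le_of_sq_le_mul {Λ l q K : ℝ} (hΛ : 0 < Λ) (hl : 0 < l) (hK : 0 ≤ K)
    (hq : Λ - q ≤ K) (h : (q + 2) ^ 2 ≤ Λ * l) : Λ - l ≤ 2 * K := by
  by_contra! hcon
  rcases le_or_gt 0 (Λ - K) with h8 | h8
  · have h9 : (Λ - K) ^ 2 ≤ Λ * l := le_trans (pow_le_pow_left₀ h8 (by linarith) 2) h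
    nlinarith [sq_nonneg K]
  · linarith

/-- For `Λ/4 ≤ l ≤ Λ` the geometric mean of `Λ` and `l` is at least `(2l + Λ)/3`, because `(4l -
Λ)(Λ - l) ≥ 0`. -/
theorem third_le_of_mul_lt_sq {Λ l q : ℝ} (hlΛ : l ≤ Λ) (h4 : Λ / 4 ≤ l)
    (hq0 : 0 < q) (hq : Λ * l < (q + 2) ^ 2) : (Λ - l) / 3 - 2 ≤ q - l := by
  by_contra! hcon
  have h5 : q + 2 ≤ (2 * l + Λ) / 3 := by linarith
  have h6 : (q + 2) ^ 2 ≤ ((2 * l + Λ) / 3) ^ 2 := pow_le_pow_left₀ (by linarith) h5 2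
  nlinarith [mul_nonneg (show 0 ≤ 4 * l - Λ by linarith) (show 0 ≤ Λ - l by linarith)]

theorem le_of_mul_lt_sq {Λ l q : ℝ} (hl : 0 < l) (h4 : l < Λ / 4) (hq0 : 0 < q)
    (hq : Λ * l < (q + 2) ^ 2) : l - 2 ≤ q - l := by
  by_contra! hcon
  nlinarith

set_option maxHeartbeats 1000000 in
/-- The complement of the patch in the cell is concentrated near the axes. -/
theorem exists_angle_bound {n : ℕ} (hn : n ≠ 0) (C₁ : ℝ) (hC₁ : 0 ≤ C₁) : ∃ C, 0 < C ∧
    ∀ (x y : ℝ → ℝ) (T Λ : ℝ), 1 ≤ T → IsCellPath x y T →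
      (⟨x 0, y 0⟩ : ℂ) ∉ initialPatch n →
      Real.exp (-T) * Λ * flatness n (Real.exp (-T) * Λ) ≤ C₁ * (Real.exp (-2 * Λ) * Λ) →
      2 * (x T * y T) / (x T ^ 2 + y T ^ 2) ≤
        C * (Real.exp (-(Λ - depth T (x T) (y T)) / 4) + Real.exp (-depth T (x T) (y T))) := by
  obtain ⟨M, hM, HM⟩ := exists_level_le_of_incoming hn
  -- `D` will bound `e^{Λ-lp}` when the turning point is forced up to the depth of the tip, so that
  -- `K = log D` bounds `Λ - lp`.
  set D : ℝ := 1 + Real.exp 2 * 2 * M * C₁ with hD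
  have hD1 : 1 ≤ D := le_add_of_nonneg_right (by positivity)
  set K : ℝ := Real.log D with hK
  have hK0 : 0 ≤ K := Real.log_nonneg hD1
  refine ⟨Real.exp 4 + Real.exp K + D, by positivity, fun x y T Λ hT1 h h0 htip => ?_⟩
  have hT : 0 ≤ T := by linarith
  have mT : T ∈ Icc 0 T := right_mem_Icc.2 hT
  have m0 : (0 : ℝ) ∈ Icc 0 T := left_mem_Icc.2 hT
  have hxT := h.x_pos T mT
  have hyT := h.y_pos T mT
  have hr : 0 < x T ^ 2 + y T ^ 2 := by positivity
  have htriv : 2 * (x T * y T) / (x T ^ 2 + y T ^ 2) ≤ 1 := by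
    rw [div_le_one hr]; nlinarith [sq_nonneg (x T - y T)]
  have hlT := h.depth_pos T mT
  have hrl := h.exp_le_sq_add_sq mT
  set l := depth T (x T) (y T) with hl
  have hA := Real.exp_pos (-(Λ - l) / 4)
  have hB := Real.exp_pos (-l)
  -- the trivial region
  have trivial_of : ∀ k : ℝ, k ≤ 4 ∨ k ≤ K → -k ≤ -(Λ - l) / 4 ∨ -k ≤ -l →
      2 * (x T * y T) / (x T ^ 2 + y T ^ 2) ≤
        (Real.exp 4 + Real.exp K + D) * (Real.exp (-(Λ - l) / 4) + Real.exp (-l)) := by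
    intro k hk hk2
    refine htriv.trans ?_
    have h1 : Real.exp k ≤ Real.exp 4 + Real.exp K + D := by
      rcases hk with hk | hk
      · linarith [Real.exp_le_exp.2 hk, Real.exp_pos K]
      · linarith [Real.exp_le_exp.2 hk, Real.exp_pos 4]
    have h2 : Real.exp (-k) ≤ Real.exp (-(Λ - l) / 4) + Real.exp (-l) := by
      rcases hk2 with hk | hk
      · linarith [Real.exp_le_exp.2 hk]
      · linarith [Real.exp_le_exp.2 hk]
    calc (1 : ℝ) = Real.exp k * Real.exp (-k) := by rw [← Real.exp_add]; simp
      _ ≤ _ := mul_le_mul h1 h2 (Real.exp_pos _).le (by positivity)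
  have fin : ∀ c E : ℝ, c ≤ Real.exp 4 + Real.exp K + D → 0 ≤ c →
      (E ≤ Real.exp (-(Λ - l) / 4) ∨ E ≤ Real.exp (-l)) → 0 ≤ E →
      2 * (x T * y T) / (x T ^ 2 + y T ^ 2) ≤ c * E →
      2 * (x T * y T) / (x T ^ 2 + y T ^ 2) ≤
        (Real.exp 4 + Real.exp K + D) * (Real.exp (-(Λ - l) / 4) + Real.exp (-l)) := by
    intro c E hc hc0 hE hE0 hle
    refine hle.trans (mul_le_mul hc ?_ hE0 (by positivity))
    rcases hE with hE | hE <;> linarith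
  by_cases hl1 : l < 1
  · exact trivial_of 1 (Or.inl (by norm_num)) (Or.inr (by linarith))
  by_cases hlΛ : Λ < l + 2
  · exact trivial_of 1 (Or.inl (by norm_num)) (Or.inl (by linarith))
  push Not at hl1 hlΛ
  -- conversion of level bounds to angle bounds
  have conv : ∀ B : ℝ, x T * y T * l ≤ B * (l * Real.exp (-2 * l)) →
      2 * (x T * y T) / (x T ^ 2 + y T ^ 2) ≤ 2 * Real.exp 2 * B := by
    intro B hBl
    have hP : x T * y T ≤ B * Real.exp (-2 * l) := by
      have : (x T * y T) * l ≤ (B * Real.exp (-2 * l)) * l := by linarith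
      exact le_of_mul_le_mul_right this hlT
    have hB0 : 0 ≤ B := by
      by_contra! hcon
      have := mul_pos hxT hyT
      nlinarith [Real.exp_pos (-2 * l)]
    rw [div_le_iff₀ hr]
    have e : Real.exp 2 * Real.exp (-2 - 2 * l) = Real.exp (-2 * l) := by
      rw [← Real.exp_add]; congr 1; ring
    calc 2 * (x T * y T) ≤ 2 * (B * Real.exp (-2 * l)) := by linarith
      _ = 2 * Real.exp 2 * B * Real.exp (-2 - 2 * l) := by rw [← e]; ring
      _ ≤ _ := mul_le_mul_of_nonneg_left hrl (by positivity)
  have hΛ0 : 0 < Λ := by linarith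
  -- A path that is still incoming has level at most `O(e^{-2Λ}Λ)` by the tip condition, and
  -- dividing by `r² ≥ e^{-2-2l}` turns this into an angle of order `e^{-(Λ-l)}`. For an outgoing
  -- path the depth `lp` at the turning point decides.
  rcases h.incoming_or_switch hT hn h0 with hin | ⟨p, hp, hout, hpc⟩
  · have h1 := HM x y T h h0 T mT hin (Real.exp (-T) * Λ)
      (mul_le_mul_of_nonneg_left hlΛ (Real.exp_pos _).le)
    have h2 : x T * y T * l ≤ M * C₁ * (Real.exp (-(Λ - l)) * (l * Real.exp (-2 * l))) := by
      refine le_trans ?_ (mul_exp_le_of_le hl1 (by linarith) (by positivity))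
      rw [mul_assoc M]
      exact h1.trans (mul_le_mul_of_nonneg_left htip hM.le)
    have h3 := conv (M * C₁ * Real.exp (-(Λ - l))) (by linarith)
    refine fin D (Real.exp (-(Λ - l))) (by linarith [Real.exp_pos 4, Real.exp_pos K]) (by linarith)
      (Or.inl (Real.exp_le_exp.2 (by linarith))) (Real.exp_pos _).le (h3.trans ?_)
    have := Real.exp_pos (-(Λ - l))
    rw [hD]; nlinarith
  · have hlp0 := h.depth_pos p hp
    have hanti : ∀ u ∈ Icc p T, l ≤ depth u (x u) (y u) := fun u hu =>
      h.depth_antitone (hp.1.trans hu.1) hu.2 le_rfl fun v hv => hout v ⟨hu.1.trans hv.1, hv.2⟩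
    have hllp := hanti p ⟨le_rfl, hp.2⟩
    have hPp := h.mul_le_exp hp
    have hrp := h.exp_le_sq_add_sq hp
    have hlev := h.level_le hp.1 hp.2 le_rfl
    have hdec := h.outgoing_decay hp.1 hp.2 le_rfl fun u hu => hl1.trans (hanti u hu)
    have hxp := h.x_pos p hp
    have hyp := h.y_pos p hp
    have hcp1 : x p / y p ≤ 1 := by
      have := hout p ⟨le_rfl, hp.2⟩
      rw [one_le_div hxp] at this
      rwa [div_le_one hyp]
    have hYp : -Real.log (y p) + decay p - 1 + 3 / 2 * (x p / y p) ^ 2 ≤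
        depth p (x p) (y p) + 2 := by
      have h1 := log_le_depth (t := p) (y := x p) hyp
      rw [depth_comm] at h1
      have h2 : (x p / y p) ^ 2 ≤ 1 := pow_le_one₀ (div_pos hxp hyp).le hcp1
      linarith
    have hYT : l ≤ -Real.log (y T) + decay T - 1 + 3 / 2 * (x T / y T) ^ 2 := by
      have h1 := depth_le_log (t := T) (y := x T) hyT
      rw [depth_comm, ← hl] at h1
      linarith [sq_nonneg (x T / y T)]
    have hexp : Real.exp (T - p) * l ≤ depth p (x p) (y p) + 2 := by
      have h1 := mul_le_mul_of_nonneg_left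
        (hYT.trans (hdec.trans (mul_le_mul_of_nonneg_left hYp (Real.exp_pos _).le)))
        (Real.exp_pos (T - p)).le
      rwa [← mul_assoc (Real.exp (T - p)) (Real.exp (-(T - p))), ← Real.exp_add, add_neg_cancel,
        Real.exp_zero, one_mul] at h1
    set lp := depth p (x p) (y p) with hlp
    have hangle : 2 * (x T * y T) / (x T ^ 2 + y T ^ 2) ≤ Real.exp 2 * Real.exp (-(lp - l)) := by
      have h1 : x T * y T * l ≤ 1 / 2 * (Real.exp (-(lp - l)) * (l * Real.exp (-2 * l))) := by
        refine le_trans ?_ (mul_exp_le_of_le hl1 hllp (by norm_num))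
        refine hlev.trans ?_
        have := mul_le_mul_of_nonneg_right hPp hlp0.le
        linarith
      have h2 := conv (1 / 2 * Real.exp (-(lp - l))) (by linarith)
      linarith
    have hfin : ∀ m : ℝ, m - 2 ≤ lp - l →
        (-m ≤ -(Λ - l) / 4 ∨ -m ≤ -l) →
        2 * (x T * y T) / (x T ^ 2 + y T ^ 2) ≤
          (Real.exp 4 + Real.exp K + D) * (Real.exp (-(Λ - l) / 4) + Real.exp (-l)) := by
      intro m hm hm2
      refine fin (Real.exp 4) (Real.exp (-m)) (by linarith [Real.exp_pos K]) (Real.exp_pos _).le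
        (hm2.imp (fun h => Real.exp_le_exp.2 h) fun h => Real.exp_le_exp.2 h) (Real.exp_pos _).le
        (hangle.trans ?_)
      rw [← Real.exp_add, ← Real.exp_add]
      exact Real.exp_le_exp.2 (by linarith)
    rcases hpc with rfl | ⟨hd1, hin⟩
    · refine hfin l ?_ (Or.inr le_rfl)
      -- The path was outgoing from the start. Since `T ≥ 1`, the outgoing decay gives `lp + 2 ≥
      -- 2l`, so the level bound yields an angle `O(e^{-l})`.
      have h1 : 2 ≤ Real.exp (T - 0) := by
        have := Real.add_one_le_exp (T - 0)
        linarith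
      nlinarith
    -- The threshold is the geometric mean of `Λ` and `l`. Below it, `e^{T-p}(lp+2) ≤ (lp+2)²/l ≤
    -- Λ`, so the incoming bound applies at time `p`. There the path is on the diagonal, with level
    -- of order `e^{-2lp}lp`; hence `lp ≥ Λ - K`, then `l ≥ Λ - 2K`, and the claim is trivial. Above
    -- the threshold `lp - l` is at least `(Λ-l)/3 - 2` or `l - 2`, and the angle is
    -- `O(e^{-(lp-l)})`.
    · rcases le_or_gt ((lp + 2) ^ 2) (Λ * l) with hq | hq
      · have hw : Real.exp (-p) * (lp + 2) ≤ Real.exp (-T) * Λ := by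
          have h1 : Real.exp (T - p) * (lp + 2) ≤ Λ := by
            have h2 : (Real.exp (T - p) * (lp + 2)) * l ≤ Λ * l := by
              have := mul_le_mul_of_nonneg_right hexp (show 0 ≤ lp + 2 by linarith)
              nlinarith
            exact le_of_mul_le_mul_right h2 hlT
          have h2 := mul_le_mul_of_nonneg_left h1 (Real.exp_pos (-T)).le
          rwa [← mul_assoc, ← Real.exp_add, show -T + (T - p) = -p by ring] at h2
        have h1 := HM x y T h h0 p hp hin _ hw
        rw [← hlp] at h1
        have hxy : y p = x p := by rwa [div_eq_one_iff_eq hxp.ne'] at hd1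
        have h2 : Real.exp (-2 - 2 * lp) / 2 * lp ≤ M * (C₁ * (Real.exp (-2 * Λ) * Λ)) := by
          refine le_trans ?_ (h1.trans (mul_le_mul_of_nonneg_left htip hM.le))
          refine mul_le_mul_of_nonneg_right ?_ hlp0.le
          rw [hxy] at hrp ⊢
          linarith
        have hlpΛ : lp ≤ Λ := le_of_sq_le_mul hlT hllp hq
        have h3 := mul_exp_le_of_le (K := M * C₁) (hl1.trans hllp) hlpΛ (by positivity)
        have h4 : Real.exp (-2 - 2 * lp) / 2 ≤
            M * C₁ * (Real.exp (-(Λ - lp)) * Real.exp (-2 * lp)) := by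
          have : Real.exp (-2 - 2 * lp) / 2 * lp ≤
            M * C₁ * (Real.exp (-(Λ - lp)) * Real.exp (-2 * lp)) * lp := by linarith
          exact le_of_mul_le_mul_right this hlp0
        have h5 : Real.exp (Λ - lp) ≤ D := by
          have e1 : Real.exp (-2 - 2 * lp) = Real.exp (-2 * lp) * (Real.exp 2)⁻¹ := by
            rw [← Real.exp_neg, ← Real.exp_add]; congr 1; ring
          have e2 : Real.exp (-(Λ - lp)) = (Real.exp (Λ - lp))⁻¹ := Real.exp_neg _
          rw [e1, e2] at h4
          have p1 := Real.exp_pos (-2 * lp)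
          have p2 := Real.exp_pos (Λ - lp)
          have p3 := Real.exp_pos 2
          have h6 : (Real.exp 2)⁻¹ / 2 ≤ M * C₁ * (Real.exp (Λ - lp))⁻¹ := by
            have : (Real.exp 2)⁻¹ / 2 * Real.exp (-2 * lp) ≤
              M * C₁ * (Real.exp (Λ - lp))⁻¹ * Real.exp (-2 * lp) := by linarith
            exact le_of_mul_le_mul_right this p1
          rw [← div_eq_mul_inv, le_div_iff₀ p2, inv_eq_one_div, div_div, div_mul_eq_mul_div,
            one_mul, div_le_iff₀ (by positivity)] at h6
          rw [hD]; linarith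
        have h6 : Λ - lp ≤ K := by
          rw [hK, ← Real.log_exp (Λ - lp)]
          exact Real.log_le_log (Real.exp_pos _) h5
        refine trivial_of K (Or.inr le_rfl) (Or.inl ?_)
        have h7 : Λ - l ≤ 2 * K := sub_le_of_sq_le_mul hΛ0 hlT hK0 h6 hq
        linarith
      · rcases le_or_gt (Λ / 4) l with h4 | h4
        · exact hfin ((Λ - l) / 3) (third_le_of_mul_lt_sq (by linarith) h4 hlp0 hq)
            (Or.inl (by linarith))
        · exact hfin l (le_of_mul_lt_sq hlT h4 hlp0 hq) (Or.inr le_rfl)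

/-- If the diagonal point of depth `l = e^{δT}` came from outside the initial patch, its level,
about `e^{-2l}l`, would be at most `O(u f(u))` with `u` of order `e^{-(1-δ)T}`. But `f(u) ≤
exp(-(8u²)⁻ⁿ)`, and `u^{-2n}` is at least of order `e^{2n(1-δ)T}`, which eventually beats every
multiple of `l` exactly because `δ < 2n(1-δ)`. -/
theorem exists_time_mem_of_diagonal {n : ℕ} (hn : n ≠ 0) {δ : ℝ} (hδ0 : 0 < δ)
    (hδn : δ < 2 * n * (1 - δ)) : ∃ t₀, 0 ≤ t₀ ∧ ∀ (x y : ℝ → ℝ) (T : ℝ), t₀ ≤ T →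
      IsCellPath x y T → x T = y T → depth T (x T) (y T) = Real.exp (δ * T) →
      (⟨x 0, y 0⟩ : ℂ) ∈ initialPatch n := by
  obtain ⟨M, hM, HM⟩ := exists_level_le_of_incoming hn
  set K : ℝ := Real.log (6 * Real.exp 2 * M + 1) with hK
  have hK0 : 0 ≤ K := Real.log_nonneg (by linarith [show 0 ≤ 6 * Real.exp 2 * M by positivity])
  set a : ℝ := 2 * n * (1 - δ) - δ with ha
  have ha0 : 0 < a := by linarith
  have hlim : Tendsto (fun t : ℝ => Real.exp (a * t)) atTop atTop :=
    Real.tendsto_exp_atTop.comp (tendsto_id.const_mul_atTop ha0)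
  obtain ⟨t₀, ht₀⟩ := eventually_atTop.1 (hlim.eventually_gt_atTop (72 ^ n * (K + 2)))
  refine ⟨max t₀ 0, le_max_right _ _, fun x y T hTt h hxy hl => ?_⟩
  have hT : 0 ≤ T := (le_max_right _ _).trans hTt
  have hlarge := ht₀ T ((le_max_left _ _).trans hTt)
  by_contra h0
  have mT : T ∈ Icc 0 T := right_mem_Icc.2 hT
  have hxT := h.x_pos T mT
  set l := Real.exp (δ * T) with hlT
  have hl1 : 1 ≤ l := Real.one_le_exp (by positivity)
  -- After a switch to the outgoing half the depth stays at least `l ≥ 1`, so the slope increases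
  -- towards its final value `1`. It is therefore also at most `1`, and the path may be regarded as
  -- incoming throughout.
  have hin : ∀ u ∈ Icc 0 T, y u / x u ≤ 1 := by
    rcases h.incoming_or_switch hT hn h0 with hin | ⟨p, hp, hout, hpc⟩
    · exact hin
    · have hanti : ∀ u ∈ Icc p T, l ≤ depth u (x u) (y u) := fun u hu => hl ▸
        h.depth_antitone (hp.1.trans hu.1) hu.2 le_rfl fun v hv => hout v ⟨hu.1.trans hv.1, hv.2⟩
      have hmono : ∀ u ∈ Icc p T, y u / x u ≤ 1 := fun u hu => by
        have := le_of_hasDerivWithinAt_nonneg (T := T) (s := u) (t := T)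
          (fun v hv => h.hasDerivWithinAt_div ⟨hp.1.trans (hu.1.trans hv.1), hv.2⟩)
          (hp.1.trans hu.1) hu.2 le_rfl (fun v hv => by
            have hv' : v ∈ Icc p T := ⟨hu.1.trans hv.1, hv.2⟩
            have h1 := hout v hv'
            have h2 := hanti v hv'
            have h3 := decay_pos v
            exact mul_nonneg (by linarith) (by linarith))
        rw [← hxy, div_self hxT.ne'] at this
        exact this
      rcases hpc with rfl | ⟨-, hb⟩
      · exact hmono
      · intro u hu
        rcases le_total u p with hup | hup
        · exact hb u ⟨hu.1, hup⟩
        · exact hmono u ⟨hup, hu.2⟩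
  have h1 := HM x y T h h0 T mT hin _ le_rfl
  have hrl := h.exp_le_sq_add_sq mT
  rw [hl] at h1 hrl
  rw [← hxy] at h1 hrl
  set u := Real.exp (-T) * (l + 2) with hu
  have hu0 : 0 < u := by positivity
  have hul : u ≤ 3 * l := by
    have : Real.exp (-T) ≤ 1 := Real.exp_le_one_iff.2 (by linarith)
    rw [hu]; nlinarith
  have hu3 : u ≤ 3 * Real.exp (-(1 - δ) * T) := by
    have : Real.exp (-(1 - δ) * T) = Real.exp (-T) * l := by
      rw [hlT, ← Real.exp_add]; congr 1; ring
    rw [this, hu]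
    have := Real.exp_pos (-T)
    nlinarith
  have hfl := flatness_le_exp hn hu0
  have hF : 72 ^ n * ((8 * u ^ 2) ^ n)⁻¹ ≥ Real.exp (a * T) * l := by
    have h2 : (8 * u ^ 2) ^ n ≤ 72 ^ n * Real.exp (-(1 - δ) * T) ^ (2 * n) := by
      rw [pow_mul, ← mul_pow]
      refine pow_le_pow_left₀ (by positivity) ?_ n
      have := pow_le_pow_left₀ hu0.le hu3 2
      linarith
    have h3 : Real.exp (a * T) * l * Real.exp (-(1 - δ) * T) ^ (2 * n) = 1 := by
      rw [hlT, ← Real.exp_nat_mul, ← Real.exp_add, ← Real.exp_add, Real.exp_eq_one_iff, ha]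
      push_cast; ring
    rw [ge_iff_le, ← div_eq_mul_inv, le_div_iff₀ (by positivity)]
    calc Real.exp (a * T) * l * (8 * u ^ 2) ^ n
        ≤ Real.exp (a * T) * l * (72 ^ n * Real.exp (-(1 - δ) * T) ^ (2 * n)) := by gcongr
      _ = 72 ^ n * (Real.exp (a * T) * l * Real.exp (-(1 - δ) * T) ^ (2 * n)) := by ring
      _ = 72 ^ n := by rw [h3, mul_one]
  set F := ((8 * u ^ 2) ^ n)⁻¹ with hFdef
  have hFl : (K + 2) * l < F := by
    have h2 : 72 ^ n * ((K + 2) * l) < 72 ^ n * F := by nlinarith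
    exact lt_of_mul_lt_mul_left h2 (by positivity)
  have h2 : Real.exp (-2 - 2 * l) / 2 * l ≤ M * (3 * l * Real.exp (-F)) := by
    calc Real.exp (-2 - 2 * l) / 2 * l ≤ x T * x T * l := by
          refine mul_le_mul_of_nonneg_right ?_ (by linarith)
          linarith
      _ ≤ M * (u * flatness n u) := h1
      _ ≤ _ := by
        refine mul_le_mul_of_nonneg_left (mul_le_mul hul hfl (flatness_nonneg _ _) ?_) hM.le
        linarith
  have h3 : Real.exp (-2 - 2 * l) ≤ 6 * M * Real.exp (-F) := by
    have : Real.exp (-2 - 2 * l) * l ≤ 6 * M * Real.exp (-F) * l := by linarith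
    exact le_of_mul_le_mul_right this (by linarith)
  have h4 : Real.exp (F - 2 * l) ≤ 6 * Real.exp 2 * M := by
    have h5 := mul_le_mul_of_nonneg_left h3 (Real.exp_pos (F + 2)).le
    rw [← Real.exp_add] at h5
    have e1 : Real.exp (F + 2) * (6 * M * Real.exp (-F)) = 6 * Real.exp 2 * M := by
      rw [show Real.exp (F + 2) * (6 * M * Real.exp (-F)) =
        6 * M * (Real.exp (F + 2) * Real.exp (-F)) by ring, ← Real.exp_add,
        show F + 2 + -F = 2 by ring]
      ring
    rw [e1, show F + 2 + (-2 - 2 * l) = F - 2 * l by ring] at h5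
    exact h5
  have h6 : F - 2 * l ≤ K := by
    rw [hK, ← Real.log_exp (F - 2 * l)]
    exact Real.log_le_log (Real.exp_pos _) (by linarith)
  nlinarith

/-! ### The truncated base field: stream function, symmetries, incompressibility -/

/-- A continuous plane field with a stream function is incompressible. -/
theorem isIncompressible_of_stream {Ψ : ℂ → ℝ} {V : ℂ → ℂ} (hV : Continuous V)
    (hΨ : ∀ z, HasFDerivAt Ψ ((V z).im • Complex.reCLM - (V z).re • Complex.imCLM) z) :
    IsIncompressible V := by
  intro φ hφ hc
  have hΨd : Differentiable ℝ Ψ := fun z => (hΨ z).differentiableAt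
  have hΨc : Continuous Ψ := hΨd.continuous
  have hx : ∀ z, fderiv ℝ Ψ z 1 = (V z).im := fun z => by rw [(hΨ z).fderiv]; simp
  have hy : ∀ z, fderiv ℝ Ψ z Complex.I = -(V z).re := fun z => by rw [(hΨ z).fderiv]; simp
  have hφ' : ContDiff ℝ ∞ (fderiv ℝ φ) := hφ.fderiv_right (by simp)
  have hφ'' : ∀ v : ℂ, ContDiff ℝ ∞ fun z => fderiv ℝ φ z v := fun v => hφ'.clm_apply contDiff_const
  have hcv : ∀ v : ℂ, HasCompactSupport fun z => fderiv ℝ φ z v := fun v =>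
    hc.fderiv_apply (𝕜 := ℝ) v
  have hcvw : ∀ v w : ℂ, HasCompactSupport fun z => fderiv ℝ (fun z => fderiv ℝ φ z v) z w :=
    fun v w => (hcv v).fderiv_apply (𝕜 := ℝ) w
  have hd : ∀ v : ℂ, Differentiable ℝ fun z => fderiv ℝ φ z v := fun v =>
    (hφ'' v).differentiable (by simp)
  have hc2 : ∀ v w : ℂ, Continuous fun z => fderiv ℝ (fun z => fderiv ℝ φ z v) z w := fun v w =>
    ((hφ'' v).continuous_fderiv (by simp)).clm_apply continuous_const
  have hΨ' : ∀ w : ℂ, Continuous fun z => fderiv ℝ Ψ z w := fun w => by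
    have : (fun z => fderiv ℝ Ψ z w) = fun z => (V z).im * w.re - (V z).re * w.im := by
      funext z; rw [(hΨ z).fderiv]; simp
    rw [this]
    fun_prop
  have parts : ∀ v w : ℂ, ∫ z, fderiv ℝ φ z v * fderiv ℝ Ψ z w =
      -∫ z, fderiv ℝ (fun z => fderiv ℝ φ z v) z w * Ψ z := fun v w => by
    refine integral_mul_fderiv_eq_neg_fderiv_mul_of_integrable ?_ ?_ ?_ (fun z _ => hd v z)
      fun z _ => hΨd z
    · exact ((hc2 v w).mul hΨc).integrable_of_hasCompactSupport ((hcvw v w).mul_right)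
    · exact ((hφ'' v).continuous.mul (hΨ' w)).integrable_of_hasCompactSupport ((hcv v).mul_right)
    · exact ((hφ'' v).continuous.mul hΨc).integrable_of_hasCompactSupport ((hcv v).mul_right)
  have hsymm : ∀ z v w : ℂ, fderiv ℝ (fun z => fderiv ℝ φ z v) z w =
      fderiv ℝ (fun z => fderiv ℝ φ z w) z v := fun z v w => by
    have h1 : IsSymmSndFDerivAt ℝ φ z := by
      refine hφ.contDiffAt.isSymmSndFDerivAt ?_
      simp only [minSmoothness_of_isRCLikeNormedField]
      exact WithTop.coe_le_coe.2 (le_top : (2 : ℕ∞) ≤ ⊤)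
    have h2 : ∀ v w : ℂ, fderiv ℝ (fun z => fderiv ℝ φ z v) z w = fderiv ℝ (fderiv ℝ φ) z w v :=
      fun v w => by
        rw [fderiv_clm_apply (hφ'.differentiable (by simp) z) (differentiableAt_const v)]
        simp
    rw [h2, h2, h1]
  have hint : ∀ v w : ℂ, Integrable fun z => fderiv ℝ φ z v * fderiv ℝ Ψ z w := fun v w =>
    ((hφ'' v).continuous.mul (hΨ' w)).integrable_of_hasCompactSupport ((hcv v).mul_right)
  have e : ∀ z, fderiv ℝ φ z (V z) =
      fderiv ℝ φ z Complex.I * fderiv ℝ Ψ z 1 - fderiv ℝ φ z 1 * fderiv ℝ Ψ z Complex.I := by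
    intro z
    have h1 : V z = (V z).re • (1 : ℂ) + (V z).im • Complex.I := by
      simp [Complex.re_add_im]
    rw [hx, hy]
    conv_lhs => rw [h1]
    rw [map_add, map_smul, map_smul]
    simp only [smul_eq_mul]
    ring
  simp only [e]
  rw [integral_sub (hint _ _) (hint _ _), parts, parts]
  simp only [hsymm _ Complex.I 1]
  ring

/-- The logarithm `-½ log s`, continued linearly to `s ≤ e`. -/
def truncLog (e s : ℝ) : ℝ := -(1 / 2) * Real.log (max s e) + (max s e - s) / (2 * e)

theorem truncLog_of_le {e s : ℝ} (h : e ≤ s) : truncLog e s = -(1 / 2) * Real.log s := by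
  simp [truncLog, max_eq_left h]

theorem truncLog_of_ge {e s : ℝ} (h : s ≤ e) :
    truncLog e s = -(1 / 2) * Real.log e + (e - s) / (2 * e) := by
  simp [truncLog, max_eq_right h]

theorem hasDerivAt_truncLog {e : ℝ} (he : 0 < e) (s : ℝ) :
    HasDerivAt (truncLog e) (-(1 / (2 * max s e))) s := by
  have hr : e ≤ s → HasDerivWithinAt (truncLog e) (-(1 / (2 * max s e))) (Ici e) s := fun h => by
    have hs : 0 < s := he.trans_le h
    have h1 := ((Real.hasDerivAt_log hs.ne').const_mul (-(1 / 2))).hasDerivWithinAt (s := Ici e)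
    refine (h1.congr (fun t ht => truncLog_of_le ht) (truncLog_of_le h)).congr_deriv ?_
    rw [max_eq_left h]
    field_simp
  have hl : s ≤ e → HasDerivWithinAt (truncLog e) (-(1 / (2 * max s e))) (Iic e) s := fun h => by
    have h1 := ((((hasDerivAt_id s).const_sub e).div_const (2 * e)).const_add
      (-(1 / 2) * Real.log e)).hasDerivWithinAt (s := Iic e)
    refine (h1.congr (fun t ht => truncLog_of_ge ht) (truncLog_of_ge h)).congr_deriv ?_
    rw [max_eq_right h]
    field_simp
  rcases lt_trichotomy s e with h | h | h
  · exact (hl h.le).hasDerivAt (Iic_mem_nhds h)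
  · have := (hl h.le).union (hr h.ge)
    rw [Iic_union_Ici] at this
    exact hasDerivWithinAt_univ.1 this
  · exact (hr h.le).hasDerivAt (Ici_mem_nhds h)

/-- Below `e` the linear continuation is less steep than the logarithm itself, so the modulus of
continuity of `-½ log s` persists with no dependence on the truncation. -/
theorem abs_truncLog_sub_le {e s t : ℝ} (he : 0 < e) (hs : 0 < s) (hst : s ≤ t) :
    |truncLog e t - truncLog e s| ≤ Real.log (t / s) / 2 := by
  have ht : 0 < t := hs.trans_le hst
  have hlin : ∀ a b : ℝ, 0 < a → a ≤ b → b ≤ e → (b - a) / (2 * e) ≤ (Real.log b - Real.log a) / 2 := by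
    intro a b ha hab hbe
    have hb : 0 < b := ha.trans_le hab
    have h1 := Real.log_le_sub_one_of_pos (show 0 < a / b by positivity)
    rw [Real.log_div ha.ne' hb.ne'] at h1
    have h2 : (b - a) / e ≤ (b - a) / b := div_le_div_of_nonneg_left (by linarith) hb hbe
    have h3 : (b - a) / b = 1 - a / b := by field_simp
    rw [div_mul_eq_div_div_swap]
    linarith
  rw [Real.log_div ht.ne' hs.ne']
  rcases le_total e s with h | h
  · rw [truncLog_of_le h, truncLog_of_le (h.trans hst), abs_le]
    have := Real.log_le_log hs hst
    constructor <;> linarith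
  · rcases le_total e t with h' | h'
    · rw [truncLog_of_le h', truncLog_of_ge h]
      have h1 := hlin s e hs h le_rfl
      have h2 := Real.log_le_log he h'
      have h3 : 0 ≤ (e - s) / (2 * e) := div_nonneg (by linarith) (by linarith)
      rw [abs_le]
      constructor <;> linarith
    · rw [truncLog_of_ge h', truncLog_of_ge h]
      have h1 := hlin s t hs hst h'
      have h4 : (e - t) / (2 * e) - (e - s) / (2 * e) = -((t - s) / (2 * e)) := by ring
      have h3 : 0 ≤ (t - s) / (2 * e) := div_nonneg (by linarith) (by linarith)
      rw [abs_le]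
      constructor <;> linarith

theorem abs_truncLog_le {e s : ℝ} (he : 0 < e) (he1 : e ≤ 1) (hs : 0 < s) :
    |truncLog e s| ≤ |Real.log s| / 2 + 1 / 2 := by
  rcases le_total e s with h | h
  · rw [truncLog_of_le h, abs_mul]
    norm_num
    linarith
  · rw [truncLog_of_ge h]
    have h1 := Real.log_le_log hs h
    have h2 := Real.log_nonpos he.le he1
    have h3 : 0 ≤ (e - s) / (2 * e) := div_nonneg (by linarith) (by linarith)
    have h4 : (e - s) / (2 * e) ≤ 1 / 2 := by
      rw [div_le_div_iff₀ (by linarith) (by norm_num)]; linarith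
    have h5 := neg_le_abs (Real.log s)
    rw [abs_le]
    constructor <;> linarith

theorem abs_truncLog_le' {e s : ℝ} (he : 0 < e) (he1 : e ≤ 1) (hs : 0 ≤ s) (hs16 : s ≤ 16) :
    |truncLog e s| ≤ |Real.log e| / 2 + 2 := by
  rcases le_total e s with h | h
  · rw [truncLog_of_le h]
    have h1 := Real.log_le_log he h
    have h2 := Real.log_le_log (he.trans_le h) hs16
    have h3 : Real.log 16 ≤ 4 := by
      rw [show (16 : ℝ) = 2 ^ 4 by norm_num, Real.log_pow]
      have := Real.log_two_lt_d9
      push_cast; linarith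
    have h5 := neg_le_abs (Real.log e)
    have h6 := abs_nonneg (Real.log e)
    rw [abs_le]
    constructor <;> linarith
  · rw [truncLog_of_ge h]
    have h2 := Real.log_nonpos he.le he1
    have h3 : 0 ≤ (e - s) / (2 * e) := div_nonneg (by linarith) (by linarith)
    have h4 : (e - s) / (2 * e) ≤ 1 / 2 := by
      rw [div_le_div_iff₀ (by linarith) (by norm_num)]; linarith
    have h5 := neg_le_abs (Real.log e)
    rw [abs_le]
    constructor <;> linarith

/-- A radial cutoff as a function of `s = |z|²`. -/
def cutoff (s : ℝ) : ℝ := Real.smoothTransition (2 - s / 8)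

theorem cutoff_of_le {s : ℝ} (h : s ≤ 8) : cutoff s = 1 :=
  Real.smoothTransition.one_of_one_le (by linarith)

theorem cutoff_of_ge {s : ℝ} (h : 16 ≤ s) : cutoff s = 0 :=
  Real.smoothTransition.zero_of_nonpos (by linarith)

theorem cutoff_nonneg (s : ℝ) : 0 ≤ cutoff s := Real.smoothTransition.nonneg _

theorem cutoff_le_one (s : ℝ) : cutoff s ≤ 1 := Real.smoothTransition.le_one _

theorem contDiff_cutoff : ContDiff ℝ ∞ cutoff :=
  Real.smoothTransition.contDiff.comp (contDiff_const.sub (contDiff_id.div_const 8))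

theorem contDiff_deriv_cutoff : ContDiff ℝ ∞ (deriv cutoff) :=
  (contDiff_infty_iff_deriv.1 contDiff_cutoff).2

theorem hasDerivAt_cutoff (s : ℝ) : HasDerivAt cutoff (deriv cutoff s) s :=
  (contDiff_cutoff.differentiable (by simp) s).hasDerivAt

theorem deriv_cutoff_of_lt {s : ℝ} (h : s < 8) : deriv cutoff s = 0 := by
  have : cutoff =ᶠ[𝓝 s] fun _ => 1 := by
    filter_upwards [Iio_mem_nhds h] with t ht using cutoff_of_le (le_of_lt ht)
  rw [this.deriv_eq]; simp

theorem deriv_cutoff_of_le {s : ℝ} (h : s ≤ 8) : deriv cutoff s = 0 := by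
  have hcl : IsClosed {s | deriv cutoff s = 0} :=
    isClosed_eq contDiff_deriv_cutoff.continuous continuous_const
  have : Iic (8 : ℝ) ⊆ {s | deriv cutoff s = 0} := by
    rw [← closure_Iio]
    exact hcl.closure_subset_iff.2 fun s hs => deriv_cutoff_of_lt hs
  exact this h

theorem deriv_cutoff_of_ge {s : ℝ} (h : 16 ≤ s) : deriv cutoff s = 0 := by
  have hcl : IsClosed {s | deriv cutoff s = 0} :=
    isClosed_eq contDiff_deriv_cutoff.continuous continuous_const
  have : Ici (16 : ℝ) ⊆ {s | deriv cutoff s = 0} := by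
    rw [← closure_Ioi]
    refine hcl.closure_subset_iff.2 fun s hs => ?_
    have : cutoff =ᶠ[𝓝 s] fun _ => 0 := by
      filter_upwards [Ioi_mem_nhds hs] with t ht using cutoff_of_ge (le_of_lt ht)
    show deriv cutoff s = 0
    rw [this.deriv_eq]; simp
  exact this h

/-- The radial factor of the stream function of the base field. -/
def streamFactor (e a s : ℝ) : ℝ := cutoff s * (truncLog e s + a)

/-- The derivative of `streamFactor`. -/
def streamFactor' (e a s : ℝ) : ℝ :=
  deriv cutoff s * (truncLog e s + a) + cutoff s * -(1 / (2 * max s e))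

theorem hasDerivAt_streamFactor {e : ℝ} (he : 0 < e) (a s : ℝ) :
    HasDerivAt (streamFactor e a) (streamFactor' e a s) s :=
  (hasDerivAt_cutoff s).mul ((hasDerivAt_truncLog he s).add_const a)

/-- The velocity field with stream function `x y (-log r + a)`, truncated for `r² ≤ e` and cut off
for large `r`. -/
def baseField (e a : ℝ) (z : ℂ) : ℂ :=
  (streamFactor e a (Complex.normSq z) : ℂ) * -(starRingEnd ℂ z) +
    ((2 * streamFactor' e a (Complex.normSq z) * (z.re * z.im) : ℝ) : ℂ) * (Complex.I * z)

theorem baseField_re (e a : ℝ) (z : ℂ) : (baseField e a z).re =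
    -(streamFactor e a (Complex.normSq z) * z.re) -
      2 * streamFactor' e a (Complex.normSq z) * (z.re * z.im) * z.im := by
  simp only [baseField, Complex.add_re, Complex.re_ofReal_mul, Complex.neg_re, Complex.conj_re,
    Complex.I_mul_re]
  ring

theorem baseField_im (e a : ℝ) (z : ℂ) : (baseField e a z).im =
    streamFactor e a (Complex.normSq z) * z.im +
      2 * streamFactor' e a (Complex.normSq z) * (z.re * z.im) * z.re := by
  simp only [baseField, Complex.add_im, Complex.im_ofReal_mul, Complex.neg_im, Complex.conj_im,
    Complex.I_mul_im]
  ring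

theorem baseField_neg (e a : ℝ) (z : ℂ) : baseField e a (-z) = -baseField e a z := by
  simp only [baseField, Complex.normSq_neg, map_neg, Complex.neg_re, Complex.neg_im]
  push_cast
  ring

theorem baseField_conj (e a : ℝ) (z : ℂ) :
    baseField e a (starRingEnd ℂ z) = starRingEnd ℂ (baseField e a z) := by
  apply Complex.ext
  · simp only [baseField_re, Complex.normSq_conj, Complex.conj_re, Complex.conj_im]
    ring
  · simp only [baseField_im, Complex.normSq_conj, Complex.conj_re, Complex.conj_im]
    ring

theorem baseField_eq_zero {e a : ℝ} {z : ℂ} (hz : 4 ≤ ‖z‖) : baseField e a z = 0 := by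
  have h : 16 ≤ Complex.normSq z := by
    rw [Complex.normSq_eq_norm_sq]; nlinarith
  simp [baseField, streamFactor, streamFactor', cutoff_of_ge h, deriv_cutoff_of_ge h]

theorem baseField_eq_of_le {e e' a : ℝ} {z : ℂ} (h : e ≤ Complex.normSq z)
    (h' : e' ≤ Complex.normSq z) : baseField e a z = baseField e' a z := by
  simp only [baseField, streamFactor, streamFactor', truncLog_of_le h, truncLog_of_le h',
    max_eq_left h, max_eq_left h']

theorem continuous_truncLog_max {X : Type*} [TopologicalSpace X] {e s : X → ℝ} {A : Set X}
    (he : ContinuousOn e A) (hs : ContinuousOn s A) (h0 : ∀ x ∈ A, 0 < e x) :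
    ContinuousOn (fun x => truncLog (e x) (s x)) A := by
  unfold truncLog
  have hm : ContinuousOn (fun x => max (s x) (e x)) A := hs.sup he
  refine (continuousOn_const.mul (hm.log fun x hx => ?_)).add ((hm.sub hs).div
    (continuousOn_const.mul he) fun x hx => ?_)
  · exact (lt_max_of_lt_right (h0 x hx)).ne'
  · have := h0 x hx
    positivity

theorem continuousOn_baseField {X : Type*} [TopologicalSpace X] {e a : X → ℝ} {f : X → ℂ}
    {A : Set X} (he : ContinuousOn e A) (ha : ContinuousOn a A) (hf : ContinuousOn f A)
    (h0 : ∀ x ∈ A, 0 < e x) : ContinuousOn (fun x => baseField (e x) (a x) (f x)) A := by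
  have hs : ContinuousOn (fun x => Complex.normSq (f x)) A :=
    Complex.continuous_normSq.comp_continuousOn hf
  have ht := continuous_truncLog_max he hs h0
  have hc : ContinuousOn (fun x => cutoff (Complex.normSq (f x))) A :=
    contDiff_cutoff.continuous.comp_continuousOn hs
  have hc' : ContinuousOn (fun x => deriv cutoff (Complex.normSq (f x))) A :=
    contDiff_deriv_cutoff.continuous.comp_continuousOn hs
  have hm : ContinuousOn (fun x => 1 / (2 * max (Complex.normSq (f x)) (e x))) A := by
    refine continuousOn_const.div (continuousOn_const.mul (hs.sup he)) fun x hx => ?_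
    have : 0 < max (Complex.normSq (f x)) (e x) := lt_max_of_lt_right (h0 x hx)
    positivity
  have h1 : ContinuousOn (fun x => streamFactor (e x) (a x) (Complex.normSq (f x))) A :=
    hc.mul (ht.add ha)
  have h2 : ContinuousOn (fun x => streamFactor' (e x) (a x) (Complex.normSq (f x))) A :=
    (hc'.mul (ht.add ha)).add (hc.mul hm.neg)
  have hre : ContinuousOn (fun x => (f x).re) A := Complex.continuous_re.comp_continuousOn hf
  have him : ContinuousOn (fun x => (f x).im) A := Complex.continuous_im.comp_continuousOn hf
  unfold baseField
  refine ((Complex.continuous_ofReal.comp_continuousOn h1).mul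
    (Complex.continuous_conj.comp_continuousOn hf).neg).add
    ((Complex.continuous_ofReal.comp_continuousOn
      ((continuousOn_const.mul h2).mul (hre.mul him))).mul (continuousOn_const.mul hf))

theorem continuous_baseField {e : ℝ} (he : 0 < e) (a : ℝ) : Continuous (baseField e a) := by
  rw [← continuousOn_univ]
  exact continuousOn_baseField continuousOn_const continuousOn_const continuousOn_id fun _ _ => he

theorem isIncompressible_baseField {e : ℝ} (he : 0 < e) (a : ℝ) :
    IsIncompressible (baseField e a) := by
  refine isIncompressible_of_stream (continuous_baseField he a)
    (Ψ := fun z => z.re * z.im * streamFactor e a (z.re ^ 2 + z.im ^ 2)) fun z => ?_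
  have hre : HasFDerivAt (fun z : ℂ => z.re) Complex.reCLM z := Complex.reCLM.hasFDerivAt
  have him : HasFDerivAt (fun z : ℂ => z.im) Complex.imCLM z := Complex.imCLM.hasFDerivAt
  have hs : Complex.normSq z = z.re ^ 2 + z.im ^ 2 := by rw [Complex.normSq_apply]; ring
  have h1 := (hasDerivAt_streamFactor he a (z.re ^ 2 + z.im ^ 2)).comp_hasFDerivAt z
    ((hre.pow 2).add (him.pow 2))
  refine ((hre.mul him).mul h1).congr_fderiv ?_
  ext w
  simp [baseField_re, baseField_im, hs]
  ring

/-! ### Lipschitz and log-Lipschitz bounds of the base field -/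

/-- The modulus of continuity of log-Lipschitz fields. -/
def logModulus (d : ℝ) : ℝ := d * (1 + |Real.log d|)

theorem le_logModulus {d : ℝ} (hd : 0 ≤ d) : d ≤ logModulus d :=
  le_mul_of_one_le_right hd (by linarith [abs_nonneg (Real.log d)])

theorem log_four_le : Real.log 4 ≤ 2 := by
  rw [show (4 : ℝ) = 2 ^ 2 by norm_num, Real.log_pow]
  have := Real.log_two_lt_d9
  push_cast; linarith

theorem log_normSq (z : ℂ) : Real.log (Complex.normSq z) = 2 * Real.log ‖z‖ := by
  rw [Complex.normSq_eq_norm_sq, Real.log_pow]; norm_num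

theorem abs_re_mul_im_le (z : ℂ) : |z.re * z.im| ≤ Complex.normSq z / 2 := by
  rw [Complex.normSq_apply, abs_le]
  constructor <;> nlinarith [sq_nonneg (z.re - z.im), sq_nonneg (z.re + z.im)]

/-- The part of the base field that is singular at the origin, without the cutoff. -/
def coreField (e : ℝ) (z : ℂ) : ℂ :=
  (truncLog e (Complex.normSq z) : ℂ) * -(starRingEnd ℂ z) -
    ((z.re * z.im / max (Complex.normSq z) e : ℝ) : ℂ) * (Complex.I * z)

theorem abs_div_max_le {e : ℝ} (he : 0 < e) (z : ℂ) :
    |z.re * z.im / max (Complex.normSq z) e| ≤ 1 / 2 := by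
  have hm : 0 < max (Complex.normSq z) e := lt_max_of_lt_right he
  rw [abs_div, abs_of_pos hm, div_le_iff₀ hm]
  have h1 := abs_re_mul_im_le z
  have h2 := le_max_left (Complex.normSq z) e
  linarith

theorem norm_coreField_add_le {e : ℝ} (he : 0 < e) (z : ℂ) :
    ‖coreField e z + (truncLog e (Complex.normSq z) : ℂ) * starRingEnd ℂ z‖ ≤ ‖z‖ / 2 := by
  have e1 : coreField e z + (truncLog e (Complex.normSq z) : ℂ) * starRingEnd ℂ z =
      -(((z.re * z.im / max (Complex.normSq z) e : ℝ) : ℂ) * (Complex.I * z)) := by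
    rw [coreField]; ring
  rw [e1, norm_neg, norm_mul, norm_mul, Complex.norm_I, one_mul, Complex.norm_real,
    Real.norm_eq_abs]
  nlinarith [abs_div_max_le he z, norm_nonneg z]

theorem norm_coreField_le {e : ℝ} (he : 0 < e) (he1 : e ≤ 1) {z : ℂ} (hz : ‖z‖ ≤ 4) :
    ‖coreField e z‖ ≤ 12 := by
  rcases eq_or_ne z 0 with rfl | h0
  · simp [coreField]
  have hzp : 0 < ‖z‖ := norm_pos_iff.2 h0
  have h1 := norm_coreField_add_le he z
  have h2 : ‖coreField e z‖ ≤ ‖z‖ / 2 + |truncLog e (Complex.normSq z)| * ‖z‖ := by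
    have h3 : coreField e z = (coreField e z + (truncLog e (Complex.normSq z) : ℂ) *
      starRingEnd ℂ z) - (truncLog e (Complex.normSq z) : ℂ) * starRingEnd ℂ z := by ring
    rw [h3]
    refine (norm_sub_le _ _).trans (add_le_add h1 ?_)
    rw [norm_mul, RCLike.norm_conj, Complex.norm_real, Real.norm_eq_abs]
  have h4 := abs_truncLog_le he he1 (Complex.normSq_pos.2 h0)
  rw [log_normSq, abs_mul, abs_two] at h4
  have h5 : |Real.log ‖z‖| * ‖z‖ ≤ 8 := by
    rcases le_or_gt ‖z‖ 1 with h | h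
    · rw [abs_of_nonpos (Real.log_nonpos hzp.le h)]
      have := Real.one_sub_inv_le_log_of_pos hzp
      have h6 : (‖z‖)⁻¹ * ‖z‖ = 1 := inv_mul_cancel₀ hzp.ne'
      nlinarith
    · rw [abs_of_nonneg (Real.log_nonneg h.le)]
      have := (Real.log_le_log hzp hz).trans log_four_le
      have h6 := Real.log_nonneg h.le
      nlinarith
  nlinarith

/-- The logarithm enters only at the outer point `w`. Its variation is multiplied by the smaller
norm, and `|z| log(|w|/|z|) ≤ |w| - |z|`, so it costs a bounded Lipschitz constant. The quotient
`xy/max(r², e)` is handled in the same way. -/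
theorem norm_coreField_sub_le {e : ℝ} (he : 0 < e) {z w : ℂ} (hzw : ‖z‖ ≤ ‖w‖) :
    ‖coreField e w - coreField e z‖ ≤ (|truncLog e (Complex.normSq w)| + 5) * ‖w - z‖ := by
  rcases eq_or_ne w 0 with rfl | hw0
  · have : z = 0 := by simpa using hzw
    simp [this]
  have hw : 0 < ‖w‖ := norm_pos_iff.2 hw0
  have hsw : Complex.normSq w = ‖w‖ ^ 2 := Complex.normSq_eq_norm_sq w
  have hsz : Complex.normSq z = ‖z‖ ^ 2 := Complex.normSq_eq_norm_sq z
  have hd := norm_sub_norm_le w z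
  have hd0 := norm_nonneg (w - z)
  have hz0 := norm_nonneg z
  have hlog : |truncLog e (Complex.normSq w) - truncLog e (Complex.normSq z)| * ‖z‖ ≤ ‖w - z‖ := by
    rcases eq_or_ne z 0 with rfl | h0
    · simp
    have hz : 0 < ‖z‖ := norm_pos_iff.2 h0
    have h1 := abs_truncLog_sub_le he (Complex.normSq_pos.2 h0)
      (show Complex.normSq z ≤ Complex.normSq w by rw [hsw, hsz]; gcongr)
    have h2 : Real.log (Complex.normSq w / Complex.normSq z) / 2 = Real.log (‖w‖ / ‖z‖) := by
      rw [hsw, hsz, ← div_pow, Real.log_pow]; push_cast; ring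
    rw [h2] at h1
    have h3 := Real.log_le_sub_one_of_pos (show 0 < ‖w‖ / ‖z‖ by positivity)
    calc _ ≤ (‖w‖ / ‖z‖ - 1) * ‖z‖ := mul_le_mul_of_nonneg_right (h1.trans h3) hz.le
      _ = ‖w‖ - ‖z‖ := by field_simp
      _ ≤ _ := hd
  set M := max (Complex.normSq w) e with hM
  set N := max (Complex.normSq z) e with hN
  have hM0 : 0 < M := lt_max_of_lt_right he
  have hN0 : 0 < N := lt_max_of_lt_right he
  have hMw : ‖w‖ ^ 2 ≤ M := hsw ▸ le_max_left _ _
  have hNM : N ≤ M := max_le_max_right e (by rw [hsw, hsz]; gcongr)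
  have hMN : M - N ≤ 2 * ‖w‖ * ‖w - z‖ := by
    have h1 : M ≤ N + (‖w‖ ^ 2 - ‖z‖ ^ 2) := by
      rw [hM, hN, hsw, hsz]
      refine max_le ?_ ?_
      · linarith [le_max_left (‖z‖ ^ 2) e]
      · have : ‖z‖ ^ 2 ≤ ‖w‖ ^ 2 := by gcongr
        linarith [le_max_right (‖z‖ ^ 2) e]
    nlinarith
  have hp : |w.re * w.im - z.re * z.im| ≤ 2 * ‖w‖ * ‖w - z‖ := by
    have e1 : w.re * w.im - z.re * z.im = w.re * (w - z).im + z.im * (w - z).re := by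
      simp only [Complex.sub_re, Complex.sub_im]; ring
    rw [e1]
    refine (abs_add_le _ _).trans ?_
    rw [abs_mul, abs_mul]
    have h1 := mul_le_mul (Complex.abs_re_le_norm w) (Complex.abs_im_le_norm (w - z))
      (abs_nonneg _) (norm_nonneg _)
    have h2 := mul_le_mul ((Complex.abs_im_le_norm z).trans hzw) (Complex.abs_re_le_norm (w - z))
      (abs_nonneg _) (norm_nonneg _)
    linarith
  have hk : |w.re * w.im / M - z.re * z.im / N| * ‖z‖ ≤ 3 * ‖w - z‖ := by
    have e1 : w.re * w.im / M - z.re * z.im / N =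
        (w.re * w.im - z.re * z.im) / M - z.re * z.im / N * ((M - N) / M) := by
      field_simp; ring
    have h1 : |(w.re * w.im - z.re * z.im) / M| ≤ 2 * ‖w‖ * ‖w - z‖ / ‖w‖ ^ 2 := by
      rw [abs_div, abs_of_pos hM0]
      exact div_le_div₀ (by positivity) hp (by positivity) hMw
    have h2 : |z.re * z.im / N * ((M - N) / M)| ≤ 1 / 2 * (2 * ‖w‖ * ‖w - z‖ / ‖w‖ ^ 2) := by
      rw [abs_mul]
      refine mul_le_mul (abs_div_max_le he z) ?_ (abs_nonneg _) (by norm_num)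
      rw [abs_div, abs_of_pos hM0, abs_of_nonneg (sub_nonneg.2 hNM)]
      exact div_le_div₀ (by positivity) hMN (by positivity) hMw
    have h3 : 2 * ‖w‖ * ‖w - z‖ / ‖w‖ ^ 2 * ‖z‖ ≤ 2 * ‖w - z‖ := by
      rw [div_mul_eq_mul_div, div_le_iff₀ (by positivity)]
      nlinarith [mul_nonneg hw.le hd0, mul_le_mul_of_nonneg_left hzw (mul_nonneg hw.le hd0)]
    rw [e1]
    calc _ ≤ (2 * ‖w‖ * ‖w - z‖ / ‖w‖ ^ 2 + 1 / 2 * (2 * ‖w‖ * ‖w - z‖ / ‖w‖ ^ 2)) * ‖z‖ :=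
          mul_le_mul_of_nonneg_right ((abs_sub _ _).trans (add_le_add h1 h2)) hz0
      _ ≤ _ := by linarith
  have e1 : coreField e w - coreField e z =
      (truncLog e (Complex.normSq w) : ℂ) * -(starRingEnd ℂ (w - z)) +
      ((truncLog e (Complex.normSq w) - truncLog e (Complex.normSq z) : ℝ) : ℂ) *
        -(starRingEnd ℂ z) -
      (((w.re * w.im / M : ℝ) : ℂ) * (Complex.I * (w - z)) +
      ((w.re * w.im / M - z.re * z.im / N : ℝ) : ℂ) * (Complex.I * z)) := by
    simp only [coreField, map_sub, ← hM, ← hN]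
    push_cast
    ring
  have hkw := abs_div_max_le he w
  rw [← hM] at hkw
  rw [e1]
  refine (norm_sub_le _ _).trans ((add_le_add (norm_add_le _ _) (norm_add_le _ _)).trans ?_)
  simp only [norm_mul, norm_neg, RCLike.norm_conj, Complex.norm_real, Real.norm_eq_abs,
    Complex.norm_I, one_mul]
  have h5 := mul_le_mul_of_nonneg_right hkw hd0
  linarith

/-- The part of the base field that is proportional to `a`. -/
def strainField (z : ℂ) : ℂ :=
  (cutoff (Complex.normSq z) : ℂ) * -(starRingEnd ℂ z) +
    ((2 * deriv cutoff (Complex.normSq z) * (z.re * z.im) : ℝ) : ℂ) * (Complex.I * z)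

/-- The contribution of the cutoff to the base field. -/
def rimField (z : ℂ) : ℂ :=
  ((2 * (deriv cutoff (Complex.normSq z) * (-(1 / 2) * Real.log (Complex.normSq z))) *
    (z.re * z.im) : ℝ) : ℂ) * (Complex.I * z)

theorem baseField_eq {e : ℝ} (he1 : e ≤ 1) (a : ℝ) (z : ℂ) :
    baseField e a z = (cutoff (Complex.normSq z) : ℂ) * coreField e z + (a : ℂ) * strainField z +
      rimField z := by
  have h : deriv cutoff (Complex.normSq z) * truncLog e (Complex.normSq z) =
      deriv cutoff (Complex.normSq z) * (-(1 / 2) * Real.log (Complex.normSq z)) := by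
    rcases le_total (Complex.normSq z) 8 with h8 | h8
    · rw [deriv_cutoff_of_le h8]; ring
    · rw [truncLog_of_le (by linarith)]
  rw [rimField, ← h]
  simp only [baseField, streamFactor, streamFactor', coreField, strainField]
  push_cast
  ring

theorem contDiff_normSq : ContDiff ℝ ∞ fun z : ℂ => Complex.normSq z := by
  have : (fun z : ℂ => Complex.normSq z) = fun z => z.re * z.re + z.im * z.im :=
    funext fun z => Complex.normSq_apply z
  rw [this]
  exact (Complex.reCLM.contDiff.mul Complex.reCLM.contDiff).add
    (Complex.imCLM.contDiff.mul Complex.imCLM.contDiff)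

theorem hasCompactSupport_of_norm_ge {E : Type*} [Zero E] {f : ℂ → E} {R : ℝ}
    (h : ∀ z, R ≤ ‖z‖ → f z = 0) : HasCompactSupport f := by
  refine HasCompactSupport.of_support_subset_isCompact (isCompact_closedBall (0 : ℂ) R) fun z hz => ?_
  by_contra hcon
  rw [mem_closedBall_zero_iff, not_le] at hcon
  exact hz (h z hcon.le)

theorem four_le_normSq {z : ℂ} (hz : 4 ≤ ‖z‖) : 16 ≤ Complex.normSq z := by
  rw [Complex.normSq_eq_norm_sq]; nlinarith

theorem exists_lipschitz_bound {f : ℂ → ℂ} (hf : ContDiff ℝ ∞ f)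
    (h : ∀ z, 4 ≤ ‖z‖ → f z = 0) : ∃ C, 0 ≤ C ∧ (∀ z, ‖f z‖ ≤ C) ∧
      ∀ z w, ‖f w - f z‖ ≤ C * ‖w - z‖ := by
  have hc := hasCompactSupport_of_norm_ge h
  obtain ⟨K, hK⟩ := ContDiff.lipschitzWith_of_hasCompactSupport hc hf (by simp)
  obtain ⟨B, hB⟩ := hc.exists_bound_of_continuous hf.continuous
  refine ⟨max K B, le_max_of_le_left K.2, fun z => (hB z).trans (le_max_right _ _), fun z w => ?_⟩
  have := hK.dist_le_mul w z
  rw [dist_eq_norm, dist_eq_norm] at this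
  exact this.trans (mul_le_mul_of_nonneg_right (le_max_left _ _) (norm_nonneg _))

theorem contDiff_strainField : ContDiff ℝ ∞ strainField := by
  have hre : ContDiff ℝ ∞ fun z : ℂ => z.re := Complex.reCLM.contDiff
  have him : ContDiff ℝ ∞ fun z : ℂ => z.im := Complex.imCLM.contDiff
  have hc : ContDiff ℝ ∞ fun z : ℂ => cutoff (Complex.normSq z) := contDiff_cutoff.comp contDiff_normSq
  have hc' : ContDiff ℝ ∞ fun z : ℂ => deriv cutoff (Complex.normSq z) :=
    contDiff_deriv_cutoff.comp contDiff_normSq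
  exact ((Complex.ofRealCLM.contDiff.comp hc).mul Complex.conjCLE.contDiff.neg).add
    ((Complex.ofRealCLM.contDiff.comp ((contDiff_const.mul hc').mul (hre.mul him))).mul
      (contDiff_const.mul contDiff_id))

theorem contDiff_rimField : ContDiff ℝ ∞ rimField := by
  have hre : ContDiff ℝ ∞ fun z : ℂ => z.re := Complex.reCLM.contDiff
  have him : ContDiff ℝ ∞ fun z : ℂ => z.im := Complex.imCLM.contDiff
  have hl : ContDiff ℝ ∞ fun s : ℝ => deriv cutoff s * (-(1 / 2) * Real.log s) := by
    rw [contDiff_iff_contDiffAt]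
    intro s
    rcases lt_or_ge s 8 with h | h
    · have : (fun s : ℝ => deriv cutoff s * (-(1 / 2) * Real.log s)) =ᶠ[𝓝 s] fun _ => 0 := by
        filter_upwards [Iio_mem_nhds h] with t ht
        rw [deriv_cutoff_of_lt ht, zero_mul]
      exact contDiffAt_const.congr_of_eventuallyEq this
    · exact contDiff_deriv_cutoff.contDiffAt.mul
        (contDiffAt_const.mul (Real.contDiffAt_log.2 (by linarith)))
  have hl' := hl.comp contDiff_normSq
  exact (Complex.ofRealCLM.contDiff.comp ((contDiff_const.mul hl').mul (hre.mul him))).mul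
    (contDiff_const.mul contDiff_id)

/-- Apart from the core the field is smooth with compact support, so the single unbounded quantity
is `truncLog` at the outer point. Estimating that quantity by `e` gives a Lipschitz constant at each
time; estimating it by `‖w - z‖` gives log-Lipschitz continuity uniformly in the truncation. -/
theorem exists_baseField_bound : ∃ C, 0 ≤ C ∧ ∀ e a : ℝ, 0 < e → e ≤ 1 → |a| ≤ 1 →
    (∀ z, ‖baseField e a z‖ ≤ C) ∧
    (∀ z w, ‖z‖ ≤ ‖w‖ → ‖w‖ < 4 → ‖baseField e a w - baseField e a z‖ ≤
      (|truncLog e (Complex.normSq w)| + C) * ‖w - z‖) ∧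
    (∀ z w, ‖z‖ ≤ ‖w‖ → 4 ≤ ‖w‖ → ‖baseField e a w - baseField e a z‖ ≤ C * ‖w - z‖) := by
  obtain ⟨C₁, hC₁, hb₁, hl₁⟩ := exists_lipschitz_bound contDiff_strainField fun z hz => by
    simp [strainField, cutoff_of_ge (four_le_normSq hz), deriv_cutoff_of_ge (four_le_normSq hz)]
  obtain ⟨C₂, hC₂, hb₂, hl₂⟩ := exists_lipschitz_bound contDiff_rimField fun z hz => by
    simp [rimField, deriv_cutoff_of_ge (four_le_normSq hz)]
  obtain ⟨C₃, hC₃, -, hl₃⟩ := exists_lipschitz_bound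
    (f := fun z => (cutoff (Complex.normSq z) : ℂ))
    (Complex.ofRealCLM.contDiff.comp (contDiff_cutoff.comp contDiff_normSq)) fun z hz => by
    simp [cutoff_of_ge (four_le_normSq hz)]
  have hcut : ∀ z : ℂ, ‖(cutoff (Complex.normSq z) : ℂ)‖ ≤ 1 := fun z => by
    rw [Complex.norm_real, Real.norm_eq_abs, abs_of_nonneg (cutoff_nonneg _)]
    exact cutoff_le_one _
  refine ⟨12 + C₁ + C₂ + 12 * C₃, by positivity, fun e a he he1 ha => ?_⟩
  have haz : ∀ z : ℂ, ‖(a : ℂ) * z‖ ≤ ‖z‖ := fun z => by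
    rw [norm_mul, Complex.norm_real, Real.norm_eq_abs]
    exact mul_le_of_le_one_left (norm_nonneg _) ha
  have rest : ∀ z w, ‖((a : ℂ) * strainField w + rimField w) -
      ((a : ℂ) * strainField z + rimField z)‖ ≤ (C₁ + C₂) * ‖w - z‖ := fun z w => by
    rw [show ((a : ℂ) * strainField w + rimField w) - ((a : ℂ) * strainField z + rimField z) =
      (a : ℂ) * (strainField w - strainField z) + (rimField w - rimField z) by ring, add_mul]
    exact (norm_add_le _ _).trans (add_le_add ((haz _).trans (hl₁ _ _)) (hl₂ _ _))
  have split : ∀ z w, ‖z‖ ≤ 4 → ‖baseField e a w - baseField e a z‖ ≤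
      ‖(cutoff (Complex.normSq w) : ℂ) * (coreField e w - coreField e z)‖ +
        (C₁ + C₂ + 12 * C₃) * ‖w - z‖ := fun z w hz => by
    rw [baseField_eq he1, baseField_eq he1, show
      (cutoff (Complex.normSq w) : ℂ) * coreField e w + (a : ℂ) * strainField w + rimField w -
      ((cutoff (Complex.normSq z) : ℂ) * coreField e z + (a : ℂ) * strainField z + rimField z) =
      (cutoff (Complex.normSq w) : ℂ) * (coreField e w - coreField e z) +
      (((cutoff (Complex.normSq w) : ℂ) - cutoff (Complex.normSq z)) * coreField e z +
      (((a : ℂ) * strainField w + rimField w) - ((a : ℂ) * strainField z + rimField z))) by ring]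
    refine (norm_add_le _ _).trans (add_le_add le_rfl ((norm_add_le _ _).trans ?_))
    have h1 := rest z w
    have h2 : ‖((cutoff (Complex.normSq w) : ℂ) - cutoff (Complex.normSq z)) * coreField e z‖ ≤
        C₃ * ‖w - z‖ * 12 := by
      rw [norm_mul]
      exact mul_le_mul (hl₃ z w) (norm_coreField_le he he1 hz) (norm_nonneg _) (by positivity)
    linarith
  refine ⟨fun z => ?_, fun z w hzw hw => ?_, fun z w hzw hw => ?_⟩
  · have h1 : ‖(cutoff (Complex.normSq z) : ℂ) * coreField e z‖ ≤ 12 := by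
      rcases le_or_gt ‖z‖ 4 with h | h
      · rw [norm_mul]
        nlinarith [hcut z, norm_coreField_le he he1 h, norm_nonneg (coreField e z)]
      · simp [cutoff_of_ge (four_le_normSq h.le)]
    rw [baseField_eq he1]
    refine (norm_add_le _ _).trans ((add_le_add (norm_add_le _ _) le_rfl).trans ?_)
    have h2 := (haz (strainField z)).trans (hb₁ z)
    have h3 := hb₂ z
    linarith [mul_nonneg (show (0 : ℝ) ≤ 12 by norm_num) hC₃]
  · refine (split z w (hzw.trans hw.le)).trans ?_
    have h1 : ‖(cutoff (Complex.normSq w) : ℂ) * (coreField e w - coreField e z)‖ ≤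
        (|truncLog e (Complex.normSq w)| + 5) * ‖w - z‖ := by
      rw [norm_mul]
      have h2 := norm_coreField_sub_le he hzw
      have h3 := hcut w
      have h4 := norm_nonneg (coreField e w - coreField e z)
      nlinarith
    nlinarith [norm_nonneg (w - z)]
  · rcases le_or_gt ‖z‖ 4 with h | h
    · refine (split z w h).trans ?_
      rw [cutoff_of_ge (four_le_normSq hw)]
      simp only [Complex.ofReal_zero, zero_mul, norm_zero, zero_add]
      exact mul_le_mul_of_nonneg_right (by linarith) (norm_nonneg _)
    · rw [baseField_eq_zero hw, baseField_eq_zero h.le, sub_zero, norm_zero]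
      positivity

theorem exists_baseField_lipschitz : ∃ C, 0 ≤ C ∧ ∀ e a : ℝ, 0 < e → e ≤ 1 → |a| ≤ 1 → ∀ z w,
    ‖baseField e a w - baseField e a z‖ ≤ (|Real.log e| + C) * ‖w - z‖ := by
  obtain ⟨C, hC, H⟩ := exists_baseField_bound
  refine ⟨C + 2, by positivity, fun e a he he1 ha => ?_⟩
  obtain ⟨-, h2, h3⟩ := H e a he he1 ha
  have key : ∀ z w : ℂ, ‖z‖ ≤ ‖w‖ → ‖baseField e a w - baseField e a z‖ ≤
      (|Real.log e| + (C + 2)) * ‖w - z‖ := fun z w hzw => by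
    have hlog := abs_nonneg (Real.log e)
    rcases lt_or_ge ‖w‖ 4 with h | h
    · refine (h2 z w hzw h).trans (mul_le_mul_of_nonneg_right ?_ (norm_nonneg _))
      have := abs_truncLog_le' he he1 (Complex.normSq_nonneg w)
        (by rw [Complex.normSq_eq_norm_sq]; nlinarith [norm_nonneg w])
      linarith
    · exact (h3 z w hzw h).trans (mul_le_mul_of_nonneg_right (by linarith) (norm_nonneg _))
  intro z w
  rcases le_total ‖z‖ ‖w‖ with h | h
  · exact key z w h
  · rw [norm_sub_rev, norm_sub_rev w]; exact key w z h

/-- If `w` is the outer point then `‖w - z‖ ≤ 2‖w‖`, so the logarithm at `w` is dominated by the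
logarithm of the distance. -/
theorem exists_baseField_logLipschitz : ∃ C, 0 ≤ C ∧ ∀ e a : ℝ, 0 < e → e ≤ 1 → |a| ≤ 1 →
    ∀ z w, ‖baseField e a w - baseField e a z‖ ≤ C * logModulus ‖w - z‖ := by
  obtain ⟨C, hC, H⟩ := exists_baseField_bound
  refine ⟨C + 3, by positivity, fun e a he he1 ha => ?_⟩
  obtain ⟨-, h2, h3⟩ := H e a he he1 ha
  have key : ∀ z w : ℂ, ‖z‖ ≤ ‖w‖ → ‖baseField e a w - baseField e a z‖ ≤
      (C + 3) * logModulus ‖w - z‖ := fun z w hzw => by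
    rcases eq_or_ne w z with rfl | hne
    · simp [logModulus]
    have hd : 0 < ‖w - z‖ := norm_pos_iff.2 (sub_ne_zero.2 hne)
    have hw : 0 < ‖w‖ := by
      by_contra! hcon
      have h1 : w = 0 := norm_le_zero_iff.1 hcon
      have h2 : z = 0 := norm_le_zero_iff.1 (hzw.trans hcon)
      exact hne (h1.trans h2.symm)
    have hlog := abs_nonneg (Real.log ‖w - z‖)
    suffices h : ‖baseField e a w - baseField e a z‖ ≤
        (|Real.log ‖w - z‖| + (C + 3)) * ‖w - z‖ by
      refine h.trans ?_
      rw [logModulus]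
      nlinarith [mul_nonneg hd.le hlog, mul_nonneg hC (mul_nonneg hd.le hlog)]
    rcases lt_or_ge ‖w‖ 4 with h | h
    · refine (h2 z w hzw h).trans (mul_le_mul_of_nonneg_right ?_ (norm_nonneg _))
      have h4 := abs_truncLog_le he he1 (Complex.normSq_pos.2 (norm_pos_iff.1 hw))
      rw [log_normSq, abs_mul, abs_two] at h4
      have h5 : |Real.log ‖w‖| ≤ |Real.log ‖w - z‖| + 2 := by
        rcases le_or_gt ‖w‖ 1 with h1 | h1
        · rw [abs_of_nonpos (Real.log_nonpos hw.le h1)]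
          have h6 : ‖w - z‖ ≤ 2 * ‖w‖ := (norm_sub_le _ _).trans (by linarith)
          have h7 := Real.log_le_log hd h6
          rw [Real.log_mul (by norm_num) hw.ne'] at h7
          have h8 := Real.log_two_lt_d9
          have h9 := neg_abs_le (Real.log ‖w - z‖)
          linarith
        · rw [abs_of_nonneg (Real.log_nonneg h1.le)]
          have := (Real.log_le_log hw h.le).trans log_four_le
          linarith
      linarith
    · exact (h3 z w hzw h).trans (mul_le_mul_of_nonneg_right (by linarith) (norm_nonneg _))
  intro z w
  rcases le_total ‖z‖ ‖w‖ with h | h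
  · exact key z w h
  · rw [norm_sub_rev, norm_sub_rev w]; exact key w z h

/-- The behaviour of the base field near the origin. -/
theorem norm_baseField_add_le {e a : ℝ} (he : 0 < e) (he1 : e ≤ 1) (ha : |a| ≤ 1) {z : ℂ}
    (hz : ‖z‖ ≤ 2) :
    ‖baseField e a z + (truncLog e (Complex.normSq z) : ℂ) * starRingEnd ℂ z‖ ≤ 2 * ‖z‖ := by
  have h8 : Complex.normSq z ≤ 8 := by
    rw [Complex.normSq_eq_norm_sq]; nlinarith [norm_nonneg z]
  have e1 : baseField e a z + (truncLog e (Complex.normSq z) : ℂ) * starRingEnd ℂ z =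
      (coreField e z + (truncLog e (Complex.normSq z) : ℂ) * starRingEnd ℂ z) +
        (a : ℂ) * -(starRingEnd ℂ z) := by
    rw [baseField_eq he1, strainField, rimField, cutoff_of_le h8, deriv_cutoff_of_le h8]
    push_cast
    ring
  rw [e1]
  refine (norm_add_le _ _).trans ?_
  rw [norm_mul, norm_neg, RCLike.norm_conj, Complex.norm_real, Real.norm_eq_abs]
  have := norm_coreField_add_le he z
  nlinarith [norm_nonneg z]

/-! ### Biot–Savart velocities: near and far kernels -/

/-- An integrable majorant of products of two kernels at distance `δ`. -/
def pairKernel (δ r : ℝ) : ℝ := (Iio 1).indicator (fun r => 2 / (r * (r + δ))) r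

theorem pairKernel_nonneg {δ r : ℝ} (hδ : 0 < δ) (hr : 0 ≤ r) : 0 ≤ pairKernel δ r := by
  unfold pairKernel
  exact indicator_apply_nonneg fun _ => by positivity

theorem pow_smul_pairKernel {δ y : ℝ} (hδ : 0 < δ) (hy : 0 < y) :
    y ^ (Module.finrank ℝ ℂ - 1) • pairKernel δ y = (Iio 1).indicator (fun y => 2 / (y + δ)) y := by
  rw [Complex.finrank_real_complex]
  by_cases h : y ∈ Iio (1 : ℝ)
  · simp only [pairKernel, indicator_of_mem h, smul_eq_mul]
    field_simp
    norm_num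
  · simp [pairKernel, indicator_of_notMem h]

theorem continuousOn_two_div {δ : ℝ} (hδ : 0 < δ) :
    ContinuousOn (fun y : ℝ => 2 / (y + δ)) (Icc 0 1) :=
  continuousOn_const.div (by fun_prop) fun y hy => by
    have := hy.1
    positivity

theorem integrable_pairKernel {δ : ℝ} (hδ : 0 < δ) :
    Integrable fun w : ℂ => pairKernel δ ‖w‖ := by
  rw [integrable_fun_norm_addHaar]
  refine (integrableOn_congr_fun (fun y hy => pow_smul_pairKernel hδ hy) measurableSet_Ioi).2 ?_
  have h : IntegrableOn (fun y : ℝ => 2 / (y + δ)) (Iio 1 ∩ Ioi 0) := by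
    refine ((continuousOn_two_div hδ).integrableOn_Icc).mono_set ?_
    rintro y ⟨h1, h2⟩
    exact ⟨le_of_lt h2, le_of_lt h1⟩
  rw [IntegrableOn, ← Measure.restrict_restrict measurableSet_Iio] at h
  exact (integrable_indicator_iff measurableSet_Iio).2 h

theorem integral_pairKernel {δ : ℝ} (hδ : 0 < δ) :
    ∫ w : ℂ, pairKernel δ ‖w‖ = 4 * Real.pi * (Real.log (1 + δ) - Real.log δ) := by
  rw [integral_fun_norm_addHaar, setIntegral_congr_fun measurableSet_Ioi
    (fun y hy => pow_smul_pairKernel hδ hy), setIntegral_indicator measurableSet_Iio,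
    Ioi_inter_Iio, ← integral_Ioc_eq_integral_Ioo, ← intervalIntegral.integral_of_le zero_le_one]
  have h := intervalIntegral.integral_eq_sub_of_hasDerivAt (a := 0) (b := 1)
    (f := fun y => 2 * Real.log (y + δ)) (f' := fun y => 2 / (y + δ)) (fun y hy => by
      rw [uIcc_of_le zero_le_one] at hy
      have h0 : 0 < y + δ := by linarith [hy.1]
      refine (((hasDerivAt_id y).add_const δ).log h0.ne').const_mul 2 |>.congr_deriv ?_
      rw [id, mul_one_div]) ((continuousOn_two_div hδ).intervalIntegrable_of_Icc zero_le_one)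
  rw [h, Complex.finrank_real_complex, Measure.real, Complex.volume_ball]
  simp
  ring

theorem log_one_add_sub_log_le {δ : ℝ} (hδ : 0 < δ) :
    Real.log (1 + δ) - Real.log δ ≤ 1 + |Real.log δ| := by
  have h2 := Real.log_two_lt_d9
  rcases le_total δ 1 with h | h
  · rw [abs_of_nonpos (Real.log_nonpos hδ.le h)]
    have := Real.log_le_log (by linarith) (show 1 + δ ≤ 2 by linarith)
    linarith
  · rw [abs_of_nonneg (Real.log_nonneg h)]
    have h3 := Real.log_le_log (by linarith) (show 1 + δ ≤ 2 * δ by linarith)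
    rw [Real.log_mul (by norm_num) hδ.ne'] at h3
    have := Real.log_nonneg h
    linarith

/-- The Biot–Savart kernel `w^⊥ / |w|²`. -/
def vortexKernel (w : ℂ) : ℂ := ((‖w‖ ^ 2)⁻¹ : ℝ) • (Complex.I * w)

theorem vortexKernel_eq (w : ℂ) : vortexKernel w = Complex.I * (starRingEnd ℂ w)⁻¹ := by
  rcases eq_or_ne w 0 with rfl | h
  · simp [vortexKernel]
  · have h1 : (‖w‖ : ℂ) ^ 2 = w * starRingEnd ℂ w := by
      rw [Complex.mul_conj, Complex.normSq_eq_norm_sq]; push_cast; rfl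
    have h2 : starRingEnd ℂ w ≠ 0 := (map_ne_zero _).2 h
    rw [vortexKernel, Complex.real_smul]
    push_cast
    rw [h1]
    field_simp

theorem norm_vortexKernel (w : ℂ) : ‖vortexKernel w‖ = ‖w‖⁻¹ := by
  rw [vortexKernel_eq, norm_mul, Complex.norm_I, one_mul, norm_inv, RCLike.norm_conj]

theorem norm_vortexKernel_sub {a b : ℂ} (ha : a ≠ 0) (hb : b ≠ 0) :
    ‖vortexKernel a - vortexKernel b‖ = ‖a - b‖ / (‖a‖ * ‖b‖) := by
  have ha' : starRingEnd ℂ a ≠ 0 := (map_ne_zero _).2 ha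
  have hb' : starRingEnd ℂ b ≠ 0 := (map_ne_zero _).2 hb
  rw [vortexKernel_eq, vortexKernel_eq, ← mul_sub, norm_mul, Complex.norm_I, one_mul,
    inv_sub_inv ha' hb', norm_div, norm_mul, ← map_sub, RCLike.norm_conj, RCLike.norm_conj,
    RCLike.norm_conj, norm_sub_rev]

theorem vortexKernel_neg (w : ℂ) : vortexKernel (-w) = -vortexKernel w := by
  simp [vortexKernel]

theorem measurable_vortexKernel : Measurable vortexKernel := by
  unfold vortexKernel
  fun_prop

/-- The long-range part of the kernel. -/
def farKernel (w : ℂ) : ℂ := (1 - cutoff (Complex.normSq w / 12)) • vortexKernel w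

/-- The short-range part of the kernel. -/
def nearKernel (w : ℂ) : ℂ := cutoff (Complex.normSq w / 12) • vortexKernel w

theorem nearKernel_add_farKernel (w : ℂ) : nearKernel w + farKernel w = vortexKernel w := by
  rw [nearKernel, farKernel, ← add_smul, add_sub_cancel, one_smul]

theorem nearKernel_neg (w : ℂ) : nearKernel (-w) = -nearKernel w := by
  simp [nearKernel, vortexKernel_neg]

theorem farKernel_neg (w : ℂ) : farKernel (-w) = -farKernel w := by
  simp [farKernel, vortexKernel_neg]

theorem farKernel_eq_zero {w : ℂ} (h : ‖w‖ ≤ 9) : farKernel w = 0 := by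
  have : Complex.normSq w / 12 ≤ 8 := by
    rw [Complex.normSq_eq_norm_sq]; nlinarith [norm_nonneg w]
  simp [farKernel, cutoff_of_le this]

theorem nearKernel_eq_zero {w : ℂ} (h : 14 ≤ ‖w‖) : nearKernel w = 0 := by
  have : 16 ≤ Complex.normSq w / 12 := by
    rw [Complex.normSq_eq_norm_sq]; nlinarith
  simp [nearKernel, cutoff_of_ge this]

theorem measurable_farKernel : Measurable farKernel := by
  unfold farKernel
  have := contDiff_cutoff.continuous.measurable
  have := measurable_vortexKernel
  have := Complex.continuous_normSq.measurable
  fun_prop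

theorem measurable_nearKernel : Measurable nearKernel := by
  unfold nearKernel
  have := contDiff_cutoff.continuous.measurable
  have := measurable_vortexKernel
  have := Complex.continuous_normSq.measurable
  fun_prop

theorem norm_farKernel_le (w : ℂ) : ‖farKernel w‖ ≤ 1 := by
  rcases le_or_gt ‖w‖ 9 with h | h
  · simp [farKernel_eq_zero h]
  · rw [farKernel, norm_smul, norm_vortexKernel, Real.norm_eq_abs]
    have h1 := cutoff_nonneg (Complex.normSq w / 12)
    have h2 := cutoff_le_one (Complex.normSq w / 12)
    rw [abs_of_nonneg (by linarith)]
    have h3 : ‖w‖⁻¹ ≤ 1 := inv_le_one_of_one_le₀ (by linarith)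
    exact mul_le_one₀ (by linarith) (by positivity) h3

theorem norm_nearKernel_le (w : ℂ) : ‖nearKernel w‖ ≤ ‖w‖⁻¹ := by
  rw [nearKernel, norm_smul, norm_vortexKernel, Real.norm_eq_abs, abs_of_nonneg (cutoff_nonneg _)]
  exact mul_le_of_le_one_left (by positivity) (cutoff_le_one _)

theorem exists_farKernel_lipschitz : ∃ C, 0 ≤ C ∧ ∀ a b : ℂ,
    ‖farKernel b - farKernel a‖ ≤ C * ‖b - a‖ := by
  have hs : HasCompactSupport fun w : ℂ => cutoff (Complex.normSq w / 12) :=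
    hasCompactSupport_of_norm_ge (R := 14) fun w h => cutoff_of_ge (by
      rw [Complex.normSq_eq_norm_sq]; nlinarith)
  have hd : ContDiff ℝ ∞ fun w : ℂ => cutoff (Complex.normSq w / 12) :=
    contDiff_cutoff.comp (contDiff_normSq.div_const 12)
  obtain ⟨L, hL⟩ := ContDiff.lipschitzWith_of_hasCompactSupport hs hd (by simp)
  have hL' : ∀ a b : ℂ, |cutoff (Complex.normSq a / 12) - cutoff (Complex.normSq b / 12)| ≤
      L * ‖b - a‖ := fun a b => by
    have := hL.dist_le_mul a b
    rwa [Real.dist_eq, dist_eq_norm, norm_sub_rev] at this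
  have key : ∀ a b : ℂ, ‖a‖ ≤ ‖b‖ → ‖farKernel b - farKernel a‖ ≤ (L + 1) * ‖b - a‖ := by
    intro a b hab
    rcases le_or_gt ‖b‖ 9 with hb | hb
    · rw [farKernel_eq_zero hb, farKernel_eq_zero (hab.trans hb), sub_zero, norm_zero]
      positivity
    · have hb0 : b ≠ 0 := norm_pos_iff.1 (by linarith)
      have e : farKernel b - farKernel a =
          (1 - cutoff (Complex.normSq a / 12)) • (vortexKernel b - vortexKernel a) +
          (cutoff (Complex.normSq a / 12) - cutoff (Complex.normSq b / 12)) • vortexKernel b := by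
        simp only [farKernel, sub_smul, smul_sub]; abel
      have h1 : ‖(1 - cutoff (Complex.normSq a / 12)) • (vortexKernel b - vortexKernel a)‖ ≤
          1 * ‖b - a‖ := by
        rcases le_or_gt ‖a‖ 9 with ha | ha
        · have : Complex.normSq a / 12 ≤ 8 := by
            rw [Complex.normSq_eq_norm_sq]; nlinarith [norm_nonneg a]
          rw [cutoff_of_le this, sub_self, zero_smul, norm_zero]
          positivity
        · have ha0 : a ≠ 0 := norm_pos_iff.1 (by linarith)
          have h1 := cutoff_nonneg (Complex.normSq a / 12)
          have h2 := cutoff_le_one (Complex.normSq a / 12)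
          rw [norm_smul, norm_vortexKernel_sub hb0 ha0, Real.norm_eq_abs,
            abs_of_nonneg (by linarith)]
          refine mul_le_mul (by linarith) (div_le_self (norm_nonneg _) ?_) (by positivity) one_pos.le
          nlinarith
      have h2 : ‖(cutoff (Complex.normSq a / 12) - cutoff (Complex.normSq b / 12)) •
          vortexKernel b‖ ≤ L * ‖b - a‖ := by
        rw [norm_smul, norm_vortexKernel, Real.norm_eq_abs]
        have h3 : ‖b‖⁻¹ ≤ 1 := inv_le_one_of_one_le₀ (by linarith)
        calc _ ≤ L * ‖b - a‖ * 1 := mul_le_mul (hL' a b) h3 (by positivity) (by positivity)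
          _ = _ := mul_one _
      rw [e]
      exact (norm_add_le _ _).trans (by linarith)
  refine ⟨L + 1, by positivity, fun a b => ?_⟩
  rcases le_total ‖a‖ ‖b‖ with h | h
  · exact key a b h
  · rw [norm_sub_rev, norm_sub_rev b]; exact key b a h

/-- Bounded measurable vorticities supported in the ball of radius `4`. -/
structure IsVorticity (θ : ℂ → ℝ) : Prop where
  measurable : Measurable θ
  abs_le : ∀ z, |θ z| ≤ 2
  eq_zero : ∀ z, 4 < ‖z‖ → θ z = 0

/-- The velocity generated by the vorticity `θ` through the kernel `k`. -/
def kernelVelocity (k : ℂ → ℂ) (θ : ℂ → ℝ) (z : ℂ) : ℂ := (1 / 2 : ℝ) • ∫ ξ : ℂ, θ ξ • k (z - ξ)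

theorem eulerVelocity_eq (θ : ℂ → ℝ) : eulerVelocity θ = kernelVelocity vortexKernel θ := by
  funext z
  simp only [eulerVelocity, kernelVelocity, vortexKernel, smul_smul, div_eq_mul_inv]

theorem kernelVelocity_neg {k : ℂ → ℂ} (hk : ∀ w, k (-w) = -k w) {θ : ℂ → ℝ}
    (hθ : ∀ w, θ (-w) = θ w) (z : ℂ) : kernelVelocity k θ (-z) = -kernelVelocity k θ z := by
  rw [kernelVelocity, kernelVelocity, ← smul_neg, ← integral_neg,
    ← integral_neg_eq_self (fun ξ => θ ξ • k (-z - ξ))]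
  congr 2
  funext ξ
  rw [hθ, show -z - -ξ = -(z - ξ) by ring, hk, smul_neg]

/-- The indicator of the ball of radius `4`. -/
def ballIndicator (ξ : ℂ) : ℝ := (Metric.closedBall (0 : ℂ) 4).indicator (fun _ => 1) ξ

theorem ballIndicator_nonneg (ξ : ℂ) : 0 ≤ ballIndicator ξ :=
  indicator_nonneg (fun _ _ => zero_le_one) _

theorem integrable_ballIndicator : Integrable ballIndicator :=
  (integrable_indicator_iff measurableSet_closedBall).2
    (integrableOn_const (measure_closedBall_lt_top.ne))

theorem IsVorticity.abs_le_ballIndicator {θ : ℂ → ℝ} (hθ : IsVorticity θ) (ξ : ℂ) :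
    |θ ξ| ≤ 2 * ballIndicator ξ := by
  unfold ballIndicator
  by_cases h : ξ ∈ Metric.closedBall (0 : ℂ) 4
  · rw [indicator_of_mem h, mul_one]; exact hθ.abs_le ξ
  · rw [indicator_of_notMem h, hθ.eq_zero ξ (by simpa using h)]; simp

theorem integrable_pairKernel_sub {δ : ℝ} (hδ : 0 < δ) (z : ℂ) :
    Integrable fun ξ : ℂ => pairKernel δ ‖z - ξ‖ :=
  (integrable_pairKernel hδ).comp_sub_left z

theorem integral_pairKernel_sub (δ : ℝ) (z : ℂ) :
    ∫ ξ : ℂ, pairKernel δ ‖z - ξ‖ = ∫ w : ℂ, pairKernel δ ‖w‖ :=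
  integral_sub_left_eq_self (fun w : ℂ => pairKernel δ ‖w‖) volume z

theorem inv_le_pairKernel {r : ℝ} (hr : 0 ≤ r) : r⁻¹ ≤ pairKernel 1 r + 1 := by
  rcases hr.eq_or_lt with rfl | h0
  · have := pairKernel_nonneg one_pos (le_refl (0 : ℝ))
    simp only [inv_zero]; linarith
  rcases lt_or_ge r 1 with h | h
  · have h1 : r⁻¹ ≤ 2 / (r * (r + 1)) := by
      rw [inv_eq_one_div, div_le_div_iff₀ h0 (by positivity)]; nlinarith
    rw [pairKernel, indicator_of_mem (show r ∈ Iio (1 : ℝ) from h)]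
    linarith
  · rw [pairKernel, indicator_of_notMem (by simpa using h)]
    have := inv_le_one_of_one_le₀ h
    linarith

/-- For `a ≤ b` the condition `a + b ≥ 2δ` gives `b ≥ (a + δ)/2`. The product is thus bounded by a
kernel in the smaller radius alone, whose integral is of order `log(1/δ)` for small `δ`. -/
theorem inv_mul_le_pairKernel {δ a b : ℝ} (hδ : 0 < δ) (ha : 0 < a) (hb : 0 < b)
    (hab : 2 * δ ≤ a + b) : (a * b)⁻¹ ≤ pairKernel δ a + pairKernel δ b + 2 := by
  have key : ∀ a b : ℝ, 0 < a → 0 < b → 2 * δ ≤ a + b → a ≤ b →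
      (a * b)⁻¹ ≤ pairKernel δ a + pairKernel δ b + 2 := by
    intro a b ha hb hab hle
    have hb' := pairKernel_nonneg hδ hb.le
    have h1 : (a * b)⁻¹ ≤ 2 / (a * (a + δ)) := by
      rw [inv_eq_one_div, div_le_div_iff₀ (by positivity) (by positivity)]
      nlinarith
    rcases lt_or_ge a 1 with h | h
    · rw [pairKernel, indicator_of_mem (show a ∈ Iio (1 : ℝ) from h)]
      linarith
    · have ha' := pairKernel_nonneg hδ ha.le
      have : 2 / (a * (a + δ)) ≤ 2 := div_le_self (by norm_num) (by nlinarith)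
      linarith
  rcases le_total a b with h | h
  · exact key a b ha hb hab h
  · rw [mul_comm, add_comm (pairKernel δ a)]
    exact key b a hb ha (by linarith) h

theorem IsVorticity.norm_smul_le {θ : ℂ → ℝ} (hθ : IsVorticity θ) {k : ℂ → ℂ}
    (hkb : ∀ w, ‖k w‖ ≤ ‖w‖⁻¹ + 1) (z ξ : ℂ) :
    ‖θ ξ • k (z - ξ)‖ ≤ 2 * (pairKernel 1 ‖z - ξ‖) + 4 * ballIndicator ξ := by
  rw [norm_smul, Real.norm_eq_abs]
  have h1 := hθ.abs_le_ballIndicator ξ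
  have h2 := (hkb (z - ξ)).trans (add_le_add_left (inv_le_pairKernel (norm_nonneg (z - ξ))) 1)
  have h3 := pairKernel_nonneg one_pos (norm_nonneg (z - ξ))
  have h4 : ballIndicator ξ ≤ 1 := indicator_le_self' (by simp) ξ |>.trans le_rfl
  have h5 := ballIndicator_nonneg ξ
  calc |θ ξ| * ‖k (z - ξ)‖ ≤ (2 * ballIndicator ξ) * (pairKernel 1 ‖z - ξ‖ + 1 + 1) :=
        mul_le_mul h1 h2 (norm_nonneg _) (by positivity)
    _ ≤ _ := by nlinarith

theorem IsVorticity.integrable_smul {θ : ℂ → ℝ} (hθ : IsVorticity θ) {k : ℂ → ℂ}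
    (hk : Measurable k) (hkb : ∀ w, ‖k w‖ ≤ ‖w‖⁻¹ + 1) (z : ℂ) :
    Integrable fun ξ => θ ξ • k (z - ξ) := by
  have hb : Integrable fun ξ : ℂ => 2 * (pairKernel 1 ‖z - ξ‖) + 4 * ballIndicator ξ :=
    ((integrable_pairKernel_sub one_pos z).const_mul 2).add (integrable_ballIndicator.const_mul 4)
  refine hb.mono' ?_ (ae_of_all _ fun ξ => ?_)
  · exact (hθ.measurable.smul (hk.comp (measurable_const.sub measurable_id))).aestronglyMeasurable
  · exact hθ.norm_smul_le hkb z ξ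

theorem IsVorticity.norm_kernelVelocity_le {k : ℂ → ℂ}
    (hkb : ∀ w, ‖k w‖ ≤ ‖w‖⁻¹ + 1) : ∃ C, 0 ≤ C ∧ ∀ θ : ℂ → ℝ, IsVorticity θ → ∀ z,
      ‖kernelVelocity k θ z‖ ≤ C := by
  refine ⟨(∫ w : ℂ, pairKernel 1 ‖w‖) + 2 * ∫ w, ballIndicator w, ?_, fun θ hθ z => ?_⟩
  · have h1 : 0 ≤ ∫ w : ℂ, pairKernel 1 ‖w‖ :=
      integral_nonneg fun w => pairKernel_nonneg one_pos (norm_nonneg w)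
    have h2 : 0 ≤ ∫ w, ballIndicator w := integral_nonneg ballIndicator_nonneg
    positivity
  · have hb : Integrable fun ξ : ℂ => 2 * (pairKernel 1 ‖z - ξ‖) + 4 * ballIndicator ξ :=
      ((integrable_pairKernel_sub one_pos z).const_mul 2).add (integrable_ballIndicator.const_mul 4)
    have h := norm_integral_le_of_norm_le hb (f := fun ξ => θ ξ • k (z - ξ))
      (ae_of_all _ fun ξ => hθ.norm_smul_le hkb z ξ)
    rw [integral_add ((integrable_pairKernel_sub one_pos z).const_mul 2)
      (integrable_ballIndicator.const_mul 4), integral_const_mul, integral_const_mul,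
      integral_pairKernel_sub] at h
    rw [kernelVelocity, norm_smul, show ‖(1 / 2 : ℝ)‖ = 1 / 2 by norm_num]
    linarith

/-- The kernel is conjugate to `1/w`, so its difference is exactly `|a - b|/(|a||b|)`. Integrating
with `pairKernel` at `δ = ‖w - z‖/2` produces one logarithm of the distance. -/
theorem exists_kernelVelocity_logLipschitz : ∃ C, 0 ≤ C ∧ ∀ θ : ℂ → ℝ, IsVorticity θ →
    ∀ z w, ‖kernelVelocity vortexKernel θ w - kernelVelocity vortexKernel θ z‖ ≤
      C * logModulus ‖w - z‖ := by
  have hvk : ∀ w, ‖vortexKernel w‖ ≤ ‖w‖⁻¹ + 1 := fun w => by rw [norm_vortexKernel]; linarith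
  have hB0 : 0 ≤ ∫ w, ballIndicator w := integral_nonneg ballIndicator_nonneg
  refine ⟨2 * (8 * Real.pi) * 2 + 2 * ∫ w, ballIndicator w, by positivity, fun θ hθ z w => ?_⟩
  rcases eq_or_ne w z with rfl | hne
  · simp [logModulus]
  have hd : 0 < ‖w - z‖ := norm_pos_iff.2 (sub_ne_zero.2 hne)
  set δ := ‖w - z‖ / 2 with hδ
  have hδ0 : 0 < δ := by positivity
  have hb : Integrable fun ξ : ℂ => ‖w - z‖ * (2 * (pairKernel δ ‖w - ξ‖) +
      2 * (pairKernel δ ‖z - ξ‖) + 4 * ballIndicator ξ) :=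
    ((((integrable_pairKernel_sub hδ0 w).const_mul 2).add
      ((integrable_pairKernel_sub hδ0 z).const_mul 2)).add
      (integrable_ballIndicator.const_mul 4)).const_mul _
  have hnull : ∀ᵐ ξ : ℂ, ξ ≠ w ∧ ξ ≠ z := by
    have h1 : ∀ x : ℂ, ∀ᵐ ξ : ℂ, ξ ≠ x := fun x => by
      simp [ae_iff]
    exact (h1 w).and (h1 z)
  have h := norm_integral_le_of_norm_le hb
    (f := fun ξ => θ ξ • vortexKernel (w - ξ) - θ ξ • vortexKernel (z - ξ)) (by
      filter_upwards [hnull] with ξ hξ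
      have hw0 : w - ξ ≠ 0 := sub_ne_zero.2 hξ.1.symm
      have hz0 : z - ξ ≠ 0 := sub_ne_zero.2 hξ.2.symm
      rw [← smul_sub, norm_smul, Real.norm_eq_abs, norm_vortexKernel_sub hw0 hz0,
        show w - ξ - (z - ξ) = w - z by ring, div_eq_mul_inv]
      have h1 := hθ.abs_le_ballIndicator ξ
      have h2 := inv_mul_le_pairKernel hδ0 (norm_pos_iff.2 hw0) (norm_pos_iff.2 hz0) (by
        have := norm_sub_le (w - ξ) (z - ξ)
        rw [show w - ξ - (z - ξ) = w - z by ring] at this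
        rw [hδ]; linarith)
      have h3 := pairKernel_nonneg hδ0 (norm_nonneg (w - ξ))
      have h3' := pairKernel_nonneg hδ0 (norm_nonneg (z - ξ))
      have h4 : ballIndicator ξ ≤ 1 := indicator_le_self' (by simp) ξ |>.trans le_rfl
      have h5 := ballIndicator_nonneg ξ
      calc |θ ξ| * (‖w - z‖ * (‖w - ξ‖ * ‖z - ξ‖)⁻¹)
          = ‖w - z‖ * (|θ ξ| * (‖w - ξ‖ * ‖z - ξ‖)⁻¹) := by ring
        _ ≤ ‖w - z‖ * ((2 * ballIndicator ξ) *
            (pairKernel δ ‖w - ξ‖ + pairKernel δ ‖z - ξ‖ + 2)) := by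
          refine mul_le_mul_of_nonneg_left (mul_le_mul h1 h2 (by positivity) (by positivity)) hd.le
        _ ≤ _ := by
          refine mul_le_mul_of_nonneg_left ?_ hd.le
          nlinarith)
  have hi : Integrable fun ξ : ℂ => 2 * (pairKernel δ ‖w - ξ‖) + 2 * (pairKernel δ ‖z - ξ‖) :=
    ((integrable_pairKernel_sub hδ0 w).const_mul 2).add
      ((integrable_pairKernel_sub hδ0 z).const_mul 2)
  rw [integral_sub (hθ.integrable_smul measurable_vortexKernel hvk w)
    (hθ.integrable_smul measurable_vortexKernel hvk z), integral_const_mul,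
    integral_add hi (integrable_ballIndicator.const_mul 4),
    integral_add ((integrable_pairKernel_sub hδ0 w).const_mul 2)
      ((integrable_pairKernel_sub hδ0 z).const_mul 2), integral_const_mul, integral_const_mul,
    integral_const_mul, integral_pairKernel_sub, integral_pairKernel_sub,
    integral_pairKernel hδ0] at h
  rw [kernelVelocity, kernelVelocity, ← smul_sub, norm_smul,
    show ‖(1 / 2 : ℝ)‖ = 1 / 2 by norm_num]
  have hl := log_one_add_sub_log_le hδ0
  have hlδ : |Real.log δ| ≤ |Real.log ‖w - z‖| + 1 := by
    rw [hδ, Real.log_div hd.ne' (by norm_num)]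
    have h2 := Real.log_two_lt_d9
    have h3 := Real.log_two_gt_d9
    refine (abs_sub _ _).trans ?_
    rw [abs_of_pos (show 0 < Real.log 2 by linarith)]
    linarith
  have hpi := Real.pi_pos
  have hlog := abs_nonneg (Real.log ‖w - z‖)
  rw [logModulus]
  have h6 : Real.pi * (Real.log (1 + δ) - Real.log δ) ≤ Real.pi * (2 * (1 + |Real.log ‖w - z‖|)) :=
    mul_le_mul_of_nonneg_left (by linarith) hpi.le
  have h7 : (2 * (4 * Real.pi * (Real.log (1 + δ) - Real.log δ)) +
      2 * (4 * Real.pi * (Real.log (1 + δ) - Real.log δ)) + 4 * ∫ w, ballIndicator w) ≤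
      2 * ((2 * (8 * Real.pi) * 2 + 2 * ∫ w, ballIndicator w) * (1 + |Real.log ‖w - z‖|)) := by
    nlinarith [mul_nonneg hB0 hlog, mul_nonneg hpi.le hlog]
  have h8 := h.trans (mul_le_mul_of_nonneg_left h7 hd.le)
  linarith

theorem exists_farVelocity_lipschitz : ∃ C, 0 ≤ C ∧ ∀ θ : ℂ → ℝ, IsVorticity θ →
    ∀ z w, ‖kernelVelocity farKernel θ w - kernelVelocity farKernel θ z‖ ≤ C * ‖w - z‖ := by
  obtain ⟨L, hL0, hL⟩ := exists_farKernel_lipschitz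
  have hB0 : 0 ≤ ∫ w, ballIndicator w := integral_nonneg ballIndicator_nonneg
  have hk : ∀ w, ‖farKernel w‖ ≤ ‖w‖⁻¹ + 1 := fun w => by
    have : 0 ≤ ‖w‖⁻¹ := by positivity
    linarith [norm_farKernel_le w]
  refine ⟨L * ∫ w, ballIndicator w, by positivity, fun θ hθ z w => ?_⟩
  have h := norm_integral_le_of_norm_le (integrable_ballIndicator.const_mul (2 * (L * ‖w - z‖)))
    (f := fun ξ => θ ξ • farKernel (w - ξ) - θ ξ • farKernel (z - ξ)) (ae_of_all _ fun ξ => by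
      rw [← smul_sub, norm_smul, Real.norm_eq_abs]
      have h1 := hθ.abs_le_ballIndicator ξ
      have h2 := hL (z - ξ) (w - ξ)
      rw [show w - ξ - (z - ξ) = w - z by ring] at h2
      have h5 := ballIndicator_nonneg ξ
      calc _ ≤ (2 * ballIndicator ξ) * (L * ‖w - z‖) :=
            mul_le_mul h1 h2 (norm_nonneg _) (by positivity)
        _ = _ := by ring)
  rw [integral_sub (hθ.integrable_smul measurable_farKernel hk w)
    (hθ.integrable_smul measurable_farKernel hk z), integral_const_mul] at h
  rw [kernelVelocity, kernelVelocity, ← smul_sub, norm_smul,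
    show ‖(1 / 2 : ℝ)‖ = 1 / 2 by norm_num]
  linarith

theorem IsVorticity.farVelocity_eq_zero {θ : ℂ → ℝ} (hθ : IsVorticity θ) {z : ℂ} (hz : ‖z‖ ≤ 5) :
    kernelVelocity farKernel θ z = 0 := by
  have : ∀ ξ, θ ξ • farKernel (z - ξ) = 0 := fun ξ => by
    rcases le_or_gt ‖ξ‖ 4 with h | h
    · rw [farKernel_eq_zero ((norm_sub_le _ _).trans (by linarith)), smul_zero]
    · rw [hθ.eq_zero ξ h, zero_smul]
  simp [kernelVelocity, this]

theorem IsVorticity.nearVelocity_eq_zero {θ : ℂ → ℝ} (hθ : IsVorticity θ) {z : ℂ}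
    (hz : 18 ≤ ‖z‖) : kernelVelocity nearKernel θ z = 0 := by
  have : ∀ ξ, θ ξ • nearKernel (z - ξ) = 0 := fun ξ => by
    rcases le_or_gt ‖ξ‖ 4 with h | h
    · rw [nearKernel_eq_zero, smul_zero]
      have := norm_sub_norm_le z ξ
      linarith
    · rw [hθ.eq_zero ξ h, zero_smul]
  simp [kernelVelocity, this]

theorem norm_nearKernel_le' (w : ℂ) : ‖nearKernel w‖ ≤ ‖w‖⁻¹ + 1 :=
  (norm_nearKernel_le w).trans (by linarith)

theorem norm_farKernel_le' (w : ℂ) : ‖farKernel w‖ ≤ ‖w‖⁻¹ + 1 := by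
  have : 0 ≤ ‖w‖⁻¹ := by positivity
  linarith [norm_farKernel_le w]

theorem IsVorticity.near_add_far {θ : ℂ → ℝ} (hθ : IsVorticity θ) (z : ℂ) :
    kernelVelocity nearKernel θ z + kernelVelocity farKernel θ z =
      kernelVelocity vortexKernel θ z := by
  rw [kernelVelocity, kernelVelocity, kernelVelocity, ← smul_add,
    ← integral_add (hθ.integrable_smul measurable_nearKernel norm_nearKernel_le' z)
      (hθ.integrable_smul measurable_farKernel norm_farKernel_le' z)]
  congr 2
  funext ξ
  rw [← smul_add, nearKernel_add_farKernel]

theorem exists_nearVelocity_logLipschitz : ∃ C, 0 ≤ C ∧ ∀ θ : ℂ → ℝ, IsVorticity θ →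
    ∀ z w, ‖kernelVelocity nearKernel θ w - kernelVelocity nearKernel θ z‖ ≤
      C * logModulus ‖w - z‖ := by
  obtain ⟨C₁, hC₁, h₁⟩ := exists_kernelVelocity_logLipschitz
  obtain ⟨C₂, hC₂, h₂⟩ := exists_farVelocity_lipschitz
  refine ⟨C₁ + C₂, by positivity, fun θ hθ z w => ?_⟩
  have e : kernelVelocity nearKernel θ w - kernelVelocity nearKernel θ z =
      (kernelVelocity vortexKernel θ w - kernelVelocity vortexKernel θ z) -
      (kernelVelocity farKernel θ w - kernelVelocity farKernel θ z) := by
    rw [← hθ.near_add_far, ← hθ.near_add_far]; ring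
  rw [e, add_mul]
  exact (norm_sub_le _ _).trans (add_le_add (h₁ θ hθ z w) ((h₂ θ hθ z w).trans
    (mul_le_mul_of_nonneg_left (le_logModulus (norm_nonneg _)) hC₂)))

/-! ### Incompressibility of the near velocity -/

theorem nearKernel_polar {r : ℝ} (hr : 0 < r) (t : ℝ) :
    nearKernel (r * (Real.cos t + Real.sin t * Complex.I)) =
      (cutoff (r ^ 2 / 12) * (r ^ 2)⁻¹) • (Complex.I * (r * (Real.cos t + Real.sin t * Complex.I))) := by
  have h : ‖(r * (Real.cos t + Real.sin t * Complex.I) : ℂ)‖ = r := by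
    rw [← Complex.polarCoord_symm_apply (r, t), Complex.norm_polarCoord_symm, abs_of_pos hr]
  rw [nearKernel, vortexKernel, Complex.normSq_eq_norm_sq, h, smul_smul]

theorem continuous_polar (r : ℝ) :
    Continuous fun t : ℝ => (r * (Real.cos t + Real.sin t * Complex.I) : ℂ) := by fun_prop

theorem hasDerivAt_polar (r t : ℝ) :
    HasDerivAt (fun t : ℝ => (r * (Real.cos t + Real.sin t * Complex.I) : ℂ))
      (Complex.I * (r * (Real.cos t + Real.sin t * Complex.I))) t := by
  have h1 := (Real.hasDerivAt_cos t).ofReal_comp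
  have h2 := ((Real.hasDerivAt_sin t).ofReal_comp).mul_const Complex.I
  refine ((h1.add h2).const_mul (r : ℂ)).congr_deriv ?_
  push_cast
  linear_combination (-(r : ℂ) * Complex.sin t) * Complex.I_mul_I

theorem integral_circle_fderiv {φ : ℂ → ℝ} (hφ : ContDiff ℝ ∞ φ) (ξ : ℂ) (r : ℝ) :
    ∫ t in Ioo (-Real.pi) Real.pi, fderiv ℝ φ (ξ + r * (Real.cos t + Real.sin t * Complex.I))
      (Complex.I * (r * (Real.cos t + Real.sin t * Complex.I))) = 0 := by
  rw [← integral_Ioc_eq_integral_Ioo,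
    ← intervalIntegral.integral_of_le (by linarith [Real.pi_pos])]
  have hd : ∀ t : ℝ, HasDerivAt
      (fun t : ℝ => φ (ξ + r * (Real.cos t + Real.sin t * Complex.I)))
      (fderiv ℝ φ (ξ + r * (Real.cos t + Real.sin t * Complex.I))
        (Complex.I * (r * (Real.cos t + Real.sin t * Complex.I)))) t := fun t =>
    ((hφ.differentiable (by simp)).differentiableAt.hasFDerivAt).comp_hasDerivAt t
      ((hasDerivAt_polar r t).const_add ξ)
  have hcont : Continuous fun t : ℝ =>
      fderiv ℝ φ (ξ + r * (Real.cos t + Real.sin t * Complex.I))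
        (Complex.I * (r * (Real.cos t + Real.sin t * Complex.I))) :=
    (hφ.continuous_fderiv_apply (by simp)).comp
      ((continuous_const.add (continuous_polar r)).prodMk
        (continuous_const.mul (continuous_polar r)))
  rw [intervalIntegral.integral_eq_sub_of_hasDerivAt (fun t _ => hd t)
    (hcont.intervalIntegrable _ _)]
  simp

theorem exists_fderiv_bound {φ : ℂ → ℝ} (hφ : ContDiff ℝ ∞ φ) (hc : HasCompactSupport φ) :
    ∃ M, ∀ z, ‖fderiv ℝ φ z‖ ≤ M :=
  (hφ.continuous_fderiv (by simp)).bounded_above_of_compact_support (hc.fderiv ℝ)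

/-- The near kernel is tangent to the circles about the origin with amplitude depending only on the
radius. On each circle the integrand is a constant times the derivative of `φ` along the closed
curve and integrates to zero. Polar coordinates also show integrability, as the Jacobian cancels
`1/r`. -/
theorem integral_fderiv_nearKernel {φ : ℂ → ℝ} (hφ : ContDiff ℝ ∞ φ) (hc : HasCompactSupport φ)
    (ξ : ℂ) : ∫ w : ℂ, fderiv ℝ φ (ξ + w) (nearKernel w) = 0 := by
  obtain ⟨M, hM⟩ := exists_fderiv_bound hφ hc
  have hM0 : 0 ≤ M := (norm_nonneg _).trans (hM 0)
  have hint : IntegrableOn (fun p : ℝ × ℝ => p.1 • fderiv ℝ φ (ξ + Complex.polarCoord.symm p)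
      (nearKernel (Complex.polarCoord.symm p))) (Ioi 0 ×ˢ Ioo (-Real.pi) Real.pi)
      (volume.prod volume) := by
    have h1 : IntegrableOn (fun p : ℝ × ℝ => p.1 • fderiv ℝ φ (ξ + Complex.polarCoord.symm p)
        (nearKernel (Complex.polarCoord.symm p))) (Ioc 0 14 ×ˢ Ioo (-Real.pi) Real.pi)
        (volume.prod volume) := by
      refine Measure.integrableOn_of_bounded (M := M) ?_ ?_ ?_
      · rw [Measure.prod_prod]
        simp [ENNReal.mul_eq_top]
      · have hp : Measurable fun p : ℝ × ℝ => Complex.polarCoord.symm p := by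
          simp only [Complex.polarCoord_symm_apply]
          fun_prop
        exact (measurable_fst.smul ((hφ.continuous_fderiv_apply (by simp)).measurable.comp
          ((measurable_const.add hp).prodMk (measurable_nearKernel.comp hp)))).aestronglyMeasurable
      · refine ae_restrict_of_forall_mem (measurableSet_Ioc.prod measurableSet_Ioo) fun p hp => ?_
        have hp0 : 0 < p.1 := hp.1.1
        rw [norm_smul, Real.norm_eq_abs, abs_of_pos hp0]
        have h2 := (fderiv ℝ φ (ξ + Complex.polarCoord.symm p)).le_opNorm
          (nearKernel (Complex.polarCoord.symm p))
        have h3 := norm_nearKernel_le (Complex.polarCoord.symm p)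
        rw [Complex.norm_polarCoord_symm, abs_of_pos hp0] at h3
        have h4 := h2.trans (mul_le_mul (hM _) h3 (norm_nonneg _) hM0)
        calc _ ≤ p.1 * (M * p.1⁻¹) := mul_le_mul_of_nonneg_left h4 hp0.le
          _ = M := by field_simp
    refine h1.of_forall_sdiff_eq_zero (measurableSet_Ioi.prod measurableSet_Ioo) fun p hp => ?_
    have hp0 : 0 < p.1 := hp.1.1
    have hp1 : 14 < p.1 := by
      by_contra! hcon
      exact hp.2 ⟨⟨hp0, hcon⟩, hp.1.2⟩
    rw [nearKernel_eq_zero (by rw [Complex.norm_polarCoord_symm, abs_of_pos hp0]; exact hp1.le),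
      map_zero, smul_zero]
  rw [← Complex.integral_comp_polarCoord_symm, polarCoord_target, Measure.volume_eq_prod,
    setIntegral_prod _ hint]
  refine setIntegral_eq_zero_of_forall_eq_zero fun r hr => ?_
  have hr0 : 0 < r := hr
  simp only [Complex.polarCoord_symm_apply, nearKernel_polar hr0, map_smul, smul_smul]
  rw [integral_smul, integral_circle_fderiv hφ, smul_zero]

theorem integrable_nearKernel : Integrable nearKernel := by
  have h : Integrable fun w : ℂ => pairKernel 1 ‖w‖ +
      (Metric.closedBall (0 : ℂ) 14).indicator (fun _ => (1 : ℝ)) w :=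
    (integrable_pairKernel one_pos).add ((integrable_indicator_iff measurableSet_closedBall).2
      (integrableOn_const measure_closedBall_lt_top.ne))
  refine h.mono' measurable_nearKernel.aestronglyMeasurable (ae_of_all _ fun w => ?_)
  have h0 := pairKernel_nonneg one_pos (norm_nonneg w)
  by_cases hw : w ∈ Metric.closedBall (0 : ℂ) 14
  · rw [indicator_of_mem hw]
    exact (norm_nearKernel_le w).trans (inv_le_pairKernel (norm_nonneg w))
  · rw [nearKernel_eq_zero (by
      rw [mem_closedBall_zero_iff] at hw
      linarith), norm_zero, indicator_of_notMem hw]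
    linarith

theorem IsVorticity.integrable {θ : ℂ → ℝ} (hθ : IsVorticity θ) : Integrable θ :=
  (integrable_ballIndicator.const_mul 2).mono' hθ.measurable.aestronglyMeasurable
    (ae_of_all _ fun ξ => hθ.abs_le_ballIndicator ξ)

theorem IsVorticity.isIncompressible_nearVelocity {θ : ℂ → ℝ} (hθ : IsVorticity θ) :
    IsIncompressible (kernelVelocity nearKernel θ) := by
  intro φ hφ hc
  obtain ⟨M, hM⟩ := exists_fderiv_bound hφ hc
  have h1 : ∀ z, fderiv ℝ φ z (kernelVelocity nearKernel θ z) =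
      (1 / 2) * ∫ ξ, θ ξ * fderiv ℝ φ z (nearKernel (z - ξ)) := fun z => by
    rw [kernelVelocity, map_smul, ← ContinuousLinearMap.integral_comp_comm _
      (hθ.integrable_smul measurable_nearKernel norm_nearKernel_le' z)]
    simp only [map_smul, smul_eq_mul]
  have hI : Integrable (fun p : ℂ × ℂ => θ p.2 • nearKernel (p.1 - p.2)) (volume.prod volume) :=
    hθ.integrable.convolution_integrand (ContinuousLinearMap.lsmul ℝ ℝ) integrable_nearKernel
  have hI2 : Integrable (Function.uncurry fun z ξ : ℂ => θ ξ * fderiv ℝ φ z (nearKernel (z - ξ)))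
      (volume.prod volume) := by
    refine (hI.norm.const_mul M).mono' ?_ (ae_of_all _ fun p => ?_)
    · exact ((hθ.measurable.comp measurable_snd).mul
        ((hφ.continuous_fderiv_apply (by simp)).measurable.comp (measurable_fst.prodMk
          (measurable_nearKernel.comp (measurable_fst.sub measurable_snd))))).aestronglyMeasurable
    · have h2 := ((fderiv ℝ φ p.1).le_opNorm (nearKernel (p.1 - p.2))).trans
        (mul_le_mul_of_nonneg_right (hM _) (norm_nonneg _))
      rw [Function.uncurry, norm_mul, norm_smul]
      calc _ ≤ ‖θ p.2‖ * (M * ‖nearKernel (p.1 - p.2)‖) :=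
            mul_le_mul_of_nonneg_left h2 (norm_nonneg _)
        _ = _ := by ring
  simp only [h1]
  rw [integral_const_mul, integral_integral_swap hI2]
  have h3 : ∀ ξ, ∫ z, θ ξ * fderiv ℝ φ z (nearKernel (z - ξ)) = 0 := fun ξ => by
    rw [integral_const_mul, ← integral_add_left_eq_self _ ξ]
    simp only [add_sub_cancel_left]
    rw [integral_fderiv_nearKernel hφ hc, mul_zero]
  simp [h3]

/-! ### Continuity in time of the velocity of a transported patch -/

theorem volume_eq_zero_of_dimH_lt {s : Set ℂ} (h : dimH s < 2) : volume s = 0 := by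
  have h2 : ((2 : ℝ≥0) : ℝ) = Module.finrank ℝ ℂ := by
    rw [Complex.finrank_real_complex]; norm_num
  have h3 : (Measure.hausdorffMeasure ((2 : ℝ≥0) : ℝ) : Measure ℂ).IsAddHaarMeasure := by
    rw [h2]; exact isAddHaarMeasure_hausdorffMeasure
  exact measure_zero_of_dimH_lt (Measure.absolutelyContinuous_isAddHaarMeasure _ _) h

theorem IsSmoothPatch.volume_image_frontier {A : Set ℂ} (hA : IsSmoothPatch A) {f : ℂ → ℂ}
    {K : ℝ≥0} (hf : LipschitzWith K f) : volume (f '' frontier A) = 0 := by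
  obtain ⟨γ, hγ, -, -, -, hγ'⟩ := hA.smooth_boundary
  refine volume_eq_zero_of_dimH_lt ((hf.dimH_image_le _).trans_lt ?_)
  rw [hγ']
  refine (hγ.of_le (by simp)).dimH_range_le.trans_lt ?_
  rw [Module.finrank_self]
  norm_num

/-- The homeomorphisms `Z t` are the flow of the field `v`. -/
structure IsFlow (v : ℝ → ℂ → ℂ) (Z : ℝ → ℂ ≃ₜ ℂ) : Prop where
  initial : ∀ z, Z 0 z = z
  trajectory : ∀ T z, IsTrajectory v T (fun s => Z s z)

theorem IsFlow.exists_lipschitzWith {v : ℝ → ℂ → ℂ} {Z : ℝ → ℂ ≃ₜ ℂ} (h : IsFlow v Z)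
    (hv : IsFlowField v) {t : ℝ} (ht : 0 ≤ t) : ∃ K, LipschitzWith K (Z t) := by
  obtain ⟨K, hK⟩ := hv.lip t
  refine ⟨⟨Real.exp (K * t), (Real.exp_pos _).le⟩, LipschitzWith.of_dist_le_mul fun z w => ?_⟩
  have := (h.trajectory t z).dist_le hK (h.trajectory t w) ⟨ht, le_rfl⟩
  rw [h.initial, h.initial] at this
  exact this.trans_eq (mul_comm _ _)

/-- The points `(Z s)⁻¹ξ` and `p = (Z t)⁻¹ξ` are carried to `ξ` and `Z s p` at time `s`. Backward
Grönwall bounds their distance by a locally uniform multiple of `|ξ - Z s p|`, which tends to `0`.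
-/
theorem IsFlow.continuousWithinAt_symm {v : ℝ → ℂ → ℂ} {Z : ℝ → ℂ ≃ₜ ℂ} (h : IsFlow v Z)
    (hv : IsFlowField v) {t : ℝ} (ht : 0 ≤ t) (ξ : ℂ) :
    ContinuousWithinAt (fun s => (Z s).symm ξ) (Ici 0) t := by
  obtain ⟨K, hK⟩ := hv.lip (t + 1)
  set p := (Z t).symm ξ with hp
  have h1 : Tendsto (fun s => dist ξ (Z s p) * Real.exp (K * (t + 1))) (𝓝[Ici 0] t) (𝓝 0) := by
    have h2 : ContinuousWithinAt (fun s => Z s p) (Ici 0) t :=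
      ((h.trajectory (t + 1) p).continuousOn t ⟨ht, by linarith⟩).mono_of_mem_nhdsWithin
        (inter_mem self_mem_nhdsWithin (mem_nhdsWithin_of_mem_nhds (Iic_mem_nhds (by linarith))))
    have h3 := ((tendsto_const_nhds (x := ξ)).dist h2.tendsto).mul_const (Real.exp (K * (t + 1)))
    rwa [hp, Homeomorph.apply_symm_apply, dist_self, zero_mul] at h3
  rw [ContinuousWithinAt, tendsto_iff_dist_tendsto_zero]
  refine squeeze_zero' (Eventually.of_forall fun _ => dist_nonneg) ?_ h1
  filter_upwards [self_mem_nhdsWithin, mem_nhdsWithin_of_mem_nhds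
    (Iic_mem_nhds (show t < t + 1 by linarith))] with s hs hs1
  have hs0 : (0 : ℝ) ≤ s := hs
  have := (h.trajectory s ((Z s).symm ξ)).dist_le_reverse
    (fun u hu => hK u ⟨hu.1, hu.2.trans hs1⟩) (h.trajectory s p) (t := 0) ⟨le_rfl, hs0⟩
  rw [h.initial, h.initial, Homeomorph.apply_symm_apply, sub_zero] at this
  refine this.trans (mul_le_mul_of_nonneg_left (Real.exp_le_exp.2 ?_) dist_nonneg)
  exact mul_le_mul_of_nonneg_left hs1 K.2

theorem IsFlow.eventually_mem_iff {v : ℝ → ℂ → ℂ} {Z : ℝ → ℂ ≃ₜ ℂ} (h : IsFlow v Z)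
    (hv : IsFlowField v) {A : Set ℂ} {t : ℝ} (ht : 0 ≤ t) {ξ : ℂ} (hξ : ξ ∉ Z t '' frontier A) :
    ∀ᶠ s in 𝓝[Ici 0] t, (ξ ∈ Z s '' A ↔ ξ ∈ Z t '' A) := by
  have himg : ∀ s (B : Set ℂ), ξ ∈ Z s '' B ↔ (Z s).symm ξ ∈ B := fun s B => by
    rw [Homeomorph.image_eq_preimage_symm, mem_preimage]
  simp only [himg] at hξ ⊢
  have hc := h.continuousWithinAt_symm hv ht ξ
  by_cases hm : (Z t).symm ξ ∈ A
  · have hi : (Z t).symm ξ ∈ interior A := by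
      by_contra hcon
      exact hξ ⟨subset_closure hm, hcon⟩
    filter_upwards [hc (isOpen_interior.mem_nhds hi)] with s hs
    exact ⟨fun _ => hm, fun _ => interior_subset hs⟩
  · have hi : (Z t).symm ξ ∈ (closure A)ᶜ := fun hcon => hξ ⟨hcon, fun h' => hm (interior_subset h')⟩
    filter_upwards [hc (isClosed_closure.isOpen_compl.mem_nhds hi)] with s hs
    exact ⟨fun h' => absurd (subset_closure h') hs, fun h' => absurd h' hm⟩

theorem mem_centralReflection {A : Set ℂ} {z : ℂ} : z ∈ centralReflection A ↔ -z ∈ A := by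
  refine ⟨?_, fun h => ⟨-z, h, neg_neg z⟩⟩
  rintro ⟨w, hw, rfl⟩
  simpa using hw

theorem pairVorticity_apply (A : Set ℂ) (z : ℂ) : pairVorticity A z =
    A.indicator (fun _ => 1) z + A.indicator (fun _ => 1) (-z) := by
  rw [pairVorticity]
  congr 1
  by_cases h : -z ∈ A
  · rw [indicator_of_mem h, indicator_of_mem (mem_centralReflection.2 h)]
  · rw [indicator_of_notMem h, indicator_of_notMem (fun h' => h (mem_centralReflection.1 h'))]

theorem pairVorticity_neg (A : Set ℂ) (z : ℂ) : pairVorticity A (-z) = pairVorticity A z := by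
  rw [pairVorticity_apply, pairVorticity_apply, neg_neg, add_comm]

theorem pairVorticity_congr {A B : Set ℂ} {z : ℂ} (h : z ∈ A ↔ z ∈ B) (h' : -z ∈ A ↔ -z ∈ B) :
    pairVorticity A z = pairVorticity B z := by
  have key : ∀ w, (w ∈ A ↔ w ∈ B) →
      A.indicator (fun _ => (1 : ℝ)) w = B.indicator (fun _ => 1) w := fun w hw => by
    by_cases hA : w ∈ A
    · rw [indicator_of_mem hA, indicator_of_mem (hw.1 hA)]
    · rw [indicator_of_notMem hA, indicator_of_notMem (fun h' => hA (hw.2 h'))]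
  rw [pairVorticity_apply, pairVorticity_apply, key z h, key (-z) h']

theorem isVorticity_pairVorticity {A : Set ℂ} (hA : MeasurableSet A)
    (hA4 : ∀ z ∈ A, ‖z‖ ≤ 4) : IsVorticity (pairVorticity A) where
  measurable := by
    have h1 : Measurable (A.indicator fun _ => (1 : ℝ)) := measurable_const.indicator hA
    have h2 : pairVorticity A = fun z => A.indicator (fun _ => 1) z + A.indicator (fun _ => 1) (-z) :=
      funext (pairVorticity_apply A)
    rw [h2]
    exact h1.add (h1.comp measurable_neg)
  abs_le z := by
    rw [pairVorticity_apply]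
    have h1 : ∀ w, 0 ≤ A.indicator (fun _ => (1 : ℝ)) w ∧ A.indicator (fun _ => (1 : ℝ)) w ≤ 1 :=
      fun w => ⟨indicator_nonneg (fun _ _ => zero_le_one) w, indicator_le_self' (by simp) w⟩
    rw [abs_of_nonneg (add_nonneg (h1 z).1 (h1 (-z)).1)]
    linarith [(h1 z).2, (h1 (-z)).2]
  eq_zero z hz := by
    rw [pairVorticity_apply, indicator_of_notMem (fun h => by linarith [hA4 z h]),
      indicator_of_notMem (fun h => by have := hA4 _ h; rw [norm_neg] at this; linarith), add_zero]

/-- Dominated convergence: away from the image of the patch boundary and its reflection, the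
vorticity at a fixed point is locally constant in time. Those images are null, being Lipschitz
images of a smooth curve. -/
theorem IsFlow.continuousOn_kernelVelocity {v : ℝ → ℂ → ℂ} {Z : ℝ → ℂ ≃ₜ ℂ} (h : IsFlow v Z)
    (hv : IsFlowField v) {A : Set ℂ} (hA : IsSmoothPatch A) (hA4 : ∀ t, 0 ≤ t → ∀ z ∈ Z t '' A, ‖z‖ ≤ 4)
    {k : ℂ → ℂ} (hk : Measurable k) (hkb : ∀ w, ‖k w‖ ≤ ‖w‖⁻¹ + 1) (z : ℂ) :
    ContinuousOn (fun t => kernelVelocity k (pairVorticity (Z t '' A)) z) (Ici 0) := by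
  have hθ : ∀ t, 0 ≤ t → IsVorticity (pairVorticity (Z t '' A)) := fun t ht =>
    isVorticity_pairVorticity ((Z t).isOpenMap _ hA.isOpen).measurableSet (hA4 t ht)
  intro t ht
  have ht0 : (0 : ℝ) ≤ t := ht
  have hb : Integrable fun ξ : ℂ => 2 * (pairKernel 1 ‖z - ξ‖) + 4 * ballIndicator ξ :=
    ((integrable_pairKernel_sub one_pos z).const_mul 2).add (integrable_ballIndicator.const_mul 4)
  suffices hs : ContinuousWithinAt
      (fun t => ∫ ξ : ℂ, pairVorticity (Z t '' A) ξ • k (z - ξ)) (Ici 0) t from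
    Tendsto.const_smul (c := (1 / 2 : ℝ)) hs
  refine continuousWithinAt_of_dominated (bound := fun ξ : ℂ =>
    2 * (pairKernel 1 ‖z - ξ‖) + 4 * ballIndicator ξ) ?_ ?_ hb ?_
  · filter_upwards [self_mem_nhdsWithin] with s hs
    exact ((hθ s hs).integrable_smul hk hkb z).aestronglyMeasurable
  · filter_upwards [self_mem_nhdsWithin] with s hs
    exact ae_of_all _ fun ξ => (hθ s hs).norm_smul_le hkb z ξ
  · obtain ⟨K, hK⟩ := h.exists_lipschitzWith hv ht0
    have hnull := hA.volume_image_frontier hK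
    have hnull' : volume (Neg.neg ⁻¹' (Z t '' frontier A)) = 0 := by
      rw [Measure.measure_preimage_neg, hnull]
    filter_upwards [compl_mem_ae_iff.2 hnull, compl_mem_ae_iff.2 hnull'] with ξ h1 h2
    have hev : ∀ᶠ s in 𝓝[Ici 0] t, pairVorticity (Z t '' A) ξ • k (z - ξ) =
        pairVorticity (Z s '' A) ξ • k (z - ξ) := by
      filter_upwards [h.eventually_mem_iff hv ht0 h1, h.eventually_mem_iff hv ht0 h2] with s h3 h4
      rw [pairVorticity_congr h3 h4]
    exact tendsto_const_nhds.congr' hev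

/-! ### The velocity of a pair of patches near the origin -/

/-- The open first quadrant. -/
def quadrant : Set ℂ := {z | 0 < z.re ∧ 0 < z.im}

theorem isOpen_quadrant : IsOpen quadrant :=
  (isOpen_lt continuous_const Complex.continuous_re).inter
    (isOpen_lt continuous_const Complex.continuous_im)

theorem polar_mem_quadrant_iff {r t : ℝ} (hr : 0 < r) (ht : t ∈ Ioo (-Real.pi) Real.pi) :
    (r * (Real.cos t + Real.sin t * Complex.I) : ℂ) ∈ quadrant ↔ t ∈ Ioo 0 (Real.pi / 2) := by
  have hre : (r * (Real.cos t + Real.sin t * Complex.I) : ℂ).re = r * Real.cos t := by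
    simp [Complex.cos_ofReal_re]
  have him : (r * (Real.cos t + Real.sin t * Complex.I) : ℂ).im = r * Real.sin t := by
    simp [Complex.sin_ofReal_re]
  have hpi := Real.pi_pos
  rw [quadrant, mem_ofPred_eq, hre, him, mul_pos_iff_of_pos_left hr, mul_pos_iff_of_pos_left hr]
  constructor
  · rintro ⟨hc, hs⟩
    have h0 : 0 < t := by
      by_contra! hcon
      linarith [Real.sin_nonpos_of_nonpos_of_neg_pi_le hcon ht.1.le]
    refine ⟨h0, ?_⟩
    by_contra! hcon
    linarith [Real.cos_nonpos_of_pi_div_two_le_of_le hcon (by linarith [ht.2])]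
  · rintro ⟨h1, h2⟩
    exact ⟨Real.cos_pos_of_mem_Ioo ⟨by linarith, h2⟩, Real.sin_pos_of_pos_of_lt_pi h1 ht.2⟩

theorem norm_polar {r : ℝ} (hr : 0 < r) (t : ℝ) :
    ‖(r * (Real.cos t + Real.sin t * Complex.I) : ℂ)‖ = r := by
  rw [← Complex.polarCoord_symm_apply (r, t), Complex.norm_polarCoord_symm, abs_of_pos hr]

theorem integral_exp_two_mul_I :
    ∫ t in Ioo (0 : ℝ) (Real.pi / 2), Complex.exp (2 * Complex.I * t) = Complex.I := by
  rw [← integral_Ioc_eq_integral_Ioo,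
    ← intervalIntegral.integral_of_le (by linarith [Real.pi_pos]),
    integral_exp_mul_complex (by simp)]
  have h1 : 2 * Complex.I * ((Real.pi / 2 : ℝ) : ℂ) = Real.pi * Complex.I := by push_cast; ring
  rw [h1, Complex.exp_pi_mul_I]
  simp
  field_simp
  linear_combination (-2 : ℂ) * Complex.I_mul_I

theorem integral_inv_Ioo {m R : ℝ} (hm : 0 < m) (h : m ≤ R) :
    ∫ r in Ioo m R, ((r⁻¹ : ℝ) : ℂ) = (Real.log (R / m) : ℝ) := by
  rw [integral_complex_ofReal, ← integral_Ioc_eq_integral_Ioo,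
    ← intervalIntegral.integral_of_le h, integral_inv_of_pos hm (hm.trans_le h)]

/-- In polar coordinates the integrand becomes `r⁻¹ e^{2it}`. The angular integral over a quarter
circle is `i`, not zero; this is the source of the logarithmic strain. -/
theorem integral_quadrant_annulus {m R : ℝ} (hm : 0 < m) (h : m ≤ R) :
    ∫ ξ : ℂ, (quadrant ∩ {ξ | m < ‖ξ‖ ∧ ‖ξ‖ < R}).indicator
      (fun ξ => ((starRingEnd ℂ ξ) ^ 2)⁻¹) ξ = Complex.I * (Real.log (R / m) : ℝ) := by
  rw [← Complex.integral_comp_polarCoord_symm, polarCoord_target, Measure.volume_eq_prod]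
  have h1 : ∀ p ∈ Ioi (0 : ℝ) ×ˢ Ioo (-Real.pi) Real.pi,
      p.1 • (quadrant ∩ {ξ | m < ‖ξ‖ ∧ ‖ξ‖ < R}).indicator
        (fun ξ => ((starRingEnd ℂ ξ) ^ 2)⁻¹) (Complex.polarCoord.symm p) =
      (Ioo m R).indicator (fun r => ((r⁻¹ : ℝ) : ℂ)) p.1 *
        (Ioo 0 (Real.pi / 2)).indicator (fun t => Complex.exp (2 * Complex.I * t)) p.2 := by
    rintro ⟨r, t⟩ ⟨hr, ht⟩
    simp only at hr ht
    have hr0 : 0 < r := hr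
    rw [Complex.polarCoord_symm_apply]
    simp only
    by_cases hm1 : r ∈ Ioo m R
    · by_cases ht1 : t ∈ Ioo 0 (Real.pi / 2)
      · rw [indicator_of_mem hm1, indicator_of_mem ht1, indicator_of_mem]
        · have e1 : (Real.cos t + Real.sin t * Complex.I : ℂ) = Complex.exp (t * Complex.I) := by
            rw [Complex.exp_mul_I]; push_cast; rfl
          have e2 : starRingEnd ℂ (t * Complex.I) = -(t * Complex.I) := by simp
          rw [e1, map_mul, Complex.conj_ofReal, ← Complex.exp_conj, e2, mul_pow, mul_inv,
            ← Complex.exp_nat_mul, ← Complex.exp_neg, Complex.real_smul]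
          have hrc : (r : ℂ) ≠ 0 := by exact_mod_cast hr0.ne'
          push_cast
          rw [show -(2 * -(t * Complex.I)) = 2 * Complex.I * t by ring]
          field_simp
        · exact ⟨(polar_mem_quadrant_iff hr0 ht).2 ht1, by
            simp only [mem_ofPred_eq, norm_polar hr0]; exact hm1⟩
      · rw [indicator_of_notMem ht1, indicator_of_notMem, smul_zero, mul_zero]
        exact fun hc => ht1 ((polar_mem_quadrant_iff hr0 ht).1 hc.1)
    · rw [indicator_of_notMem hm1, indicator_of_notMem, smul_zero, zero_mul]
      intro hc
      have := hc.2
      simp only [mem_ofPred_eq, norm_polar hr0] at this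
      exact hm1 this
  rw [setIntegral_congr_fun (measurableSet_Ioi.prod measurableSet_Ioo) h1,
    setIntegral_prod_mul, setIntegral_indicator measurableSet_Ioo,
    setIntegral_indicator measurableSet_Ioo, inter_eq_right.2, inter_eq_right.2,
    integral_inv_Ioo hm h, integral_exp_two_mul_I, mul_comm]
  · exact Ioo_subset_Ioo (by linarith [Real.pi_pos]) (by linarith [Real.pi_pos])
  · exact fun r hr => hm.trans hr.1

theorem integrable_norm_inv_closedBall {R : ℝ} (hR : 0 ≤ R) :
    Integrable (fun w : ℂ => (Iic R).indicator (fun r => r⁻¹) ‖w‖) ∧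
      ∫ w : ℂ, (Iic R).indicator (fun r => r⁻¹) ‖w‖ = 2 * Real.pi * R := by
  have h1 : ∀ y ∈ Ioi (0 : ℝ), y ^ (Module.finrank ℝ ℂ - 1) • (Iic R).indicator (fun r => r⁻¹) y =
      (Iic R).indicator (fun _ => (1 : ℝ)) y := fun y hy => by
    have hy0 : (0 : ℝ) < y := hy
    rw [Complex.finrank_real_complex]
    by_cases h : y ∈ Iic R
    · rw [indicator_of_mem h, indicator_of_mem h, smul_eq_mul, show 2 - 1 = 1 from rfl, pow_one,
        mul_inv_cancel₀ hy0.ne']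
    · rw [indicator_of_notMem h, indicator_of_notMem h, smul_zero]
  constructor
  · rw [integrable_fun_norm_addHaar]
    refine (integrableOn_congr_fun h1 measurableSet_Ioi).2 ?_
    have h : IntegrableOn (fun _ : ℝ => (1 : ℝ)) (Iic R ∩ Ioi 0) := by
      rw [inter_comm, Ioi_inter_Iic]
      exact integrableOn_const (by simp)
    rw [IntegrableOn, ← Measure.restrict_restrict measurableSet_Iic] at h
    exact (integrable_indicator_iff measurableSet_Iic).2 h
  · rw [integral_fun_norm_addHaar, setIntegral_congr_fun measurableSet_Ioi h1,
      setIntegral_indicator measurableSet_Iic, Ioi_inter_Iic]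
    simp [hR, Measure.real, Complex.volume_ball, Complex.finrank_real_complex]
    ring

theorem integrable_norm_pow_compl_closedBall {R : ℝ} (hR : 0 < R) :
    Integrable (fun w : ℂ => (Ioi R).indicator (fun r => (r ^ 4)⁻¹) ‖w‖) ∧
      ∫ w : ℂ, (Ioi R).indicator (fun r => (r ^ 4)⁻¹) ‖w‖ = Real.pi / R ^ 2 := by
  have h1 : ∀ y ∈ Ioi (0 : ℝ),
      y ^ (Module.finrank ℝ ℂ - 1) • (Ioi R).indicator (fun r => (r ^ 4)⁻¹) y =
      (Ioi R).indicator (fun r => r ^ (-3 : ℝ)) y := fun y hy => by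
    have hy0 : (0 : ℝ) < y := hy
    rw [Complex.finrank_real_complex]
    by_cases h : y ∈ Ioi R
    · rw [indicator_of_mem h, indicator_of_mem h, smul_eq_mul, Real.rpow_neg hy0.le,
        show (3 : ℝ) = ((3 : ℕ) : ℝ) by norm_num, Real.rpow_natCast]
      field_simp
      norm_num
    · rw [indicator_of_notMem h, indicator_of_notMem h, smul_zero]
  constructor
  · rw [integrable_fun_norm_addHaar]
    refine (integrableOn_congr_fun h1 measurableSet_Ioi).2 ?_
    have h : IntegrableOn (fun r : ℝ => r ^ (-3 : ℝ)) (Ioi R ∩ Ioi 0) := by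
      rw [inter_eq_left.2 (Ioi_subset_Ioi hR.le)]
      exact integrableOn_Ioi_rpow_of_lt (by norm_num) hR
    rw [IntegrableOn, ← Measure.restrict_restrict measurableSet_Ioi] at h
    exact (integrable_indicator_iff measurableSet_Ioi).2 h
  · rw [integral_fun_norm_addHaar, setIntegral_congr_fun measurableSet_Ioi h1,
      setIntegral_indicator measurableSet_Ioi, inter_eq_right.2 (Ioi_subset_Ioi hR.le),
      integral_Ioi_rpow_of_lt (by norm_num) hR]
    have h2 : R ^ ((-3 : ℝ) + 1) = (R ^ 2)⁻¹ := by
      rw [show (-3 : ℝ) + 1 = -((2 : ℕ) : ℝ) by norm_num, Real.rpow_neg hR.le, Real.rpow_natCast]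
    rw [h2]
    simp [Measure.real, Complex.volume_ball, Complex.finrank_real_complex]
    field_simp
    norm_num

theorem min_le_sin_two_mul {t : ℝ} (h0 : 0 < t) (h1 : t < Real.pi / 2) :
    min t (Real.pi / 2 - t) ≤ Real.sin (2 * t) := by
  have hpi := Real.pi_pos
  have hpi4 := Real.pi_lt_four
  have key : ∀ u, 0 ≤ u → u ≤ Real.pi / 2 → u / 2 ≤ Real.sin u := fun u hu0 hu1 => by
    refine le_trans ?_ (Real.mul_le_sin hu0 hu1)
    rw [div_eq_mul_inv, mul_comm]
    refine mul_le_mul_of_nonneg_right ?_ hu0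
    rw [inv_eq_one_div, div_le_div_iff₀ (by norm_num) hpi]
    linarith
  rcases le_total (2 * t) (Real.pi / 2) with h | h
  · have := key (2 * t) (by linarith) h
    exact (min_le_left _ _).trans (by linarith)
  · have := key (Real.pi - 2 * t) (by linarith) (by linarith)
    rw [Real.sin_pi_sub] at this
    exact (min_le_right _ _).trans (by linarith)

/-- An integrable angular weight that dominates the indicator of thin sectors along the axes. -/
def angularWeight (t : ℝ) : ℝ :=
  (Ioo 0 (Real.pi / 2)).indicator
    (fun t => t ^ (-(1 / 2) : ℝ) + (Real.pi / 2 - t) ^ (-(1 / 2) : ℝ)) t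

theorem integrable_angularWeight : Integrable angularWeight := by
  have h1 : IntervalIntegrable (fun t : ℝ => t ^ (-(1 / 2) : ℝ)) volume 0 (Real.pi / 2) :=
    intervalIntegral.intervalIntegrable_rpow' (by norm_num)
  have h2 := (h1.comp_sub_left (Real.pi / 2)).symm
  rw [sub_zero, sub_self] at h2
  have h3 := h1.add h2
  rw [intervalIntegrable_iff_integrableOn_Ioo_of_le (by linarith [Real.pi_pos])] at h3
  exact (integrable_indicator_iff measurableSet_Ioo).2 h3

/-- The radial weight used to measure thin sets between the radii `ε` and `1`. -/
def radialWeight (ε r : ℝ) : ℝ :=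
  ε ^ (1 / 8 : ℝ) * (Ioi ε).indicator (fun r => r ^ (-(9 / 8) : ℝ)) r +
    (Ioo 0 1).indicator (fun r => r ^ (-(1 / 2) : ℝ)) r

theorem integrable_radialWeight {ε : ℝ} (hε : 0 < ε) : IntegrableOn (radialWeight ε) (Ioi 0) ∧
    ∫ r in Ioi 0, radialWeight ε r = 8 + ∫ r in Ioo (0 : ℝ) 1, r ^ (-(1 / 2) : ℝ) := by
  have h1 : IntegrableOn (fun r : ℝ => r ^ (-(9 / 8) : ℝ)) (Ioi ε) :=
    integrableOn_Ioi_rpow_of_lt (by norm_num) hε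
  have h2 : IntegrableOn (fun r : ℝ => r ^ (-(1 / 2) : ℝ)) (Ioo 0 1) := by
    rw [← intervalIntegrable_iff_integrableOn_Ioo_of_le zero_le_one]
    exact intervalIntegral.intervalIntegrable_rpow' (by norm_num)
  have h3 : IntegrableOn (fun r => ε ^ (1 / 8 : ℝ) * (Ioi ε).indicator
      (fun r => r ^ (-(9 / 8) : ℝ)) r) (Ioi 0) :=
    (((integrable_indicator_iff measurableSet_Ioi).2 h1).const_mul _).integrableOn
  have h4 : IntegrableOn ((Ioo (0 : ℝ) 1).indicator (fun r => r ^ (-(1 / 2) : ℝ))) (Ioi 0) :=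
    ((integrable_indicator_iff measurableSet_Ioo).2 h2).integrableOn
  refine ⟨h3.add h4, ?_⟩
  simp only [radialWeight]
  rw [integral_add h3 h4, integral_const_mul, setIntegral_indicator measurableSet_Ioi,
    setIntegral_indicator measurableSet_Ioo, inter_eq_right.2 (Ioi_subset_Ioi hε.le),
    inter_eq_right.2 Ioo_subset_Ioi_self, integral_Ioi_rpow_of_lt (by norm_num) hε,
    show -(9 / 8 : ℝ) + 1 = -(1 / 8) by norm_num, Real.rpow_neg hε.le]
  have := Real.rpow_pos_of_pos hε (1 / 8)
  congr 1
  field_simp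

/-- If `m` is the angular distance to the nearer axis, then `m ≤ sin 2t ≤` the bound, so `1 ≤
(bound/m)^{1/2}`. The indicator of a thin sector is thus dominated by a product of a radial and an
angular function; the exponents `1/4` and `1` are halved, while `m^{-1/2}` stays integrable. -/
theorem one_le_of_sin_le {C ε r t : ℝ} (hC : 1 ≤ C) (hε : 0 < ε) (hr : 0 < r)
    (ht : t ∈ Ioo 0 (Real.pi / 2)) (h : Real.sin (2 * t) ≤ C * ((ε / r) ^ (1 / 4 : ℝ) + r)) :
    1 ≤ C * (((ε / r) ^ (1 / 8 : ℝ) + r ^ (1 / 2 : ℝ)) * angularWeight t) := by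
  obtain ⟨h0, h1⟩ := ht
  have hq : 0 < ε / r := by positivity
  have h2 := (min_le_sin_two_mul h0 h1).trans h
  set m := min t (Real.pi / 2 - t) with hm
  have hm0 : 0 < m := lt_min h0 (by linarith)
  have hw : m ^ (-(1 / 2) : ℝ) ≤ angularWeight t := by
    rw [angularWeight, indicator_of_mem (show t ∈ Ioo 0 (Real.pi / 2) from ⟨h0, h1⟩)]
    have e1 := Real.rpow_nonneg h0.le (-(1 / 2) : ℝ)
    have e2 := Real.rpow_nonneg (show 0 ≤ Real.pi / 2 - t by linarith) (-(1 / 2) : ℝ)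
    rcases min_choice t (Real.pi / 2 - t) with h' | h' <;> rw [hm, h'] <;> linarith
  have e8 := Real.rpow_pos_of_pos hq (1 / 8 : ℝ)
  have e2 := Real.rpow_pos_of_pos hr (1 / 2 : ℝ)
  have hsq : C * ((ε / r) ^ (1 / 4 : ℝ) + r) ≤ (C * ((ε / r) ^ (1 / 8 : ℝ) + r ^ (1 / 2 : ℝ))) ^ 2 := by
    have f1 : (ε / r) ^ (1 / 4 : ℝ) = ((ε / r) ^ (1 / 8 : ℝ)) ^ 2 := by
      rw [← Real.rpow_natCast, ← Real.rpow_mul hq.le]; norm_num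
    have f2 : r = (r ^ (1 / 2 : ℝ)) ^ 2 := by
      rw [← Real.rpow_natCast, ← Real.rpow_mul hr.le]; norm_num
    rw [f1]
    nth_rewrite 2 [f2]
    rw [mul_pow]
    have : C ≤ C ^ 2 := by nlinarith
    refine mul_le_mul this ?_ (by positivity) (by positivity)
    nlinarith
  have h3 : m ^ (1 / 2 : ℝ) ≤ C * ((ε / r) ^ (1 / 8 : ℝ) + r ^ (1 / 2 : ℝ)) := by
    rw [← Real.sqrt_eq_rpow]
    exact Real.sqrt_le_iff.2 ⟨by positivity, h2.trans hsq⟩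
  have h4 : m ^ (1 / 2 : ℝ) * m ^ (-(1 / 2) : ℝ) = 1 := by
    rw [← Real.rpow_add hm0]; norm_num
  calc 1 = m ^ (1 / 2 : ℝ) * m ^ (-(1 / 2) : ℝ) := h4.symm
    _ ≤ C * ((ε / r) ^ (1 / 8 : ℝ) + r ^ (1 / 2 : ℝ)) * angularWeight t :=
      mul_le_mul h3 hw (Real.rpow_nonneg hm0.le _) (by positivity)
    _ = _ := mul_assoc _ _ _

/-- Thin sets along the axes of the first quadrant carry a bounded amount of the kernel `|ξ|⁻²`. -/
theorem exists_thin_integral_bound (C : ℝ) (hC : 1 ≤ C) : ∃ C', 0 ≤ C' ∧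
    ∀ (G : Set ℂ) (ε : ℝ), 0 < ε → (∀ ξ ∈ G, ξ ∈ quadrant ∧ ε < ‖ξ‖ ∧ ‖ξ‖ < 1 ∧
      2 * (ξ.re * ξ.im) / (ξ.re ^ 2 + ξ.im ^ 2) ≤ C * ((ε / ‖ξ‖) ^ (1 / 4 : ℝ) + ‖ξ‖)) →
    ∫ ξ, G.indicator (fun ξ => (‖ξ‖ ^ 2)⁻¹) ξ ≤ C' := by
  have hA0 : ∀ t, 0 ≤ angularWeight t := fun t => indicator_nonneg (fun t ht =>
    add_nonneg (Real.rpow_nonneg ht.1.le _) (Real.rpow_nonneg (by linarith [ht.2]) _)) t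
  have hR0 : ∀ ε, 0 < ε → ∀ r, 0 ≤ radialWeight ε r := fun ε hε r => by
    refine add_nonneg (mul_nonneg (Real.rpow_nonneg hε.le _) (indicator_nonneg (fun r hr =>
      Real.rpow_nonneg (hε.trans hr).le _) _)) (indicator_nonneg (fun r hr =>
      Real.rpow_nonneg hr.1.le _) _)
  have hB0 : 0 ≤ ∫ r in Ioo (0 : ℝ) 1, r ^ (-(1 / 2) : ℝ) :=
    setIntegral_nonneg measurableSet_Ioo fun r hr => Real.rpow_nonneg hr.1.le _
  have hW0 : 0 ≤ ∫ t in Ioo (-Real.pi) Real.pi, angularWeight t := integral_nonneg hA0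
  refine ⟨(C * (8 + ∫ r in Ioo (0 : ℝ) 1, r ^ (-(1 / 2) : ℝ))) *
    ∫ t in Ioo (-Real.pi) Real.pi, angularWeight t, by positivity, fun G ε hε hG => ?_⟩
  obtain ⟨hi, hv⟩ := integrable_radialWeight hε
  rw [← hv, ← integral_const_mul C (radialWeight ε), ← setIntegral_prod_mul, ← Complex.integral_comp_polarCoord_symm,
    polarCoord_target, Measure.volume_eq_prod]
  refine integral_mono_of_nonneg ?_ ?_ ?_
  · refine ae_restrict_of_forall_mem (measurableSet_Ioi.prod measurableSet_Ioo) fun p hp => ?_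
    have : (0 : ℝ) < p.1 := hp.1
    exact smul_nonneg this.le (indicator_nonneg (fun ξ _ => by positivity) _)
  · rw [← Measure.prod_restrict]
    exact Integrable.mul_prod (hi.const_mul C) integrable_angularWeight.integrableOn
  · refine ae_restrict_of_forall_mem (measurableSet_Ioi.prod measurableSet_Ioo) fun p hp => ?_
    obtain ⟨r, t⟩ := p
    obtain ⟨hr, ht⟩ := hp
    have hr0 : 0 < r := hr
    simp only at ht ⊢
    rw [Complex.polarCoord_symm_apply]
    simp only
    set ξ : ℂ := r * (Real.cos t + Real.sin t * Complex.I) with hξ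
    have hn : ‖ξ‖ = r := norm_polar hr0 t
    by_cases hm : ξ ∈ G
    · obtain ⟨hq, h1, h2, h3⟩ := hG ξ hm
      have ht' := (polar_mem_quadrant_iff hr0 ht).1 hq
      have hre : ξ.re = r * Real.cos t := by
        simp [hξ, Complex.cos_ofReal_re]
      have him : ξ.im = r * Real.sin t := by
        simp [hξ, Complex.sin_ofReal_re]
      have e1 : 2 * (ξ.re * ξ.im) / (ξ.re ^ 2 + ξ.im ^ 2) = Real.sin (2 * t) := by
        rw [hre, him, Real.sin_two_mul, show (r * Real.cos t) ^ 2 + (r * Real.sin t) ^ 2 = r ^ 2 by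
          rw [mul_pow, mul_pow, ← mul_add, Real.cos_sq_add_sin_sq, mul_one]]
        field_simp
      rw [e1, hn] at h3
      rw [hn] at h1 h2
      have h4 := one_le_of_sin_le hC hε hr0 ht' h3
      rw [indicator_of_mem hm, hn, smul_eq_mul]
      -- After division by `r` the two radial terms are `ε^{1/8} r^{-9/8}` on `(ε, ∞)` and
      -- `r^{-1/2}` on `(0, 1)`; their integrals do not depend on `ε`.
      have e2 : radialWeight ε r = r⁻¹ * ((ε / r) ^ (1 / 8 : ℝ) + r ^ (1 / 2 : ℝ)) := by
        rw [radialWeight, indicator_of_mem (show r ∈ Ioi ε from h1),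
          indicator_of_mem (show r ∈ Ioo (0 : ℝ) 1 from ⟨hr0, h2⟩), mul_add,
          Real.div_rpow hε.le hr0.le]
        have f1 : r ^ (-(9 / 8) : ℝ) = r⁻¹ * (r ^ (1 / 8 : ℝ))⁻¹ := by
          rw [← Real.rpow_neg hr0.le, ← Real.rpow_neg_one, ← Real.rpow_add hr0]; norm_num
        have f2 : r ^ (-(1 / 2) : ℝ) = r⁻¹ * r ^ (1 / 2 : ℝ) := by
          rw [← Real.rpow_neg_one, ← Real.rpow_add hr0]; norm_num
        rw [f1, f2]
        ring
      have e3 : r * (r ^ 2)⁻¹ = r⁻¹ * 1 := by field_simp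
      rw [e2, e3]
      calc r⁻¹ * 1 ≤ r⁻¹ * (C * (((ε / r) ^ (1 / 8 : ℝ) + r ^ (1 / 2 : ℝ)) * angularWeight t)) :=
            mul_le_mul_of_nonneg_left h4 (by positivity)
        _ = _ := by ring
    · rw [indicator_of_notMem hm, smul_zero]
      exact mul_nonneg (mul_nonneg (by linarith) (hR0 ε hε r)) (hA0 t)

theorem integral_quadrant_annulus' {m R : ℝ} (hm : 0 < m) (hR : 0 < R) :
    ∫ ξ : ℂ, (quadrant ∩ {ξ | m < ‖ξ‖ ∧ ‖ξ‖ < R}).indicator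
      (fun ξ => ((starRingEnd ℂ ξ) ^ 2)⁻¹) ξ = Complex.I * (max 0 (Real.log (R / m)) : ℝ) := by
  rcases le_total m R with h | h
  · rw [integral_quadrant_annulus hm h, max_eq_right (Real.log_nonneg ((one_le_div hm).2 h))]
  · have : quadrant ∩ {ξ | m < ‖ξ‖ ∧ ‖ξ‖ < R} = ∅ := by
      ext ξ
      simp only [mem_inter_iff, mem_ofPred_eq, mem_empty_iff_false, iff_false]
      rintro ⟨-, h1, h2⟩
      linarith
    rw [this, max_eq_left (Real.log_nonpos (by positivity) ((div_le_one hm).2 h))]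
    simp

theorem isOpen_quadrant_annulus (m R : ℝ) :
    IsOpen (quadrant ∩ {ξ : ℂ | m < ‖ξ‖ ∧ ‖ξ‖ < R}) :=
  isOpen_quadrant.inter ((isOpen_lt continuous_const continuous_norm).inter
    (isOpen_lt continuous_norm continuous_const))

theorem integrable_indicator_annulus {E : Type*} [NormedAddCommGroup E] {S : Set ℂ}
    (hS : MeasurableSet S) {m R : ℝ} (hm : 0 < m) (hSm : ∀ ξ ∈ S, m < ‖ξ‖ ∧ ‖ξ‖ < R) {f : ℂ → E}
    (hf : StronglyMeasurable f) (hfb : ∀ ξ, ‖f ξ‖ ≤ (‖ξ‖ ^ 2)⁻¹) : Integrable (S.indicator f) := by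
  rw [integrable_indicator_iff hS]
  refine Measure.integrableOn_of_bounded (M := (m ^ 2)⁻¹) ?_ hf.aestronglyMeasurable ?_
  · exact (measure_mono (fun ξ hξ => by
      simpa using (hSm ξ hξ).2)).trans_lt (measure_ball_lt_top (x := (0 : ℂ)) (r := R)) |>.ne
  · refine ae_restrict_of_forall_mem hS fun ξ hξ => (hfb ξ).trans ?_
    have := (hSm ξ hξ).1
    gcongr

/-- With `a`, `b` the conjugates of `z`, `ξ`, the symmetrized kernel is `i a/(a² - b²)`. Its leading
term for small `a` is `-i a/b²`, and the remainder is cubic in `a`. -/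
theorem norm_pair_kernel_sub_le {z ξ : ℂ} (h : 2 * ‖z‖ < ‖ξ‖) :
    ‖(1 / 2 : ℝ) • (vortexKernel (z - ξ) + vortexKernel (z + ξ)) -
      -(Complex.I * starRingEnd ℂ z * ((starRingEnd ℂ ξ) ^ 2)⁻¹)‖ ≤
      2 * ‖z‖ ^ 3 * (‖ξ‖ ^ 4)⁻¹ := by
  set a := starRingEnd ℂ z with ha
  set b := starRingEnd ℂ ξ with hb
  have na : ‖a‖ = ‖z‖ := RCLike.norm_conj z
  have nb : ‖b‖ = ‖ξ‖ := RCLike.norm_conj ξ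
  have hz0 := norm_nonneg z
  have hξ0 : 0 < ‖ξ‖ := by linarith
  have hb0 : b ≠ 0 := by rw [← norm_pos_iff, nb]; exact hξ0
  have h1 : 0 < ‖a - b‖ := by
    have := norm_sub_norm_le b a
    rw [norm_sub_rev] at this
    linarith
  have h2 : 0 < ‖a + b‖ := by
    have := norm_sub_norm_le b (-a)
    rw [norm_neg, sub_neg_eq_add, add_comm] at this
    linarith
  have h1' := norm_pos_iff.1 h1
  have h2' := norm_pos_iff.1 h2
  have h3 : a ^ 2 - b ^ 2 ≠ 0 := by
    rw [sq_sub_sq]; exact mul_ne_zero h2' h1'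
  have e : (1 / 2 : ℝ) • (vortexKernel (z - ξ) + vortexKernel (z + ξ)) -
      -(Complex.I * a * (b ^ 2)⁻¹) = Complex.I * (a ^ 3 / (b ^ 2 * (a ^ 2 - b ^ 2))) := by
    rw [vortexKernel_eq, vortexKernel_eq, map_sub, map_add, ← ha, ← hb, Complex.real_smul]
    push_cast
    field_simp
    ring
  have h4 : ‖ξ‖ ^ 2 / 2 ≤ ‖a ^ 2 - b ^ 2‖ := by
    have := norm_sub_norm_le (b ^ 2) (a ^ 2)
    rw [norm_sub_rev, norm_pow, norm_pow, na, nb] at this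
    nlinarith
  rw [e, norm_mul, Complex.norm_I, one_mul, norm_div, norm_mul, norm_pow, norm_pow, na, nb,
    ← div_eq_mul_inv, div_le_div_iff₀ (by positivity) (by positivity)]
  have h5 : 0 ≤ 2 * ‖z‖ ^ 3 * ‖ξ‖ ^ 2 := by positivity
  nlinarith [mul_le_mul_of_nonneg_left h4 h5]

theorem kernelVelocity_pairVorticity {A : Set ℂ} (hA : MeasurableSet A) (hA4 : ∀ z ∈ A, ‖z‖ ≤ 4)
    (z : ℂ) : Integrable (fun ξ => A.indicator (fun _ => (1 : ℝ)) ξ •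
        ((1 / 2 : ℝ) • (vortexKernel (z - ξ) + vortexKernel (z + ξ)))) ∧
      kernelVelocity vortexKernel (pairVorticity A) z = ∫ ξ, A.indicator (fun _ => (1 : ℝ)) ξ •
        ((1 / 2 : ℝ) • (vortexKernel (z - ξ) + vortexKernel (z + ξ))) := by
  have hvk : ∀ w, ‖vortexKernel w‖ ≤ ‖w‖⁻¹ + 1 := fun w => by rw [norm_vortexKernel]; linarith
  have h01 : ∀ w, |A.indicator (fun _ => (1 : ℝ)) w| ≤ 2 := fun w => by
    rw [abs_of_nonneg (indicator_nonneg (fun _ _ => zero_le_one) w)]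
    exact (indicator_le_self' (by simp) w).trans one_le_two
  have hm : Measurable (A.indicator fun _ => (1 : ℝ)) := measurable_const.indicator hA
  have hv : IsVorticity (A.indicator fun _ => (1 : ℝ)) :=
    ⟨hm, h01, fun w hw => indicator_of_notMem (fun h => by linarith [hA4 w h]) _⟩
  have hv' : IsVorticity fun w => A.indicator (fun _ => (1 : ℝ)) (-w) :=
    ⟨hm.comp measurable_neg, fun w => h01 (-w), fun w hw => indicator_of_notMem (fun h => by
      have := hA4 _ h
      rw [norm_neg] at this
      linarith) _⟩
  have i1 := hv.integrable_smul measurable_vortexKernel hvk z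
  have i2 := hv'.integrable_smul measurable_vortexKernel hvk z
  have i3 : Integrable fun ξ => A.indicator (fun _ => (1 : ℝ)) ξ • vortexKernel (z + ξ) := by
    simpa using i2.comp_neg
  have e : ∀ ξ, A.indicator (fun _ => (1 : ℝ)) ξ •
      ((1 / 2 : ℝ) • (vortexKernel (z - ξ) + vortexKernel (z + ξ))) =
      (1 / 2 : ℝ) • (A.indicator (fun _ => (1 : ℝ)) ξ • vortexKernel (z - ξ) +
        A.indicator (fun _ => (1 : ℝ)) ξ • vortexKernel (z + ξ)) := fun ξ => by
    rw [smul_comm, smul_add]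
  simp only [e]
  refine ⟨(i1.add i3).smul (1 / 2 : ℝ), ?_⟩
  rw [integral_smul, integral_add i1 i3, kernelVelocity]
  congr 1
  simp only [pairVorticity_apply, add_smul]
  rw [integral_add i1 i2]
  congr 1
  rw [← integral_neg_eq_self]
  simp

/-- Both quantities equal `-log max(r, ε)` up to bounded errors: the factor `2`, the outer radius
`1/e`, the positive part, and the linear continuation. -/
theorem abs_log_sub_truncLog_le {ε r : ℝ} (hε : 0 < ε) (hε1 : ε ≤ 1) (hr : 0 ≤ r) (hr2 : r ≤ 2) :
    |max 0 (Real.log (Real.exp (-1) / max (2 * r) ε)) - truncLog (ε ^ 2) (r ^ 2)| ≤ 4 := by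
  set M := max r ε with hM
  set m := max (2 * r) ε with hm
  have hM0 : 0 < M := lt_max_of_lt_right hε
  have hm0 : 0 < m := lt_max_of_lt_right hε
  have h1 : M ≤ m := max_le_max (by linarith) le_rfl
  have h2 : m ≤ 2 * M := max_le (by linarith [le_max_left r ε]) (by linarith [le_max_right r ε])
  have h3 : M ≤ 2 := max_le hr2 (by linarith)
  have l2 := Real.log_two_lt_d9
  have l1 := Real.log_le_log hM0 h1
  have l3 := Real.log_le_log hm0 h2
  rw [Real.log_mul (by norm_num) hM0.ne'] at l3
  have l4 := Real.log_le_log hM0 h3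
  have hsq : max (r ^ 2) (ε ^ 2) = M ^ 2 := by
    rcases le_total r ε with h | h
    · rw [hM, max_eq_right h, max_eq_right (pow_le_pow_left₀ hr h 2)]
    · rw [hM, max_eq_left h, max_eq_left (pow_le_pow_left₀ hε.le h 2)]
  have h5 : 0 ≤ (M ^ 2 - r ^ 2) / (2 * ε ^ 2) ∧ (M ^ 2 - r ^ 2) / (2 * ε ^ 2) ≤ 1 / 2 := by
    rcases le_total r ε with h | h
    · rw [hM, max_eq_right h]
      have := pow_le_pow_left₀ hr h 2
      refine ⟨div_nonneg (by linarith) (by positivity), ?_⟩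
      rw [div_le_iff₀ (by positivity)]
      nlinarith [sq_nonneg r]
    · rw [hM, max_eq_left h]
      simp
  rw [truncLog, hsq, Real.log_pow, Real.log_div (Real.exp_pos _).ne' hm0.ne', Real.log_exp]
  push_cast
  rw [abs_le]
  rcases le_total 0 (-1 - Real.log m) with h | h
  · rw [max_eq_right h]
    constructor <;> linarith [h5.1, h5.2]
  · rw [max_eq_left h]
    constructor <;> linarith [h5.1, h5.2]

/-- The part of the quadrant between the radii `ε` and `exp (-1)` that is not covered by `A`. -/
def quadrantGap (A : Set ℂ) (ε : ℝ) : Set ℂ :=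
  (quadrant ∩ {ξ | ε < ‖ξ‖ ∧ ‖ξ‖ < Real.exp (-1)}) \ A

/-- The five terms are the errors of replacing the patch by the quadrant annulus: the two
singularities within radius comparable to `|z|`, the cubic remainder of the kernel beyond `2|z|`,
the part of the quadrant not covered, and the part of the patch outside radius `1/e`. Each has
integral `O(|z|)` once the gap is thin. -/
theorem norm_velocity_integrand_sub_le {A : Set ℂ} {ε : ℝ} (hAq : A ⊆ quadrant)
    (hA4 : ∀ z ∈ A, ‖z‖ ≤ 4) (hAε : ∀ z ∈ A, ε < ‖z‖) (z ξ : ℂ) :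
    ‖A.indicator (fun _ => (1 : ℝ)) ξ • ((1 / 2 : ℝ) •
        (vortexKernel (z - ξ) + vortexKernel (z + ξ))) -
      -(Complex.I * starRingEnd ℂ z * (quadrant ∩
        {ξ | max (2 * ‖z‖) ε < ‖ξ‖ ∧ ‖ξ‖ < Real.exp (-1)}).indicator
          (fun ξ => ((starRingEnd ℂ ξ) ^ 2)⁻¹) ξ)‖ ≤
      (Iic (3 * ‖z‖)).indicator (fun r => r⁻¹) ‖z - ξ‖ +
        (Iic (3 * ‖z‖)).indicator (fun r => r⁻¹) ‖z + ξ‖ +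
        2 * ‖z‖ ^ 3 * (Ioi (2 * ‖z‖)).indicator (fun r => (r ^ 4)⁻¹) ‖ξ‖ +
        ‖z‖ * (quadrantGap A ε).indicator (fun ξ => (‖ξ‖ ^ 2)⁻¹) ξ +
        ‖z‖ * (Real.exp (-1) ^ 2)⁻¹ * ballIndicator ξ := by
  have p1 : ∀ w : ℂ, 0 ≤ (Iic (3 * ‖z‖)).indicator (fun r : ℝ => r⁻¹) ‖w‖ := fun w =>
    indicator_apply_nonneg fun _ => by positivity
  have p2 : 0 ≤ (Ioi (2 * ‖z‖)).indicator (fun r : ℝ => (r ^ 4)⁻¹) ‖ξ‖ :=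
    indicator_apply_nonneg fun _ => by positivity
  have p3 : 0 ≤ (quadrantGap A ε).indicator (fun ξ : ℂ => (‖ξ‖ ^ 2)⁻¹) ξ :=
    indicator_apply_nonneg fun _ => by positivity
  have p4 := ballIndicator_nonneg ξ
  have q1 := p1 (z - ξ)
  have q2 := p1 (z + ξ)
  have hz := norm_nonneg z
  have q3 : 0 ≤ 2 * ‖z‖ ^ 3 * (Ioi (2 * ‖z‖)).indicator (fun r : ℝ => (r ^ 4)⁻¹) ‖ξ‖ := by
    positivity
  have q4 : 0 ≤ ‖z‖ * (quadrantGap A ε).indicator (fun ξ : ℂ => (‖ξ‖ ^ 2)⁻¹) ξ := by positivity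
  have q5 : 0 ≤ ‖z‖ * (Real.exp (-1) ^ 2)⁻¹ * ballIndicator ξ := by positivity
  have hT : ‖Complex.I * starRingEnd ℂ z * ((starRingEnd ℂ ξ) ^ 2)⁻¹‖ = ‖z‖ * (‖ξ‖ ^ 2)⁻¹ := by
    rw [norm_mul, norm_mul, Complex.norm_I, one_mul, norm_inv, norm_pow, RCLike.norm_conj,
      RCLike.norm_conj]
  by_cases hξ : ξ ∈ A
  · rw [indicator_of_mem hξ, one_smul]
    rcases le_or_gt ‖ξ‖ (2 * ‖z‖) with h | h
    · rw [indicator_of_notMem (fun hc => by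
        have := (le_max_left (2 * ‖z‖) ε).trans_lt hc.2.1
        linarith), mul_zero, neg_zero, sub_zero, norm_smul, show ‖(1 / 2 : ℝ)‖ = 1 / 2 by norm_num]
      have n1 : ‖z - ξ‖ ≤ 3 * ‖z‖ := (norm_sub_le _ _).trans (by linarith)
      have n2 : ‖z + ξ‖ ≤ 3 * ‖z‖ := (norm_add_le _ _).trans (by linarith)
      have e1 : (Iic (3 * ‖z‖)).indicator (fun r : ℝ => r⁻¹) ‖z - ξ‖ = ‖z - ξ‖⁻¹ :=
        indicator_of_mem (show ‖z - ξ‖ ∈ Iic (3 * ‖z‖) from n1) _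
      have e2 : (Iic (3 * ‖z‖)).indicator (fun r : ℝ => r⁻¹) ‖z + ξ‖ = ‖z + ξ‖⁻¹ :=
        indicator_of_mem (show ‖z + ξ‖ ∈ Iic (3 * ‖z‖) from n2) _
      have h1 := norm_add_le (vortexKernel (z - ξ)) (vortexKernel (z + ξ))
      rw [norm_vortexKernel, norm_vortexKernel, ← e1, ← e2] at h1
      linarith
    · have h1 := norm_pair_kernel_sub_le h
      have e3 : (Ioi (2 * ‖z‖)).indicator (fun r : ℝ => (r ^ 4)⁻¹) ‖ξ‖ = (‖ξ‖ ^ 4)⁻¹ :=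
        indicator_of_mem (show ‖ξ‖ ∈ Ioi (2 * ‖z‖) from h) _
      rw [← e3] at h1
      rcases lt_or_ge ‖ξ‖ (Real.exp (-1)) with h2 | h2
      · rw [indicator_of_mem]
        · linarith
        · exact ⟨hAq hξ, max_lt h (hAε ξ hξ), h2⟩
      · rw [indicator_of_notMem (fun hc => by linarith [hc.2.2]), mul_zero, neg_zero, sub_zero]
        have e5 : ballIndicator ξ = 1 :=
          indicator_of_mem (mem_closedBall_zero_iff.2 (hA4 ξ hξ)) _
        have h3 : ‖z‖ * (‖ξ‖ ^ 2)⁻¹ ≤ ‖z‖ * (Real.exp (-1) ^ 2)⁻¹ * ballIndicator ξ := by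
          rw [e5, mul_one]
          have := Real.exp_pos (-1)
          gcongr
        have h4 := norm_sub_norm_le ((1 / 2 : ℝ) • (vortexKernel (z - ξ) + vortexKernel (z + ξ)))
          (-(Complex.I * starRingEnd ℂ z * ((starRingEnd ℂ ξ) ^ 2)⁻¹))
        rw [norm_neg, hT] at h4
        linarith
  · rw [indicator_of_notMem hξ, zero_smul, zero_sub, neg_neg]
    by_cases hS : ξ ∈ quadrant ∩ {ξ | max (2 * ‖z‖) ε < ‖ξ‖ ∧ ‖ξ‖ < Real.exp (-1)}
    · rw [indicator_of_mem hS, hT]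
      have hG : ξ ∈ quadrantGap A ε :=
        ⟨⟨hS.1, (le_max_right _ _).trans_lt hS.2.1, hS.2.2⟩, hξ⟩
      have e4 : (quadrantGap A ε).indicator (fun ξ : ℂ => (‖ξ‖ ^ 2)⁻¹) ξ = (‖ξ‖ ^ 2)⁻¹ :=
        indicator_of_mem hG _
      rw [e4] at q4 ⊢
      linarith
    · rw [indicator_of_notMem hS, mul_zero, norm_zero]
      linarith

/-- The velocity of an odd pair of patches that covers most of the first quadrant near the origin
is a truncated logarithmic strain up to a linear error. -/
theorem exists_velocity_expansion (C : ℝ) : ∃ C', 0 ≤ C' ∧ ∀ (A : Set ℂ) (ε : ℝ),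
    MeasurableSet A → A ⊆ quadrant → (∀ z ∈ A, ‖z‖ ≤ 4) → 0 < ε → ε ≤ 1 → (∀ z ∈ A, ε < ‖z‖) →
    ∫ ξ, (quadrantGap A ε).indicator (fun ξ => (‖ξ‖ ^ 2)⁻¹) ξ ≤ C →
    ∀ z, ‖z‖ ≤ 2 → ‖kernelVelocity vortexKernel (pairVorticity A) z -
      truncLog (ε ^ 2) (Complex.normSq z) * starRingEnd ℂ z‖ ≤ C' * ‖z‖ := by
  have hB0 : 0 ≤ ∫ w, ballIndicator w := integral_nonneg ballIndicator_nonneg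
  have hpi := Real.pi_pos
  refine ⟨12 * Real.pi + Real.pi + max C 0 + (Real.exp (-1) ^ 2)⁻¹ * (∫ w, ballIndicator w) + 4,
    by positivity, fun A ε hA hAq hA4 hε hε1 hAε hJ z hz2 => ?_⟩
  rcases eq_or_ne z 0 with rfl | hz0
  · have h := kernelVelocity_neg vortexKernel_neg (pairVorticity_neg A) 0
    rw [neg_zero, eq_neg_iff_add_eq_zero, add_self_eq_zero] at h
    simp [h]
  have hz : 0 < ‖z‖ := norm_pos_iff.2 hz0
  set m := max (2 * ‖z‖) ε with hm
  have hm0 : 0 < m := lt_max_of_lt_right hε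
  set S := quadrant ∩ {ξ : ℂ | m < ‖ξ‖ ∧ ‖ξ‖ < Real.exp (-1)} with hS
  have hconj : Measurable fun ξ : ℂ => ((starRingEnd ℂ ξ) ^ 2)⁻¹ :=
    (Complex.continuous_conj.measurable.pow_const 2).inv
  have iS : Integrable (S.indicator fun ξ => ((starRingEnd ℂ ξ) ^ 2)⁻¹) :=
    integrable_indicator_annulus (isOpen_quadrant_annulus m _).measurableSet hm0
      (fun ξ hξ => hξ.2) hconj.stronglyMeasurable
      (fun ξ => by rw [norm_inv, norm_pow, RCLike.norm_conj])
  have hG : MeasurableSet (quadrantGap A ε) :=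
    (isOpen_quadrant_annulus ε _).measurableSet.diff hA
  have iG : Integrable ((quadrantGap A ε).indicator fun ξ => (‖ξ‖ ^ 2)⁻¹) :=
    integrable_indicator_annulus hG hε (fun ξ hξ => hξ.1.2)
      ((measurable_norm.pow_const 2).inv.stronglyMeasurable)
      (fun ξ => by rw [norm_inv, norm_pow, norm_norm])
  obtain ⟨i1, v1⟩ := integrable_norm_inv_closedBall (R := 3 * ‖z‖) (by positivity)
  obtain ⟨i2, v2⟩ := integrable_norm_pow_compl_closedBall (R := 2 * ‖z‖) (by positivity)
  have i1m : Integrable fun ξ : ℂ => (Iic (3 * ‖z‖)).indicator (fun r : ℝ => r⁻¹) ‖z - ξ‖ :=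
    i1.comp_sub_left z
  have i1p : Integrable fun ξ : ℂ => (Iic (3 * ‖z‖)).indicator (fun r : ℝ => r⁻¹) ‖z + ξ‖ :=
    i1.comp_add_left z
  have v1m : ∫ ξ : ℂ, (Iic (3 * ‖z‖)).indicator (fun r : ℝ => r⁻¹) ‖z - ξ‖ =
      2 * Real.pi * (3 * ‖z‖) := by
    rw [← v1]
    exact integral_sub_left_eq_self
      (fun w : ℂ => (Iic (3 * ‖z‖)).indicator (fun r : ℝ => r⁻¹) ‖w‖) volume z
  have v1p : ∫ ξ : ℂ, (Iic (3 * ‖z‖)).indicator (fun r : ℝ => r⁻¹) ‖z + ξ‖ =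
      2 * Real.pi * (3 * ‖z‖) := by
    rw [← v1]
    exact integral_add_left_eq_self
      (fun w : ℂ => (Iic (3 * ‖z‖)).indicator (fun r : ℝ => r⁻¹) ‖w‖) z
  obtain ⟨iu, vu⟩ := kernelVelocity_pairVorticity hA hA4 z
  have iT : Integrable fun ξ => -(Complex.I * starRingEnd ℂ z *
      S.indicator (fun ξ => ((starRingEnd ℂ ξ) ^ 2)⁻¹) ξ) := (iS.const_mul _).neg
  have i3 := i2.const_mul (2 * ‖z‖ ^ 3)
  have i4 := iG.const_mul ‖z‖
  have i5 := integrable_ballIndicator.const_mul (‖z‖ * (Real.exp (-1) ^ 2)⁻¹)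
  have hb1 := i1m.add i1p
  have hb2 := hb1.add i3
  have hb3 := hb2.add i4
  have hb4 := hb3.add i5
  have key := norm_integral_le_of_norm_le hb4
    (ae_of_all _ fun ξ => norm_velocity_integrand_sub_le hAq hA4 hAε z ξ)
  rw [integral_sub iu iT, ← vu, integral_neg, integral_const_mul, hS,
    integral_quadrant_annulus' hm0 (Real.exp_pos _), integral_add' hb3 i5, integral_add' hb2 i4,
    integral_add' hb1 i3, integral_add' i1m i1p, integral_const_mul, integral_const_mul,
    integral_const_mul, v1m, v1p, v2] at key
  · have hlog := abs_log_sub_truncLog_le hε hε1 hz.le hz2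
    rw [← Complex.normSq_eq_norm_sq, ← hm] at hlog
    set L := max 0 (Real.log (Real.exp (-1) / m))
    set t := truncLog (ε ^ 2) (Complex.normSq z)
    have e : kernelVelocity vortexKernel (pairVorticity A) z - t * starRingEnd ℂ z =
        (kernelVelocity vortexKernel (pairVorticity A) z -
          -(Complex.I * starRingEnd ℂ z * (Complex.I * (L : ℝ)))) +
          ((L - t : ℝ) : ℂ) * starRingEnd ℂ z := by
      push_cast
      linear_combination (-(starRingEnd ℂ z) * L) * Complex.I_mul_I
    rw [e]
    refine (norm_add_le _ _).trans ?_
    have h2 : ‖((L - t : ℝ) : ℂ) * starRingEnd ℂ z‖ ≤ 4 * ‖z‖ := by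
      rw [norm_mul, RCLike.norm_conj, Complex.norm_real]
      exact mul_le_mul_of_nonneg_right hlog hz.le
    have h3 : 2 * ‖z‖ ^ 3 * (Real.pi / (2 * ‖z‖) ^ 2) = Real.pi / 2 * ‖z‖ := by
      field_simp
    rw [h3] at key
    have h4 : ‖z‖ * ∫ ξ, (quadrantGap A ε).indicator (fun ξ => (‖ξ‖ ^ 2)⁻¹) ξ ≤ ‖z‖ * max C 0 :=
      mul_le_mul_of_nonneg_left (hJ.trans (le_max_left _ _)) hz.le
    have h5 : 0 ≤ Real.pi * ‖z‖ := by positivity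
    linarith [key]

/-! ### Trajectories of the truncated cell flow -/

/-- The time-dependent strain coefficient of the cell flow. -/
def levelShift (t : ℝ) : ℝ := 3 / 2 * decay t - 1

theorem continuous_decay : Continuous decay :=
  continuous_iff_continuousAt.2 fun t => (hasDerivAt_decay t).continuousAt

theorem continuous_levelShift : Continuous levelShift :=
  (continuous_const.mul continuous_decay).sub continuous_const

theorem abs_levelShift_le {t : ℝ} (ht : 0 ≤ t) : |levelShift t| ≤ 1 := by
  have h1 := decay_pos t
  have h2 := decay_le_one ht
  rw [levelShift, abs_le]
  constructor <;> linarith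

/-- The flow whose streamlines form a circular cell, truncated where `|z|² ≤ e t`. -/
def cellField (e : ℝ → ℝ) (t : ℝ) (z : ℂ) : ℂ := baseField (e t) (levelShift t) z

/-- Admissible truncation scales. -/
structure IsTruncation (e : ℝ → ℝ) : Prop where
  cont : ContinuousOn e (Ici 0)
  pos : ∀ t, 0 ≤ t → 0 < e t
  le_one : ∀ t, 0 ≤ t → e t ≤ 1

theorem isTruncation_const {e : ℝ} (h0 : 0 < e) (h1 : e ≤ 1) : IsTruncation fun _ => e :=
  ⟨continuousOn_const, fun _ _ => h0, fun _ _ => h1⟩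

theorem IsTruncation.isFlowField {e : ℝ → ℝ} (he : IsTruncation e) :
    IsFlowField (cellField e) where
  cont z := continuousOn_baseField he.cont continuous_levelShift.continuousOn continuousOn_const
    fun t ht => he.pos t ht
  lip T := by
    obtain ⟨C, hC, H⟩ := exists_baseField_lipschitz
    rcases lt_or_ge T 0 with hT | hT
    · exact ⟨0, fun t ht => absurd (ht.1.trans ht.2) (not_le.2 hT)⟩
    obtain ⟨t₀, ht₀, hmin⟩ := isCompact_Icc.exists_isMinOn (nonempty_Icc.2 hT)
      (he.cont.mono Icc_subset_Ici_self)
    refine ⟨⟨|Real.log (e t₀)| + C, by positivity⟩, fun t ht => LipschitzWith.of_dist_le_mul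
      fun z w => ?_⟩
    rw [dist_eq_norm, dist_eq_norm]
    refine (H (e t) (levelShift t) (he.pos t ht.1) (he.le_one t ht.1) (abs_levelShift_le ht.1)
      w z).trans (mul_le_mul_of_nonneg_right ?_ (norm_nonneg _))
    have h1 := Real.log_le_log (he.pos t₀ ht₀.1) (hmin ht)
    have h2 := Real.log_nonpos (he.pos t ht.1).le (he.le_one t ht.1)
    have h3 := Real.log_nonpos (he.pos t₀ ht₀.1).le (he.le_one t₀ ht₀.1)
    show |Real.log (e t)| + C ≤ |Real.log (e t₀)| + C
    rw [abs_of_nonpos h2, abs_of_nonpos h3]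
    linarith
  bdd T := by
    obtain ⟨C, hC, H⟩ := exists_baseField_bound
    exact ⟨C, fun t ht z => (H (e t) (levelShift t) (he.pos t ht.1) (he.le_one t ht.1)
      (abs_levelShift_le ht.1)).1 z⟩

theorem cellField_eq_zero {e : ℝ → ℝ} {t : ℝ} {z : ℂ} (hz : 4 ≤ ‖z‖) : cellField e t z = 0 :=
  baseField_eq_zero hz

theorem cellField_zero (e : ℝ → ℝ) (t : ℝ) : cellField e t 0 = 0 := by
  simp [cellField, baseField]

theorem isTrajectory_const {v : ℝ → ℂ → ℂ} {z : ℂ} (h : ∀ t, v t z = 0) (T : ℝ) :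
    IsTrajectory v T fun _ => z := fun s _ => by
  rw [h s]; exact hasDerivWithinAt_const _ _ _

theorem IsTruncation.norm_le_four {e : ℝ → ℝ} (he : IsTruncation e) {T t : ℝ} {γ : ℝ → ℂ}
    (h : IsTrajectory (cellField e) T γ) (ht : t ∈ Icc 0 T) (h4 : ‖γ t‖ ≤ 4) :
    ∀ s ∈ Icc 0 T, ‖γ s‖ ≤ 4 := by
  intro s hs
  by_contra! hcon
  have := he.isFlowField.trajectory_unique hs h
    (isTrajectory_const (fun t => cellField_eq_zero hcon.le) T) rfl ht
  rw [this] at h4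
  linarith

theorem IsTruncation.ne_zero {e : ℝ → ℝ} (he : IsTruncation e) {T t : ℝ} {γ : ℝ → ℂ}
    (h : IsTrajectory (cellField e) T γ) (ht : t ∈ Icc 0 T) (h0 : γ t ≠ 0) :
    ∀ s ∈ Icc 0 T, γ s ≠ 0 := by
  intro s hs hcon
  exact h0 (he.isFlowField.trajectory_unique hs h
    (isTrajectory_const (cellField_zero e) T) hcon ht)

theorem IsTrajectory.conj {e : ℝ → ℝ} {T : ℝ} {γ : ℝ → ℂ} (h : IsTrajectory (cellField e) T γ) :
    IsTrajectory (cellField e) T fun s => starRingEnd ℂ (γ s) := fun s hs => by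
  rw [cellField, baseField_conj]
  exact Complex.conjCLE.toContinuousLinearMap.hasFDerivAt.comp_hasDerivWithinAt s (h s hs)

theorem IsTrajectory.neg {v : ℝ → ℂ → ℂ} (hv : ∀ t, 0 ≤ t → ∀ z, v t (-z) = -v t z) {T : ℝ}
    {γ : ℝ → ℂ} (h : IsTrajectory v T γ) : IsTrajectory v T fun s => -γ s := fun s hs => by
  rw [hv s hs.1]
  exact (h s hs).neg

theorem pos_on_of_ne_zero {f : ℝ → ℝ} {T t : ℝ} (hf : ContinuousOn f (Icc 0 T)) (ht : t ∈ Icc 0 T)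
    (hpos : 0 < f t) (h0 : ∀ s ∈ Icc 0 T, f s ≠ 0) : ∀ s ∈ Icc 0 T, 0 < f s := by
  intro s hs
  by_contra! hcon
  have h1 : uIcc s t ⊆ Icc 0 T := ordConnected_Icc.uIcc_subset hs ht
  obtain ⟨u, hu, hfu⟩ := intermediate_value_uIcc (hf.mono h1)
    (show (0 : ℝ) ∈ uIcc (f s) (f t) from mem_uIcc.2 (Or.inl ⟨hcon, hpos.le⟩))
  exact h0 u (h1 hu) hfu

/-- The field commutes with the reflections in both axes. A trajectory that meets an axis coincides
with its mirror image by uniqueness and stays on that axis for all times. -/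
theorem IsTruncation.mem_quadrant {e : ℝ → ℝ} (he : IsTruncation e) {T t : ℝ} {γ : ℝ → ℂ}
    (h : IsTrajectory (cellField e) T γ) (ht : t ∈ Icc 0 T) (hq : γ t ∈ quadrant) :
    ∀ s ∈ Icc 0 T, γ s ∈ quadrant := by
  have h1 : ∀ s ∈ Icc 0 T, 0 < (γ s).re := by
    refine pos_on_of_ne_zero (Complex.continuous_re.comp_continuousOn h.continuousOn) ht hq.1
      fun s hs hcon => ?_
    have h2 := he.isFlowField.trajectory_unique hs h
      (h.conj.neg (fun t _ z => baseField_neg _ _ z)) (Complex.ext (by simp [hcon]) (by simp)) ht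
    have h3 := congrArg Complex.re h2
    simp only [Complex.neg_re, Complex.conj_re] at h3
    linarith [hq.1]
  have h2 : ∀ s ∈ Icc 0 T, 0 < (γ s).im := by
    refine pos_on_of_ne_zero (Complex.continuous_im.comp_continuousOn h.continuousOn) ht hq.2
      fun s hs hcon => ?_
    have h2 := he.isFlowField.trajectory_unique hs h h.conj
      (Complex.ext (by simp) (by simp [hcon])) ht
    have h3 := congrArg Complex.im h2
    simp only [Complex.conj_im] at h3
    linarith [hq.2]
  exact fun s hs => ⟨h1 s hs, h2 s hs⟩

theorem norm_sq_eq (z : ℂ) : ‖z‖ ^ 2 = z.re ^ 2 + z.im ^ 2 := by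
  rw [← Complex.normSq_eq_norm_sq, Complex.normSq_apply]; ring

/-- All truncations of the base field are dominated by one logarithmic field. -/
theorem exists_baseField_le_log : ∃ K, 16 ≤ K ∧ ∀ e a : ℝ, 0 < e → e ≤ 1 → |a| ≤ 1 →
    ∀ z : ℂ, z ≠ 0 → ‖z‖ ≤ 4 → ‖baseField e a z‖ ≤ ‖z‖ * Real.log (K / ‖z‖) := by
  obtain ⟨C, hC, H⟩ := exists_baseField_bound
  refine ⟨Real.exp (C + 16), ?_, fun e a he he1 ha z hz0 hz4 => ?_⟩
  · linarith [Real.add_one_le_exp (C + 16)]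
  have hz : 0 < ‖z‖ := norm_pos_iff.2 hz0
  have l2 := Real.log_two_lt_d9
  rw [Real.log_div (Real.exp_pos _).ne' hz.ne', Real.log_exp]
  rcases le_or_gt ‖z‖ 2 with h2 | h2
  · have h3 := norm_baseField_add_le he he1 ha h2
    have hl := Real.log_le_log hz h2
    have ht : |truncLog e (Complex.normSq z)| ≤ -Real.log ‖z‖ + 2 := by
      rcases le_total e (Complex.normSq z) with h | h
      · rw [truncLog_of_le h, log_normSq, abs_le]
        constructor <;> linarith
      · have hs : 0 < Complex.normSq z := Complex.normSq_pos.2 hz0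
        have h4 := Real.log_le_log hs h
        rw [log_normSq] at h4
        have h5 := Real.log_nonpos he.le he1
        have h6 : 0 ≤ (e - Complex.normSq z) / (2 * e) := div_nonneg (by linarith) (by linarith)
        have h7 : (e - Complex.normSq z) / (2 * e) ≤ 1 / 2 := by
          rw [div_le_iff₀ (by linarith)]; linarith
        rw [truncLog_of_ge h, abs_le]
        constructor <;> linarith
    have h4 : ‖(truncLog e (Complex.normSq z) : ℂ) * starRingEnd ℂ z‖ ≤
        (-Real.log ‖z‖ + 2) * ‖z‖ := by
      rw [norm_mul, RCLike.norm_conj, Complex.norm_real]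
      exact mul_le_mul_of_nonneg_right ht hz.le
    have h5 := norm_sub_le (baseField e a z + (truncLog e (Complex.normSq z) : ℂ) * starRingEnd ℂ z)
      ((truncLog e (Complex.normSq z) : ℂ) * starRingEnd ℂ z)
    rw [add_sub_cancel_right] at h5
    nlinarith [mul_nonneg hC hz.le]
  · have h3 := (H e a he he1 ha).1 z
    have hl := Real.log_le_log hz hz4
    have := log_four_le
    have h4 : C * 1 ≤ (C + 16 - Real.log ‖z‖) * ‖z‖ := mul_le_mul (by linarith) (by linarith)
      (by norm_num) (by linarith)
    linarith

theorem hasDerivWithinAt_log_norm {γ : ℝ → ℂ} {w : ℂ} {S : Set ℝ} {s : ℝ}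
    (h : HasDerivWithinAt γ w S s) (h0 : γ s ≠ 0) :
    HasDerivWithinAt (fun s => Real.log ‖γ s‖)
      (((γ s).re * w.re + (γ s).im * w.im) / ‖γ s‖ ^ 2) S s := by
  have hre : HasDerivWithinAt (fun s => (γ s).re) w.re S s :=
    Complex.reCLM.hasFDerivAt.comp_hasDerivWithinAt s h
  have him : HasDerivWithinAt (fun s => (γ s).im) w.im S s :=
    Complex.imCLM.hasFDerivAt.comp_hasDerivWithinAt s h
  have hpos : 0 < ‖γ s‖ ^ 2 := pow_pos (norm_pos_iff.2 h0) 2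
  have h1 := ((hre.fun_pow 2).add (him.fun_pow 2)).log (by
    rw [Pi.add_apply, ← norm_sq_eq]; exact hpos.ne')
  have h2 : (fun s => Real.log ‖γ s‖) =
      fun s => 1 / 2 * Real.log (((fun s => (γ s).re ^ 2) + fun s => (γ s).im ^ 2) s) := by
    funext u
    rw [Pi.add_apply, ← norm_sq_eq, Real.log_pow]
    push_cast; ring
  rw [h2]
  refine (h1.const_mul (1 / 2)).congr_deriv ?_
  rw [Pi.add_apply, ← norm_sq_eq]
  push_cast
  field_simp

theorem abs_radial_le (z w : ℂ) (hz : z ≠ 0) :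
    |(z.re * w.re + z.im * w.im) / ‖z‖ ^ 2| ≤ ‖w‖ / ‖z‖ := by
  have h0 : 0 < ‖z‖ := norm_pos_iff.2 hz
  rw [abs_div, abs_of_pos (pow_pos h0 2), div_le_div_iff₀ (pow_pos h0 2) h0]
  have h1 : |z.re * w.re + z.im * w.im| ≤ ‖z‖ * ‖w‖ := by
    refine abs_le_of_sq_le_sq ?_ (by positivity)
    rw [mul_pow, norm_sq_eq, norm_sq_eq]
    nlinarith [sq_nonneg (z.re * w.im - z.im * w.re)]
  nlinarith

/-- Trajectories approach the origin at most doubly exponentially, uniformly in the truncation. -/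
theorem exists_norm_ge : ∃ K, 16 ≤ K ∧ ∀ e, IsTruncation e → ∀ (T : ℝ) (γ : ℝ → ℂ),
    IsTrajectory (cellField e) T γ → ∀ t ∈ Icc 0 T, γ t ≠ 0 → ‖γ t‖ ≤ 4 → ∀ s ∈ Icc 0 T,
      K * Real.exp (-(Real.exp |s - t| * Real.log (K / ‖γ t‖))) ≤ ‖γ s‖ := by
  obtain ⟨K, hK, H⟩ := exists_baseField_le_log
  have hK0 : 0 < K := by linarith
  refine ⟨K, hK, fun e he T γ h t ht h0 h4 s hs => ?_⟩
  have h0' := he.ne_zero h ht h0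
  have h4' := he.norm_le_four h ht h4
  have hd : ∀ u ∈ Icc 0 T, HasDerivWithinAt (fun u => Real.log K - Real.log ‖γ u‖)
      (-(((γ u).re * (cellField e u (γ u)).re + (γ u).im * (cellField e u (γ u)).im) /
        ‖γ u‖ ^ 2)) (Icc 0 T) u := fun u hu =>
    (hasDerivWithinAt_log_norm (h u hu) (h0' u hu)).const_sub _
  have hb : ∀ u ∈ Icc 0 T, |-(((γ u).re * (cellField e u (γ u)).re +
      (γ u).im * (cellField e u (γ u)).im) / ‖γ u‖ ^ 2)| ≤ Real.log K - Real.log ‖γ u‖ := by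
    intro u hu
    have hr : 0 < ‖γ u‖ := norm_pos_iff.2 (h0' u hu)
    rw [abs_neg]
    refine (abs_radial_le _ _ (h0' u hu)).trans ?_
    rw [div_le_iff₀ hr, ← Real.log_div hK0.ne' hr.ne', mul_comm]
    exact H _ _ (he.pos u hu.1) (he.le_one u hu.1) (abs_levelShift_le hu.1) _ (h0' u hu) (h4' u hu)
  -- The function `log(K/|γ|)` changes at a rate at most equal to itself, so it grows at most like
  -- `e^{|s-t|}` in both time directions.
  have key : Real.log K - Real.log ‖γ s‖ ≤
      Real.exp |s - t| * (Real.log K - Real.log ‖γ t‖) := by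
    rcases le_total t s with hts | hst
    · have := le_of_hasDerivWithinAt_nonpos (T := T)
        (fun u hu => IsCellPath.hasDerivWithinAt_exp_neg_mul (hd u ⟨ht.1.trans hu.1, hu.2.trans hs.2⟩)
          (-1)) ht.1 hts hs.2 (fun u hu => by
            refine mul_nonpos_of_nonneg_of_nonpos (Real.exp_pos _).le ?_
            have := (abs_le.1 (hb u ⟨ht.1.trans hu.1, hu.2.trans hs.2⟩)).2
            linarith)
      have h2 := le_exp_mul_of_exp_mul_le this
      rw [abs_of_nonneg (by linarith)]
      rwa [show -1 * (t - s) = s - t by ring] at h2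
    · have := le_of_hasDerivWithinAt_nonneg (T := T)
        (fun u hu => IsCellPath.hasDerivWithinAt_exp_neg_mul (hd u ⟨hs.1.trans hu.1, hu.2.trans ht.2⟩)
          1) hs.1 hst ht.2 (fun u hu => by
            refine mul_nonneg (Real.exp_pos _).le ?_
            have := (abs_le.1 (hb u ⟨hs.1.trans hu.1, hu.2.trans ht.2⟩)).1
            linarith)
      have h2 := le_exp_mul_of_exp_mul_le this
      rw [abs_of_nonpos (by linarith)]
      rwa [show 1 * (t - s) = -(s - t) by ring] at h2
  have hr : 0 < ‖γ s‖ := norm_pos_iff.2 (h0' s hs)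
  have hr' : 0 < ‖γ t‖ := norm_pos_iff.2 h0
  rw [← Real.log_le_log_iff (mul_pos hK0 (Real.exp_pos _)) hr,
    Real.log_mul hK0.ne' (Real.exp_pos _).ne', Real.log_exp, Real.log_div hK0.ne' hr'.ne']
  linarith

theorem depth_eq {t : ℝ} {z : ℂ} : depth t z.re z.im = -Real.log ‖z‖ + decay t - 1 := by
  rw [depth, ← norm_sq_eq, Real.log_pow]
  push_cast; ring

theorem cellField_re {e : ℝ → ℝ} {t : ℝ} {z : ℂ} (h : e t ≤ Complex.normSq z)
    (h8 : Complex.normSq z ≤ 8) : (cellField e t z).re =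
      -z.re * (depth t z.re z.im + decay t / 2) + z.re * z.im ^ 2 / (z.re ^ 2 + z.im ^ 2) := by
  have hs : Complex.normSq z = z.re ^ 2 + z.im ^ 2 := by rw [Complex.normSq_apply]; ring
  rw [cellField, baseField_re, streamFactor, streamFactor', cutoff_of_le h8, deriv_cutoff_of_le h8,
    truncLog_of_le h, max_eq_left h, hs, depth, levelShift]
  rcases eq_or_ne (z.re ^ 2 + z.im ^ 2) 0 with h0 | h0
  · rw [h0]; simp; ring
  · field_simp
    ring

theorem cellField_im {e : ℝ → ℝ} {t : ℝ} {z : ℂ} (h : e t ≤ Complex.normSq z)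
    (h8 : Complex.normSq z ≤ 8) : (cellField e t z).im =
      z.im * (depth t z.re z.im + decay t / 2) - z.re ^ 2 * z.im / (z.re ^ 2 + z.im ^ 2) := by
  have hs : Complex.normSq z = z.re ^ 2 + z.im ^ 2 := by rw [Complex.normSq_apply]; ring
  rw [cellField, baseField_im, streamFactor, streamFactor', cutoff_of_le h8, deriv_cutoff_of_le h8,
    truncLog_of_le h, max_eq_left h, hs, depth, levelShift]
  rcases eq_or_ne (z.re ^ 2 + z.im ^ 2) 0 with h0 | h0
  · rw [h0]; simp; ring
  · field_simp
    ring

theorem normSq_le_of_depth_nonneg {t : ℝ} (ht : 0 ≤ t) {z : ℂ} (hz : z ≠ 0)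
    (h : 0 ≤ depth t z.re z.im) : Complex.normSq z ≤ 1 := by
  rw [depth_eq] at h
  have h1 := decay_le_one ht
  have h2 : 0 < ‖z‖ := norm_pos_iff.2 hz
  have h3 : ‖z‖ ≤ 1 := (Real.log_nonpos_iff h2.le).1 (by linarith)
  rw [Complex.normSq_eq_norm_sq]
  exact pow_le_one₀ h2.le h3

/-- A trajectory that ends in the cell has always been in the cell. -/
theorem IsTruncation.isCellPath {e : ℝ → ℝ} (he : IsTruncation e) {T : ℝ} (hT : 0 ≤ T) {γ : ℝ → ℂ}
    (h : IsTrajectory (cellField e) T γ) (hq : γ T ∈ quadrant)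
    (hd : 0 < depth T (γ T).re (γ T).im) (hn : ∀ s ∈ Icc 0 T, e s ≤ Complex.normSq (γ s)) :
    IsCellPath (fun s => (γ s).re) (fun s => (γ s).im) T := by
  have hQ := he.mem_quadrant h (right_mem_Icc.2 hT) hq
  have h0 : ∀ s ∈ Icc 0 T, γ s ≠ 0 := fun s hs hcon => by
    have := (hQ s hs).1
    rw [hcon] at this
    simp at this
  have hdep : ∀ s ∈ Icc 0 T, HasDerivWithinAt
      (fun s => 1 - depth s (γ s).re (γ s).im)
      (((γ s).re * (cellField e s (γ s)).re + (γ s).im * (cellField e s (γ s)).im) / ‖γ s‖ ^ 2 +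
        decay s / 2) (Icc 0 T) s := fun s hs => by
    have h1 := (((hasDerivWithinAt_log_norm (h s hs) (h0 s hs)).neg.add
      (hasDerivAt_decay s).hasDerivWithinAt).sub_const 1).const_sub 1
    refine (h1.congr (fun u hu => ?_) ?_).congr_deriv (by ring)
    · rw [depth_eq]; rfl
    · rw [depth_eq]; rfl
  have hpos : ∀ s ∈ Icc 0 T, 0 < depth s (γ s).re (γ s).im := by
    intro s hs
    by_contra! hcon
    have hsub : Icc s T ⊆ Icc 0 T := Icc_subset_Icc_left hs.1
    -- On the rim the depth has derivative `-decay · σ < 0`, so once `1 - ℓ ≥ 1` this persists up to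
    -- time `T`, against the positive final depth.
    have h1 := one_le_of_barrier (s₀ := s) (T := T)
      (fun u hu => ((hdep u (hsub hu)).mono hsub).continuousWithinAt)
      (fun u hu => (hdep u (hsub hu)).mono hsub) (by linarith) (fun u hu _ h1 => by
        have hu' := hsub hu
        have hd0 : depth u (γ u).re (γ u).im = 0 := by linarith
        have h8 : Complex.normSq (γ u) ≤ 8 :=
          (normSq_le_of_depth_nonneg hu'.1 (h0 u hu') hd0.ge).trans (by norm_num)
        rw [cellField_re (hn u hu') h8, cellField_im (hn u hu') h8, hd0, norm_sq_eq]
        obtain ⟨hx, hy⟩ := hQ u hu'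
        have hκ := decay_pos u
        have : ((γ u).re * (-(γ u).re * (0 + decay u / 2) +
            (γ u).re * (γ u).im ^ 2 / ((γ u).re ^ 2 + (γ u).im ^ 2)) +
            (γ u).im * ((γ u).im * (0 + decay u / 2) -
              (γ u).re ^ 2 * (γ u).im / ((γ u).re ^ 2 + (γ u).im ^ 2))) /
            ((γ u).re ^ 2 + (γ u).im ^ 2) + decay u / 2 =
            decay u * (γ u).im ^ 2 / ((γ u).re ^ 2 + (γ u).im ^ 2) := by
          field_simp
          ring
        rw [this]
        positivity) T ⟨hs.2, le_rfl⟩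
    linarith
  have h8 : ∀ s ∈ Icc 0 T, Complex.normSq (γ s) ≤ 8 := fun s hs =>
    (normSq_le_of_depth_nonneg hs.1 (h0 s hs) (hpos s hs).le).trans (by norm_num)
  refine ⟨fun s hs => (hQ s hs).1, fun s hs => (hQ s hs).2, hpos, fun s hs => ?_, fun s hs => ?_⟩
  · rw [← cellField_re (hn s hs) (h8 s hs)]
    exact Complex.reCLM.hasFDerivAt.comp_hasDerivWithinAt s (h s hs)
  · rw [← cellField_im (hn s hs) (h8 s hs)]
    exact Complex.imCLM.hasFDerivAt.comp_hasDerivWithinAt s (h s hs)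

theorem IsTrajectory.cellField_congr {e e' : ℝ → ℝ} {T : ℝ} {γ : ℝ → ℂ}
    (h : IsTrajectory (cellField e) T γ) (hn : ∀ s ∈ Icc 0 T, e s ≤ Complex.normSq (γ s))
    (hn' : ∀ s ∈ Icc 0 T, e' s ≤ Complex.normSq (γ s)) : IsTrajectory (cellField e') T γ :=
  h.congr_field fun s hs => baseField_eq_of_le (hn s hs) (hn' s hs)

/-! ### The patch carried by the cell flow -/

/-- The evolution of the initial patch by a cell flow, truncated so close to the origin that the
trajectories of the patch do not see the truncation. -/
structure IsPatchFlow (n : ℕ) (r : ℝ → ℝ) (Φ : ℝ → ℂ ≃ₜ ℂ) : Prop where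
  truncation : IsTruncation fun t => r t ^ 2
  pos : ∀ t, 0 < r t
  antitone : Antitone r
  flow : IsFlow (cellField fun t => r t ^ 2) Φ
  norm_ge : ∀ t, 0 ≤ t → ∀ z ∈ initialPatch n, r t ≤ ‖Φ t z‖

/-- The lower bound for trajectories is uniform over all truncations. The radius `r` can therefore
be fixed first, from that bound and the initial distance, and the resulting flow automatically keeps
the patch outside it. -/
theorem exists_isPatchFlow (n : ℕ) : ∃ r Φ, IsPatchFlow n r Φ := by
  obtain ⟨K, hK, H⟩ := exists_norm_ge
  have hK0 : 0 < K := by linarith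
  set c := Real.log (K * 10 ^ 14) with hc
  have hc0 : 0 ≤ c := Real.log_nonneg (by linarith)
  set r : ℝ → ℝ := fun t => K * Real.exp (-(Real.exp t * c)) with hr
  have hrpos : ∀ t, 0 < r t := fun t => mul_pos hK0 (Real.exp_pos _)
  have hanti : Antitone r := fun s t hst => by
    refine mul_le_mul_of_nonneg_left (Real.exp_le_exp.2 (neg_le_neg ?_)) hK0.le
    exact mul_le_mul_of_nonneg_right (Real.exp_le_exp.2 hst) hc0
  have hr1 : ∀ t, 0 ≤ t → r t ≤ 1 := fun t ht => by
    refine (hanti ht).trans ?_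
    rw [hr]
    simp only [Real.exp_zero, one_mul]
    rw [hc, Real.exp_neg, Real.exp_log (by positivity), mul_inv, ← mul_assoc,
      mul_inv_cancel₀ hK0.ne']
    norm_num
  have htr : IsTruncation fun t => r t ^ 2 :=
    ⟨Continuous.continuousOn (by fun_prop), fun t _ => pow_pos (hrpos t) 2,
      fun t ht => pow_le_one₀ (hrpos t).le (hr1 t ht)⟩
  obtain ⟨Φ, h0, h1, -⟩ := htr.isFlowField.exists_flow
  refine ⟨r, Φ, htr, hrpos, hanti, ⟨h0, h1⟩, fun t ht z hz => ?_⟩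
  have hz0 := norm_ge_of_mem_initialPatch hz
  have hzp : 0 < ‖z‖ := lt_of_lt_of_le (by norm_num) hz0
  have hz4 : ‖z‖ ≤ 4 := by
    obtain ⟨h1, h2, h3, h4⟩ := initialPatch_subset hz
    have := norm_sq_eq z
    nlinarith [norm_nonneg z]
  have h2 := H _ htr t _ (h1 t z) 0 ⟨le_rfl, ht⟩ (by rw [h0]; exact norm_pos_iff.1 hzp)
    (by rw [h0]; exact hz4) t ⟨ht, le_rfl⟩
  rw [h0, sub_zero, abs_of_nonneg ht] at h2
  refine le_trans (mul_le_mul_of_nonneg_left (Real.exp_le_exp.2 (neg_le_neg ?_)) hK0.le) h2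
  refine mul_le_mul_of_nonneg_left (Real.log_le_log (by positivity) ?_) (Real.exp_pos _).le
  rw [div_le_iff₀ hzp]
  have h5 : K * 10 ^ 14 * (1 / 10 ^ 14) ≤ K * 10 ^ 14 * ‖z‖ :=
    mul_le_mul_of_nonneg_left hz0 (by positivity)
  linarith

namespace IsPatchFlow

variable {n : ℕ} {r : ℝ → ℝ} {Φ : ℝ → ℂ ≃ₜ ℂ}

theorem sq_le_normSq (h : IsPatchFlow n r Φ) {t : ℝ} (ht : 0 ≤ t) {z : ℂ} (hz : z ∈ initialPatch n) :
    r t ^ 2 ≤ Complex.normSq (Φ t z) := by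
  rw [Complex.normSq_eq_norm_sq]
  exact pow_le_pow_left₀ (h.pos t).le (h.norm_ge t ht z hz) 2

theorem norm_le_four (h : IsPatchFlow n r Φ) {t : ℝ} (ht : 0 ≤ t) :
    ∀ z ∈ Φ t '' initialPatch n, ‖z‖ ≤ 4 := by
  rintro _ ⟨z, hz, rfl⟩
  refine h.truncation.norm_le_four (h.flow.trajectory t z) (t := 0) ⟨le_rfl, ht⟩ ?_ t ⟨ht, le_rfl⟩
  rw [h.flow.initial]
  obtain ⟨h1, h2, h3, h4⟩ := initialPatch_subset hz
  have := norm_sq_eq z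
  nlinarith [norm_nonneg z]

theorem subset_quadrant (h : IsPatchFlow n r Φ) {t : ℝ} (ht : 0 ≤ t) :
    Φ t '' initialPatch n ⊆ quadrant := by
  rintro _ ⟨z, hz, rfl⟩
  refine h.truncation.mem_quadrant (h.flow.trajectory t z) (t := 0) ⟨le_rfl, ht⟩ ?_ t ⟨ht, le_rfl⟩
  rw [h.flow.initial]
  obtain ⟨h1, h2, h3, h4⟩ := initialPatch_subset hz
  exact ⟨h1, h3⟩

/-- The point is followed backwards from time `T` by a flow with a constant truncation `ρ`, chosen
so small that neither this trajectory nor the patch trajectories up to time `T` see it. The path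
obeys the untruncated equations. Although `Φ` may truncate a trajectory outside the patch,
uniqueness in the common field still decides membership in the patch. -/
theorem exists_cellPath (h : IsPatchFlow n r Φ) {T : ℝ} (hT : 0 ≤ T) {z : ℂ} (hz : z ∈ quadrant)
    (hd : 0 < depth T z.re z.im) : ∃ x y : ℝ → ℝ, IsCellPath x y T ∧ x T = z.re ∧ y T = z.im ∧
      ((⟨x 0, y 0⟩ : ℂ) ∈ initialPatch n ↔ z ∈ Φ T '' initialPatch n) := by
  obtain ⟨K, hK, H⟩ := exists_norm_ge
  have hK0 : 0 < K := by linarith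
  have hz0 : z ≠ 0 := fun hcon => by
    have := hz.1
    rw [hcon] at this
    simp at this
  have hzp : 0 < ‖z‖ := norm_pos_iff.2 hz0
  have hz1 : ‖z‖ ≤ 1 := by
    have := normSq_le_of_depth_nonneg hT hz0 hd.le
    rw [Complex.normSq_eq_norm_sq] at this
    nlinarith
  have hlog : 0 ≤ Real.log (K / ‖z‖) := Real.log_nonneg (by rw [one_le_div hzp]; linarith)
  set ρ := min (K * Real.exp (-(Real.exp T * Real.log (K / ‖z‖)))) (r T) with hρ
  have hρ0 : 0 < ρ := lt_min (mul_pos hK0 (Real.exp_pos _)) (h.pos T)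
  have hρT : ρ ^ 2 ≤ r T ^ 2 := pow_le_pow_left₀ hρ0.le (min_le_right _ _) 2
  have htr : IsTruncation fun _ => ρ ^ 2 := isTruncation_const (pow_pos hρ0 2)
    (hρT.trans (h.truncation.le_one T hT))
  obtain ⟨γ, hγT, hγ⟩ := htr.isFlowField.exists_trajectory (right_mem_Icc.2 hT) z
  have hn : ∀ s ∈ Icc 0 T, ρ ^ 2 ≤ Complex.normSq (γ s) := fun s hs => by
    have h1 := H _ htr T γ hγ T (right_mem_Icc.2 hT) (by rwa [hγT]) (by rw [hγT]; linarith) s hs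
    rw [hγT] at h1
    rw [Complex.normSq_eq_norm_sq]
    refine pow_le_pow_left₀ hρ0.le ((min_le_left _ _).trans (le_trans ?_ h1)) 2
    refine mul_le_mul_of_nonneg_left (Real.exp_le_exp.2 (neg_le_neg ?_)) hK0.le
    refine mul_le_mul_of_nonneg_right (Real.exp_le_exp.2 ?_) hlog
    rw [abs_of_nonpos (by linarith [hs.2])]
    linarith [hs.1]
  have hmem : ∀ w ∈ initialPatch n, IsTrajectory (cellField fun _ => ρ ^ 2) T fun s => Φ s w :=
    fun w hw => (h.flow.trajectory T w).cellField_congr (fun s hs => h.sq_le_normSq hs.1 hw)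
      fun s hs => (hρT.trans (pow_le_pow_left₀ (h.pos T).le (h.antitone hs.2) 2)).trans
        (h.sq_le_normSq hs.1 hw)
  refine ⟨fun s => (γ s).re, fun s => (γ s).im, htr.isCellPath hT hγ (by rwa [hγT])
    (by rwa [hγT]) hn, congrArg Complex.re hγT, congrArg Complex.im hγT, ?_⟩
  have m0 : (0 : ℝ) ∈ Icc 0 T := left_mem_Icc.2 hT
  have mT : T ∈ Icc 0 T := right_mem_Icc.2 hT
  constructor
  · intro h0
    refine ⟨γ 0, h0, ?_⟩
    have := htr.isFlowField.trajectory_unique m0 (hmem (γ 0) h0) hγ (h.flow.initial _) mT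
    rw [← hγT]
    exact this
  · rintro ⟨w, hw, hwz⟩
    have := htr.isFlowField.trajectory_unique mT (hmem w hw) hγ (by rw [hγT]; exact hwz) m0
    simp only [h.flow.initial] at this
    show γ 0 ∈ initialPatch n
    rwa [← this]

end IsPatchFlow

/-! ### Distance of the patch from the origin and thinness of the gap -/

theorem exists_time_exp_ge {δ : ℝ} (hδ : 0 < δ) : ∃ t₁ : ℝ, 1 ≤ t₁ ∧ ∀ t, t₁ ≤ t →
    2 * t + 40 ≤ Real.exp (δ * t) := by
  refine ⟨44 / δ ^ 2 + 2, by have : 0 < 44 / δ ^ 2 := by positivity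
                             linarith, fun t ht => ?_⟩
  have h1 : 44 / δ ^ 2 ≤ t := by linarith
  have h2 : 0 < 44 / δ ^ 2 := by positivity
  rw [div_le_iff₀ (by positivity)] at h1
  have h3 := Real.quadratic_le_exp_of_nonneg (show 0 ≤ δ * t by nlinarith)
  nlinarith [mul_pos hδ (show 0 < t by linarith)]

theorem angle_le_one {x y : ℝ} : 2 * (x * y) / (x ^ 2 + y ^ 2) ≤ 1 :=
  div_le_one_of_le₀ (by nlinarith [sq_nonneg (x - y)]) (by positivity)

theorem mem_quadrant_ne_zero {z : ℂ} (hz : z ∈ quadrant) : z ≠ 0 := fun hcon => by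
  have := hz.1
  rw [hcon] at this
  simp at this

namespace IsPatchFlow

variable {n : ℕ} {r : ℝ → ℝ} {Φ : ℝ → ℂ ≃ₜ ℂ}

theorem nonempty (Φ : ℝ → ℂ ≃ₜ ℂ) (n : ℕ) (t : ℝ) : (Φ t '' initialPatch n).Nonempty :=
  ⟨_, mem_image_of_mem _ (one_add_I_mem_initialPatch n)⟩

theorem le_infDist (h : IsPatchFlow n r Φ) {t : ℝ} (ht : 0 ≤ t) :
    r t ≤ Metric.infDist 0 (Φ t '' initialPatch n) := by
  refine (Metric.le_infDist (nonempty Φ n t)).2 ?_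
  rintro _ ⟨z, hz, rfl⟩
  rw [dist_zero_left]
  exact h.norm_ge t ht z hz

theorem infDist_pos (h : IsPatchFlow n r Φ) {t : ℝ} (ht : 0 ≤ t) :
    0 < Metric.infDist 0 (Φ t '' initialPatch n) := (h.pos t).trans_le (h.le_infDist ht)

theorem infDist_le_four (h : IsPatchFlow n r Φ) {t : ℝ} (ht : 0 ≤ t) :
    Metric.infDist 0 (Φ t '' initialPatch n) ≤ 4 := by
  obtain ⟨z, hz⟩ := nonempty Φ n t
  refine (Metric.infDist_le_dist_of_mem hz).trans ?_
  rw [dist_zero_left]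
  exact h.norm_le_four ht z hz

theorem exists_time_infDist_le (h : IsPatchFlow n r Φ) (hn : n ≠ 0) {δ : ℝ} (hδ0 : 0 < δ)
    (hδn : δ < 2 * n * (1 - δ)) : ∃ t₀, 0 ≤ t₀ ∧ ∀ t, t₀ ≤ t →
      Metric.infDist 0 (Φ t '' initialPatch n) ≤ Real.exp (-Real.exp (δ * t)) := by
  obtain ⟨t₀, ht₀, H⟩ := exists_time_mem_of_diagonal hn hδ0 hδn
  refine ⟨t₀, ht₀, fun t ht => ?_⟩
  have ht0 : 0 ≤ t := ht₀.trans ht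
  set ρ := Real.exp (decay t - 1 - Real.exp (δ * t)) with hρ
  have hρ0 : 0 < ρ := Real.exp_pos _
  set z : ℂ := ⟨ρ / √2, ρ / √2⟩ with hz
  have h2 : 0 < √2 := by positivity
  have hn' : ‖z‖ = ρ := by
    have h3 : ‖z‖ ^ 2 = ρ ^ 2 := by
      rw [norm_sq_eq]
      simp only [hz, div_pow, Real.sq_sqrt (show (0 : ℝ) ≤ 2 by norm_num)]
      ring
    exact (pow_left_inj₀ (norm_nonneg _) hρ0.le two_ne_zero).1 h3
  have hdep : depth t z.re z.im = Real.exp (δ * t) := by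
    rw [depth_eq, hn', hρ, Real.log_exp]; ring
  obtain ⟨x, y, hp, hx, hy, hiff⟩ := h.exists_cellPath ht0 (z := z)
    ⟨div_pos hρ0 h2, div_pos hρ0 h2⟩ (by rw [hdep]; exact Real.exp_pos _)
  have hmem := hiff.1 (H x y t ht hp (by rw [hx, hy]) (by rw [hx, hy, hdep]))
  refine (Metric.infDist_le_dist_of_mem hmem).trans ?_
  rw [dist_zero_left, hn']
  exact Real.exp_le_exp.2 (by linarith [decay_le_one ht0])

/-- The tip is a point of the patch whose distance to the origin is at most twice the infimum, and
`Λ` is its depth. The double exponential approach already proved makes it so deep that its path must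
have been incoming initially and its level has been nearly conserved. -/
theorem exists_time_tip (h : IsPatchFlow n r Φ) (hn : n ≠ 0) {δ : ℝ} (hδ0 : 0 < δ)
    (hδn : δ < 2 * n * (1 - δ)) : ∃ t₁, 1 ≤ t₁ ∧ ∀ t, t₁ ≤ t → ∃ Λ,
      Real.exp (-t) * Λ * flatness n (Real.exp (-t) * Λ) ≤ 10 ^ 31 * (Real.exp (-2 * Λ) * Λ) ∧
      decay t - 1 - Λ ≤ Real.log (2 * Metric.infDist 0 (Φ t '' initialPatch n)) := by
  obtain ⟨t₀, ht₀, H⟩ := h.exists_time_infDist_le hn hδ0 hδn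
  obtain ⟨t₁, ht₁, H₁⟩ := exists_time_exp_ge hδ0
  refine ⟨max t₀ t₁, le_max_of_le_right ht₁, fun t ht => ?_⟩
  have hE := H₁ t ((le_max_right _ _).trans ht)
  have ht1 : 1 ≤ t := ht₁.trans ((le_max_right _ _).trans ht)
  have ht0 : 0 ≤ t := by linarith
  have hd := H t ((le_max_left _ _).trans ht)
  have hpos := h.infDist_pos ht0
  obtain ⟨A, hA, hAd⟩ := (Metric.infDist_lt_iff (nonempty Φ n t)).1
    (show Metric.infDist 0 (Φ t '' initialPatch n) < 2 * Metric.infDist 0 (Φ t '' initialPatch n) by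
      linarith)
  rw [dist_zero_left] at hAd
  have hAq := h.subset_quadrant ht0 hA
  have hA0 : 0 < ‖A‖ := norm_pos_iff.2 (mem_quadrant_ne_zero hAq)
  have hlogA : Real.log ‖A‖ ≤ 1 - Real.exp (δ * t) := by
    have h1 := Real.log_le_log hA0 (hAd.le.trans (mul_le_mul_of_nonneg_left hd zero_le_two))
    rw [Real.log_mul two_ne_zero (Real.exp_pos _).ne', Real.log_exp] at h1
    have := Real.log_two_lt_d9
    linarith
  have hκ := decay_pos t
  have hdepth : 38 ≤ depth t A.re A.im := by
    rw [depth_eq]; linarith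
  obtain ⟨x, y, hp, hx, hy, hiff⟩ := h.exists_cellPath ht0 hAq (by linarith)
  have hmem := hiff.2 hA
  refine ⟨depth t A.re A.im, ?_, ?_⟩
  · have key := hp.flatness_le_of_tip ht0 hn hmem ?_ ?_ (by rw [hx, hy]; linarith)
    · rwa [hx, hy] at key
    · rw [hx, hy]
      have e1 : A.re * A.im ≤ Real.exp (2 * (1 - Real.exp (δ * t))) := by
        have e2 : ‖A‖ ^ 2 ≤ Real.exp (2 * (1 - Real.exp (δ * t))) := by
          rw [two_mul, Real.exp_add, sq]
          have := (Real.log_le_iff_le_exp hA0).1 hlogA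
          exact mul_self_le_mul_self hA0.le this
        rw [norm_sq_eq] at e2
        nlinarith [sq_nonneg (A.re - A.im), sq_nonneg A.re, sq_nonneg A.im]
      have e3 : 1 + t ≤ Real.exp t := by linarith [Real.add_one_le_exp t]
      have e4 : A.re * A.im * Real.exp (2 * t) * (1 + t) ≤
          Real.exp (2 * (1 - Real.exp (δ * t))) * Real.exp (2 * t) * Real.exp t :=
        mul_le_mul (mul_le_mul_of_nonneg_right e1 (Real.exp_pos _).le) e3 (by linarith)
          (by positivity)
      refine e4.trans ?_
      rw [← Real.exp_add, ← Real.exp_add]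
      have e5 : Real.exp (2 * (1 - Real.exp (δ * t)) + 2 * t + t) ≤ Real.exp (-10) :=
        Real.exp_le_exp.2 (by linarith)
      refine e5.trans ?_
      rw [Real.exp_neg, ← one_div, div_le_div_iff₀ (Real.exp_pos _) (by norm_num)]
      have e6 : (2 : ℝ) ≤ Real.exp 1 := by linarith [Real.add_one_le_exp 1]
      have e7 : Real.exp 10 = Real.exp 1 ^ 10 := by rw [← Real.exp_nat_mul]; norm_num
      have e8 := pow_le_pow_left₀ (by norm_num) e6 10
      rw [← e7] at e8
      norm_num at e8
      linarith
    · rw [hx, hy]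
      -- The initial depth is at most `14 log 10 ≤ 35`, below the depth `38` of the tip.
      have e1 := norm_ge_of_mem_initialPatch hmem
      have e2 := Real.log_le_log (by norm_num) e1
      have e3 : Real.log (1 / 10 ^ 14) = -(14 * Real.log 10) := by
        rw [one_div, Real.log_inv, Real.log_pow]; push_cast; ring
      have e4 : Real.log 10 ≤ 5 / 2 := by
        have f1 : Real.log 10 ≤ Real.log 4 + Real.log (5 / 2) := by
          rw [← Real.log_mul (by norm_num) (by norm_num)]; norm_num
        have f2 := Real.log_two_lt_d9
        have f3 : Real.log 4 = 2 * Real.log 2 := by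
          rw [show (4 : ℝ) = 2 ^ 2 by norm_num, Real.log_pow]; norm_num
        have f4 : Real.log (5 / 2) ≤ 1 := by
          rw [Real.log_le_iff_le_exp (by norm_num)]
          linarith [Real.exp_one_gt_d9]
        linarith
      have e5 := depth_eq (t := 0) (z := ⟨x 0, y 0⟩)
      simp only [decay_zero] at e5
      rw [e5]
      linarith
  · rw [depth_eq]
    have := Real.log_le_log hA0 hAd.le
    linarith

/-- The part of the quadrant that is missed by the patch is thin. -/
theorem exists_gap_bound (h : IsPatchFlow n r Φ) (hn : n ≠ 0) {δ : ℝ} (hδ0 : 0 < δ)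
    (hδn : δ < 2 * n * (1 - δ)) : ∃ C, 1 ≤ C ∧ ∀ t, 0 ≤ t →
      ∀ ξ ∈ quadrantGap (Φ t '' initialPatch n)
        (Metric.infDist 0 (Φ t '' initialPatch n) / 4),
      2 * (ξ.re * ξ.im) / (ξ.re ^ 2 + ξ.im ^ 2) ≤
        C * ((Metric.infDist 0 (Φ t '' initialPatch n) / 4 / ‖ξ‖) ^ (1 / 4 : ℝ) + ‖ξ‖) := by
  obtain ⟨t₁, ht₁, H⟩ := h.exists_time_tip hn hδ0 hδn
  obtain ⟨C, hC, HC⟩ := exists_angle_bound hn (10 ^ 31) (by norm_num)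
  have hr1 := h.pos t₁
  refine ⟨8 * C + 4 / r t₁ + 1, by
    have : 0 < 4 / r t₁ := by positivity
    linarith, fun t ht ξ hξ => ?_⟩
  obtain ⟨⟨hq, h1, h2⟩, hmem⟩ := hξ
  set ε := Metric.infDist 0 (Φ t '' initialPatch n) / 4 with hε
  have hε0 : 0 < ε := by have := h.infDist_pos ht; positivity
  have hξ0 : 0 < ‖ξ‖ := hε0.trans h1
  have hp0 : 0 ≤ (ε / ‖ξ‖) ^ (1 / 4 : ℝ) := Real.rpow_nonneg (by positivity) _
  rcases le_total t t₁ with h3 | h3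
  -- Up to time `t₁` every missed point has norm at least `r t₁ / 4`, so the term `C‖ξ‖` alone
  -- exceeds the trivial bound `1`.
  · have h4 : r t₁ / 4 ≤ ‖ξ‖ := by
      have := (h.antitone h3).trans (h.le_infDist ht)
      linarith
    refine angle_le_one.trans ?_
    calc (1 : ℝ) = 4 / r t₁ * (r t₁ / 4) := by field_simp
      _ ≤ 4 / r t₁ * ‖ξ‖ := mul_le_mul_of_nonneg_left h4 (by positivity)
      _ ≤ (8 * C + 4 / r t₁ + 1) * ((ε / ‖ξ‖) ^ (1 / 4 : ℝ) + ‖ξ‖) :=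
        mul_le_mul (by linarith) (by linarith) hξ0.le (by positivity)
  · obtain ⟨Λ, hΛ, hlog⟩ := H t h3
    have hκ := decay_pos t
    have hlogξ : Real.log ‖ξ‖ < -1 := (Real.log_lt_iff_lt_exp hξ0).2 h2
    -- For `‖ξ‖ < 1/e` the depth is positive at every time, since the cell always contains the
    -- quarter disc of radius `1/e`. This is why the gap is considered only up to that radius.
    obtain ⟨x, y, hp, hx, hy, hiff⟩ := h.exists_cellPath ht hq (by rw [depth_eq]; linarith)
    have h5 := HC x y t Λ (ht₁.trans h3) hp (fun hc => hmem (hiff.1 hc)) hΛ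
    rw [hx, hy, depth_eq] at h5
    -- The tip bound reads `decay - 1 - Λ ≤ log(8ε)`, hence `-(Λ - ℓ) ≤ log(8ε/‖ξ‖)`; a quarter of
    -- it gives the power `1/4`.
    have e1 : Real.exp (-(Λ - (-Real.log ‖ξ‖ + decay t - 1)) / 4) ≤ 8 * (ε / ‖ξ‖) ^ (1 / 4 : ℝ) := by
      have e2 : -(Λ - (-Real.log ‖ξ‖ + decay t - 1)) / 4 ≤
          (Real.log 8 + Real.log (ε / ‖ξ‖)) * (1 / 4) := by
        rw [Real.log_div hε0.ne' hξ0.ne', ← add_sub_assoc, ← Real.log_mul (by norm_num) hε0.ne',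
          show 8 * ε = 2 * Metric.infDist 0 (Φ t '' initialPatch n) by rw [hε]; ring]
        linarith
      refine (Real.exp_le_exp.2 e2).trans ?_
      rw [← Real.log_mul (by norm_num) (by positivity), ← Real.rpow_def_of_pos (by positivity),
        Real.mul_rpow (by norm_num) (by positivity)]
      refine mul_le_mul_of_nonneg_right ?_ hp0
      exact (Real.rpow_le_rpow_of_exponent_le (by norm_num) (by norm_num)).trans_eq (Real.rpow_one 8)
    have e3 : Real.exp (-(-Real.log ‖ξ‖ + decay t - 1)) ≤ 8 * ‖ξ‖ := by
      have e4 : -(-Real.log ‖ξ‖ + decay t - 1) ≤ 1 + Real.log ‖ξ‖ := by linarith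
      refine (Real.exp_le_exp.2 e4).trans ?_
      rw [Real.exp_add, Real.exp_log hξ0]
      exact mul_le_mul_of_nonneg_right (by linarith [Real.exp_one_lt_d9]) hξ0.le
    have h6 : C * (Real.exp (-(Λ - (-Real.log ‖ξ‖ + decay t - 1)) / 4) +
        Real.exp (-(-Real.log ‖ξ‖ + decay t - 1))) ≤
        C * (8 * (ε / ‖ξ‖) ^ (1 / 4 : ℝ) + 8 * ‖ξ‖) :=
      mul_le_mul_of_nonneg_left (by linarith) hC.le
    have h7 : 0 ≤ (4 / r t₁ + 1) * ((ε / ‖ξ‖) ^ (1 / 4 : ℝ) + ‖ξ‖) := by positivity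
    linarith [h5.trans h6]

end IsPatchFlow

/-! ### The strain and the particle flow -/

theorem continuous_of_logModulus {f : ℂ → ℂ} {C : ℝ}
    (h : ∀ z w, ‖f w - f z‖ ≤ C * logModulus ‖w - z‖) : Continuous f := by
  refine continuous_iff_continuousAt.2 fun z => ?_
  rw [ContinuousAt, tendsto_iff_norm_sub_tendsto_zero]
  refine squeeze_zero (fun w => norm_nonneg _) (fun w => h z w) ?_
  have h1 : Continuous fun d : ℝ => C * (d + |d * Real.log d|) :=
    continuous_const.mul (continuous_id.add Real.continuous_mul_log.abs)
  have h2 : Continuous fun w : ℂ => C * (‖w - z‖ + |‖w - z‖ * Real.log ‖w - z‖|) :=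
    h1.comp (continuous_norm.comp (continuous_id.sub continuous_const))
  have h3 := h2.tendsto z
  simp only [sub_self, norm_zero, zero_mul, abs_zero, add_zero, mul_zero] at h3
  refine h3.congr fun w => ?_
  rw [logModulus, abs_mul, abs_of_nonneg (norm_nonneg _)]
  ring

theorem IsIncompressible.neg_sub {v w : ℂ → ℂ} (hv : IsIncompressible v) (hw : IsIncompressible w)
    (hvc : Continuous v) (hwc : Continuous w) : IsIncompressible fun z => -v z - w z := by
  intro φ hφ hc
  have key : ∀ {u : ℂ → ℂ}, Continuous u → Integrable fun z => fderiv ℝ φ z (u z) := fun hu =>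
    ((hφ.continuous_fderiv_apply (by simp)).comp (continuous_id.prodMk hu)).integrable_of_hasCompactSupport
      ((hc.fderiv ℝ).mono fun z hz hcon => hz (by
        simp only [Function.comp, id]
        rw [hcon]; simp))
  have h1 : ∀ z, fderiv ℝ φ z (-v z - w z) = -fderiv ℝ φ z (v z) - fderiv ℝ φ z (w z) := fun z => by
    rw [map_sub, map_neg]
  simp only [h1]
  have h2 : Integrable fun z => -fderiv ℝ φ z (v z) := (key hvc).neg
  rw [integral_sub h2 (key hwc), integral_neg, hv φ hφ hc, hw φ hφ hc]
  simp

namespace IsPatchFlow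

variable {n : ℕ} {r : ℝ → ℝ} {Φ : ℝ → ℂ ≃ₜ ℂ}

/-- The truncation scale adapted to the distance of the patch to the origin. -/
def scale (Φ : ℝ → ℂ ≃ₜ ℂ) (n : ℕ) (t : ℝ) : ℝ := Metric.infDist 0 (Φ t '' initialPatch n) / 4

theorem scale_pos (h : IsPatchFlow n r Φ) {t : ℝ} (ht : 0 ≤ t) : 0 < scale Φ n t := by
  have := h.infDist_pos ht
  unfold scale
  positivity

theorem scale_le_one (h : IsPatchFlow n r Φ) {t : ℝ} (ht : 0 ≤ t) : scale Φ n t ≤ 1 := by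
  have := h.infDist_le_four ht
  unfold scale
  linarith

theorem scale_lt_norm (h : IsPatchFlow n r Φ) {t : ℝ} (ht : 0 ≤ t) {z : ℂ}
    (hz : z ∈ Φ t '' initialPatch n) : scale Φ n t < ‖z‖ := by
  have h1 := Metric.infDist_le_dist_of_mem (x := 0) hz
  have h2 := h.infDist_pos ht
  rw [dist_zero_left] at h1
  unfold scale
  linarith

theorem infDist_le_add (h : IsPatchFlow n r Φ) {M : ℝ} (hM : ∀ t, 0 ≤ t → ∀ z,
    ‖cellField (fun t => r t ^ 2) t z‖ ≤ M) {s t : ℝ} (hs : 0 ≤ s) (ht : 0 ≤ t) :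
    Metric.infDist 0 (Φ s '' initialPatch n) ≤
      Metric.infDist 0 (Φ t '' initialPatch n) + M * |s - t| := by
  rw [← sub_le_iff_le_add]
  refine (Metric.le_infDist (nonempty Φ n t)).2 ?_
  rintro _ ⟨z, hz, rfl⟩
  have h1 := Metric.infDist_le_dist_of_mem (x := 0) (mem_image_of_mem (Φ s) hz)
  rw [dist_zero_left] at h1 ⊢
  have h2 := (convex_Icc 0 (max s t)).norm_image_sub_le_of_norm_hasDerivWithin_le
    (h.flow.trajectory (max s t) z) (fun u hu => hM u hu.1 _) (x := t) (y := s)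
    ⟨ht, le_max_right _ _⟩ ⟨hs, le_max_left _ _⟩
  rw [Real.norm_eq_abs] at h2
  have h3 := norm_sub_norm_le (Φ s z) (Φ t z)
  linarith

theorem continuousOn_infDist (h : IsPatchFlow n r Φ) :
    ContinuousOn (fun t => Metric.infDist 0 (Φ t '' initialPatch n)) (Ici 0) := by
  obtain ⟨M, hM0, H⟩ := exists_baseField_bound
  have hM : ∀ t, 0 ≤ t → ∀ z, ‖cellField (fun t => r t ^ 2) t z‖ ≤ M := fun t ht =>
    (H _ _ (h.truncation.pos t ht) (h.truncation.le_one t ht) (abs_levelShift_le ht)).1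
  refine LipschitzOnWith.continuousOn (K := ⟨M, hM0⟩) (LipschitzOnWith.of_dist_le_mul
    fun s hs t ht => ?_)
  rw [Real.dist_eq, Real.dist_eq, abs_sub_le_iff]
  have h1 := h.infDist_le_add hM hs ht
  have h2 := h.infDist_le_add hM ht hs
  rw [abs_sub_comm] at h2
  constructor
  · show _ ≤ M * _
    linarith
  · show _ ≤ M * _
    linarith

theorem isTruncation_scale (h : IsPatchFlow n r Φ) : IsTruncation fun t => scale Φ n t ^ 2 where
  cont := (h.continuousOn_infDist.div_const 4).pow 2
  pos _ ht := pow_pos (h.scale_pos ht) 2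
  le_one _ ht := pow_le_one₀ (h.scale_pos ht).le (h.scale_le_one ht)

/-- The vorticity at time `t`. -/
def vorticity (Φ : ℝ → ℂ ≃ₜ ℂ) (n : ℕ) (t : ℝ) : ℂ → ℝ := pairVorticity (Φ t '' initialPatch n)

theorem isVorticity (h : IsPatchFlow n r Φ) {t : ℝ} (ht : 0 ≤ t) :
    IsVorticity (vorticity Φ n t) :=
  isVorticity_pairVorticity
    ((Φ t).isOpenMap _ (isSmoothPatch_initialPatch n).isOpen).measurableSet (h.norm_le_four ht)

theorem continuousOn_velocity (h : IsPatchFlow n r Φ) {k : ℂ → ℂ} (hk : Measurable k)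
    (hkb : ∀ w, ‖k w‖ ≤ ‖w‖⁻¹ + 1) (z : ℂ) :
    ContinuousOn (fun t => kernelVelocity k (vorticity Φ n t) z) (Ici 0) :=
  h.flow.continuousOn_kernelVelocity h.truncation.isFlowField (isSmoothPatch_initialPatch n)
    (fun _ ht => h.norm_le_four ht) hk hkb z

/-- The total velocity of the particles. -/
def particleField (Φ : ℝ → ℂ ≃ₜ ℂ) (n : ℕ) (t : ℝ) (z : ℂ) : ℂ :=
  cellField (fun t => scale Φ n t ^ 2) t z - kernelVelocity farKernel (vorticity Φ n t) z

/-- The added strain. -/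
def strain (Φ : ℝ → ℂ ≃ₜ ℂ) (n : ℕ) (t : ℝ) (z : ℂ) : ℂ :=
  -cellField (fun t => scale Φ n t ^ 2) (max t 0) z -
    kernelVelocity nearKernel (vorticity Φ n (max t 0)) z

theorem vorticity_neg (t : ℝ) (z : ℂ) : vorticity Φ n t (-z) = vorticity Φ n t z :=
  pairVorticity_neg _ z

theorem particleField_neg (t : ℝ) (z : ℂ) :
    particleField Φ n t (-z) = -particleField Φ n t z := by
  rw [particleField, particleField, kernelVelocity_neg farKernel_neg (vorticity_neg t), cellField,
    baseField_neg, cellField]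
  ring

theorem isFlowField_particleField (h : IsPatchFlow n r Φ) :
    IsFlowField (particleField Φ n) where
  cont z := (h.isTruncation_scale.isFlowField.cont z).sub
    (h.continuousOn_velocity measurable_farKernel norm_farKernel_le' z)
  lip T := by
    obtain ⟨K, hK⟩ := h.isTruncation_scale.isFlowField.lip T
    obtain ⟨C, hC, H⟩ := exists_farVelocity_lipschitz
    refine ⟨K + ⟨C, hC⟩, fun t ht => (hK t ht).sub (LipschitzWith.of_dist_le_mul fun z w => ?_)⟩
    rw [dist_eq_norm, dist_eq_norm]
    exact H _ (h.isVorticity ht.1) w z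
  bdd T := by
    obtain ⟨M, hM⟩ := h.isTruncation_scale.isFlowField.bdd T
    obtain ⟨C, hC, H⟩ := IsVorticity.norm_kernelVelocity_le norm_farKernel_le'
    exact ⟨M + C, fun t ht z => (norm_sub_le _ _).trans
      (add_le_add (hM t ht z) (H _ (h.isVorticity ht.1) z))⟩

/-- The near velocity in the strain cancels the near part of the Euler velocity, leaving the cell
field minus the far velocity. -/
theorem neg_euler_add_strain (h : IsPatchFlow n r Φ) {t : ℝ} (ht : 0 ≤ t) (z : ℂ) :
    -(eulerVelocity (vorticity Φ n t) z + strain Φ n t z) = particleField Φ n t z := by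
  rw [eulerVelocity_eq, ← (h.isVorticity ht).near_add_far, strain, particleField, max_eq_left ht]
  ring

/-- On the patch nothing distinguishes the two fields: the far velocity vanishes for norm at most
`5`, and the patch stays outside both truncation radii. -/
theorem isTrajectory_particleField (h : IsPatchFlow n r Φ) {z : ℂ} (hz : z ∈ initialPatch n)
    (T : ℝ) : IsTrajectory (particleField Φ n) T fun s => Φ s z :=
  (h.flow.trajectory T z).congr_field fun s hs => by
    have h4 := h.norm_le_four hs.1 _ (mem_image_of_mem (Φ s) hz)
    rw [particleField, (h.isVorticity hs.1).farVelocity_eq_zero (by linarith), sub_zero]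
    refine baseField_eq_of_le (h.sq_le_normSq hs.1 hz) ?_
    rw [Complex.normSq_eq_norm_sq]
    exact pow_le_pow_left₀ (h.scale_pos hs.1).le
      (h.scale_lt_norm hs.1 (mem_image_of_mem (Φ s) hz)).le 2

/-- Near the origin the cell field is `-truncLog · z̄ + O(|z|)` and the patch velocity is `truncLog
· z̄ + O(|z|)` with the same truncation, so the logarithms cancel in their sum. This is why the
truncation of the strain is tied to the actual distance of the patch and not to the a priori radius
`r`. For `|z| > 2` boundedness suffices. -/
theorem exists_strain_linear_bound (h : IsPatchFlow n r Φ) (hn : n ≠ 0) {δ : ℝ} (hδ0 : 0 < δ)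
    (hδn : δ < 2 * n * (1 - δ)) : ∃ K, ∀ t, 0 ≤ t → ∀ z, ‖strain Φ n t z‖ ≤ K * ‖z‖ := by
  obtain ⟨C₁, hC₁, hgap⟩ := h.exists_gap_bound hn hδ0 hδn
  obtain ⟨C₂, hC₂, hthin⟩ := exists_thin_integral_bound C₁ hC₁
  obtain ⟨C₃, hC₃, hvel⟩ := exists_velocity_expansion C₂
  obtain ⟨M, hM, hbase⟩ := exists_baseField_bound
  obtain ⟨N, hN, hnear⟩ := IsVorticity.norm_kernelVelocity_le norm_nearKernel_le'
  refine ⟨C₃ + 2 + M + N, fun t ht z => ?_⟩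
  have he := h.isTruncation_scale
  have hv := h.isVorticity ht
  rw [strain, max_eq_left ht]
  rcases le_or_gt ‖z‖ 2 with h2 | h2
  · have hb := norm_baseField_add_le (he.pos t ht) (he.le_one t ht) (abs_levelShift_le ht) h2
    have hJ := hthin (quadrantGap (Φ t '' initialPatch n) (scale Φ n t)) (scale Φ n t)
      (h.scale_pos ht) fun ξ hξ => ⟨hξ.1.1, hξ.1.2.1, hξ.1.2.2.trans
        (exp_neg_lt_one one_pos), hgap t ht ξ hξ⟩
    have hu := hvel _ _ ((Φ t).isOpenMap _ (isSmoothPatch_initialPatch n).isOpen).measurableSet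
      (h.subset_quadrant ht) (h.norm_le_four ht) (h.scale_pos ht) (h.scale_le_one ht)
      (fun z hz => h.scale_lt_norm ht hz) hJ z h2
    have e1 : kernelVelocity nearKernel (vorticity Φ n t) z =
        kernelVelocity vortexKernel (vorticity Φ n t) z := by
      rw [← hv.near_add_far, hv.farVelocity_eq_zero (by linarith), add_zero]
    have e2 : -cellField (fun t => scale Φ n t ^ 2) t z -
        kernelVelocity nearKernel (vorticity Φ n t) z =
        -(baseField (scale Φ n t ^ 2) (levelShift t) z +
          truncLog (scale Φ n t ^ 2) (Complex.normSq z) * starRingEnd ℂ z) -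
        (kernelVelocity vortexKernel (vorticity Φ n t) z -
          truncLog (scale Φ n t ^ 2) (Complex.normSq z) * starRingEnd ℂ z) := by
      rw [e1, cellField]; ring
    rw [e2]
    refine (norm_sub_le _ _).trans ?_
    rw [norm_neg]
    have h3 : 0 ≤ (M + N) * ‖z‖ := by positivity
    have hu' : ‖kernelVelocity vortexKernel (vorticity Φ n t) z -
      truncLog (scale Φ n t ^ 2) (Complex.normSq z) * starRingEnd ℂ z‖ ≤ C₃ * ‖z‖ := hu
    linarith
  · have h3 : ‖cellField (fun t => scale Φ n t ^ 2) t z‖ ≤ M :=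
      (hbase _ _ (he.pos t ht) (he.le_one t ht) (abs_levelShift_le ht)).1 z
    have h4 := hnear _ hv z
    have h5 := norm_sub_le (-cellField (fun t => scale Φ n t ^ 2) t z)
      (kernelVelocity nearKernel (vorticity Φ n t) z)
    rw [norm_neg] at h5
    nlinarith [mul_nonneg (add_nonneg (add_nonneg hC₃ zero_le_two) (add_nonneg hM hN))
      (show 0 ≤ ‖z‖ - 1 by linarith)]

theorem exists_strain_logLipschitz (h : IsPatchFlow n r Φ) : ∃ K, ∀ t, 0 ≤ t → ∀ z w,
    ‖strain Φ n t w - strain Φ n t z‖ ≤ K * logModulus ‖w - z‖ := by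
  obtain ⟨C₁, -, h₁⟩ := exists_baseField_logLipschitz
  obtain ⟨C₂, -, h₂⟩ := exists_nearVelocity_logLipschitz
  refine ⟨C₁ + C₂, fun t ht z w => ?_⟩
  have he := h.isTruncation_scale
  have h3 := h₁ _ _ (he.pos t ht) (he.le_one t ht) (abs_levelShift_le ht) z w
  have h4 := h₂ _ (h.isVorticity ht) z w
  have e : strain Φ n t w - strain Φ n t z =
      -(cellField (fun t => scale Φ n t ^ 2) t w - cellField (fun t => scale Φ n t ^ 2) t z) -
      (kernelVelocity nearKernel (vorticity Φ n t) w -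
        kernelVelocity nearKernel (vorticity Φ n t) z) := by
    rw [strain, strain, max_eq_left ht]; ring
  rw [e, add_mul]
  refine (norm_sub_le _ _).trans ?_
  rw [norm_neg]
  exact add_le_add h3 h4

theorem continuous_strain (h : IsPatchFlow n r Φ) (z : ℂ) :
    Continuous fun t => strain Φ n t z := by
  have h1 : Continuous fun t : ℝ => max t 0 := continuous_id.max continuous_const
  have h2 := (h.isTruncation_scale.isFlowField.cont z).comp_continuous h1 fun t => le_max_right t 0
  have h3 := (h.continuousOn_velocity measurable_nearKernel norm_nearKernel_le' z).comp_continuous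
    h1 fun t => le_max_right t 0
  exact h2.neg.sub h3

theorem isAdmissibleStrain (h : IsPatchFlow n r Φ) (hn : n ≠ 0) {δ : ℝ} (hδ0 : 0 < δ)
    (hδn : δ < 2 * n * (1 - δ)) : IsAdmissibleStrain (strain Φ n) where
  measurable := by
    obtain ⟨K, hK⟩ := h.exists_strain_logLipschitz
    -- The argument `max t 0` extends the strain constantly to negative times. It is then continuous
    -- in `t` on the whole line and measurable in `z`, hence jointly measurable.
    have hc : ∀ t, Measurable (strain Φ n t) := fun t => by
      have e : strain Φ n t = strain Φ n (max t 0) := by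
        funext z
        simp [strain]
      rw [e]
      exact (continuous_of_logModulus (hK _ (le_max_right t 0))).measurable
    exact measurable_uncurry_of_continuous_of_measurable (u := strain Φ n)
      h.continuous_strain hc
  compact_support := by
    refine ⟨18, fun t ht z hz => ?_⟩
    rw [strain, max_eq_left ht, cellField_eq_zero (by linarith),
      (h.isVorticity ht).nearVelocity_eq_zero hz.le]
    simp
  incompressible t ht := by
    obtain ⟨C, -, hC⟩ := exists_nearVelocity_logLipschitz
    have he := h.isTruncation_scale.pos t ht
    have e : strain Φ n t = fun z => -cellField (fun t => scale Φ n t ^ 2) t z -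
        kernelVelocity nearKernel (vorticity Φ n t) z := by
      funext z
      rw [strain, max_eq_left ht]
    rw [e]
    exact (isIncompressible_baseField he _).neg_sub (h.isVorticity ht).isIncompressible_nearVelocity
      (continuous_baseField he _) (continuous_of_logModulus (hC _ (h.isVorticity ht)))
  odd t _ z := by
    rw [strain, strain, kernelVelocity_neg nearKernel_neg (vorticity_neg _), cellField,
      baseField_neg, cellField]
    ring
  linear_bound := by
    obtain ⟨K, hK⟩ := h.exists_strain_linear_bound hn hδ0 hδn
    refine ⟨K, fun t ht z hz => ?_⟩
    rw [div_le_iff₀ (norm_pos_iff.2 hz)]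
    exact hK t ht z
  log_lipschitz := by
    obtain ⟨K, hK⟩ := h.exists_strain_logLipschitz
    refine ⟨K, fun t ht z₁ z₂ => ?_⟩
    rw [norm_sub_rev z₁]
    exact hK t ht z₁ z₂

/-- The homeomorphisms are the flow of the total particle field, not `Φ` itself: the two agree on
the initial patch by uniqueness, and so transport it to the same sets. Oddness of the particle field
takes care of the reflected patch. -/
theorem exists_patchDynamics (h : IsPatchFlow n r Φ) : ∃ Z : ℝ → ℂ ≃ₜ ℂ,
    IsPatchDynamics (strain Φ n) (fun t => Φ t '' initialPatch n) Z := by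
  have hv := h.isFlowField_particleField
  obtain ⟨Z, hZ0, hZ, hZ'⟩ := hv.exists_flow
  have hΦ : ∀ t, 0 ≤ t → ∀ z ∈ initialPatch n, Z t z = Φ t z := fun t ht z hz =>
    hv.trajectory_unique (left_mem_Icc.2 ht) (hZ t z) (h.isTrajectory_particleField hz t)
      (by rw [hZ0, h.flow.initial]) (right_mem_Icc.2 ht)
  have hodd : ∀ t, 0 ≤ t → ∀ z, Z t (-z) = -Z t z := fun t ht z =>
    hv.trajectory_unique (left_mem_Icc.2 ht) (hZ t (-z))
      ((hZ t z).neg fun t _ z => particleField_neg t z) (by rw [hZ0, hZ0]) (right_mem_Icc.2 ht)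
  have hΩ0 : Φ 0 '' initialPatch n = initialPatch n := by
    simp [image_congr fun z _ => h.flow.initial z]
  have hΩ : ∀ t, 0 ≤ t → Φ t '' initialPatch n = Z t '' (Φ 0 '' initialPatch n) := fun t ht => by
    rw [hΩ0]
    exact image_congr fun z hz => (hΦ t ht z hz).symm
  refine ⟨Z, ⟨hZ0, fun z t ht => ?_, hΩ, fun t ht z => ?_⟩⟩
  · have := hZ' z t ht
    rwa [← h.neg_euler_add_strain ht] at this
  · have hm : ∀ w, Z t w ∈ Φ t '' initialPatch n ↔ w ∈ Φ 0 '' initialPatch n := fun w => by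
      rw [hΩ t ht]
      exact (Z t).injective.mem_set_image
    refine (pairVorticity_apply _ _).trans (Eq.trans ?_ (pairVorticity_apply _ _).symm)
    rw [← hodd t ht]
    have key : ∀ w, (Φ t '' initialPatch n).indicator (fun _ => (1 : ℝ)) (Z t w) =
        (Φ 0 '' initialPatch n).indicator (fun _ => 1) w := fun w => by
      by_cases hw : w ∈ Φ 0 '' initialPatch n
      · rw [indicator_of_mem hw, indicator_of_mem ((hm w).2 hw)]
      · rw [indicator_of_notMem hw, indicator_of_notMem fun hc => hw ((hm w).1 hc)]
    rw [key, key]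

end IsPatchFlow

/-! ### Distances and conclusion -/

theorem norm_le_norm_add_of_mem_quadrant {a b : ℂ} (ha : a ∈ quadrant) (hb : b ∈ quadrant) :
    ‖a‖ ≤ ‖a + b‖ := by
  refine (pow_le_pow_iff_left₀ (norm_nonneg _) (norm_nonneg _) two_ne_zero).1 ?_
  rw [norm_sq_eq, norm_sq_eq, Complex.add_re, Complex.add_im]
  have := ha.1
  have := ha.2
  have := hb.1
  have := hb.2
  gcongr <;> linarith

/-- For `a`, `b` in the quadrant the distance of `a` to `-b` is `|a + b| ≥ |a|`, and the pair `a`,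
`-a` realizes `2|a|`. So both distances in the theorem are comparable. -/
theorem infDist_le_setDist {A : Set ℂ} (hA : A ⊆ quadrant) (hne : A.Nonempty) :
    Metric.infDist 0 A ≤ setDist A (centralReflection A) ∧
      setDist A (centralReflection A) ≤ 2 * Metric.infDist 0 A := by
  have hbdd : BddBelow {r : ℝ | ∃ a ∈ A, ∃ b ∈ centralReflection A, r = dist a b} :=
    ⟨0, by rintro _ ⟨a, -, b, -, rfl⟩; exact dist_nonneg⟩
  constructor
  · obtain ⟨a, ha⟩ := hne
    refine le_csInf ⟨_, a, ha, -a, mem_centralReflection.2 (by rwa [neg_neg]), rfl⟩ ?_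
    rintro _ ⟨a, ha, _, ⟨b, hb, rfl⟩, rfl⟩
    refine (Metric.infDist_le_dist_of_mem ha).trans ?_
    rw [dist_zero_left, dist_eq_norm, sub_neg_eq_add]
    exact norm_le_norm_add_of_mem_quadrant (hA ha) (hA hb)
  · rw [← div_le_iff₀' two_pos, Metric.le_infDist hne]
    intro a ha
    rw [div_le_iff₀' two_pos, dist_zero_left]
    refine csInf_le hbdd ⟨a, ha, -a, mem_centralReflection.2 (by rwa [neg_neg]), ?_⟩
    rw [dist_eq_norm, sub_neg_eq_add, ← two_mul, norm_mul]
    simp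

theorem exists_flatness_order {δ : ℝ} (hδ1 : δ < 1) : ∃ n : ℕ, n ≠ 0 ∧ δ < 2 * n * (1 - δ) := by
  obtain ⟨n, hn⟩ := exists_nat_gt (1 / (1 - δ))
  have h1 : 0 < 1 - δ := by linarith
  rw [div_lt_iff₀ h1] at hn
  refine ⟨n, ?_, by linarith⟩
  rintro rfl
  simp at hn
  linarith

end

theorem theorem1 :
    ∃ c C : ℝ, 0 < c ∧ ∀ δ : ℝ, 0 < δ → δ < 1 →
      ∃ (Ω : ℝ → Set ℂ) (S : ℝ → ℂ → ℂ) (Z : ℝ → ℂ ≃ₜ ℂ),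
        IsSmoothPatch (Ω 0) ∧
        c ≤ setDist (Ω 0) (centralReflection (Ω 0)) ∧
        setDist (Ω 0) (centralReflection (Ω 0)) ≤ C ∧
        IsAdmissibleStrain S ∧
        IsPatchDynamics S Ω Z ∧
        (∃ a A : ℝ, 0 < a ∧ ∀ t : ℝ, 0 ≤ t →
          a * setDist (Ω t) (centralReflection (Ω t)) ≤ Metric.infDist 0 (Ω t) ∧
          Metric.infDist 0 (Ω t) ≤ A * setDist (Ω t) (centralReflection (Ω t))) ∧
        (∃ B : ℝ, ∀ t : ℝ, 0 ≤ t →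
          setDist (Ω t) (centralReflection (Ω t)) ≤ B * Real.exp (-Real.exp (δ * t))) := by
  -- The lower constant is the distance of the initial patch from the origin, the upper one twice
  -- the bound `4` for that distance. Neither depends on `n`, hence neither depends on `δ`.
  refine ⟨1 / 10 ^ 14, 8, by norm_num, fun δ hδ0 hδ1 => ?_⟩
  obtain ⟨n, hn, hδn⟩ := exists_flatness_order hδ1
  obtain ⟨r, Φ, h⟩ := exists_isPatchFlow n
  obtain ⟨Z, hZ⟩ := h.exists_patchDynamics
  obtain ⟨t₀, ht₀, hdecay⟩ := h.exists_time_infDist_le hn hδ0 hδn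
  have hdist : ∀ t : ℝ, 0 ≤ t → Metric.infDist 0 (Φ t '' initialPatch n) ≤
        setDist (Φ t '' initialPatch n) (centralReflection (Φ t '' initialPatch n)) ∧
      setDist (Φ t '' initialPatch n) (centralReflection (Φ t '' initialPatch n)) ≤
        2 * Metric.infDist 0 (Φ t '' initialPatch n) := fun t ht =>
    infDist_le_setDist (h.subset_quadrant ht) (IsPatchFlow.nonempty Φ n t)
  have hΩ0 : Φ 0 '' initialPatch n = initialPatch n := by
    simp [Set.image_congr fun z _ => h.flow.initial z]
  have hlow : 1 / 10 ^ 14 ≤ Metric.infDist 0 (Φ 0 '' initialPatch n) := by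
    refine (Metric.le_infDist (IsPatchFlow.nonempty Φ n 0)).2 fun z hz => ?_
    rw [hΩ0] at hz
    rw [dist_zero_left]
    exact norm_ge_of_mem_initialPatch hz
  refine ⟨fun t => Φ t '' initialPatch n, IsPatchFlow.strain Φ n, Z, ?_,
    hlow.trans (hdist 0 le_rfl).1, (hdist 0 le_rfl).2.trans ?_, h.isAdmissibleStrain hn hδ0 hδn,
    hZ, ⟨1 / 2, 1, by norm_num, fun t ht => ⟨?_, ?_⟩⟩,
    ⟨max 2 (8 * Real.exp (Real.exp (δ * t₀))), fun t ht => (hdist t ht).2.trans ?_⟩⟩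
  · simp only [hΩ0]
    exact isSmoothPatch_initialPatch n
  · have := h.infDist_le_four le_rfl
    linarith
  · have := (hdist t ht).2
    linarith
  · rw [one_mul]
    exact (hdist t ht).1
  · have hp := Real.exp_pos (-Real.exp (δ * t))
    rcases le_total t₀ t with h1 | h1
    · have h2 := hdecay t h1
      have h3 := mul_le_mul_of_nonneg_right (le_max_left 2 (8 * Real.exp (Real.exp (δ * t₀)))) hp.le
      linarith
    -- Before `t₀` only boundedness is available; the second entry of the maximum compensates for
    -- the smallest value of the double exponential on `[0, t₀]`.
    · have h2 := h.infDist_le_four ht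
      have h3 := mul_le_mul_of_nonneg_right (le_max_right 2 (8 * Real.exp (Real.exp (δ * t₀)))) hp.le
      have h4 : 1 ≤ Real.exp (Real.exp (δ * t₀)) * Real.exp (-Real.exp (δ * t)) := by
        rw [← Real.exp_add, Real.one_le_exp_iff]
        have := Real.exp_le_exp.2 (mul_le_mul_of_nonneg_left h1 hδ0.le)
        linarith
      linarith
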